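/- **Setting.** An *orbifold groupoid* is a proper étale Lie groupoid. Let $\mathsf G$ be an orbifold groupoid of finite dimension with an invariant almost complex structure $J$ (for example a symplectic orbifold groupoid with a tame $J$), and let $\mathsf Z\subset\mathsf G$ be an almost complex divisor: the full subgroupoid on a closed $G_1$-invariant submanifold $Z_0\subset G_0$ of real codimension $2$ with $J(TZ_0)=TZ_0$. Let $[\mathsf Z]\in H^2(\mathsf G;\mathbb R)$ (de Rham cohomology of invariant forms) be the dual class of $\mathsf Z$, i.e. the image of the Thom class of $\mathsf Z$ under $H^2(\mathsf G,\mathsf G\setminus\mathsf Z)\to H^2(\mathsf G)$. Explicitly, a closed invariant $2$-form $\eta$ on $G_0$ represents $[\mathsf Z]$ if there is an invariant $1$-form $\alpha$ on $G_0\setminus Z_0$ with $\eta=d\alpha$ there and $\int_{\mathbb D}u^*\eta-\int_{\partial\mathbb D}u^*\alpha=1$ for every smooth closed disc $u:\mathbb D\to G_0$ that meets $Z_0$ only at $u(0)$, transversely and with complex linear normal derivative at $0$. (A Thom form of the normal bundle, supported in a disc bundle and with integral $1$ over the fibres, is such an $\eta$.) Let $\mathsf C$ be a compact orbicurve (possibly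 nodal, with balanced nodes; finitely many marked and nodal points, all other points having trivial local group), and let $|C|$ be the orbit space of its normalization (of $\mathsf C$ itself if there are no nodes). Let $\mathsf f:\mathsf C\xleftarrow{\ \epsilon\ }\mathsf K\xrightarrow{\ \phi\ }\mathsf G$ be a holomorphic orbifold morphism, i.e. $\epsilon$ is a holomorphic equivalence and $\phi$ is a $J$-holomorphic homomorphism of groupoids. The class $[\mathsf C]$ acts on invariant $2$-forms by the orbifold integral $\int^{orb}_{\mathsf C}$ (over the normalization), and $\mathsf f_*[\mathsf C]$ acts on closed invariant $2$-forms on $\mathsf G$ by $\eta\mapsto\int^{orb}_{\mathsf C}\mathsf f^*\eta$. For $y\in|C|$ with $|\mathsf f|(y)\in|\mathsf Z|$ let $r_y$ be the order of the local group of $y$. The *fractional contact order* of $\mathsf f$ with $\mathsf Z$ at $y$ is $\ell_y=d_y/r_y$ if, for a holomorphic coordinate $w$ centred at the point over $y$ in an orbifold chart and for local coordinates of $G_0$ in $V\times\mathbb C$, with $V\subset Z_0$ open and the second coordinate vanishing exactly on $Z_0$ and having along $Z_0$ a complex linear, surjective differential, the local lift of $\mathsf f$ has the form $$f_0(w)=\bigl(f^1(w),\,w^{d_y}+O(w^{d_y+1})\bigr).$$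 **Lemma 3.3.** Suppose that only finitely many points $y_1,\dots,y_k$ of $|C|$ are mapped to $|\mathsf Z|$ (so that the image of $\mathsf f$ meets $|\mathsf Z|$ in finitely many points). Then the fractional contact order $\ell_{y_i}$ exists and is unique for every $i$, and $$\mathsf f_*[\mathsf C]\cap[\mathsf Z]=\mathsf f^*[\mathsf Z]\cap[\mathsf C]=\sum_{i=1}^k\ell_{y_i},$$ that is, $\int^{orb}_{\mathsf C}\mathsf f^*\eta=\sum_{i}\ell_{y_i}$ for every $\eta$ that represents $[\mathsf Z]$. -/

import Mathlib

open scoped Manifold ContDiff Topology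
open Set MeasureTheory

universe u v w

noncomputable section

/-! ## Differential forms on manifolds -/

section Forms

variable {E : Type*} [NormedAddCommGroup E] [NormedSpace ℝ E]
  {F : Type*} [NormedAddCommGroup F] [NormedSpace ℝ F]
  {M : Type*} [TopologicalSpace M] [ChartedSpace E M]
  {N : Type*} [TopologicalSpace N] [ChartedSpace F N]

/-- The derivative of a map between real manifolds, as a linear map between the model spaces
(Mathlib's tangent space at a point is the model space, by definition). -/
def manifoldDeriv (E : Type*) [NormedAddCommGroup E] [NormedSpace ℝ E]
    (F : Type*) [NormedAddCommGroup F] [NormedSpace ℝ F]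
    {M : Type*} [TopologicalSpace M] [ChartedSpace E M]
    {N : Type*} [TopologicalSpace N] [ChartedSpace F N] (f : M → N) (x : M) : E →L[ℝ] F :=
  mfderiv 𝓘(ℝ, E) 𝓘(ℝ, F) f x

/-- Real differential forms of degree `k` on a manifold `M` modelled on `E` (no regularity): the
value at `x` is an alternating form on the tangent space at `x`. -/
abbrev DForm (E : Type*) [NormedAddCommGroup E] [NormedSpace ℝ E] (M : Type*) (k : ℕ) :=
  M → E [⋀^Fin k]→L[ℝ] ℝ

/-- The pull-back of a form by a map. -/
def DForm.pullback {k : ℕ} (f : M → N) (η : DForm F N k) : DForm E M k := fun x =>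
  (η (f x)).compContinuousLinearMap (manifoldDeriv E F f x)

/-- The expression of a form in a chart: its pull-back by the inverse of the chart. It is
meaningful on the target of the chart. -/
def DForm.inChart {k : ℕ} (η : DForm E M k) (e : OpenPartialHomeomorph M E) : DForm E E k :=
  DForm.pullback e.symm η

/-- `η` is smooth on the open set `W`. -/
def DForm.SmoothOn {k : ℕ} (η : DForm E M k) (W : Set M) : Prop :=
  ∀ e ∈ atlas E M, ContDiffOn ℝ ∞ (η.inChart e) (e.target ∩ e.symm ⁻¹' W)

/-- `dα = β` on the open set `W`. -/
def DForm.HasExtDerivOn {k : ℕ} (α : DForm E M k) (β : DForm E M (k + 1)) (W : Set M) : Prop :=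
  ∀ e ∈ atlas E M, ∀ p ∈ e.target ∩ e.symm ⁻¹' W, extDeriv (α.inChart e) p = β.inChart e p

end Forms

/-! ## Orbifold groupoids -/

/-- An orbifold groupoid: a proper etale Lie groupoid whose spaces of objects and arrows are
(Hausdorff, second countable) smooth manifolds modelled on `E`. The composite `comp g h` is the
arrow "first `g`, then `h`"; it is meaningful only if `tgt g = src h`. As the source and the target
are local diffeomorphisms, the continuity of the composition implies its smoothness. -/
structure OrbifoldGroupoid (E : Type v) [NormedAddCommGroup E] [NormedSpace ℝ E] where
  Obj : Type u
  Arr : Type u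
  [topObj : TopologicalSpace Obj]
  [topArr : TopologicalSpace Arr]
  [chartObj : ChartedSpace E Obj]
  [chartArr : ChartedSpace E Arr]
  [mfdObj : IsManifold 𝓘(ℝ, E) ∞ Obj]
  [mfdArr : IsManifold 𝓘(ℝ, E) ∞ Arr]
  [t2Obj : T2Space Obj]
  [t2Arr : T2Space Arr]
  [sccObj : SecondCountableTopology Obj]
  [sccArr : SecondCountableTopology Arr]
  src : Arr → Obj
  tgt : Arr → Obj
  comp : Arr → Arr → Arr
  unit : Obj → Arr
  inv : Arr → Arr
  src_comp : ∀ g h, tgt g = src h → src (comp g h) = src g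
  tgt_comp : ∀ g h, tgt g = src h → tgt (comp g h) = tgt h
  comp_assoc : ∀ g h k, tgt g = src h → tgt h = src k →
    comp (comp g h) k = comp g (comp h k)
  src_unit : ∀ x, src (unit x) = x
  tgt_unit : ∀ x, tgt (unit x) = x
  unit_comp : ∀ g, comp (unit (src g)) g = g
  comp_unit : ∀ g, comp g (unit (tgt g)) = g
  src_inv : ∀ g, src (inv g) = tgt g
  tgt_inv : ∀ g, tgt (inv g) = src g
  comp_inv : ∀ g, comp g (inv g) = unit (src g)
  inv_comp : ∀ g, comp (inv g) g = unit (tgt g)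
  continuousOn_comp : ContinuousOn (fun p : Arr × Arr => comp p.1 p.2) {p | tgt p.1 = src p.2}
  smooth_unit : ContMDiff 𝓘(ℝ, E) 𝓘(ℝ, E) ∞ unit
  smooth_inv : ContMDiff 𝓘(ℝ, E) 𝓘(ℝ, E) ∞ inv
  /-- the groupoid is etale -/
  etale_src : IsLocalDiffeomorph 𝓘(ℝ, E) 𝓘(ℝ, E) ∞ src
  etale_tgt : IsLocalDiffeomorph 𝓘(ℝ, E) 𝓘(ℝ, E) ∞ tgt
  /-- the groupoid is proper -/
  proper : IsProperMap (fun g => (src g, tgt g))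

attribute [instance] OrbifoldGroupoid.topObj OrbifoldGroupoid.topArr OrbifoldGroupoid.chartObj
  OrbifoldGroupoid.chartArr OrbifoldGroupoid.mfdObj OrbifoldGroupoid.mfdArr
  OrbifoldGroupoid.t2Obj OrbifoldGroupoid.t2Arr OrbifoldGroupoid.sccObj OrbifoldGroupoid.sccArr

namespace OrbifoldGroupoid

variable {E : Type*} [NormedAddCommGroup E] [NormedSpace ℝ E] (G : OrbifoldGroupoid E)

/-- Two objects are in the same orbit if there is an arrow between them. -/
def orbitSetoid : Setoid G.Obj where
  r x y := ∃ g, G.src g = x ∧ G.tgt g = y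
  iseqv :=
    { refl := fun x => ⟨G.unit x, G.src_unit x, G.tgt_unit x⟩
      symm := by
        rintro x y ⟨g, hx, hy⟩
        exact ⟨G.inv g, (G.src_inv g).trans hy, (G.tgt_inv g).trans hx⟩
      trans := by
        rintro x y z ⟨g, hx, hy⟩ ⟨h, hy', hz⟩
        have hc : G.tgt g = G.src h := hy.trans hy'.symm
        exact ⟨G.comp g h, (G.src_comp g h hc).trans hx, (G.tgt_comp g h hc).trans hz⟩ }

/-- The orbit space `|G|`, with the quotient topology. -/
abbrev Orbit := Quotient G.orbitSetoid

/-- The orbit of an object. -/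
def orbit (x : G.Obj) : G.Orbit := Quotient.mk G.orbitSetoid x

/-- The local (isotropy) group at `x`, as a set of arrows. -/
def isotropy (x : G.Obj) : Set G.Arr := {g | G.src g = x ∧ G.tgt g = x}

/-- The subset `Z` of the objects is a union of orbits. -/
def IsInvariantSet (Z : Set G.Obj) : Prop := ∀ g, G.src g ∈ Z ↔ G.tgt g ∈ Z

/-- The form `η`, on the invariant set of objects `W`, is invariant under the arrows. -/
def IsInvariantFormOn {k : ℕ} (η : DForm E G.Obj k) (W : Set G.Obj) : Prop :=
  ∀ g, G.src g ∈ W →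
    (DForm.pullback G.src η : DForm E G.Arr k) g = (DForm.pullback G.tgt η : DForm E G.Arr k) g

end OrbifoldGroupoid

/-- A homomorphism of orbifold groupoids (it commutes with the inverses as well). -/
structure GroupoidHom {E : Type*} [NormedAddCommGroup E] [NormedSpace ℝ E]
    {F : Type*} [NormedAddCommGroup F] [NormedSpace ℝ F]
    (H : OrbifoldGroupoid E) (G : OrbifoldGroupoid F) where
  obj : H.Obj → G.Obj
  arr : H.Arr → G.Arr
  smooth_obj : ContMDiff 𝓘(ℝ, E) 𝓘(ℝ, F) ∞ obj
  smooth_arr : ContMDiff 𝓘(ℝ, E) 𝓘(ℝ, F) ∞ arr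
  src_arr : ∀ g, G.src (arr g) = obj (H.src g)
  tgt_arr : ∀ g, G.tgt (arr g) = obj (H.tgt g)
  arr_unit : ∀ x, arr (H.unit x) = G.unit (obj x)
  arr_comp : ∀ g h, H.tgt g = H.src h → arr (H.comp g h) = G.comp (arr g) (arr h)

/-- A homomorphism between etale groupoids of the same dimension is an equivalence if it is a local
diffeomorphism on objects (on etale groupoids this is the submersion condition), meets every orbit,
and identifies the arrows `k → k'` with the arrows `obj k → obj k'` (on etale groupoids a bijection
onto the fibre product is a diffeomorphism). -/
structure GroupoidHom.IsEquivalence {E : Type*} [NormedAddCommGroup E] [NormedSpace ℝ E]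
    {H G : OrbifoldGroupoid E} (ε : GroupoidHom H G) : Prop where
  etale : IsLocalDiffeomorph 𝓘(ℝ, E) 𝓘(ℝ, E) ∞ ε.obj
  ess_surj : ∀ x : G.Obj, ∃ p : H.Obj × G.Arr, G.src p.2 = ε.obj p.1 ∧ G.tgt p.2 = x
  full_faithful : ∀ (k k' : H.Obj) (a : G.Arr), G.src a = ε.obj k → G.tgt a = ε.obj k' →
    ∃! κ : H.Arr, H.src κ = k ∧ H.tgt κ = k' ∧ ε.arr κ = a

/-! ## Almost complex structures and divisors -/

/-- An almost complex structure on an orbifold groupoid: a smooth endomorphism field of the tangent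
bundle of the manifold of objects, of square `-1`, that is invariant under the arrows. -/
structure AlmostComplexStructure {E : Type*} [NormedAddCommGroup E] [NormedSpace ℝ E]
    (G : OrbifoldGroupoid E) where
  /-- the endomorphism of the tangent space at each object -/
  J : G.Obj → E →L[ℝ] E
  sq : ∀ x v, J x (J x v) = -v
  smooth : ∀ e ∈ atlas E G.Obj, ContDiffOn ℝ ∞
    (fun p : E => (manifoldDeriv E E e (e.symm p)).comp
      ((J (e.symm p)).comp (manifoldDeriv E E e.symm p))) e.target
  invariant : ∀ (g : G.Arr) (a b : E),
    J (G.src g) (manifoldDeriv E E G.src g a) = manifoldDeriv E E G.src g b →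
    J (G.tgt g) (manifoldDeriv E E G.tgt g a) = manifoldDeriv E E G.tgt g b

section Divisor

variable {E : Type*} [NormedAddCommGroup E] [NormedSpace ℝ E] {G : OrbifoldGroupoid E}
  (J : AlmostComplexStructure G)

/-- `h` is a complex coordinate normal to `Z` near the object `z`: near `z` it is smooth, `Z` is its
zero set, and along `Z` its differential is complex linear and onto. So `h` is the second component
of local coordinates with values in `V × ℂ`, where `V` is open in `Z` and `ℂ` is the fibre of the
normal bundle. -/
def IsNormalCoordinate (Z : Set G.Obj) (z : G.Obj) (h : G.Obj → ℂ) : Prop :=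
  ∃ U : Set G.Obj, IsOpen U ∧ z ∈ U ∧ ContMDiffOn 𝓘(ℝ, E) 𝓘(ℝ, ℂ) ∞ h U ∧
    (∀ x ∈ U, x ∈ Z ↔ h x = 0) ∧
    ∀ x ∈ U ∩ Z, Function.Surjective (manifoldDeriv E ℂ h x) ∧
      ∀ v : E, manifoldDeriv E ℂ h x (J.J x v) = Complex.I * manifoldDeriv E ℂ h x v

/-- `Z` is the set of objects of an almost complex divisor: a closed invariant submanifold of real
codimension two whose tangent spaces are preserved by `J`. -/
structure IsDivisor (Z : Set G.Obj) : Prop where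
  closed : IsClosed Z
  invariant : G.IsInvariantSet Z
  coordinate : ∀ z ∈ Z, ∃ h : G.Obj → ℂ, IsNormalCoordinate J Z z h

/-- `u` is a closed disc in the manifold of objects (smooth up to the boundary) that meets `Z` only
at its centre and is there normal to `Z`: transverse, with complex linear normal derivative. -/
structure IsNormalDisc (Z : Set G.Obj) (u : ℂ → G.Obj) : Prop where
  smooth : ∃ R : ℝ, 1 < R ∧ ContMDiffOn 𝓘(ℝ, ℂ) 𝓘(ℝ, E) ∞ u (Metric.ball 0 R)
  meets : ∀ ζ ∈ Metric.closedBall (0 : ℂ) 1, u ζ ∈ Z ↔ ζ = 0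
  normal : ∃ (h : G.Obj → ℂ) (a : ℂ), IsNormalCoordinate J Z (u 0) h ∧ a ≠ 0 ∧
    (fun ζ : ℂ => h (u ζ) - a * ζ) =O[𝓝 0] (fun ζ : ℂ => ζ ^ 2)

/-- The integral of `u^* η` over the closed unit disc. -/
def discIntegral (u : ℂ → G.Obj) (η : DForm E G.Obj 2) : ℝ :=
  ∫ ζ in Metric.closedBall (0 : ℂ) 1, (DForm.pullback u η : DForm ℂ ℂ 2) ζ ![1, Complex.I]

/-- The integral of `u^* α` over the unit circle, counterclockwise. -/
def circleFormIntegral (u : ℂ → G.Obj) (α : DForm E G.Obj 1) : ℝ :=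
  ∫ θ in (0 : ℝ)..(2 * Real.pi), (DForm.pullback u α : DForm ℂ ℂ 1)
    (Complex.exp (θ * Complex.I)) ![Complex.I * Complex.exp (θ * Complex.I)]

/-- The closed invariant form `η` represents the class `[Z] ∈ H²(G; ℝ)` dual to `Z`, that is, the
image of the Thom class of `Z` under `H²(G, G ∖ Z) → H²(G)`, where the relative group is computed
by the de Rham complex of pairs `(η, α)`, `η` a form on `G` and `α` a form on `G ∖ Z` of one degree
less. The Thom class is the class of the pairs with `dη = 0`, `η = dα` off `Z`, that have the value
`1` on the normal discs of `Z` relative to their boundaries. In particular, a Thom form of the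
normal bundle, with support in a disc bundle and integral `1` over the fibres, is such an `η`, and
so is every closed invariant form that differs from it by the differential of an invariant form. -/
structure RepresentsDualClass (Z : Set G.Obj) (η : DForm E G.Obj 2) : Prop where
  smooth : η.SmoothOn univ
  invariant : G.IsInvariantFormOn η univ
  closed : η.HasExtDerivOn 0 univ
  thom : ∃ α : DForm E G.Obj 1, α.SmoothOn Zᶜ ∧ G.IsInvariantFormOn α Zᶜ ∧
    α.HasExtDerivOn η Zᶜ ∧
    ∀ u : ℂ → G.Obj, IsNormalDisc J Z u → discIntegral u η - circleFormIntegral u α = 1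

end Divisor

/-! ## Orbicurves -/

/-- An orbifold groupoid of complex dimension one: the manifolds of objects and arrows are Riemann
surfaces and the source and target are holomorphic (then so are the other structure maps). -/
structure ComplexOrbifoldGroupoid extends OrbifoldGroupoid.{u} ℂ where
  holoObj : IsManifold 𝓘(ℂ) ω Obj
  holoArr : IsManifold 𝓘(ℂ) ω Arr
  holo_src : MDifferentiable 𝓘(ℂ) 𝓘(ℂ) src
  holo_tgt : MDifferentiable 𝓘(ℂ) 𝓘(ℂ) tgt

namespace ComplexOrbifoldGroupoid

variable (C : ComplexOrbifoldGroupoid)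

/-- The number by which the isotropy arrow `g` acts on the complex tangent line at its source. -/
def rotation (g : C.Arr) : ℂ :=
  let ds : ℂ →L[ℂ] ℂ := mfderiv 𝓘(ℂ) 𝓘(ℂ) C.src g
  let dt : ℂ →L[ℂ] ℂ := mfderiv 𝓘(ℂ) 𝓘(ℂ) C.tgt g
  dt (ds.inverse 1)

/-- An orbifold partition of unity: finitely many smooth functions `weight j`, each with compact
support in the domain of a chart, such that the sum of their values over all the arrows that start
at `x`, taken at the targets, is `1` for every `x`. (In a chart `D → D / ℤ_r` these sums contain each
point of an orbit `r / #stabilizer` times with multiplicity `#stabilizer`, so that this is a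
partition of unity on the orbit space in which a chart has the weight `1 / r`.) -/
structure Partition where
  n : ℕ
  chart : Fin n → OpenPartialHomeomorph C.Obj ℂ
  chart_mem : ∀ j, chart j ∈ atlas ℂ C.Obj
  weight : Fin n → C.Obj → ℝ
  smooth : ∀ j, ContMDiff 𝓘(ℝ, ℂ) 𝓘(ℝ, ℝ) ∞ (weight j)
  compact : ∀ j, HasCompactSupport (weight j)
  support : ∀ j, tsupport (weight j) ⊆ (chart j).source
  sum_eq_one : ∀ x : C.Obj,
    ∑ j, ∑ᶠ g : {g : C.Arr // C.src g = x}, weight j (C.tgt g.1) = 1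

variable {C}

/-- The integral of a `2`-form, computed with an orbifold partition of unity. -/
def Partition.integral (P : C.Partition) (ξ : DForm ℂ C.Obj 2) : ℝ :=
  ∑ j, ∫ p in (P.chart j).target,
    P.weight j ((P.chart j).symm p) * ξ.inChart (P.chart j) p ![1, Complex.I]

variable (C)

open Classical in
/-- The orbifold integral of an invariant `2`-form over `C` (with compact orbit space). -/
def orbIntegral (ξ : DForm ℂ C.Obj 2) : ℝ :=
  if hP : Nonempty C.Partition then hP.some.integral ξ else 0

end ComplexOrbifoldGroupoid

/-- A compact orbicurve, possibly nodal and possibly disconnected, given by its normalization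
(a groupoid presenting a smooth orbicurve) and the pairs of points of the normalization that are
identified to nodes. All orbifold points are marked or nodal, and the nodes are balanced. -/
structure Orbicurve where
  /-- the normalization -/
  norm : ComplexOrbifoldGroupoid.{u}
  compact : CompactSpace norm.Orbit
  Mark : Type
  finite_mark : Finite Mark
  mark : Mark → norm.Obj
  Node : Type
  finite_node : Finite Node
  /-- the two points over a node, one on each branch -/
  branch : Node → Bool → norm.Obj
  distinct : Function.Injective (Sum.elim (fun i => norm.orbit (mark i))
    (fun q : Node × Bool => norm.orbit (branch q.1 q.2)))
  isotropy_trivial : ∀ x : norm.Obj, (∀ i, norm.orbit x ≠ norm.orbit (mark i)) →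
    (∀ ν b, norm.orbit x ≠ norm.orbit (branch ν b)) → norm.isotropy x = {norm.unit x}
  /-- the identification of the local groups of the two branches -/
  glue : ∀ ν, norm.isotropy (branch ν true) ≃ norm.isotropy (branch ν false)
  glue_comp : ∀ ν (g h k : norm.isotropy (branch ν true)), norm.comp g h = k →
    norm.comp (glue ν g) (glue ν h) = (glue ν k : norm.Arr)
  balanced : ∀ ν (g : norm.isotropy (branch ν true)),
    norm.rotation g * norm.rotation (glue ν g) = 1

/-- A holomorphic orbifold morphism from an orbicurve `C` to an almost complex orbifold groupoid:
a diagram `C ← K → G` of groupoids, where `eps : K → C` is a holomorphic equivalence and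
`phi : K → G` is a `J`-holomorphic homomorphism (on the normalizations), together with, for each
node, an arrow of `G` between the images of its two branches that is compatible with the
identification of the local groups of the branches. -/
structure HolomorphicOrbimorphism (C : Orbicurve.{u}) {E : Type*} [NormedAddCommGroup E]
    [NormedSpace ℝ E] {G : OrbifoldGroupoid E} (J : AlmostComplexStructure G) where
  K : ComplexOrbifoldGroupoid.{w}
  eps : GroupoidHom K.toOrbifoldGroupoid C.norm.toOrbifoldGroupoid
  eps_equiv : eps.IsEquivalence
  eps_holo : MDifferentiable 𝓘(ℂ) 𝓘(ℂ) eps.obj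
  phi : GroupoidHom K.toOrbifoldGroupoid G
  phi_holo : ∀ (k : K.Obj) (v : ℂ),
    manifoldDeriv ℂ E phi.obj k (Complex.I * v) =
      J.J (phi.obj k) (manifoldDeriv ℂ E phi.obj k v)
  /-- an object of `K` over a branch of a node, and the arrow that identifies its image -/
  lift : C.Node → Bool → K.Obj
  liftArr : C.Node → Bool → C.norm.Arr
  src_liftArr : ∀ ν b, C.norm.src (liftArr ν b) = eps.obj (lift ν b)
  tgt_liftArr : ∀ ν b, C.norm.tgt (liftArr ν b) = C.branch ν b
  nodeArr : C.Node → G.Arr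
  src_nodeArr : ∀ ν, G.src (nodeArr ν) = phi.obj (lift ν true)
  tgt_nodeArr : ∀ ν, G.tgt (nodeArr ν) = phi.obj (lift ν false)
  node_compat : ∀ ν (g : C.norm.isotropy (C.branch ν true)) (κ κ' : K.Arr),
    κ ∈ K.isotropy (lift ν true) → κ' ∈ K.isotropy (lift ν false) →
    C.norm.comp (eps.arr κ) (liftArr ν true) = C.norm.comp (liftArr ν true) g →
    C.norm.comp (eps.arr κ') (liftArr ν false) = C.norm.comp (liftArr ν false) (C.glue ν g) →
    G.comp (phi.arr κ) (nodeArr ν) = G.comp (nodeArr ν) (phi.arr κ')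

namespace HolomorphicOrbimorphism

variable {C : Orbicurve} {E : Type*} [NormedAddCommGroup E] [NormedSpace ℝ E]
  {G : OrbifoldGroupoid E} {J : AlmostComplexStructure G} (f : HolomorphicOrbimorphism C J)

/-- The points of `|C|` (of its normalization) whose image under `|f| : |C| → |G|` is in `|Z|`. -/
def preimage (Z : Set G.Obj) : Set C.norm.Orbit :=
  {y | ∃ k : f.K.Obj, C.norm.orbit (f.eps.obj k) = y ∧ f.phi.obj k ∈ Z}

/-- The pull-back to `C` of an invariant form on `G`. At the object `x` it is the pull-back by the
local lift `phi ∘ eps⁻¹ ∘ src ∘ tgt⁻¹` of `f`, where the inverses are the local ones at an object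
`k` of `K` and an arrow `a : eps k → x`; for an invariant form the choice of `(k, a)` does not
matter. -/
def pullback {k : ℕ} (η : DForm E G.Obj k) : DForm ℂ C.norm.Obj k := fun x =>
  let p := (f.eps_equiv.ess_surj x).choose
  (η (f.phi.obj p.1)).compContinuousLinearMap
    ((manifoldDeriv ℂ E f.phi.obj p.1).comp
      ((manifoldDeriv ℂ ℂ f.eps.obj p.1).inverse.comp
        ((manifoldDeriv ℂ ℂ C.norm.src p.2).comp (manifoldDeriv ℂ ℂ C.norm.tgt p.2).inverse)))

/-- The local lift of `f` at the object `k` has the form `w ↦ (f¹(w), w ^ d + O(w ^ (d + 1)))`, for a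
holomorphic coordinate `w` centred at `k` and a complex coordinate normal to `Z`. -/
def HasLocalOrder (Z : Set G.Obj) (k : f.K.Obj) (d : ℕ) : Prop :=
  ∃ h : G.Obj → ℂ, IsNormalCoordinate J Z (f.phi.obj k) h ∧
    ∃ e ∈ IsManifold.maximalAtlas 𝓘(ℂ) ω f.K.Obj, k ∈ e.source ∧ e k = 0 ∧
      (fun ζ : ℂ => h (f.phi.obj (e.symm ζ)) - ζ ^ d) =O[𝓝 0] (fun ζ : ℂ => ζ ^ (d + 1))

/-- `ℓ = d / r` is the fractional contact order of `f` with `Z` at the point `y` of `|C|`, `r` being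
the order of the local group of `C` at `y`. -/
def IsFractionalContactOrder (Z : Set G.Obj) (y : C.norm.Orbit) (ℓ : ℚ) : Prop :=
  ∃ (k : f.K.Obj) (d : ℕ), C.norm.orbit (f.eps.obj k) = y ∧ f.HasLocalOrder Z k d ∧
    ℓ = (d : ℚ) / (Nat.card (C.norm.isotropy (f.eps.obj k)) : ℚ)

end HolomorphicOrbimorphism

/-- The fundamental class `[C]`, as a functional on invariant `2`-forms. -/
def Orbicurve.fundamentalClass (C : Orbicurve) (ξ : DForm ℂ C.norm.Obj 2) : ℝ :=
  C.norm.orbIntegral ξ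

/-- The class `f_*[C]`, as a functional on closed invariant `2`-forms on `G`. -/
def HolomorphicOrbimorphism.pushforwardClass {C : Orbicurve} {E : Type*} [NormedAddCommGroup E]
    [NormedSpace ℝ E] {G : OrbifoldGroupoid E} {J : AlmostComplexStructure G}
    (f : HolomorphicOrbimorphism C J) (η : DForm E G.Obj 2) : ℝ :=
  C.fundamentalClass (f.pullback η)

end

/-!
# The degree of a divisor on an orbicurve is the sum of the fractional contact orders

*Contact orders.* Let `h` be a normal coordinate of the divisor and `φ` a local lift of the
morphism at a contact point. The differential of `h` is complex linear along the divisor, and `φ`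
is `J`-holomorphic, so `∂̄(h ∘ φ)` is bounded by a multiple of `h ∘ φ` (`exists_norm_dbar_le`). A
function `g` with `|∂̄g| ≤ C |g|` that is not identically zero near the origin has a leading term
`a w ^ d` with `a ≠ 0` (`exists_leading_term`): the rescalings of `g` converge to its first
nonzero Taylor polynomial, which is therefore holomorphic, and a function that is flat at the
origin vanishes by Carleman's method (`eventually_eq_zero_of_flat`). As the contact points are
isolated, this applies to `h ∘ φ` and gives the existence of the contact order. It does not depend
on the choices, since two normal coordinates at the ends of an arrow bound each other
(`contact_order_le`) and the order of the local group is constant on an orbit.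

*The integral.* Let `η` represent the dual class, with the primitive `α` off the divisor, and let
`v i` be cut-off functions on the objects of the orbicurve whose orbit sums add up to one. The sum
of the terms `d(v i) ∧ f^*α` over an orbit is zero, so the orbifold integral of `f^*η` is the sum
of the integrals of `v i f^*η + d(v i) ∧ f^*α`, which are equal to `d(v i f^*α)` off the contact
points (`Partition.integral_eq_sum_cutoffForm`). This rests on a change of variables along the
arrows, which are a correspondence between the objects and themselves (`integral_fiberSum_eq`).
The cut-off functions are chosen such that each contact point has one of its own, with the value
`1 / r` at a lift of the point, for a local group of order `r`, while the remaining ones vanish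
near all contact points. The latter contribute nothing, by Stokes
(`integral_cutoffForm_eq_zero`).

It remains to see that a cut-off function with the value `c` at a contact point of order `d`
contributes `d c` (`integral_cutoff_pullback_eq_mul_contact_order`). In coordinates in which the
divisor is the zero set of a linear map `L`, the form `η` has a primitive `lam` near the point,
and `α - lam` is closed off the divisor. It has a period, the integral over loops of winding
number one around the divisor (`exists_period`). The normalization of the dual class on small
normal discs shows that the period is `-1`, and the image of a small circle around the contact
point winds `d` times around the divisor, whence the contribution
(`integral_cutoff_eq_mul_contact_order`).
-/

/-! ### The Cauchy-Riemann operator and unique continuation -/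

/-- The Cauchy-Riemann operator, normalised as `-2i ∂/∂w̄`: the failure of the real differential of
`g` to be complex linear. -/
noncomputable def dbar (g : ℂ → ℂ) (w : ℂ) : ℂ := fderiv ℝ g w Complex.I - Complex.I * fderiv ℝ g w 1

lemma clm_complex_apply (A : ℂ →L[ℝ] ℂ) (v : ℂ) : A v = v.re * A 1 + v.im * A Complex.I := by
  have h : v = v.re • (1 : ℂ) + v.im • Complex.I := by
    simp [Complex.re_add_im]
  conv_lhs => rw [h]
  rw [map_add, map_smul, map_smul, Complex.real_smul, Complex.real_smul]

lemma clm_I_mul_sub (A : ℂ →L[ℝ] ℂ) (v : ℂ) :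
    A (Complex.I * v) - Complex.I * A v =
      (starRingEnd ℂ) v * (A Complex.I - Complex.I * A 1) := by
  rw [clm_complex_apply A (Complex.I * v), clm_complex_apply A v]
  have h : (starRingEnd ℂ) v = v.re - v.im * Complex.I := by
    apply Complex.ext <;> simp
  rw [h]
  simp only [Complex.mul_re, Complex.mul_im, Complex.I_re, Complex.I_im]
  push_cast
  linear_combination (-(v.im * A 1)) * Complex.I_mul_I

/-- The sup-norm estimate for the Cauchy-Riemann operator on compactly supported functions. It is
the Cauchy-Pompeiu formula in polar coordinates around `z`. -/
lemma norm_le_of_norm_dbar_le {F : ℂ → ℂ} (hF : ContDiff ℝ 1 F) {R M : ℝ} (hR : 0 < R)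
    (hsupp : ∀ w, R < ‖w‖ → F w = 0) (hM : ∀ w, ‖dbar F w‖ ≤ M) (z : ℂ) (hz : ‖z‖ ≤ R) :
    ‖F z‖ ≤ 3 * R * M := by
  -- The circle of radius `3 R` around `z` lies outside the support of `F`.
  set S : ℝ := 3 * R with hS
  let γ : ℝ → ℝ → ℂ := fun r θ => z + r * Complex.exp (θ * Complex.I)
  have hcd : Continuous (fderiv ℝ F) := hF.continuous_fderiv one_ne_zero
  have hdiff : Differentiable ℝ F := hF.differentiable one_ne_zero
  -- The radial derivative of `F` and, up to the factor `r`, its angular derivative.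
  let P : ℝ → ℝ → ℂ := fun r θ => fderiv ℝ F (γ r θ) (Complex.exp (θ * Complex.I))
  let Q : ℝ → ℝ → ℂ := fun r θ => fderiv ℝ F (γ r θ) (Complex.I * Complex.exp (θ * Complex.I))
  have hγ : Continuous (fun p : ℝ × ℝ => γ p.1 p.2) := by fun_prop
  have hP : Continuous (Function.uncurry P) := by
    show Continuous fun p : ℝ × ℝ => P p.1 p.2
    exact (hcd.comp hγ).clm_apply (by fun_prop)
  have hQ : Continuous (Function.uncurry Q) := by
    show Continuous fun p : ℝ × ℝ => Q p.1 p.2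
    exact (hcd.comp hγ).clm_apply (by fun_prop)
  have hPr : ∀ θ, ∫ r in (0 : ℝ)..S, P r θ = - F z := by
    intro θ
    have h1 : ∀ r ∈ uIcc 0 S, HasDerivAt (fun r : ℝ => F (γ r θ)) (P r θ) r := by
      intro r _
      have h2 : HasDerivAt (fun r : ℝ => γ r θ) (Complex.exp (θ * Complex.I)) r := by
        have := ((Complex.ofRealCLM.hasDerivAt (x := r)).mul_const
          (Complex.exp (θ * Complex.I))).const_add z
        simpa [γ] using this
      exact (hdiff (γ r θ)).hasFDerivAt.comp_hasDerivAt r h2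
    rw [intervalIntegral.integral_eq_sub_of_hasDerivAt h1]
    · have h3 : F (γ S θ) = 0 := by
        apply hsupp
        have h4 : ‖(S : ℂ) * Complex.exp (θ * Complex.I)‖ = S := by
          rw [norm_mul, Complex.norm_exp_ofReal_mul_I, mul_one, Complex.norm_real,
            Real.norm_of_nonneg (by positivity)]
        have h5 : ‖(S : ℂ) * Complex.exp (θ * Complex.I)‖ ≤ ‖γ S θ‖ + ‖z‖ := by
          have : (S : ℂ) * Complex.exp (θ * Complex.I) = γ S θ - z := by simp [γ]
          rw [this]; exact norm_sub_le _ _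
        linarith
      rw [h3]; simp [γ]
    · exact (hP.comp (by fun_prop : Continuous fun r : ℝ => (r, θ))).intervalIntegrable _ _
  have hQθ : ∀ r : ℝ, r ≠ 0 → ∫ θ in (0 : ℝ)..(2 * Real.pi), Q r θ = 0 := by
    intro r hr
    have h1 : ∀ θ ∈ uIcc 0 (2 * Real.pi),
        HasDerivAt (fun θ : ℝ => F (γ r θ)) (r * Q r θ) θ := by
      intro θ _
      have h2 : HasDerivAt (fun θ : ℝ => γ r θ)
          (r • (Complex.I * Complex.exp (θ * Complex.I))) θ := by
        have h3 : HasDerivAt (fun θ : ℝ => Complex.exp (θ * Complex.I))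
            (Complex.exp (θ * Complex.I) * Complex.I) θ := by
          have := ((Complex.ofRealCLM.hasDerivAt (x := θ)).mul_const Complex.I).cexp
          simpa using this
        have := (h3.const_mul (r : ℂ)).const_add z
        refine this.congr_deriv ?_
        rw [Complex.real_smul]; ring
      have := (hdiff (γ r θ)).hasFDerivAt.comp_hasDerivAt θ h2
      rw [map_smul, Complex.real_smul] at this
      exact this
    have h2 := intervalIntegral.integral_eq_sub_of_hasDerivAt h1
      ((continuous_const.mul
        (hQ.comp (by fun_prop : Continuous fun θ : ℝ => (r, θ)))).intervalIntegrable _ _)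
    have h3 : γ r (2 * Real.pi) = γ r 0 := by
      simp [γ, Complex.exp_two_pi_mul_I]
    rw [h3, sub_self, intervalIntegral.integral_const_mul] at h2
    exact (mul_eq_zero.1 h2).resolve_left (by exact_mod_cast hr)
  have hswap : ∫ θ in (0 : ℝ)..(2 * Real.pi), ∫ r in (0 : ℝ)..S, Q r θ = 0 := by
    rw [MeasureTheory.intervalIntegral_intervalIntegral_swap]
    · have : ∀ᵐ r : ℝ, r ∈ uIoc 0 S → ∫ θ in (0 : ℝ)..(2 * Real.pi), Q r θ = 0 := by
        refine Filter.Eventually.of_forall fun r hr => hQθ r ?_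
        rw [uIoc_of_le (by positivity)] at hr
        exact hr.1.ne'
      rw [intervalIntegral.integral_congr_ae this]; simp
    · have : Continuous (Function.uncurry fun θ r => Q r θ) := hQ.comp continuous_swap
      exact (this.continuousOn.integrableOn_compact
        (isCompact_uIcc.prod isCompact_uIcc)).mono_set
        (prod_mono uIoc_subset_uIcc uIoc_subset_uIcc)
  have hcont1 : ∀ θ, Continuous fun r => Q r θ := fun θ =>
    hQ.comp (by fun_prop : Continuous fun r : ℝ => (r, θ))
  have hcont2 : ∀ θ, Continuous fun r => P r θ := fun θ =>
    hP.comp (by fun_prop : Continuous fun r : ℝ => (r, θ))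
  -- By `clm_I_mul_sub`, the integrand `Q - i P` is `∂̄F` up to a factor of modulus one.
  have hinner : ∀ θ, ∫ r in (0 : ℝ)..S, (Q r θ - Complex.I * P r θ) =
      (∫ r in (0 : ℝ)..S, Q r θ) + Complex.I * F z := by
    intro θ
    have hi : IntervalIntegrable (fun r => Complex.I * P r θ) volume 0 S :=
      (continuous_const.mul (hcont2 θ)).intervalIntegrable _ _
    rw [intervalIntegral.integral_sub ((hcont1 θ).intervalIntegrable _ _) hi,
      intervalIntegral.integral_const_mul, hPr θ]
    ring
  have htotal : ∫ θ in (0 : ℝ)..(2 * Real.pi), ∫ r in (0 : ℝ)..S, (Q r θ - Complex.I * P r θ) =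
      (2 * Real.pi : ℝ) * (Complex.I * F z) := by
    simp_rw [hinner]
    rw [intervalIntegral.integral_add, hswap, intervalIntegral.integral_const]
    · simp
    · exact (intervalIntegral.continuous_parametric_intervalIntegral_of_continuous'
        (f := fun θ r => Q r θ) (hQ.comp continuous_swap) 0 S).intervalIntegrable _ _
    · simp
  have hbound : ∀ r θ, ‖Q r θ - Complex.I * P r θ‖ ≤ M := by
    intro r θ
    have h1 := clm_I_mul_sub (fderiv ℝ F (γ r θ)) (Complex.exp (θ * Complex.I))
    show ‖fderiv ℝ F (γ r θ) (Complex.I * Complex.exp (θ * Complex.I)) -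
      Complex.I * fderiv ℝ F (γ r θ) (Complex.exp (θ * Complex.I))‖ ≤ M
    rw [h1, norm_mul, RCLike.norm_conj, Complex.norm_exp_ofReal_mul_I, one_mul]
    exact hM _
  have h1 : ‖∫ θ in (0 : ℝ)..(2 * Real.pi), ∫ r in (0 : ℝ)..S, (Q r θ - Complex.I * P r θ)‖ ≤
      M * |S - 0| * |2 * Real.pi - 0| :=
    intervalIntegral.norm_integral_le_of_norm_le_const fun θ _ =>
      intervalIntegral.norm_integral_le_of_norm_le_const fun r _ => hbound r θ
  rw [htotal, norm_mul, norm_mul, Complex.norm_I, one_mul, Complex.norm_real,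
    Real.norm_of_nonneg Real.two_pi_pos.le, sub_zero, sub_zero, abs_of_pos Real.two_pi_pos,
    abs_of_pos (by positivity : (0 : ℝ) < S), mul_comm] at h1
  have := le_of_mul_le_mul_right h1 Real.two_pi_pos
  linarith

/-- On discs so small that `6 R C ≤ 1`, the term `C * ‖F w‖` of a bound for `∂̄F` is absorbed. -/
lemma norm_le_of_norm_dbar_le_mul_add {F : ℂ → ℂ} (hF : ContDiff ℝ 1 F) {R C B : ℝ} (hR : 0 < R)
    (hsupp : ∀ w, R < ‖w‖ → F w = 0) (hB : 0 ≤ B) (hRC : 6 * R * C ≤ 1)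
    (hM : ∀ w, ‖dbar F w‖ ≤ C * ‖F w‖ + B) (hC : 0 ≤ C) (z : ℂ) : ‖F z‖ ≤ 6 * R * B := by
  have hc : HasCompactSupport F := by
    refine HasCompactSupport.intro (isCompact_closedBall (0 : ℂ) R) fun w hw => hsupp w ?_
    simpa using hw
  obtain ⟨m, hm⟩ := hF.continuous.norm.exists_forall_ge_of_hasCompactSupport hc.norm
  refine (hm z).trans ?_
  by_cases hmR : ‖m‖ ≤ R
  · have h := norm_le_of_norm_dbar_le hF hR hsupp (M := C * ‖F m‖ + B)
      (fun w => (hM w).trans (by gcongr; exact hm w)) m hmR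
    nlinarith [norm_nonneg (F m), mul_le_mul_of_nonneg_right hRC (norm_nonneg (F m))]
  · rw [hsupp m (not_le.1 hmR)]
    simp only [norm_zero]; positivity

lemma dbar_congr {f g : ℂ → ℂ} {w : ℂ} (h : f =ᶠ[𝓝 w] g) : dbar f w = dbar g w := by
  simp only [dbar, h.fderiv_eq]

lemma dbar_mul {f g : ℂ → ℂ} {w : ℂ} (hf : DifferentiableAt ℝ f w) (hg : DifferentiableAt ℝ g w) :
    dbar (fun w => f w * g w) w = f w * dbar g w + dbar f w * g w := by
  simp only [dbar]
  rw [fderiv_fun_mul hf hg]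
  simp only [add_apply, smul_apply, smul_eq_mul]
  ring

lemma dbar_of_differentiableAt {f : ℂ → ℂ} {w : ℂ} (hf : DifferentiableAt ℂ f w) :
    dbar f w = 0 := by
  simp only [dbar]
  rw [hf.fderiv_restrictScalars ℝ]
  simp only [ContinuousLinearMap.coe_restrictScalars']
  have := (fderiv ℂ f w).map_smul Complex.I 1
  simp only [smul_eq_mul, mul_one] at this
  rw [this, sub_self]

lemma norm_dbar_le (f : ℂ → ℂ) (w : ℂ) : ‖dbar f w‖ ≤ 2 * ‖fderiv ℝ f w‖ := by
  have h1 := (fderiv ℝ f w).le_opNorm Complex.I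
  have h2 := (fderiv ℝ f w).le_opNorm 1
  simp only [Complex.norm_I, norm_one, mul_one] at h1 h2
  calc ‖dbar f w‖ ≤ ‖fderiv ℝ f w Complex.I‖ + ‖Complex.I * fderiv ℝ f w 1‖ := norm_sub_le _ _
    _ ≤ 2 * ‖fderiv ℝ f w‖ := by rw [norm_mul, Complex.norm_I, one_mul]; linarith

/-- Unique continuation: a function with `|∂̄g| ≤ C |g|` that vanishes to infinite order at a point
vanishes near it. This is Carleman's method: the sup-norm estimate is applied to `g / wⁿ`, cut off
near the circle of radius `R` and near the origin, and `n` is sent to infinity. -/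
lemma eventually_eq_zero_of_flat {g : ℂ → ℂ} (hg : ContDiffAt ℝ 1 g 0)
    (hflat : ∀ n : ℕ, g =O[𝓝 0] fun w : ℂ => ‖w‖ ^ n) {C : ℝ}
    (hC : ∀ᶠ w in 𝓝 (0 : ℂ), ‖dbar g w‖ ≤ C * ‖g w‖) : ∀ᶠ w in 𝓝 (0 : ℂ), g w = 0 := by
  wlog hC0 : 0 ≤ C generalizing C
  · refine this (C := 0) ?_ le_rfl
    filter_upwards [hC] with w hw
    refine hw.trans ?_
    have := norm_nonneg (g w)
    nlinarith
  obtain ⟨δ, hδ, hball⟩ := Metric.eventually_nhds_iff_ball.1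
    ((hg.eventually (by simp)).and hC)
  set R : ℝ := min (δ / 2) (1 / (6 * C + 6)) with hR
  have hR0 : 0 < R := lt_min (by positivity) (by positivity)
  have hRδ : R < δ := (min_le_left _ _).trans_lt (by linarith)
  have hRC : 6 * R * C ≤ 1 := by
    have h1 : R ≤ 1 / (6 * C + 6) := min_le_right _ _
    rw [le_div_iff₀ (by positivity)] at h1
    nlinarith
  -- `X` is the outer cut-off function; `Y` below is the one at the origin, at scale `ε`.
  let χ : ContDiffBump (0 : ℂ) := ⟨R / 2, R, by positivity, by linarith⟩
  have hχd : ContDiff ℝ 1 χ := χ.contDiff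
  obtain ⟨K, hK⟩ := (hχd.continuous_fderiv one_ne_zero).bounded_above_of_compact_support
    (χ.hasCompactSupport.fderiv (𝕜 := ℝ))
  have hK0 : 0 ≤ K := (norm_nonneg _).trans (hK 0)
  let X : ℂ → ℂ := fun w => (χ w : ℂ)
  have hXd : ContDiff ℝ 1 X := Complex.ofRealCLM.contDiff.comp hχd
  have hXfd : ∀ w, ‖fderiv ℝ X w‖ ≤ K := by
    intro w
    have : HasFDerivAt X (Complex.ofRealCLM.comp (fderiv ℝ χ w)) w :=
      Complex.ofRealCLM.hasFDerivAt.comp w (hχd.differentiable one_ne_zero w).hasFDerivAt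
    rw [this.fderiv]
    refine (ContinuousLinearMap.opNorm_comp_le _ _).trans ?_
    rw [Complex.ofRealCLM_norm, one_mul]; exact hK w
  have hXn : ∀ w, ‖X w‖ ≤ 1 := by
    intro w
    simp only [X, Complex.norm_real, Real.norm_of_nonneg χ.nonneg]
    exact χ.le_one
  have hXone : ∀ w, ‖w‖ ≤ R / 2 → X w = 1 := by
    intro w hw
    simp only [X]
    rw [χ.one_of_mem_closedBall (by simpa using hw)]; simp
  have hXzero : ∀ w, R ≤ ‖w‖ → X w = 0 := by
    intro w hw
    simp only [X]
    rw [χ.zero_of_le_dist (by simpa using hw)]; simp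
  have hXd1 : ∀ w, ‖w‖ < R / 2 → dbar X w = 0 := by
    intro w hw
    have h1 : X =ᶠ[𝓝 w] fun _ => 1 := by
      filter_upwards [(isOpen_lt continuous_norm continuous_const).mem_nhds hw] with v hv
      exact hXone v (le_of_lt hv)
    rw [dbar_congr h1, dbar_of_differentiableAt (differentiableAt_const _)]
  have hXd0 : ∀ w, R < ‖w‖ → dbar X w = 0 := by
    intro w hw
    have h1 : X =ᶠ[𝓝 w] fun _ => 0 := by
      filter_upwards [(isOpen_lt continuous_const continuous_norm).mem_nhds hw] with v hv
      exact hXzero v (le_of_lt hv)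
    rw [dbar_congr h1, dbar_of_differentiableAt (differentiableAt_const _)]
  obtain ⟨G, hG⟩ : ∃ G, ∀ w ∈ Metric.closedBall (0 : ℂ) R, ‖g w‖ ≤ G := by
    have hc : ContinuousOn g (Metric.closedBall (0 : ℂ) R) := fun w hw =>
      (hball w (Metric.closedBall_subset_ball hRδ hw)).1.continuousAt.continuousWithinAt
    exact (isCompact_closedBall _ _).exists_bound_of_continuousOn hc
  have hG0 : 0 ≤ G := (norm_nonneg _).trans (hG 0 (by simp [hR0.le]))
  -- the estimate for `g / wⁿ`, with the cut-off at the origin removed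
  have key : ∀ n : ℕ, ∀ z : ℂ, z ≠ 0 → ‖z‖ < R / 2 →
      ‖g z‖ ≤ ‖z‖ ^ n * (6 * R * (2 * K * (G / (R / 2) ^ n))) := by
    intro n z hz hzR
    obtain ⟨c, hc⟩ := (hflat (n + 2)).bound
    obtain ⟨η, hη, hcη⟩ := Metric.eventually_nhds_iff_ball.1 hc
    have hc' : ∀ w ∈ Metric.ball (0 : ℂ) η, ‖g w‖ ≤ |c| * ‖w‖ ^ (n + 2) := by
      intro w hw
      refine (hcη w hw).trans ?_
      rw [norm_pow, norm_norm]
      gcongr; exact le_abs_self c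
    have hev : ∀ᶠ ε : ℝ in 𝓝[>] 0, ‖g z‖ ≤ ‖z‖ ^ n *
        (6 * R * (2 * K * (G / (R / 2) ^ n) + 2 * K * |c| * R ^ 2 * ε)) := by
      have hz0 : 0 < ‖z‖ := norm_pos_iff.2 hz
      have h1 : ∀ᶠ ε : ℝ in 𝓝[>] 0, R * ε < ‖z‖ :=
        nhdsWithin_le_nhds ((continuous_const.mul continuous_id).tendsto' (0 : ℝ) 0 (by simp)
          |>.eventually (gt_mem_nhds hz0))
      have h2 : ∀ᶠ ε : ℝ in 𝓝[>] 0, R * ε < η :=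
        nhdsWithin_le_nhds ((continuous_const.mul continuous_id).tendsto' (0 : ℝ) 0 (by simp)
          |>.eventually (gt_mem_nhds hη))
      filter_upwards [h1, h2, self_mem_nhdsWithin] with ε hεz hεη hε
      have hε0 : 0 < ε := hε
      let Y : ℂ → ℂ := fun w => 1 - X (ε⁻¹ • w)
      have hYd : ContDiff ℝ 1 Y := contDiff_const.sub (hXd.comp (contDiff_const_smul _))
      have hnorm : ∀ w : ℂ, ‖ε⁻¹ • w‖ = ‖w‖ / ε := by
        intro w
        rw [norm_smul, norm_inv, Real.norm_of_nonneg hε0.le, inv_mul_eq_div]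
      have hYn : ∀ w, ‖Y w‖ ≤ 1 := by
        intro w
        have : Y w = ((1 - χ (ε⁻¹ • w) : ℝ) : ℂ) := by simp [Y, X]
        rw [this, Complex.norm_real, Real.norm_of_nonneg (sub_nonneg.2 χ.le_one)]
        linarith [χ.nonneg (x := ε⁻¹ • w)]
      have hYdbar : ∀ w, dbar Y w = - ((ε⁻¹ : ℝ) : ℂ) * dbar X (ε⁻¹ • w) := by
        intro w
        have h1 : HasFDerivAt Y (-((fderiv ℝ X (ε⁻¹ • w)).comp
            (ε⁻¹ • ContinuousLinearMap.id ℝ ℂ))) w := by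
          have h2 := ((hXd.differentiable one_ne_zero (ε⁻¹ • w)).hasFDerivAt.comp w
            ((hasFDerivAt_id w).const_smul ε⁻¹)).const_sub (1 : ℂ)
          exact h2
        simp only [dbar]
        rw [h1.fderiv]
        generalize fderiv ℝ X (ε⁻¹ • w) = A
        simp only [neg_apply, ContinuousLinearMap.comp_apply, smul_apply,
          ContinuousLinearMap.id_apply, map_smul]
        simp only [Complex.real_smul]
        ring
      have hYdb : ∀ w, ‖dbar Y w‖ ≤ 2 * K / ε := by
        intro w
        rw [hYdbar, norm_mul, norm_neg, Complex.norm_real, norm_inv, Real.norm_of_nonneg hε0.le,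
          inv_mul_eq_div]
        gcongr
        exact (norm_dbar_le _ _).trans (by gcongr; exact hXfd _)
      have hYd0 : ∀ w, R * ε < ‖w‖ → dbar Y w = 0 := by
        intro w hw
        rw [hYdbar, hXd0 _ (by rw [hnorm, lt_div_iff₀ hε0]; exact hw), mul_zero]
      have hYzero : ∀ w, ‖w‖ < R * ε / 2 → Y w = 0 := by
        intro w hw
        simp only [Y]
        rw [hXone _ (by rw [hnorm, div_le_iff₀ hε0]; linarith), sub_self]
      let H : ℂ → ℂ := fun w => g w * (w ^ n)⁻¹
      let F : ℂ → ℂ := fun w => X w * (Y w * H w)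
      have hHd : ∀ w, w ≠ 0 → ‖w‖ ≤ R → ContDiffAt ℝ 1 H w := by
        intro w hw hwR
        refine (hball w ?_).1.mul ?_
        · simpa using hwR.trans_lt hRδ
        · exact (contDiffAt_id.pow n).inv (pow_ne_zero n hw)
      have hFnear : ∀ w, ‖w‖ < R * ε / 2 → F =ᶠ[𝓝 w] fun _ => 0 := by
        intro w hw
        filter_upwards [(isOpen_lt continuous_norm continuous_const).mem_nhds hw] with v hv
        simp only [F, hYzero v hv, zero_mul, mul_zero]
      have hFfar : ∀ w, R < ‖w‖ → F =ᶠ[𝓝 w] fun _ => 0 := by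
        intro w hw
        filter_upwards [(isOpen_lt continuous_const continuous_norm).mem_nhds hw] with v hv
        simp only [F, hXzero v (le_of_lt hv), zero_mul]
      have hne : ∀ w : ℂ, ¬ ‖w‖ < R * ε / 2 → w ≠ 0 := by
        rintro w hw rfl
        apply hw; rw [norm_zero]; positivity
      have hF : ContDiff ℝ 1 F := by
        rw [contDiff_iff_contDiffAt]
        intro w
        by_cases h1 : ‖w‖ < R * ε / 2
        · exact contDiffAt_const.congr_of_eventuallyEq (hFnear w h1)
        by_cases h2 : R < ‖w‖
        · exact contDiffAt_const.congr_of_eventuallyEq (hFfar w h2)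
        exact hXd.contDiffAt.mul (hYd.contDiffAt.mul (hHd w (hne w h1) (not_lt.1 h2)))
      have hB : 0 ≤ 2 * K * (G / (R / 2) ^ n) + 2 * K * |c| * R ^ 2 * ε := by positivity
      have hFdbar : ∀ w, ‖dbar F w‖ ≤ C * ‖F w‖ +
          (2 * K * (G / (R / 2) ^ n) + 2 * K * |c| * R ^ 2 * ε) := by
        intro w
        by_cases h1 : ‖w‖ < R * ε / 2
        · rw [dbar_congr (hFnear w h1), dbar_of_differentiableAt (differentiableAt_const _),
            norm_zero]
          positivity
        by_cases h2 : R < ‖w‖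
        · rw [dbar_congr (hFfar w h2), dbar_of_differentiableAt (differentiableAt_const _),
            norm_zero]
          positivity
        have hw0 := hne w h1
        have hwR := not_lt.1 h2
        have hwδ : w ∈ Metric.ball (0 : ℂ) δ := by simpa using hwR.trans_lt hRδ
        have hXw := hXd.differentiable one_ne_zero w
        have hYw := hYd.differentiable one_ne_zero w
        have hgw := (hball w hwδ).1.differentiableAt one_ne_zero
        have hu : DifferentiableAt ℂ (fun w : ℂ => (w ^ n)⁻¹) w :=
          (differentiableAt_id.pow n).inv (pow_ne_zero n hw0)
        have hHw : DifferentiableAt ℝ H w := hgw.mul (hu.restrictScalars ℝ)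
        have hHdbar : dbar H w = dbar g w * (w ^ n)⁻¹ := by
          show dbar (fun w => g w * (w ^ n)⁻¹) w = _
          rw [dbar_mul hgw (hu.restrictScalars ℝ), dbar_of_differentiableAt hu]; ring
        have hexp : dbar F w = X w * (Y w * (dbar g w * (w ^ n)⁻¹)) +
            (dbar X w * Y w * H w + X w * (dbar Y w * H w)) := by
          show dbar (fun w => X w * (Y w * H w)) w = _
          rw [dbar_mul (g := fun w => Y w * H w) hXw (hYw.mul hHw), dbar_mul hYw hHw, hHdbar]; ring
        -- The first term is absorbed. The second, from the outer cut-off, lives on `R / 2 ≤ |w|`.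
        -- The third, from the inner one, is small because `g` vanishes to order `n + 2`.
        have t1 : ‖X w * (Y w * (dbar g w * (w ^ n)⁻¹))‖ ≤ C * ‖F w‖ := by
          simp only [F, H, norm_mul]
          have h3 := (hball w hwδ).2
          calc ‖X w‖ * (‖Y w‖ * (‖dbar g w‖ * ‖(w ^ n)⁻¹‖)) ≤
              ‖X w‖ * (‖Y w‖ * ((C * ‖g w‖) * ‖(w ^ n)⁻¹‖)) := by gcongr
            _ = C * (‖X w‖ * (‖Y w‖ * (‖g w‖ * ‖(w ^ n)⁻¹‖))) := by ring
        have t2 : ‖dbar X w * Y w * H w‖ ≤ 2 * K * (G / (R / 2) ^ n) := by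
          by_cases h3 : ‖w‖ < R / 2
          · rw [hXd1 w h3, zero_mul, zero_mul, norm_zero]; positivity
          have h4 : ‖dbar X w‖ ≤ 2 * K := (norm_dbar_le _ _).trans (by gcongr; exact hXfd _)
          have h5 : ‖H w‖ ≤ G / (R / 2) ^ n := by
            simp only [H, norm_mul, norm_inv, norm_pow]
            rw [← div_eq_mul_inv]
            exact div_le_div₀ hG0 (hG w (by simpa using hwR)) (by positivity)
              (pow_le_pow_left₀ (by positivity) (not_lt.1 h3) n)
          rw [norm_mul, norm_mul]
          calc ‖dbar X w‖ * ‖Y w‖ * ‖H w‖ ≤ (2 * K) * 1 * (G / (R / 2) ^ n) := by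
                gcongr; exact hYn w
            _ = _ := by ring
        have t3 : ‖X w * (dbar Y w * H w)‖ ≤ 2 * K * |c| * R ^ 2 * ε := by
          by_cases h3 : R * ε < ‖w‖
          · rw [hYd0 w h3, zero_mul, mul_zero, norm_zero]; positivity
          have h3 := not_lt.1 h3
          have hw' : 0 < ‖w‖ := norm_pos_iff.2 hw0
          have h5 : ‖H w‖ ≤ |c| * (R * ε) ^ 2 := by
            simp only [H, norm_mul, norm_inv, norm_pow]
            rw [← div_eq_mul_inv, div_le_iff₀ (by positivity)]
            refine (hc' w (by simpa using h3.trans_lt hεη)).trans ?_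
            rw [pow_add, mul_assoc, mul_comm (‖w‖ ^ n)]
            gcongr
          rw [norm_mul, norm_mul]
          calc ‖X w‖ * (‖dbar Y w‖ * ‖H w‖) ≤ 1 * ((2 * K / ε) * (|c| * (R * ε) ^ 2)) := by
                gcongr
                · exact hXn w
                · exact hYdb w
            _ = _ := by field_simp
        rw [hexp]
        exact (norm_add_le _ _).trans (add_le_add t1
          ((norm_add_le _ _).trans (add_le_add t2 t3)))
      have hfin := norm_le_of_norm_dbar_le_mul_add hF hR0
        (fun w hw => (hFfar w hw).self_of_nhds) hB hRC hFdbar hC0 z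
      have hXz : X z = 1 := hXone z hzR.le
      have hYz : Y z = 1 := by
        simp only [Y]
        rw [hXzero _ (by rw [hnorm, le_div_iff₀ hε0]; exact hεz.le), sub_zero]
      simp only [F, H, hXz, hYz, one_mul, norm_mul, norm_inv, norm_pow] at hfin
      rwa [← div_eq_mul_inv, div_le_iff₀' (by positivity)] at hfin
    -- Let the scale `ε` of the inner cut-off tend to zero.
    refine ge_of_tendsto (x := 𝓝[>] (0 : ℝ)) ?_ hev
    refine tendsto_nhdsWithin_of_tendsto_nhds ?_
    refine Continuous.tendsto' (by fun_prop) _ _ (by simp)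
  -- Let `n` tend to infinity: the right side of `key` decays like `(2 |z| / R) ^ n`.
  have hlim : ∀ z : ℂ, z ≠ 0 → ‖z‖ < R / 2 → g z = 0 := by
    intro z hz hzR
    have hq : ‖z‖ / (R / 2) < 1 := (div_lt_one (by positivity)).2 hzR
    have h1 : Filter.Tendsto (fun n : ℕ => (6 * R * (2 * K * G)) * (‖z‖ / (R / 2)) ^ n)
        Filter.atTop (𝓝 0) := by
      simpa using (tendsto_pow_atTop_nhds_zero_of_lt_one (by positivity) hq).const_mul
        (6 * R * (2 * K * G))
    have h2 : ‖g z‖ ≤ 0 := by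
      refine ge_of_tendsto' h1 fun n => (key n z hz hzR).trans (le_of_eq ?_)
      generalize R / 2 = q
      rw [div_pow]; ring
    exact norm_le_zero_iff.1 h2
  have hg0 : g 0 = 0 := by
    have h1 := (hflat 1).bound
    obtain ⟨c, hc⟩ := (hflat 1).bound
    have := hc.self_of_nhds
    simpa using this
  filter_upwards [Metric.ball_mem_nhds (0 : ℂ) (by positivity : 0 < R / 2)] with z hz
  by_cases h : z = 0
  · rw [h, hg0]
  · exact hlim z h (by simpa using hz)

/-! ### The leading term of a solution of `|∂̄g| ≤ C |g|` -/

/-- Taylor's formula at the origin, with the remainder bounded by a power of the norm. -/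
lemma exists_taylor_bound {F : Type*} [NormedAddCommGroup F] [NormedSpace ℝ F] [CompleteSpace F]
    {E : Type*} [NormedAddCommGroup E] [NormedSpace ℝ E] {f : E → F} {n : ℕ}
    (hf : ContDiffAt ℝ (n + 1) f 0) : ∃ C : ℝ, 0 ≤ C ∧ ∀ᶠ w in 𝓝 (0 : E),
      ‖f w - ∑ k ∈ Finset.range (n + 1),
        ((k.factorial : ℝ)⁻¹ • iteratedFDeriv ℝ k f 0 fun _ => w)‖ ≤ C * ‖w‖ ^ (n + 1) := by
  have h1 : ∀ᶠ x in 𝓝 (0 : E), ContDiffAt ℝ (n + 1) f x := by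
    refine hf.eventually ?_
    norm_cast
    simp
  have h2 : ContinuousAt (iteratedFDeriv ℝ (n + 1) f) 0 :=
    hf.continuousAt_iteratedFDeriv (by norm_cast)
  have h3 : ∀ᶠ x in 𝓝 (0 : E), ‖iteratedFDeriv ℝ (n + 1) f x‖ <
      ‖iteratedFDeriv ℝ (n + 1) f 0‖ + 1 :=
    h2.norm.eventually (gt_mem_nhds (by linarith))
  obtain ⟨δ, hδ, hb⟩ := Metric.eventually_nhds_iff_ball.1 (h1.and h3)
  set K := ‖iteratedFDeriv ℝ (n + 1) f 0‖ + 1 with hK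
  refine ⟨(n.factorial : ℝ)⁻¹ * K, by positivity, ?_⟩
  filter_upwards [Metric.ball_mem_nhds (0 : E) hδ] with w hw
  have hw' : ∀ t ∈ Icc (0 : ℝ) 1, 0 + t • w ∈ Metric.ball (0 : E) δ := by
    intro t ht
    rw [zero_add, mem_ball_zero_iff, norm_smul, Real.norm_of_nonneg ht.1]
    rw [mem_ball_zero_iff] at hw
    nlinarith [ht.1, ht.2, norm_nonneg w]
  have h4 := map_add_eq_sum_add_integral_iteratedFDeriv (f := f) (x := 0) (y := w) (n := n)
    (fun t ht => (hb _ (hw' t ht)).1)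
  rw [zero_add] at h4
  have h5 : f w - ∑ k ∈ Finset.range (n + 1),
        ((k.factorial : ℝ)⁻¹ • iteratedFDeriv ℝ k f 0 fun _ => w) =
      (n.factorial : ℝ)⁻¹ • ∫ t in (0 : ℝ)..1,
        (1 - t) ^ n • iteratedFDeriv ℝ (n + 1) f (0 + t • w) (fun _ => w) := by
    rw [sub_eq_iff_eq_add']; exact h4
  rw [h5, norm_smul, norm_inv, Real.norm_of_nonneg (Nat.cast_nonneg _), mul_assoc]
  gcongr
  have h6 : ∀ t ∈ uIoc (0 : ℝ) 1,
      ‖(1 - t) ^ n • iteratedFDeriv ℝ (n + 1) f (0 + t • w) (fun _ => w)‖ ≤ K * ‖w‖ ^ (n + 1) := by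
    intro t ht
    rw [uIoc_of_le zero_le_one] at ht
    have ht' : t ∈ Icc (0 : ℝ) 1 := ⟨ht.1.le, ht.2⟩
    rw [norm_smul, norm_pow, Real.norm_of_nonneg (by linarith [ht.2])]
    have h7 := (iteratedFDeriv ℝ (n + 1) f (0 + t • w)).le_opNorm (fun _ => w)
    rw [Finset.prod_const, Finset.card_univ, Fintype.card_fin] at h7
    have h8 : (1 - t) ^ n ≤ 1 := pow_le_one₀ (by linarith [ht.2]) (by linarith [ht.1])
    calc (1 - t) ^ n * _ ≤ 1 * (K * ‖w‖ ^ (n + 1)) := by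
          refine mul_le_mul h8 (h7.trans ?_) (norm_nonneg _) zero_le_one
          gcongr
          exact (hb _ (hw' t ht')).2.le
      _ = _ := one_mul _
  have h9 := intervalIntegral.norm_integral_le_of_norm_le_const h6
  simpa using h9

/-- A homogeneous function of degree `k` that is `O(|w|^(k+1))` at `0` vanishes. -/
lemma eq_zero_of_homogeneous {F E : Type*} [NormedAddCommGroup F] [NormedSpace ℝ F]
    [NormedAddCommGroup E] [NormedSpace ℝ E] {p : E → F} {k : ℕ}
    (hp : ∀ (t : ℝ) w, p (t • w) = t ^ k • p w) {C : ℝ}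
    (hO : ∀ᶠ w in 𝓝 (0 : E), ‖p w‖ ≤ C * ‖w‖ ^ (k + 1)) (w : E) : p w = 0 := by
  have h1 : Filter.Tendsto (fun t : ℝ => t • w) (𝓝[>] 0) (𝓝 0) :=
    tendsto_nhdsWithin_of_tendsto_nhds
      ((continuous_id.smul continuous_const).tendsto' _ _ (by simp))
  have h2 : ∀ᶠ t : ℝ in 𝓝[>] 0, ‖p w‖ ≤ C * ‖w‖ ^ (k + 1) * t := by
    filter_upwards [h1.eventually hO, self_mem_nhdsWithin] with t ht ht0
    have ht0 : 0 < t := ht0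
    rw [hp, norm_smul, norm_smul, norm_pow, Real.norm_of_nonneg ht0.le] at ht
    have h3 : t ^ k * ‖p w‖ ≤ t ^ k * (C * ‖w‖ ^ (k + 1) * t) := by
      refine ht.trans (le_of_eq ?_); ring
    exact le_of_mul_le_mul_left h3 (by positivity)
  have h3 : ‖p w‖ ≤ 0 := by
    refine ge_of_tendsto (x := 𝓝[>] (0 : ℝ)) ?_ h2
    exact tendsto_nhdsWithin_of_tendsto_nhds (Continuous.tendsto' (by fun_prop) _ _ (by simp))
  exact norm_le_zero_iff.1 h3

/-- The boundary integral over a rectangle is bounded by the supremum times the perimeter. -/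
lemma Complex.norm_wedgeIntegral_add_le {f : ℂ → ℂ} {z w : ℂ} {M : ℝ}
    (hM : ∀ v ∈ (uIcc z.re w.re ×ℂ uIcc z.im w.im), ‖f v‖ ≤ M) :
    ‖wedgeIntegral z w f + wedgeIntegral w z f‖ ≤
      2 * M * (|w.re - z.re| + |w.im - z.im|) := by
  rw [wedgeIntegral_add_wedgeIntegral_eq]
  have h1 : ‖∫ x : ℝ in z.re..w.re, f (x + z.im * I)‖ ≤ M * |w.re - z.re| :=
    intervalIntegral.norm_integral_le_of_norm_le_const fun x hx => hM _ <| by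
      rw [mem_reProdIm]; simpa using uIoc_subset_uIcc hx
  have h2 : ‖∫ x : ℝ in z.re..w.re, f (x + w.im * I)‖ ≤ M * |w.re - z.re| :=
    intervalIntegral.norm_integral_le_of_norm_le_const fun x hx => hM _ <| by
      rw [mem_reProdIm]; simpa using uIoc_subset_uIcc hx
  have h3 : ‖∫ y : ℝ in z.im..w.im, f (w.re + y * I)‖ ≤ M * |w.im - z.im| :=
    intervalIntegral.norm_integral_le_of_norm_le_const fun x hx => hM _ <| by
      rw [mem_reProdIm]; simpa using uIoc_subset_uIcc hx
  have h4 : ‖∫ y : ℝ in z.im..w.im, f (z.re + y * I)‖ ≤ M * |w.im - z.im| :=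
    intervalIntegral.norm_integral_le_of_norm_le_const fun x hx => hM _ <| by
      rw [mem_reProdIm]; simpa using uIoc_subset_uIcc hx
  have h3' := h3
  have h4' := h4
  rw [← one_mul ‖_‖, ← norm_I, ← norm_mul, ← smul_eq_mul] at h3' h4'
  calc _ ≤ ‖∫ x : ℝ in z.re..w.re, f (x + z.im * I)‖ + ‖∫ x : ℝ in z.re..w.re, f (x + w.im * I)‖
        + ‖I • ∫ y : ℝ in z.im..w.im, f (w.re + y * I)‖
        + ‖I • ∫ y : ℝ in z.im..w.im, f (z.re + y * I)‖ :=
        (norm_sub_le _ _).trans (add_le_add ((norm_add_le _ _).trans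
          (add_le_add (norm_sub_le _ _) le_rfl)) le_rfl)
    _ ≤ _ := by linarith

lemma Complex.wedgeIntegral_sub {f g : ℂ → ℂ} {z w : ℂ}
    (hf : ContinuousOn f (uIcc z.re w.re ×ℂ uIcc z.im w.im))
    (hg : ContinuousOn g (uIcc z.re w.re ×ℂ uIcc z.im w.im)) :
    wedgeIntegral z w (fun v => f v - g v) = wedgeIntegral z w f - wedgeIntegral z w g := by
  have h1 : ∀ {f : ℂ → ℂ}, ContinuousOn f (uIcc z.re w.re ×ℂ uIcc z.im w.im) →
      IntervalIntegrable (fun x : ℝ => f (x + z.im * I)) volume z.re w.re := fun hf =>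
    (hf.comp (by fun_prop) fun x hx => by
      rw [mem_reProdIm]; simpa using hx).intervalIntegrable
  have h2 : ∀ {f : ℂ → ℂ}, ContinuousOn f (uIcc z.re w.re ×ℂ uIcc z.im w.im) →
      IntervalIntegrable (fun y : ℝ => f (w.re + y * I)) volume z.im w.im := fun hf =>
    (hf.comp (by fun_prop) fun x hx => by
      rw [mem_reProdIm]; simpa using hx).intervalIntegrable
  simp only [wedgeIntegral]
  rw [intervalIntegral.integral_sub (h1 hf) (h1 hg), intervalIntegral.integral_sub (h2 hf) (h2 hg),
    smul_sub]
  ring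

/-- The induction step for the leading term: if `|∂̄g| ≤ C |g|`, then the first nonvanishing
homogeneous Taylor polynomial `P` of `g` is a uniform limit of rescalings of `g` whose `∂̄` tends to
zero, so `P` is entire by Morera's theorem, and a homogeneous entire function is a monomial. -/
lemma exists_leading_coeff {g : ℂ → ℂ} (hg : ContDiffAt ℝ ∞ g 0) {C : ℝ}
    (hC : ∀ᶠ w in 𝓝 (0 : ℂ), ‖dbar g w‖ ≤ C * ‖g w‖) {n : ℕ}
    (hn : g =O[𝓝 0] fun w : ℂ => ‖w‖ ^ n) :
    ∃ a : ℂ, (fun w => g w - a * w ^ n) =O[𝓝 0] fun w : ℂ => ‖w‖ ^ (n + 1) := by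
  let p : ℕ → ℂ → ℂ := fun k w => (k.factorial : ℝ)⁻¹ • iteratedFDeriv ℝ k g 0 fun _ => w
  have hhom : ∀ k (t : ℝ) w, p k (t • w) = t ^ k • p k w := by
    intro k t w
    simp only [p]
    rw [(iteratedFDeriv ℝ k g 0).map_smul_univ (fun _ => t) (fun _ => w), Finset.prod_const,
      Finset.card_univ, Fintype.card_fin, smul_comm]
  have hpc : ∀ k, Continuous (p k) := fun k =>
    ((iteratedFDeriv ℝ k g 0).cont.comp (continuous_pi fun _ => continuous_id)).const_smul
      (k.factorial : ℝ)⁻¹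
  have htay : ∀ m : ℕ, ∃ K : ℝ, 0 ≤ K ∧ ∀ᶠ w in 𝓝 (0 : ℂ),
      ‖g w - ∑ k ∈ Finset.range (m + 1), p k w‖ ≤ K * ‖w‖ ^ (m + 1) := fun m =>
    exists_taylor_bound (hg.of_le (by exact_mod_cast le_top))
  obtain ⟨c, hc0, hc⟩ : ∃ c : ℝ, 0 ≤ c ∧ ∀ᶠ w in 𝓝 (0 : ℂ), ‖g w‖ ≤ c * ‖w‖ ^ n := by
    obtain ⟨c, hc0, hc⟩ := hn.exists_nonneg
    refine ⟨c, hc0, hc.bound.mono fun w hw => ?_⟩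
    simpa using hw
  -- `p k` is the Taylor polynomial of degree `k`; those of degree less than `n` vanish.
  have hzero : ∀ k, k < n → ∀ w, p k w = 0 := by
    intro k
    induction k using Nat.strong_induction_on with
    | _ k ih =>
      intro hk
      obtain ⟨K, hK0, hK⟩ := htay k
      refine eq_zero_of_homogeneous (hhom k) (C := K + c) ?_
      filter_upwards [hK, hc, Metric.ball_mem_nhds (0 : ℂ) one_pos] with w h1 h2 h3
      rw [Finset.sum_range_succ, Finset.sum_eq_zero fun j hj =>
        ih j (Finset.mem_range.1 hj) ((Finset.mem_range.1 hj).trans hk) w, zero_add] at h1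
      have h4 : ‖w‖ ^ n ≤ ‖w‖ ^ (k + 1) :=
        pow_le_pow_of_le_one (norm_nonneg _) (by simpa using (mem_ball_zero_iff.1 h3).le) hk
      calc ‖p k w‖ = ‖g w - (g w - p k w)‖ := by congr 1; ring
        _ ≤ ‖g w‖ + ‖g w - p k w‖ := norm_sub_le _ _
        _ ≤ c * ‖w‖ ^ (k + 1) + K * ‖w‖ ^ (k + 1) := by
            gcongr; exact h2.trans (by gcongr)
        _ = _ := by ring
  obtain ⟨K, hK0, hK⟩ := htay n
  have hgP : ∀ᶠ w in 𝓝 (0 : ℂ), ‖g w - p n w‖ ≤ K * ‖w‖ ^ (n + 1) := by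
    filter_upwards [hK] with w hw
    rwa [Finset.sum_range_succ, Finset.sum_eq_zero fun j hj => hzero j (Finset.mem_range.1 hj) w,
      zero_add] at hw
  have hg1 : ∀ᶠ w in 𝓝 (0 : ℂ), ContDiffAt ℝ 1 g w :=
    (hg.of_le (by exact_mod_cast le_top)).eventually (by simp)
  obtain ⟨δ, hδ, hb⟩ := Metric.eventually_nhds_iff_ball.1 (hgP.and (hg1.and (hC.and hc)))
  -- The hypothesis of Morera's theorem: the boundary integral of `p n` over a rectangle is the
  -- limit of those of the rescalings `Gs` of `g`, which are computed from their `∂̄`.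
  have hcons : Complex.IsConservativeOn (p n) univ := by
    intro z w _
    rw [← add_eq_zero_iff_eq_neg, ← norm_le_zero_iff]
    set T : Set ℂ := (uIcc z.re w.re ×ℂ uIcc z.im w.im) with hT
    have hTc : IsCompact T := isCompact_uIcc.reProdIm isCompact_uIcc
    obtain ⟨ρ, hρ⟩ := hTc.isBounded.exists_norm_le
    have hρ0 : 0 ≤ ρ := (norm_nonneg _).trans (hρ z (by simp [hT, Complex.mem_reProdIm]))
    set A := |w.re - z.re| with hA
    set B := |w.im - z.im| with hB
    have hev : ∀ᶠ s : ℝ in 𝓝[>] 0,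
        ‖Complex.wedgeIntegral z w (p n) + Complex.wedgeIntegral w z (p n)‖ ≤
          (2 * (K * ρ ^ (n + 1)) * (A + B) + |C| * c * ρ ^ n * B * A) * s := by
      have h1 : ∀ᶠ s : ℝ in 𝓝[>] 0, s * ρ < δ :=
        nhdsWithin_le_nhds ((continuous_id.mul continuous_const).tendsto' (0 : ℝ) 0 (by simp)
          |>.eventually (gt_mem_nhds hδ))
      filter_upwards [h1, self_mem_nhdsWithin] with s hsδ hs
      have hs0 : 0 < s := hs
      have hsm : ∀ v ∈ T, s • v ∈ Metric.ball (0 : ℂ) δ := by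
        intro v hv
        rw [mem_ball_zero_iff, norm_smul, Real.norm_of_nonneg hs0.le]
        exact lt_of_le_of_lt (by gcongr; exact hρ v hv) hsδ
      let Gs : ℂ → ℂ := fun v => (s ^ n)⁻¹ • g (s • v)
      have hGd : ∀ v ∈ T, HasFDerivAt Gs
          ((s ^ n)⁻¹ • (fderiv ℝ g (s • v)).comp (s • ContinuousLinearMap.id ℝ ℂ)) v := by
        intro v hv
        exact (((hb _ (hsm v hv)).2.1.differentiableAt one_ne_zero).hasFDerivAt.comp v
          ((hasFDerivAt_id v).const_smul s)).const_smul (s ^ n)⁻¹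
      have hGc : ContinuousOn Gs T := fun v hv => (hGd v hv).continuousAt.continuousWithinAt
      have hsub : ∀ v ∈ T, ‖p n v - Gs v‖ ≤ K * ρ ^ (n + 1) * s := by
        intro v hv
        have h2 := (hb _ (hsm v hv)).1
        have h3 : p n v - Gs v = -((s ^ n)⁻¹ • (g (s • v) - p n (s • v))) := by
          rw [hhom, smul_sub, smul_smul, inv_mul_cancel₀ (by positivity), one_smul, neg_sub]
        rw [h3, norm_neg, norm_smul, norm_inv, norm_pow, Real.norm_of_nonneg hs0.le,
          inv_mul_le_iff₀ (by positivity)]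
        refine h2.trans ?_
        rw [norm_smul, Real.norm_of_nonneg hs0.le, mul_pow]
        have := hρ v hv
        calc K * (s ^ (n + 1) * ‖v‖ ^ (n + 1)) ≤ K * (s ^ (n + 1) * ρ ^ (n + 1)) := by gcongr
          _ = _ := by ring
      have hT' : (uIcc w.re z.re ×ℂ uIcc w.im z.im) = T := by
        rw [hT, uIcc_comm, uIcc_comm z.im]
      have hsplit : Complex.wedgeIntegral z w (p n) + Complex.wedgeIntegral w z (p n) =
          (Complex.wedgeIntegral z w (fun v => p n v - Gs v) +
            Complex.wedgeIntegral w z (fun v => p n v - Gs v)) +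
          (Complex.wedgeIntegral z w Gs + Complex.wedgeIntegral w z Gs) := by
        rw [Complex.wedgeIntegral_sub (hpc n).continuousOn hGc,
          Complex.wedgeIntegral_sub (hpc n).continuousOn (by rw [hT']; exact hGc)]
        ring
      have hdb : ∀ v ∈ T, ‖Complex.I • fderiv ℝ Gs v 1 - fderiv ℝ Gs v Complex.I‖ ≤
          |C| * c * ρ ^ n * s := by
        intro v hv
        rw [(hGd v hv).fderiv]
        have h4 : Complex.I • ((s ^ n)⁻¹ • (fderiv ℝ g (s • v)).comp
              (s • ContinuousLinearMap.id ℝ ℂ)) 1 -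
            ((s ^ n)⁻¹ • (fderiv ℝ g (s • v)).comp (s • ContinuousLinearMap.id ℝ ℂ)) Complex.I =
            -((s ^ n)⁻¹ • s • dbar g (s • v)) := by
          simp only [dbar]
          generalize fderiv ℝ g (s • v) = L
          simp only [ContinuousLinearMap.comp_apply, smul_apply,
            ContinuousLinearMap.id_apply, map_smul]
          simp only [Complex.real_smul, smul_eq_mul]
          ring
        rw [h4, norm_neg, norm_smul, norm_smul, norm_inv, norm_pow, Real.norm_of_nonneg hs0.le,
          inv_mul_le_iff₀ (by positivity)]
        have h5 := (hb _ (hsm v hv)).2.2.1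
        have h6 := (hb _ (hsm v hv)).2.2.2
        rw [norm_smul, Real.norm_of_nonneg hs0.le, mul_pow] at h6
        have := hρ v hv
        calc s * ‖dbar g (s • v)‖ ≤ s * (|C| * (c * (s ^ n * ρ ^ n))) := by
              gcongr
              refine h5.trans (mul_le_mul (le_abs_self C) (h6.trans (by gcongr)) (norm_nonneg _)
                (abs_nonneg _))
          _ = _ := by ring
      have hWG : ‖Complex.wedgeIntegral z w Gs + Complex.wedgeIntegral w z Gs‖ ≤
          |C| * c * ρ ^ n * s * B * A := by
        rw [Complex.wedgeIntegral_add_wedgeIntegral_eq,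
          Complex.integral_boundary_rect_of_differentiableOn_real]
        · refine intervalIntegral.norm_integral_le_of_norm_le_const fun x hx =>
            intervalIntegral.norm_integral_le_of_norm_le_const fun y hy => hdb _ ?_
          rw [Complex.mem_reProdIm]
          simpa using ⟨uIoc_subset_uIcc hx, uIoc_subset_uIcc hy⟩
        · exact fun v hv => (hGd v hv).differentiableAt.differentiableWithinAt
        · have hcd : ContinuousOn (fun v => fderiv ℝ Gs v) T := by
            have h7 : ContinuousOn (fun v => (s ^ n)⁻¹ • (fderiv ℝ g (s • v)).comp
                (s • ContinuousLinearMap.id ℝ ℂ)) T := by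
              refine ContinuousOn.const_smul (ContinuousOn.clm_comp ?_ continuousOn_const) (s ^ n)⁻¹
              intro v hv
              have h8 : ContinuousAt (fderiv ℝ g) (s • v) :=
                ((hb _ (hsm v hv)).2.1.fderiv_right (m := 0) (by simp)).continuousAt
              exact (ContinuousAt.comp (g := fderiv ℝ g) (f := fun v : ℂ => s • v) h8
                (continuous_const_smul s).continuousAt).continuousWithinAt
            exact h7.congr fun v hv => (hGd v hv).fderiv
          refine ContinuousOn.integrableOn_compact hTc ?_
          exact ((hcd.clm_apply continuousOn_const).const_smul Complex.I).sub
            (hcd.clm_apply continuousOn_const)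
      rw [hsplit]
      refine (norm_add_le _ _).trans
        ((add_le_add (Complex.norm_wedgeIntegral_add_le hsub) hWG).trans (le_of_eq ?_))
      ring
    refine ge_of_tendsto (x := 𝓝[>] (0 : ℝ)) ?_ hev
    exact tendsto_nhdsWithin_of_tendsto_nhds (Continuous.tendsto' (by fun_prop) _ _ (by simp))
  have hdiff : DifferentiableOn ℂ (p n) univ :=
    (hcons.isExactOn_univ (hpc n)).differentiableOn isOpen_univ
  -- A homogeneous entire function agrees with a monomial on the real axis, hence everywhere.
  have hmon : EqOn (p n) (fun w => p n 1 * w ^ n) univ := by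
    refine AnalyticOnNhd.eqOn_of_preconnected_of_frequently_eq (z₀ := 1)
      (hdiff.analyticOnNhd isOpen_univ)
      ((by fun_prop : Differentiable ℂ fun w : ℂ => p n 1 * w ^ n).differentiableOn.analyticOnNhd
        isOpen_univ) isPreconnected_univ (mem_univ _) ?_
    have h1 : Filter.Tendsto (fun t : ℝ => (t : ℂ)) (𝓝[≠] 1) (𝓝[≠] 1) := by
      refine tendsto_nhdsWithin_iff.2 ⟨tendsto_nhdsWithin_of_tendsto_nhds
        (Complex.continuous_ofReal.tendsto' _ _ (by simp)), ?_⟩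
      filter_upwards [self_mem_nhdsWithin] with t ht
      simpa using ht
    refine h1.frequently (Filter.Eventually.frequently ?_)
    refine Filter.Eventually.of_forall fun t => ?_
    have := hhom n t 1
    rw [Complex.real_smul, mul_one] at this
    rw [this, Complex.real_smul]; push_cast; ring
  refine ⟨p n 1, Asymptotics.IsBigO.of_bound K ?_⟩
  filter_upwards [hgP] with w hw
  have h1 : p n w = p n 1 * w ^ n := hmon (mem_univ w)
  rwa [norm_pow, norm_norm, ← h1]

/-- The leading term of a nonzero solution of `|∂̄g| ≤ C |g|` is a monomial in `w`. -/
theorem exists_leading_term {g : ℂ → ℂ} (hg : ContDiffAt ℝ ∞ g 0) {C : ℝ}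
    (hC : ∀ᶠ w in 𝓝 (0 : ℂ), ‖dbar g w‖ ≤ C * ‖g w‖) (hne : ∃ᶠ w in 𝓝 (0 : ℂ), g w ≠ 0) :
    ∃ (d : ℕ) (a : ℂ), a ≠ 0 ∧
      (fun w => g w - a * w ^ d) =O[𝓝 0] fun w : ℂ => w ^ (d + 1) := by
  -- If there is no leading term, `exists_leading_coeff` shows inductively that `g` is flat.
  by_contra hcon
  push Not at hcon
  have hflat : ∀ n : ℕ, g =O[𝓝 0] fun w : ℂ => ‖w‖ ^ n := by
    intro n
    induction n with
    | zero => simpa using hg.continuousAt.isBigO_one ℝ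
    | succ n ih =>
      obtain ⟨a, ha⟩ := exists_leading_coeff hg hC ih
      by_cases h0 : a = 0
      · simpa [h0] using ha
      · refine absurd ?_ (hcon n a h0)
        refine ha.trans (Asymptotics.IsBigO.of_norm_left ?_)
        simpa using (Asymptotics.isBigO_refl (fun w : ℂ => w ^ (n + 1)) (𝓝 0)).norm_left
  exact hne ((eventually_eq_zero_of_flat (hg.of_le (by exact_mod_cast le_top)) hflat hC).mono
    fun w hw => by simpa using hw)

/-! ### Closed forms near a divisor in a vector space -/

lemma integral_fderiv_apply_eq_zero {f : ℂ → ℝ} (hf : ContDiff ℝ 1 f) (hc : HasCompactSupport f)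
    (v : ℂ) : ∫ w, fderiv ℝ f w v = 0 := by
  have hcd : Continuous fun w => fderiv ℝ f w v :=
    (hf.continuous_fderiv one_ne_zero).clm_apply continuous_const
  have hcs : HasCompactSupport fun w => fderiv ℝ f w v :=
    (hc.fderiv (𝕜 := ℝ)).comp_left (g := fun A : ℂ →L[ℝ] ℝ => A v) rfl
  have h := integral_mul_fderiv_eq_neg_fderiv_mul_of_integrable (μ := (volume : Measure ℂ))
    (f := f) (g := fun _ => (1 : ℝ)) (v := v)
    (by simpa using hcd.integrable_of_hasCompactSupport hcs) (by simp)
    (by simpa using hf.continuous.integrable_of_hasCompactSupport hc)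
    (fun x _ => hf.differentiable one_ne_zero x) (fun x _ => differentiableAt_const _)
  simpa using h.symm

/-- The integral of the exterior derivative of a compactly supported `1`-form on the plane
vanishes. -/
lemma integral_curl_eq_zero {ν : ℂ → ℂ →L[ℝ] ℝ} (hν : ContDiff ℝ 1 ν) (hc : HasCompactSupport ν) :
    ∫ w, (fderiv ℝ ν w 1 Complex.I - fderiv ℝ ν w Complex.I 1) = 0 := by
  have happ : ∀ v : ℂ, ContDiff ℝ 1 (fun w => ν w v) := fun v => hν.clm_apply contDiff_const
  have hcs : ∀ v : ℂ, HasCompactSupport (fun w => ν w v) := fun v =>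
    hc.comp_left (g := fun A : ℂ →L[ℝ] ℝ => A v) rfl
  have hfd : ∀ v u w, fderiv ℝ (fun w => ν w v) w u = fderiv ℝ ν w u v := by
    intro v u w
    have := ((hν.differentiable one_ne_zero w).hasFDerivAt.clm_apply (hasFDerivAt_const v w)).fderiv
    rw [this]; simp
  have hint : ∀ v u, Integrable (fun w => fderiv ℝ ν w u v) := by
    intro v u
    simp_rw [← hfd v u]
    refine Continuous.integrable_of_hasCompactSupport
      (((happ v).continuous_fderiv one_ne_zero).clm_apply continuous_const) ?_
    exact ((hcs v).fderiv (𝕜 := ℝ)).comp_left (g := fun A : ℂ →L[ℝ] ℝ => A u) rfl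
  rw [integral_sub (hint _ _) (hint _ _)]
  simp_rw [← hfd]
  rw [integral_fderiv_apply_eq_zero (happ _) (hcs _), integral_fderiv_apply_eq_zero (happ _) (hcs _),
    sub_zero]

section Primitive

variable {E : Type*} [NormedAddCommGroup E] [NormedSpace ℝ E] [FiniteDimensional ℝ E]

/-- Differentiation under the integral sign, for an integrand that is `C¹` in the parameter. -/
lemma hasFDerivAt_intervalIntegral_of_continuous {F : Type*} [NormedAddCommGroup F]
    [NormedSpace ℝ F] {f : E → ℝ → F} {f' : E → ℝ → E →L[ℝ] F}
    (hf : Continuous (Function.uncurry f)) (hf' : Continuous (Function.uncurry f'))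
    (hd : ∀ x t, HasFDerivAt (fun x => f x t) (f' x t) x) (a b : ℝ) (x : E) :
    HasFDerivAt (fun x => ∫ t in a..b, f x t) (∫ t in a..b, f' x t) x := by
  have : ProperSpace E := FiniteDimensional.proper ℝ E
  obtain ⟨K, hK⟩ := ((isCompact_closedBall x 1).prod (isCompact_uIcc (a := a) (b := b))
    ).exists_bound_of_continuousOn hf'.continuousOn
  have hc : ∀ x, Continuous (f x) := fun x => hf.comp (Continuous.prodMk_right x)
  have hc' : ∀ x, Continuous (f' x) := fun x => hf'.comp (Continuous.prodMk_right x)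
  refine intervalIntegral.hasFDerivAt_integral_of_dominated_of_fderiv_le (bound := fun _ => K)
    (s := Metric.ball x 1) (Metric.ball_mem_nhds x one_pos)
    (Filter.Eventually.of_forall fun y => (hc y).aestronglyMeasurable)
    ((hc x).intervalIntegrable _ _) (hc' x).aestronglyMeasurable
    (Filter.Eventually.of_forall fun t ht y hy => ?_) (by simp)
    (Filter.Eventually.of_forall fun t _ y _ => hd y t)
  exact hK (y, t) ⟨Metric.ball_subset_closedBall hy, uIoc_subset_uIcc ht⟩

set_option maxSynthPendingDepth 3 in
/-- The Poincaré lemma for closed `2`-forms on a ball, with the radial primitive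
`λ_x = ∫ t B_{tx}(x, ·) dt`. -/
theorem exists_primitive_of_closed_two_form {B : E → E →L[ℝ] E →L[ℝ] ℝ} (hB : ContDiff ℝ 1 B)
    (halt : ∀ x u v, B x u v = - B x v u) {δ : ℝ}
    (hcl : ∀ x ∈ Metric.ball (0 : E) δ, ∀ u v w,
      fderiv ℝ B x u v w - fderiv ℝ B x v u w + fderiv ℝ B x w u v = 0) :
    ∃ lam : E → E →L[ℝ] ℝ, ContDiff ℝ 1 lam ∧ ∀ x ∈ Metric.ball (0 : E) δ, ∀ u v,
      fderiv ℝ lam x u v - fderiv ℝ lam x v u = B x u v := by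
  have hBd : Differentiable ℝ B := hB.differentiable one_ne_zero
  have hBc : Continuous (fderiv ℝ B) := hB.continuous_fderiv one_ne_zero
  let f : E → ℝ → E →L[ℝ] ℝ := fun x t => t • B (t • x) x
  let f' : E → ℝ → E →L[ℝ] E →L[ℝ] ℝ := fun x t =>
    t • (t • (fderiv ℝ B (t • x)).flip x + B (t • x))
  have hsm : Continuous fun p : E × ℝ => p.2 • p.1 := by fun_prop
  have hf : Continuous (Function.uncurry f) :=
    continuous_snd.smul ((hB.continuous.comp hsm).clm_apply continuous_fst)
  have hf' : Continuous (Function.uncurry f') := by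
    refine continuous_snd.smul ((continuous_snd.smul ?_).add (hB.continuous.comp hsm))
    exact ((ContinuousLinearMap.flipₗᵢ ℝ E E (E →L[ℝ] ℝ)).continuous.comp
      (hBc.comp hsm)).clm_apply continuous_fst
  have hd : ∀ x t, HasFDerivAt (fun x => f x t) (f' x t) x := by
    intro x t
    have h1 : HasFDerivAt (fun x => B (t • x))
        ((fderiv ℝ B (t • x)).comp (t • ContinuousLinearMap.id ℝ E)) x :=
      HasFDerivAt.comp (f := fun x : E => t • x) x (hBd (t • x)).hasFDerivAt
        ((hasFDerivAt_id x).const_smul t)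
    have h2 := (h1.clm_apply (hasFDerivAt_id x)).const_smul t
    refine h2.congr_fderiv ?_
    ext u v
    simp [f']
    ring
  have hlam : ∀ x, HasFDerivAt (fun x => ∫ t in (0 : ℝ)..1, f x t)
      (∫ t in (0 : ℝ)..1, f' x t) x := fun x =>
    hasFDerivAt_intervalIntegral_of_continuous hf hf' hd 0 1 x
  refine ⟨fun x => ∫ t in (0 : ℝ)..1, f x t, ?_, ?_⟩
  · rw [contDiff_one_iff_fderiv]
    refine ⟨fun x => (hlam x).differentiableAt, ?_⟩
    have : fderiv ℝ (fun x => ∫ t in (0 : ℝ)..1, f x t) = fun x => ∫ t in (0 : ℝ)..1, f' x t :=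
      funext fun x => (hlam x).fderiv
    rw [this]
    exact intervalIntegral.continuous_parametric_intervalIntegral_of_continuous' hf' 0 1
  · intro x hx u v
    rw [(hlam x).fderiv]
    have hci : IntervalIntegrable (f' x) volume 0 1 :=
      (hf'.comp (Continuous.prodMk_right x)).intervalIntegrable _ _
    have happ : ∀ a b : E, (∫ t in (0 : ℝ)..1, f' x t) a b = ∫ t in (0 : ℝ)..1, f' x t a b := by
      intro a b
      let T : (E →L[ℝ] E →L[ℝ] ℝ) →L[ℝ] ℝ :=
        (ContinuousLinearMap.apply ℝ ℝ b).comp (ContinuousLinearMap.apply ℝ (E →L[ℝ] ℝ) a)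
      exact (T.intervalIntegral_comp_comm hci).symm
    have hcab : ∀ a b : E, Continuous fun t => f' x t a b := fun a b =>
      ((hf'.comp (Continuous.prodMk_right x)).clm_apply continuous_const).clm_apply
        continuous_const
    rw [happ, happ, ← intervalIntegral.integral_sub ((hcab u v).intervalIntegrable _ _)
      ((hcab v u).intervalIntegrable _ _)]
    -- For closed `B`, the integrand of the exterior derivative of `λ` is the derivative of
    -- `t² B_{tx}(u, v)`.
    have hder : ∀ t ∈ uIcc (0 : ℝ) 1, HasDerivAt (fun t : ℝ => t ^ 2 * B (t • x) u v)
        (f' x t u v - f' x t v u) t := by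
      intro t ht
      rw [uIcc_of_le zero_le_one] at ht
      have h1 : HasDerivAt (fun t : ℝ => B (t • x)) (fderiv ℝ B (t • x) x) t := by
        have h2 : HasDerivAt (fun t : ℝ => t • x) x t := by
          simpa using (hasDerivAt_id t).smul_const x
        exact (hBd (t • x)).hasFDerivAt.comp_hasDerivAt t h2
      have h3 : HasDerivAt (fun t : ℝ => B (t • x) u v) (fderiv ℝ B (t • x) x u v) t := by
        have := (h1.clm_apply (hasDerivAt_const t u)).clm_apply (hasDerivAt_const t v)
        simpa using this
      have h4 := ((hasDerivAt_id t).pow 2).mul h3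
      refine h4.congr_deriv ?_
      have hmem : t • x ∈ Metric.ball (0 : E) δ := by
        rw [mem_ball_zero_iff, norm_smul, Real.norm_of_nonneg ht.1]
        rw [mem_ball_zero_iff] at hx
        nlinarith [ht.1, ht.2, norm_nonneg x]
      have h5 := hcl (t • x) hmem u x v
      have hsk : ∀ a b c, fderiv ℝ B (t • x) a b c = - fderiv ℝ B (t • x) a c b := by
        intro a b c
        have e1 := (((hBd (t • x)).hasFDerivAt.clm_apply (hasFDerivAt_const b _)).clm_apply
          (hasFDerivAt_const c _))
        have e2 := (((hBd (t • x)).hasFDerivAt.clm_apply (hasFDerivAt_const c _)).clm_apply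
          (hasFDerivAt_const b _)).neg
        have e3 : (fun y => B y b c) = -fun y => B y c b := funext fun y => halt y b c
        rw [e3] at e1
        have e4 := congrArg (fun L : E →L[ℝ] ℝ => L a) (e1.unique e2)
        simpa using e4
      simp only [f', smul_apply, add_apply, ContinuousLinearMap.flip_apply, smul_eq_mul, id,
        Pi.pow_apply]
      rw [halt (t • x) v u]
      have h7 := hsk v u x
      simp only [Nat.cast_ofNat, Nat.add_one_sub_one, pow_one]
      linear_combination t ^ 2 * h7 - t ^ 2 * h5
    rw [intervalIntegral.integral_eq_sub_of_hasDerivAt hder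
      (((hcab u v).sub (hcab v u)).intervalIntegrable _ _)]
    simp

end Primitive

/-! ### The period of a closed form off the divisor -/

section Period

variable {E : Type*} [NormedAddCommGroup E] [NormedSpace ℝ E]

/-- A closed `1`-form `θ` off the divisor `L = 0` has a period `c`: the integral of `θ` over a loop
near the origin is `c` times the winding number of the loop around the divisor, the winding number
being read off a logarithm `ℓ` of `L` along the loop. The form is pulled back by the exponential
covering `x ↦ x - R L x + R exp (L x)`, whose domain is convex, so that it becomes exact; the
period is the increment of the primitive under the deck transformation. -/
theorem exists_period (L : E →L[ℝ] ℂ) (R : ℂ →L[ℝ] E) (hLR : ∀ z, L (R z) = z) {δ : ℝ}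
    (hδ : 0 < δ) {θ : E → E →L[ℝ] ℝ}
    (hθ : ∀ x ∈ Metric.ball (0 : E) δ, L x ≠ 0 → DifferentiableAt ℝ θ x)
    (hsymm : ∀ x ∈ Metric.ball (0 : E) δ, L x ≠ 0 → ∀ u v, fderiv ℝ θ x u v = fderiv ℝ θ x v u) :
    ∃ c : ℝ, ∃ ε > 0, ∀ (γ γ' : ℝ → E) (ℓ ℓ' : ℝ → ℂ) (a b : ℝ) (n : ℕ),
      (∀ t, HasDerivAt γ (γ' t) t) → (∀ t, HasDerivAt ℓ (ℓ' t) t) →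
      (∀ t, Complex.exp (ℓ t) = L (γ t)) → (∀ t, ‖γ t‖ < ε) →
      Continuous (fun t => θ (γ t) (γ' t)) → γ b = γ a →
      ℓ b = ℓ a + n * (2 * Real.pi * Complex.I) → ∫ t in a..b, θ (γ t) (γ' t) = n * c := by
  -- `P` is the projection to the divisor, `S` the exponential covering and `Ω` a convex set that it
  -- maps to the ball of radius `δ`.
  set σ : ℝ := δ / (2 * (‖R‖ + 1)) with hσ
  have hσ0 : 0 < σ := by positivity
  have hRσ : ‖R‖ * σ ≤ δ / 2 := by
    rw [hσ, mul_div_assoc', div_le_div_iff₀ (by positivity) (by positivity)]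
    nlinarith [norm_nonneg R]
  let P : E →L[ℝ] E := ContinuousLinearMap.id ℝ E - R.comp L
  have hP : ∀ x, P x = x - R (L x) := fun x => rfl
  have hLP : ∀ x, L (P x) = 0 := fun x => by rw [hP, map_sub, hLR, sub_self]
  let S : E → E := fun x => P x + R (Complex.exp (L x))
  have hLS : ∀ x, L (S x) = Complex.exp (L x) := fun x => by
    simp only [S, map_add, hLP, hLR, zero_add]
  have hLS0 : ∀ x, L (S x) ≠ 0 := fun x => by rw [hLS]; exact Complex.exp_ne_zero _
  let Ω : Set E := {x | ‖P x‖ < δ / 2 ∧ (L x).re < Real.log σ}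
  have hΩo : IsOpen Ω :=
    (isOpen_lt P.continuous.norm continuous_const).inter
      (isOpen_lt (Complex.continuous_re.comp L.continuous) continuous_const)
  have hΩc : Convex ℝ Ω := by
    have : Ω = P ⁻¹' Metric.ball 0 (δ / 2) ∩ {x | (L x).re < Real.log σ} := by
      ext; simp [Ω]
    rw [this]
    refine Convex.inter ?_ ?_
    · exact (convex_ball _ _).linear_preimage P.toLinearMap
    · exact convex_halfSpace_lt (f := fun x => (L x).re)
        ⟨fun x y => by simp, fun c x => by simp⟩ _
  have hSball : ∀ x ∈ Ω, S x ∈ Metric.ball (0 : E) δ := by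
    intro x hx
    rw [mem_ball_zero_iff]
    have h1 : ‖R (Complex.exp (L x))‖ ≤ ‖R‖ * σ := by
      refine (R.le_opNorm _).trans ?_
      gcongr
      rw [Complex.norm_exp]
      calc Real.exp (L x).re ≤ Real.exp (Real.log σ) := Real.exp_le_exp.2 hx.2.le
        _ = σ := Real.exp_log hσ0
    calc ‖S x‖ ≤ ‖P x‖ + ‖R (Complex.exp (L x))‖ := norm_add_le _ _
      _ < δ / 2 + δ / 2 := add_lt_add_of_lt_of_le hx.1 (h1.trans hRσ)
      _ = δ := by ring
  let DS : E → E →L[ℝ] E := fun x =>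
    P + R.comp ((ContinuousLinearMap.mul ℝ ℂ (Complex.exp (L x))).comp L)
  have hDS : ∀ x v, DS x v = P v + R (Complex.exp (L x) * L v) := fun x v => rfl
  have hexpd : ∀ x : E, HasFDerivAt (fun x => Complex.exp (L x))
      ((ContinuousLinearMap.mul ℝ ℂ (Complex.exp (L x))).comp L) x := by
    intro x
    have h1 := (L.hasFDerivAt (x := x)).cexp
    refine h1.congr_fderiv ?_
    ext v; simp
  have hSd : ∀ x, HasFDerivAt S (DS x) x := fun x =>
    P.hasFDerivAt.add (R.hasFDerivAt.comp x (hexpd x))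
  have hDSd : Differentiable ℝ DS := by
    intro x
    refine (differentiableAt_const _).add ((differentiableAt_const _).clm_comp
      (DifferentiableAt.clm_comp ?_ (differentiableAt_const _)))
    exact ((ContinuousLinearMap.mul ℝ ℂ).differentiableAt).comp x (hexpd x).differentiableAt
  -- The pull-back of `θ` by `S`, which is closed on `Ω` and has the primitive `F`.
  let θt : E → E →L[ℝ] ℝ := fun x => (θ (S x)).comp (DS x)
  have hθS : ∀ x ∈ Ω, DifferentiableAt ℝ (fun y => θ (S y)) x := fun x hx =>
    DifferentiableAt.comp (g := θ) x (hθ _ (hSball x hx) (hLS0 x)) (hSd x).differentiableAt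
  have hθtd : DifferentiableOn ℝ θt Ω := fun x hx =>
    ((hθS x hx).clm_comp (hDSd x)).differentiableWithinAt
  have hθt_symm : ∀ x ∈ Ω, ∀ u v, fderiv ℝ θt x u v = fderiv ℝ θt x v u := by
    intro x hx
    have key : ∀ u v, fderiv ℝ θt x u v =
        fderiv ℝ θ (S x) (DS x u) (DS x v) + θ (S x) (R (Complex.exp (L x) * L u * L v)) := by
      intro u v
      have h1 : fderiv ℝ (fun y => θt y v) x u = fderiv ℝ θt x u v := by
        have := ((hθtd x hx).differentiableAt (hΩo.mem_nhds hx)).hasFDerivAt.clm_apply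
          (hasFDerivAt_const v x)
        rw [this.fderiv]; simp
      rw [← h1]
      have h2 : HasFDerivAt (fun y => θ (S y)) ((fderiv ℝ θ (S x)).comp (DS x)) x :=
        HasFDerivAt.comp (g := θ) x (hθ _ (hSball x hx) (hLS0 x)).hasFDerivAt (hSd x)
      have h3 : HasFDerivAt (fun y => DS y v) (R.comp ((ContinuousLinearMap.mul ℝ ℂ (L v)).comp
          ((ContinuousLinearMap.mul ℝ ℂ (Complex.exp (L x))).comp L))) x := by
        have h4 := ((R.comp (ContinuousLinearMap.mul ℝ ℂ (L v))).hasFDerivAt.comp x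
          (hexpd x)).const_add (P v)
        refine (h4.congr_of_eventuallyEq (Filter.Eventually.of_forall fun y => ?_)).congr_fderiv ?_
        · simp [hDS, mul_comm]
        · ext w; simp
      have h5 := (h2.clm_apply h3).fderiv
      have h6 : (fun y => θt y v) = fun y => θ (S y) (DS y v) := rfl
      rw [h6, h5]
      simp only [add_apply, ContinuousLinearMap.comp_apply, ContinuousLinearMap.flip_apply,
        ContinuousLinearMap.mul_apply']
      rw [mul_comm (L v), add_comm]
    intro u v
    rw [key, key, hsymm _ (hSball x hx) (hLS0 x), mul_assoc, mul_comm (L u), ← mul_assoc]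
  obtain ⟨F, hF⟩ := hΩc.exists_forall_hasFDerivAt_of_fderiv_symmetric hΩo hθtd hθt_symm
  -- The deck transformation is the translation by `τ`.
  set τ : E := R (2 * Real.pi * Complex.I) with hτ
  have hPR : ∀ z, P (R z) = 0 := fun z => by rw [hP, hLR, sub_self]
  have hLτ : ∀ x, L (x + τ) = L x + 2 * Real.pi * Complex.I := fun x => by rw [map_add, hτ, hLR]
  have hPτ : ∀ x, P (x + τ) = P x := fun x => by rw [map_add, hτ, hPR, add_zero]
  have hexpτ : ∀ x, Complex.exp (L (x + τ)) = Complex.exp (L x) := fun x => by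
    rw [hLτ]; exact Complex.exp_periodic _
  have hΩτ : ∀ x ∈ Ω, x + τ ∈ Ω := by
    intro x hx
    refine ⟨by rw [hPτ]; exact hx.1, ?_⟩
    rw [hLτ]
    have : (L x + 2 * Real.pi * Complex.I).re = (L x).re := by simp
    rw [this]; exact hx.2
  have hθτ : ∀ x, θt (x + τ) = θt x := by
    intro x
    have h1 : S (x + τ) = S x := by simp only [S, hPτ, hexpτ]
    have h2 : DS (x + τ) = DS x := by simp only [DS, hexpτ]
    simp only [θt, h1, h2]
  obtain ⟨c, hc⟩ : ∃ c, ∀ x ∈ Ω, F (x + τ) = F x + c := by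
    have h1 : ∀ x ∈ Ω, HasFDerivAt (fun x => F (x + τ) - F x) (0 : E →L[ℝ] ℝ) x := by
      intro x hx
      have h2 : HasFDerivAt (fun x => F (x + τ)) (θt (x + τ)) x := by
        have := HasFDerivAt.comp (g := F) (f := fun x => x + τ) x (hF _ (hΩτ x hx))
          ((hasFDerivAt_id x).add_const τ)
        rwa [ContinuousLinearMap.comp_id] at this
      have h3 := h2.sub (hF x hx)
      rwa [hθτ, sub_self] at h3
    obtain ⟨c, hc⟩ := hΩo.exists_is_const_of_fderiv_eq_zero hΩc.isPreconnected
      (fun x hx => (h1 x hx).differentiableAt.differentiableWithinAt)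
      (fun x hx => (h1 x hx).fderiv)
    exact ⟨c, fun x hx => by linarith [hc x hx]⟩
  have hcn : ∀ n : ℕ, ∀ x ∈ Ω, x + (n : ℝ) • τ ∈ Ω ∧ F (x + (n : ℝ) • τ) = F x + n * c := by
    intro n
    induction n with
    | zero => intro x hx; simpa using hx
    | succ n ih =>
      intro x hx
      obtain ⟨h1, h2⟩ := ih x hx
      have h3 : x + ((n + 1 : ℕ) : ℝ) • τ = x + (n : ℝ) • τ + τ := by
        push_cast; rw [add_smul, one_smul, add_assoc]
      rw [h3]
      refine ⟨hΩτ _ h1, ?_⟩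
      rw [hc _ h1, h2]; push_cast; ring
  obtain ⟨ε, hε, hε1, hε2⟩ : ∃ ε > 0, (‖P‖ + 1) * ε ≤ δ / 2 ∧ (‖L‖ + 1) * ε ≤ σ := by
    refine ⟨min (δ / 2 / (‖P‖ + 1)) (σ / (‖L‖ + 1)), lt_min (by positivity) (by positivity), ?_, ?_⟩
    · rw [← le_div_iff₀' (by positivity)]; exact min_le_left _ _
    · rw [← le_div_iff₀' (by positivity)]; exact min_le_right _ _
  refine ⟨c, ε, hε, fun γ γ' ℓ ℓ' a b n hγ hℓ hexp hγε hcont hab hℓab => ?_⟩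
  -- The lift of the loop `γ` to the covering, given by the logarithm `ℓ`.
  let γt : ℝ → E := fun t => P (γ t) + R (ℓ t)
  have hLγt : ∀ t, L (γt t) = ℓ t := fun t => by simp only [γt, map_add, hLP, hLR, zero_add]
  have hPγt : ∀ t, P (γt t) = P (γ t) := fun t => by
    simp only [γt, map_add, hPR, add_zero]
    rw [hP (P (γ t)), hLP, map_zero, sub_zero]
  have hSγ : ∀ t, S (γt t) = γ t := fun t => by
    simp only [S, hLγt, hPγt, hexp]
    rw [hP, sub_add_cancel]
  have hγtΩ : ∀ t, γt t ∈ Ω := by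
    intro t
    constructor
    · rw [hPγt]
      have := P.le_opNorm (γ t)
      have h2 := hγε t
      nlinarith [norm_nonneg P, norm_nonneg (γ t)]
    · rw [hLγt, ← Real.exp_lt_exp, Real.exp_log hσ0, ← Complex.norm_exp, hexp]
      have := L.le_opNorm (γ t)
      have h2 := hγε t
      nlinarith [norm_nonneg L, norm_nonneg (γ t)]
  have hγtd : ∀ t, HasDerivAt γt (P (γ' t) + R (ℓ' t)) t := fun t =>
    (P.hasFDerivAt.comp_hasDerivAt t (hγ t)).add (R.hasFDerivAt.comp_hasDerivAt t (hℓ t))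
  have hder : ∀ t ∈ uIcc a b, HasDerivAt (fun t => F (γt t)) (θ (γ t) (γ' t)) t := by
    intro t _
    have h1 := (hF _ (hγtΩ t)).comp_hasDerivAt t (hγtd t)
    have h2 := (hSd (γt t)).comp_hasDerivAt t (hγtd t)
    have h3 : S ∘ γt = γ := funext hSγ
    rw [h3] at h2
    have h4 := h2.unique (hγ t)
    refine h1.congr_deriv ?_
    simp only [θt, ContinuousLinearMap.comp_apply]
    rw [h4, hSγ]
  rw [intervalIntegral.integral_eq_sub_of_hasDerivAt hder (hcont.intervalIntegrable _ _)]
  have hend : γt b = γt a + (n : ℝ) • τ := by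
    simp only [γt, hab, hℓab, hτ]
    rw [← map_smul, map_add, add_assoc]
    congr 2
  rw [hend, (hcn n _ (hγtΩ a)).2]
  ring

end Period

/-! ### The contribution of a contact point in a vector space -/

section LocalDegree

variable {E : Type*} [NormedAddCommGroup E] [NormedSpace ℝ E]

/-- The period of `θ` along the image of a small circle under a map of contact order `d` with the
divisor. -/
lemma integral_circle_of_contact {L : E →L[ℝ] ℂ} {θ : E → E →L[ℝ] ℝ} {ε c : ℝ}
    (hper : ∀ (γ γ' : ℝ → E) (ℓ ℓ' : ℝ → ℂ) (a b : ℝ) (n : ℕ),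
      (∀ t, HasDerivAt γ (γ' t) t) → (∀ t, HasDerivAt ℓ (ℓ' t) t) →
      (∀ t, Complex.exp (ℓ t) = L (γ t)) → (∀ t, ‖γ t‖ < ε) →
      Continuous (fun t => θ (γ t) (γ' t)) → γ b = γ a →
      ℓ b = ℓ a + n * (2 * Real.pi * Complex.I) → ∫ t in a..b, θ (γ t) (γ' t) = n * c)
    {φ : ℂ → E} {r : ℝ} {d : ℕ} (hr : 0 < r) (hφ : ∀ w, ‖w‖ = r → ContDiffAt ℝ 1 φ w)
    (hφε : ∀ w, ‖w‖ = r → ‖φ w‖ < ε) (hθ : ∀ w, ‖w‖ = r → ContinuousAt θ (φ w))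
    (hd : ∀ w, ‖w‖ = r → ‖L (φ w) / w ^ d - 1‖ < 1) (a : ℝ) :
    ∫ t in a..(a + 2 * Real.pi), θ (φ (r * Complex.exp (t * Complex.I)))
      (fderiv ℝ φ (r * Complex.exp (t * Complex.I))
        (Complex.I * (r * Complex.exp (t * Complex.I)))) = d * c := by
  let e : ℝ → ℂ := fun t => r * Complex.exp (t * Complex.I)
  have her : ∀ t, ‖e t‖ = r := fun t => by
    simp only [e, norm_mul, Complex.norm_exp_ofReal_mul_I, mul_one, Complex.norm_real,
      Real.norm_of_nonneg hr.le]
  have he0 : ∀ t, e t ≠ 0 := fun t => by rw [← norm_pos_iff, her]; exact hr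
  have hed : ∀ t, HasDerivAt e (Complex.I * e t) t := by
    intro t
    have h3 : HasDerivAt (fun θ : ℝ => Complex.exp (θ * Complex.I))
        (Complex.exp (t * Complex.I) * Complex.I) t := by
      have := ((Complex.ofRealCLM.hasDerivAt (x := t)).mul_const Complex.I).cexp
      simpa using this
    refine (h3.const_mul (r : ℂ)).congr_deriv ?_
    simp only [e]; ring
  have hγ : ∀ t, HasDerivAt (fun t => φ (e t)) (fderiv ℝ φ (e t) (Complex.I * e t)) t := fun t =>
    ((hφ _ (her t)).differentiableAt one_ne_zero).hasFDerivAt.comp_hasDerivAt t (hed t)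
  let q : ℝ → ℂ := fun t => L (φ (e t)) / e t ^ d
  have hqd : ∀ t, DifferentiableAt ℝ q t := fun t =>
    (L.hasFDerivAt.comp_hasDerivAt t (hγ t)).differentiableAt.div
      ((hed t).differentiableAt.pow d) (pow_ne_zero d (he0 t))
  have hqs : ∀ t, q t ∈ Complex.slitPlane := fun t => by
    have h1 : q t = 1 + (q t - 1) := by ring
    rw [h1]
    exact Complex.mem_slitPlane_of_norm_lt_one (hd _ (her t))
  let ℓ : ℝ → ℂ := fun t => d * (Real.log r + t * Complex.I) + Complex.log (q t)
  have hℓd : ∀ t, HasDerivAt ℓ (deriv ℓ t) t := fun t => by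
    refine DifferentiableAt.hasDerivAt (DifferentiableAt.add (by fun_prop) ?_)
    exact ((hqd t).hasDerivAt.clog_real (hqs t)).differentiableAt
  have hperiod : ∀ t, e (t + 2 * Real.pi) = e t := fun t => by
    simp only [e]
    congr 1
    push_cast
    rw [add_mul]
    exact Complex.exp_periodic _
  refine hper (fun t => φ (e t)) _ ℓ _ a (a + 2 * Real.pi) d hγ hℓd (fun t => ?_)
    (fun t => hφε _ (her t)) ?_ ?_ ?_
  · simp only [ℓ]
    rw [Complex.exp_add, Complex.exp_log (Complex.slitPlane_ne_zero (hqs t)), Complex.exp_nat_mul,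
      Complex.exp_add, ← Complex.ofReal_exp, Real.exp_log hr]
    exact mul_div_cancel₀ _ (pow_ne_zero d (he0 t))
  · rw [continuous_iff_continuousAt]
    intro t
    have h1 : ContinuousAt (fun t => θ (φ (e t))) t :=
      ContinuousAt.comp (g := θ) (hθ _ (her t)) (hγ t).continuousAt
    have h2 : ContinuousAt (fun t => fderiv ℝ φ (e t)) t :=
      ContinuousAt.comp (g := fderiv ℝ φ)
        (((hφ _ (her t)).fderiv_right (m := 0) (by simp)).continuousAt) (hed t).continuousAt
    exact h1.clm_apply (h2.clm_apply (continuousAt_const.mul (hed t).continuousAt))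
  · simp only [hperiod]
  · simp only [ℓ, q, hperiod]
    push_cast
    ring

lemma clm_complex_apply_real {F : Type*} [NormedAddCommGroup F] [NormedSpace ℝ F]
    (A : ℂ →L[ℝ] F) (v : ℂ) : A v = v.re • A 1 + v.im • A Complex.I := by
  have h : v = v.re • (1 : ℂ) + v.im • Complex.I := by
    simp [Complex.re_add_im]
  conv_lhs => rw [h]
  rw [map_add, map_smul, map_smul]

lemma hasFDerivAt_normSq_comp {β : ℝ → ℝ} (hβ : ContDiff ℝ ∞ β) (w : ℂ) :
    HasFDerivAt (fun w : ℂ => β (‖w‖ ^ 2))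
      ((2 * deriv β (‖w‖ ^ 2)) • (innerSL ℝ w)) w := by
  have h1 : HasFDerivAt (fun w : ℂ => ‖w‖ ^ 2) (2 • (innerSL ℝ w)) w :=
    (hasStrictFDerivAt_norm_sq w).hasFDerivAt
  have h2 := (hβ.differentiable (by simp) (‖w‖ ^ 2)).hasDerivAt.comp_hasFDerivAt w h1
  refine h2.congr_fderiv ?_
  ext v
  simp
  ring

/-- The pull-back of a primitive of `B` is a primitive of the pull-back of `B`. -/
lemma curl_pullback {lam : E → E →L[ℝ] ℝ} {φ : ℂ → E} {w : ℂ} {b : ℝ}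
    (hl : DifferentiableAt ℝ lam (φ w)) (hφ : ContDiffAt ℝ 2 φ w)
    (hB : fderiv ℝ lam (φ w) (fderiv ℝ φ w 1) (fderiv ℝ φ w Complex.I) -
      fderiv ℝ lam (φ w) (fderiv ℝ φ w Complex.I) (fderiv ℝ φ w 1) = b) :
    fderiv ℝ (fun w => (lam (φ w)).comp (fderiv ℝ φ w)) w 1 Complex.I -
      fderiv ℝ (fun w => (lam (φ w)).comp (fderiv ℝ φ w)) w Complex.I 1 = b := by
  have hφd : DifferentiableAt ℝ φ w := hφ.differentiableAt two_ne_zero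
  have hφd2 : DifferentiableAt ℝ (fderiv ℝ φ) w :=
    (hφ.fderiv_right (m := 1) (by norm_num)).differentiableAt one_ne_zero
  have h1 : HasFDerivAt (fun w => lam (φ w)) ((fderiv ℝ lam (φ w)).comp (fderiv ℝ φ w)) w :=
    HasFDerivAt.comp (g := lam) w hl.hasFDerivAt hφd.hasFDerivAt
  have hcomp := h1.clm_comp hφd2.hasFDerivAt
  have hsymm : fderiv ℝ (fderiv ℝ φ) w 1 Complex.I = fderiv ℝ (fderiv ℝ φ) w Complex.I 1 :=
    (hφ.isSymmSndFDerivAt (by simp)) _ _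
  rw [hcomp.fderiv]
  simp only [add_apply, ContinuousLinearMap.comp_apply, ContinuousLinearMap.compL_apply,
    ContinuousLinearMap.flip_apply]
  rw [hsymm]
  linarith

end LocalDegree

section LocalDegree

/-- The radial part of the integral over the plane of the gradient of a radial cut-off function. -/
lemma integral_deriv_comp_sq {β : ℝ → ℝ} (hβ : ContDiff ℝ ∞ β) {ε₀ : ℝ} (hε₀ : 0 < ε₀)
    (hβ1 : ∀ s, ε₀ ^ 2 ≤ s → β s = 0) :
    ∫ r in Ioi (0 : ℝ), 2 * r * deriv β (r ^ 2) = - β 0 := by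
  have hd : ∀ r : ℝ, HasDerivAt (fun r => β (r ^ 2)) (2 * r * deriv β (r ^ 2)) r := fun r => by
    have h1 : HasDerivAt (fun r : ℝ => r ^ 2) (2 * r) r := by simpa using hasDerivAt_pow 2 r
    have h2 := (hβ.differentiable (by simp) (r ^ 2)).hasDerivAt.comp r h1
    exact h2.congr_deriv (by ring)
  have hc' : Continuous (deriv β) := hβ.continuous_deriv (by simp)
  have hev : ∀ r : ℝ, ε₀ < r → β (r ^ 2) = 0 := fun r hr => hβ1 _ (by nlinarith)
  have hd0 : ∀ r : ℝ, ε₀ < r → deriv β (r ^ 2) = 0 := fun r hr => by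
    have : β =ᶠ[𝓝 (r ^ 2)] fun _ => 0 := by
      filter_upwards [lt_mem_nhds (show ε₀ ^ 2 < r ^ 2 by nlinarith)] with s hs using hβ1 s hs.le
    rw [this.deriv_eq, deriv_const]
  have hint : IntegrableOn (fun r : ℝ => 2 * r * deriv β (r ^ 2)) (Ioi 0) := by
    have h1 : IntegrableOn (fun r : ℝ => 2 * r * deriv β (r ^ 2)) (Icc 0 ε₀) :=
      (by fun_prop : Continuous fun r : ℝ => 2 * r * deriv β (r ^ 2)).continuousOn.integrableOn_compact
        isCompact_Icc
    refine h1.of_forall_sdiff_eq_zero measurableSet_Ioi fun r hr => ?_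
    have : ε₀ < r := by
      by_contra h
      exact hr.2 ⟨le_of_lt hr.1, not_lt.1 h⟩
    rw [hd0 r this, mul_zero]
  have htend : Filter.Tendsto (fun r : ℝ => β (r ^ 2)) Filter.atTop (𝓝 0) := by
    refine tendsto_const_nhds.congr' ?_
    filter_upwards [Filter.eventually_gt_atTop ε₀] with r hr using (hev r hr).symm
  rw [integral_Ioi_of_hasDerivAt_of_tendsto (hd 0).continuousAt.continuousWithinAt
    (fun r _ => hd r) hint htend]
  simp

/-- The coarea formula for a function on the punctured disc with constant integrals over the
circles, weighted by the derivative of a radial cut-off function. -/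
lemma integral_radial_mul {β : ℝ → ℝ} (hβ : ContDiff ℝ ∞ β) {ε₀ ε₁ s₀ K : ℝ} (hε₀ : 0 < ε₀)
    (hε₁ : ε₀ < ε₁) (hs₀ : 0 < s₀) (hβ0 : ∀ s, s < s₀ → β s = β 0)
    (hβ1 : ∀ s, ε₀ ^ 2 ≤ s → β s = 0) {κ : ℂ → ℝ}
    (hκ : ∀ w, w ≠ 0 → ‖w‖ < ε₁ → ContinuousAt κ w)
    (hK : ∀ r, 0 < r → r < ε₁ →
      ∫ t in (-Real.pi)..Real.pi, κ (r * Complex.exp (t * Complex.I)) = K) :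
    Continuous (fun w : ℂ => 2 * deriv β (‖w‖ ^ 2) * κ w) ∧
      HasCompactSupport (fun w : ℂ => 2 * deriv β (‖w‖ ^ 2) * κ w) ∧
      ∫ w : ℂ, 2 * deriv β (‖w‖ ^ 2) * κ w = - K * β 0 := by
  set f : ℂ → ℝ := fun w => 2 * deriv β (‖w‖ ^ 2) * κ w with hf
  have hc' : Continuous (deriv β) := hβ.continuous_deriv (by simp)
  have hd0 : ∀ s, ε₀ ^ 2 < s → deriv β s = 0 := fun s hs => by
    have : β =ᶠ[𝓝 s] fun _ => 0 := by
      filter_upwards [lt_mem_nhds hs] with s hs using hβ1 s hs.le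
    rw [this.deriv_eq, deriv_const]
  have hd1 : ∀ s, s < s₀ → deriv β s = 0 := fun s hs => by
    have : β =ᶠ[𝓝 s] fun _ => β 0 := by
      filter_upwards [gt_mem_nhds hs] with s hs using hβ0 s hs
    rw [this.deriv_eq, deriv_const]
  have hf0 : ∀ w, ε₀ < ‖w‖ → f w = 0 := fun w hw => by
    simp only [hf]
    rw [hd0 _ (by nlinarith), mul_zero, zero_mul]
  have hfc : Continuous f := by
    rw [continuous_iff_continuousAt]
    intro w
    rcases eq_or_ne w 0 with rfl | hw
    · have : f =ᶠ[𝓝 0] fun _ => 0 := by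
        have : Continuous fun w : ℂ => ‖w‖ ^ 2 := by fun_prop
        filter_upwards [(this.tendsto 0).eventually (gt_mem_nhds (by simpa using hs₀))] with w hw
        simp only [hf, hd1 _ hw, mul_zero, zero_mul]
      exact continuousAt_const.congr this.symm
    · rcases lt_or_ge ‖w‖ ε₁ with h | h
      · exact (by fun_prop : ContinuousAt (fun w : ℂ => 2 * deriv β (‖w‖ ^ 2)) w).mul (hκ w hw h)
      · have : f =ᶠ[𝓝 w] fun _ => 0 := by
          filter_upwards [continuous_norm.continuousAt.eventually (lt_mem_nhds (hε₁.trans_le h))]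
            with w hw using hf0 w hw
        exact continuousAt_const.congr this.symm
  refine ⟨hfc, HasCompactSupport.intro (isCompact_closedBall (0 : ℂ) ε₀) fun w hw => hf0 w ?_, ?_⟩
  · simpa using hw
  -- In polar coordinates the integral is the product of a radial and an angular one.
  rw [← Complex.integral_comp_polarCoord_symm f]
  have hps : ∀ p : ℝ × ℝ, Complex.polarCoord.symm p = p.1 * Complex.exp (p.2 * Complex.I) :=
    fun p => by
      rw [Complex.polarCoord_symm_apply, Complex.exp_mul_I, Complex.ofReal_cos, Complex.ofReal_sin]
  have hnorm : ∀ r t : ℝ, 0 ≤ r → ‖(r : ℂ) * Complex.exp (t * Complex.I)‖ = r := fun r t hr => by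
    rw [norm_mul, Complex.norm_exp_ofReal_mul_I, mul_one, Complex.norm_real,
      Real.norm_of_nonneg hr]
  simp_rw [hps]
  have htarget : polarCoord.target = Ioi (0 : ℝ) ×ˢ Ioo (-Real.pi) Real.pi := rfl
  rw [htarget, Measure.volume_eq_prod, setIntegral_prod]
  · rw [show -K * β 0 = K * (- β 0) by ring, ← integral_deriv_comp_sq hβ hε₀ hβ1,
      ← integral_const_mul]
    refine setIntegral_congr_fun measurableSet_Ioi fun r hr => ?_
    have hr0 : (0 : ℝ) < r := hr
    simp only [hf, hnorm r _ hr0.le, smul_eq_mul]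
    rw [integral_const_mul, integral_const_mul, ← integral_Ioc_eq_integral_Ioo,
      ← intervalIntegral.integral_of_le (by linarith [Real.pi_pos])]
    rcases lt_or_ge r ε₁ with h | h
    · rw [hK r hr0 h]; ring
    · rw [hd0 _ (by nlinarith)]; ring
  · have hcont : Continuous fun p : ℝ × ℝ => p.1 • f (p.1 * Complex.exp (p.2 * Complex.I)) := by
      fun_prop
    have h1 : IntegrableOn (fun p : ℝ × ℝ => p.1 • f (p.1 * Complex.exp (p.2 * Complex.I)))
        (Icc 0 ε₀ ×ˢ Icc (-Real.pi) Real.pi) (volume.prod volume) :=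
      hcont.continuousOn.integrableOn_compact (isCompact_Icc.prod isCompact_Icc)
    refine h1.of_forall_sdiff_eq_zero (measurableSet_Ioi.prod measurableSet_Ioo) fun p hp => ?_
    obtain ⟨⟨hp1, hp2⟩, hp3⟩ := hp
    have hp1' : (0 : ℝ) < p.1 := hp1
    have : ε₀ < p.1 := by
      by_contra h
      exact hp3 ⟨⟨hp1'.le, not_lt.1 h⟩, Ioo_subset_Icc_self hp2⟩
    rw [hf0 _ (by rw [hnorm _ _ hp1'.le]; exact this), smul_zero]

end LocalDegree

section LocalDegree

variable {E : Type*} [NormedAddCommGroup E] [NormedSpace ℝ E]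

/-- The normalization of the Thom class on small normal discs determines the period of
`A - lam`, where `A` and `lam` are primitives of `B` off the divisor and everywhere. -/
lemma integral_circle_eq_neg_one_of_thom {B : E → E →L[ℝ] E →L[ℝ] ℝ} (hB : Continuous B)
    (R : ℂ →L[ℝ] E) {A lam : E → E →L[ℝ] ℝ} (hlam : Continuous lam) {c : ℝ}
    (hA : ∀ᶠ s : ℝ in 𝓝[>] 0, ∀ w : ℂ, ‖w‖ = s → ContinuousAt A (R w))
    (hthom : ∀ᶠ s : ℝ in 𝓝[>] 0, (∫ ζ in Metric.closedBall (0 : ℂ) 1,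
      B (R (s * ζ)) (R s) (R (s * Complex.I))) -
      ∫ t in (0 : ℝ)..(2 * Real.pi), A (R (s * Complex.exp (t * Complex.I)))
        (R (s * (Complex.I * Complex.exp (t * Complex.I)))) = 1)
    (hc : ∀ᶠ s : ℝ in 𝓝[>] 0, ∫ t in (0 : ℝ)..(2 * Real.pi),
      (A - lam) (R (s * Complex.exp (t * Complex.I)))
        (R (s * (Complex.I * Complex.exp (t * Complex.I)))) = c) : c = -1 := by
  let f : ℝ → ℝ := fun s => ∫ ζ in Metric.closedBall (0 : ℂ) 1,
      B (R (s * ζ)) (R s) (R (s * Complex.I))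
  let g : ℝ → ℝ := fun s => ∫ t in (0 : ℝ)..(2 * Real.pi),
      lam (R (s * Complex.exp (t * Complex.I)))
        (R (s * (Complex.I * Complex.exp (t * Complex.I))))
  have hf : Continuous f :=
    continuous_parametric_integral_of_continuous (μ := (volume : Measure ℂ))
      (f := fun (s : ℝ) (ζ : ℂ) => B (R (s * ζ)) (R s) (R (s * Complex.I)))
      (by simp only [Function.uncurry_def]; fun_prop) (isCompact_closedBall _ _)
  have hgc : Continuous (Function.uncurry fun (s t : ℝ) =>
      lam (R (s * Complex.exp (t * Complex.I)))
        (R (s * (Complex.I * Complex.exp (t * Complex.I))))) := by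
    simp only [Function.uncurry_def]; fun_prop
  have hg : Continuous g :=
    intervalIntegral.continuous_parametric_intervalIntegral_of_continuous' (μ := volume) hgc _ _
  have hev : ∀ᶠ s : ℝ in 𝓝[>] 0, f s - g s - c = 1 := by
    filter_upwards [hA, hthom, hc, self_mem_nhdsWithin] with s h1 h2 h3 hs
    have hs0 : (0 : ℝ) < s := hs
    have hcA : Continuous fun t : ℝ => A (R (s * Complex.exp (t * Complex.I)))
        (R (s * (Complex.I * Complex.exp (t * Complex.I)))) := by
      rw [continuous_iff_continuousAt]
      intro t
      have h4 : ContinuousAt (fun t : ℝ => A (R (s * Complex.exp (t * Complex.I)))) t := by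
        refine ContinuousAt.comp (g := A) (f := fun t : ℝ => R (s * Complex.exp (t * Complex.I)))
          (h1 _ ?_) (by fun_prop)
        rw [norm_mul, Complex.norm_exp_ofReal_mul_I, mul_one, Complex.norm_real,
          Real.norm_of_nonneg hs0.le]
      exact h4.clm_apply (by fun_prop)
    have hcl : Continuous fun t : ℝ => lam (R (s * Complex.exp (t * Complex.I)))
        (R (s * (Complex.I * Complex.exp (t * Complex.I)))) :=
      hgc.comp (Continuous.prodMk_right s)
    simp only [Pi.sub_apply, sub_apply] at h3
    rw [intervalIntegral.integral_sub (hcA.intervalIntegrable _ _)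
      (hcl.intervalIntegrable _ _)] at h3
    simp only [f, g]
    linarith
  have hlim : Filter.Tendsto (fun s => f s - g s - c) (𝓝[>] 0) (𝓝 (f 0 - g 0 - c)) :=
    (((hf.sub hg).sub continuous_const).tendsto 0).mono_left nhdsWithin_le_nhds
  have h1 : f 0 - g 0 - c = 1 :=
    tendsto_nhds_unique hlim (tendsto_const_nhds.congr' (hev.mono fun s hs => hs.symm))
  have h2 : f 0 = 0 := by simp [f]
  have h3 : g 0 = 0 := by simp [g]
  rw [h2, h3] at h1
  linarith

/-- The local contribution of a point of contact. The closed form `B` on a ball of `E` has the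
primitive `A` off the divisor `L = 0`, and the pair `(B, A)` has the value one on small normal
discs. If `φ` has contact order `d` with the divisor, the integral of
`w φ^* B + dw ∧ φ^* A`, where `w` is a radial cut-off function, is `d` times the value of `w` at
the origin. -/
theorem integral_cutoff_eq_mul_contact_order [FiniteDimensional ℝ E] (L : E →L[ℝ] ℂ)
    (R : ℂ →L[ℝ] E) (hLR : ∀ z, L (R z) = z) {δ : ℝ} (hδ : 0 < δ)
    {B : E → E →L[ℝ] E →L[ℝ] ℝ} (hB : ContDiff ℝ 1 B) (halt : ∀ x u v, B x u v = - B x v u)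
    (hcl : ∀ x ∈ Metric.ball (0 : E) δ, ∀ u v w,
      fderiv ℝ B x u v w - fderiv ℝ B x v u w + fderiv ℝ B x w u v = 0)
    {A : E → E →L[ℝ] ℝ} (hA : ∀ x ∈ Metric.ball (0 : E) δ, L x ≠ 0 → ContDiffAt ℝ 1 A x)
    (hAB : ∀ x ∈ Metric.ball (0 : E) δ, L x ≠ 0 → ∀ u v,
      fderiv ℝ A x u v - fderiv ℝ A x v u = B x u v)
    (hthom : ∀ᶠ s : ℝ in 𝓝[>] 0, (∫ ζ in Metric.closedBall (0 : ℂ) 1,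
      B (R (s * ζ)) (R s) (R (s * Complex.I))) -
      ∫ t in (0 : ℝ)..(2 * Real.pi), A (R (s * Complex.exp (t * Complex.I)))
        (R (s * (Complex.I * Complex.exp (t * Complex.I)))) = 1)
    {φ : ℂ → E} (hφ : ContDiffAt ℝ 2 φ 0) (hφ0 : φ 0 = 0) {d : ℕ}
    (hd : (fun w => L (φ w) - w ^ d) =O[𝓝 0] fun w => w ^ (d + 1)) :
    ∃ ε₁ > 0, ∀ ε₀, 0 < ε₀ → ε₀ < ε₁ → ∀ β : ℝ → ℝ, ContDiff ℝ ∞ β →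
      (∃ s₀ > 0, ∀ s, s < s₀ → β s = β 0) → (∀ s, ε₀ ^ 2 ≤ s → β s = 0) →
      ∫ w : ℂ, (β (‖w‖ ^ 2) * B (φ w) (fderiv ℝ φ w 1) (fderiv ℝ φ w Complex.I) +
        (2 * deriv β (‖w‖ ^ 2) * w.re * A (φ w) (fderiv ℝ φ w Complex.I) -
          2 * deriv β (‖w‖ ^ 2) * w.im * A (φ w) (fderiv ℝ φ w 1))) = d * β 0 := by
  obtain ⟨lam, hlam, hlamB⟩ := exists_primitive_of_closed_two_form hB halt hcl
  have hlamd : Differentiable ℝ lam := hlam.differentiable one_ne_zero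
  have hθd : ∀ x ∈ Metric.ball (0 : E) δ, L x ≠ 0 → DifferentiableAt ℝ (A - lam) x := fun x hx hL =>
    ((hA x hx hL).differentiableAt one_ne_zero).sub (hlamd x)
  obtain ⟨c, ε, hε, hper⟩ := exists_period L R hLR hδ (θ := A - lam) hθd fun x hx hL u v => by
    have h1 := hAB x hx hL u v
    have h2 := hlamB x hx u v
    rw [fderiv_sub ((hA x hx hL).differentiableAt one_ne_zero) (hlamd x)]
    simp only [sub_apply]
    linarith
  have hθc : ∀ x ∈ Metric.ball (0 : E) δ, L x ≠ 0 → ContinuousAt (A - lam) x :=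
    fun x hx hL => (hθd x hx hL).continuousAt
  -- the circle of radius `s` in the normal direction
  have hRe : ∀ᶠ s : ℝ in 𝓝[>] 0, ‖R‖ * s < min ε δ := by
    have : Continuous fun s : ℝ => ‖R‖ * s := by fun_prop
    exact nhdsWithin_le_nhds ((this.tendsto 0).eventually (gt_mem_nhds (by simp [hε, hδ])))
  have hR : ∀ᶠ s : ℝ in 𝓝[>] 0, 0 < s ∧ ∀ w : ℂ, ‖w‖ = s → ‖R w‖ < min ε δ ∧ L (R w) ≠ 0 := by
    filter_upwards [hRe, self_mem_nhdsWithin] with s hs hs0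
    have hs0' : (0 : ℝ) < s := hs0
    refine ⟨hs0', fun w hw => ⟨(R.le_opNorm w).trans_lt (by rw [hw]; exact hs), ?_⟩⟩
    rw [hLR, ← norm_pos_iff, hw]; exact hs0'
  -- The circle has winding number one. As it shrinks, the integrals of `B` and `lam` tend to zero,
  -- so the normalization of the Thom class leaves `-1` for `A - lam`.
  have hc : c = -1 := by
    refine integral_circle_eq_neg_one_of_thom hB.continuous R hlam.continuous ?_ hthom ?_
    · filter_upwards [hR] with s hs w hw
      obtain ⟨h1, h2⟩ := hs.2 w hw
      exact (hA _ (by simpa using h1.trans_le (min_le_right _ _)) h2).continuousAt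
    · filter_upwards [hR] with s hs
      have := integral_circle_of_contact (d := 1) hper (φ := R) hs.1
        (fun w _ => R.contDiff.contDiffAt) (fun w hw => (hs.2 w hw).1.trans_le (min_le_left _ _))
        (fun w hw => hθc _ (by simpa using (hs.2 w hw).1.trans_le (min_le_right _ _)) (hs.2 w hw).2)
        (fun w hw => by
          have hw0 : w ≠ 0 := by rw [← norm_pos_iff, hw]; exact hs.1
          rw [hLR, pow_one, div_self hw0]; simp) 0
      simp only [zero_add, ContinuousLinearMap.fderiv, Nat.cast_one, one_mul] at this
      rw [← this]
      refine intervalIntegral.integral_congr fun t _ => ?_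
      congr 2
      ring
  -- the neighbourhood of the origin on which `φ` is controlled
  obtain ⟨K, hK⟩ := hd.bound
  have hnear : ∀ᶠ w in 𝓝 (0 : ℂ), ContDiffAt ℝ 2 φ w ∧ ‖φ w‖ < min ε δ ∧
      ‖L (φ w) - w ^ d‖ ≤ K * ‖w ^ (d + 1)‖ ∧ K * ‖w‖ < 1 := by
    have h2 : ∀ᶠ w in 𝓝 (0 : ℂ), ‖φ w‖ < min ε δ :=
      (hφ.continuousAt.norm.eventually (gt_mem_nhds (by simp [hφ0, hε, hδ])))
    have h3 : ∀ᶠ w in 𝓝 (0 : ℂ), K * ‖w‖ < 1 := by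
      have : Continuous fun w : ℂ => K * ‖w‖ := by fun_prop
      exact (this.tendsto 0).eventually (gt_mem_nhds (by simp))
    filter_upwards [hφ.eventually (by simp), h2, hK, h3] with w a b c d using ⟨a, b, c, d⟩
  obtain ⟨ε₁, hε₁, hball⟩ := Metric.eventually_nhds_iff.1 hnear
  simp only [dist_zero_right] at hball
  have hquot : ∀ w, w ≠ 0 → ‖w‖ < ε₁ → ‖L (φ w) / w ^ d - 1‖ < 1 := fun w hw hw1 => by
    obtain ⟨-, -, h3, h4⟩ := hball hw1
    have hwd : w ^ d ≠ 0 := pow_ne_zero d hw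
    rw [show L (φ w) / w ^ d - 1 = (L (φ w) - w ^ d) / w ^ d by field_simp, norm_div,
      div_lt_one (norm_pos_iff.2 hwd)]
    refine h3.trans_lt ?_
    rw [pow_succ, norm_mul]
    nlinarith [norm_pos_iff.2 hwd]
  have hLφ : ∀ w, w ≠ 0 → ‖w‖ < ε₁ → L (φ w) ≠ 0 := fun w hw hw1 h0 => by
    have := hquot w hw hw1
    simp [h0] at this
  have hφball : ∀ w, ‖w‖ < ε₁ → φ w ∈ Metric.ball (0 : E) δ := fun w hw => by
    simpa using (hball hw).2.1.trans_le (min_le_right _ _)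
  have hDφc : ∀ w, ‖w‖ < ε₁ → ContinuousAt (fderiv ℝ φ) w := fun w hw =>
    (((hball hw).1.fderiv_right (m := 1) (by norm_num)).continuousAt)
  refine ⟨ε₁, hε₁, fun ε₀ hε₀ hε₀₁ β hβ ⟨s₀, hs₀, hβ0⟩ hβ1 => ?_⟩
  -- the part of the integral that contains the closed form `θ = A - lam`
  obtain ⟨hκc, hκs, hκi⟩ := integral_radial_mul hβ hε₀ hε₀₁ hs₀ hβ0 hβ1 (K := d * c)
    (κ := fun w => (A - lam) (φ w) (fderiv ℝ φ w (Complex.I * w)))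
    (fun w hw hw1 => by
      have h1 : ContinuousAt (fun w => (A - lam) (φ w)) w :=
        ContinuousAt.comp (g := A - lam) (hθc _ (hφball w hw1) (hLφ w hw hw1))
          (hball hw1).1.continuousAt
      exact h1.clm_apply ((hDφc w hw1).clm_apply (by fun_prop)))
    (fun r hr hr1 => by
      have := integral_circle_of_contact hper hr
        (fun w hw => (hball (hw.trans_lt hr1)).1.of_le (by norm_num))
        (fun w hw => (hball (hw.trans_lt hr1)).2.1.trans_le (min_le_left _ _))
        (fun w hw => by
          have hw0 : w ≠ 0 := by rw [← norm_pos_iff, hw]; exact hr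
          exact hθc _ (hφball w (hw.trans_lt hr1)) (hLφ w hw0 (hw.trans_lt hr1)))
        (fun w hw => by
          have hw0 : w ≠ 0 := by rw [← norm_pos_iff, hw]; exact hr
          exact hquot w hw0 (hw.trans_lt hr1)) (-Real.pi)
      rw [show -Real.pi + 2 * Real.pi = Real.pi by ring] at this
      exact this)
  -- the exact part
  let μ : ℂ → ℂ →L[ℝ] ℝ := fun w => (lam (φ w)).comp (fderiv ℝ φ w)
  let ν : ℂ → ℂ →L[ℝ] ℝ := fun w => β (‖w‖ ^ 2) • μ w
  have hμ : ∀ w, ‖w‖ < ε₁ → ContDiffAt ℝ 1 μ w := fun w hw =>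
    (ContDiffAt.comp (g := lam) w hlam.contDiffAt ((hball hw).1.of_le (by norm_num))).clm_comp
      ((hball hw).1.fderiv_right (m := 1) (by norm_num))
  have hβn : ContDiff ℝ 1 fun w : ℂ => β (‖w‖ ^ 2) :=
    (hβ.of_le (by exact_mod_cast le_top)).comp (contDiff_norm_sq ℝ)
  have hν0 : ∀ w, ε₀ < ‖w‖ → ν w = 0 := fun w hw => by
    simp only [ν]; rw [hβ1 _ (by nlinarith), zero_smul]
  have hν : ContDiff ℝ 1 ν := by
    rw [contDiff_iff_contDiffAt]
    intro w
    rcases lt_or_ge ‖w‖ ε₁ with h | h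
    · exact hβn.contDiffAt.smul (hμ w h)
    · have : ν =ᶠ[𝓝 w] fun _ => 0 := by
        filter_upwards [continuous_norm.continuousAt.eventually (lt_mem_nhds (hε₀₁.trans_le h))]
          with w hw using hν0 w hw
      exact contDiffAt_const.congr_of_eventuallyEq this
  have hνs : HasCompactSupport ν :=
    HasCompactSupport.intro (isCompact_closedBall (0 : ℂ) ε₀) fun w hw => hν0 w (by simpa using hw)
  have hexact := integral_curl_eq_zero hν hνs
  have hcurl : ∀ w, fderiv ℝ ν w 1 Complex.I - fderiv ℝ ν w Complex.I 1 =
      β (‖w‖ ^ 2) * B (φ w) (fderiv ℝ φ w 1) (fderiv ℝ φ w Complex.I) +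
        (2 * deriv β (‖w‖ ^ 2) * w.re * lam (φ w) (fderiv ℝ φ w Complex.I) -
          2 * deriv β (‖w‖ ^ 2) * w.im * lam (φ w) (fderiv ℝ φ w 1)) := by
    intro w
    rcases lt_or_ge ‖w‖ ε₁ with h | h
    · have h1 := (hasFDerivAt_normSq_comp hβ w).smul
        ((hμ w h).differentiableAt one_ne_zero).hasFDerivAt
      have h2 : fderiv ℝ ν w = _ := h1.fderiv
      have h3 := curl_pullback (lam := lam) (φ := φ) (w := w) (hlamd _) (hball h).1
        (hlamB _ (hφball w h) _ _)
      change fderiv ℝ μ w 1 Complex.I - fderiv ℝ μ w Complex.I 1 = _ at h3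
      rw [h2, ← h3]
      simp [μ]
      ring
    · have h1 : ν =ᶠ[𝓝 w] fun _ => 0 := by
        filter_upwards [continuous_norm.continuousAt.eventually (lt_mem_nhds (hε₀₁.trans_le h))]
          with w hw using hν0 w hw
      have h2 : deriv β (‖w‖ ^ 2) = 0 := by
        have : β =ᶠ[𝓝 (‖w‖ ^ 2)] fun _ => 0 := by
          filter_upwards [lt_mem_nhds (show ε₀ ^ 2 < ‖w‖ ^ 2 by nlinarith)] with s hs
            using hβ1 s hs.le
        rw [this.deriv_eq, deriv_const]
      rw [h1.fderiv_eq, hβ1 (‖w‖ ^ 2) (by nlinarith), h2]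
      simp
  have hsum : ∀ w : ℂ, β (‖w‖ ^ 2) * B (φ w) (fderiv ℝ φ w 1) (fderiv ℝ φ w Complex.I) +
        (2 * deriv β (‖w‖ ^ 2) * w.re * A (φ w) (fderiv ℝ φ w Complex.I) -
          2 * deriv β (‖w‖ ^ 2) * w.im * A (φ w) (fderiv ℝ φ w 1)) =
      (fderiv ℝ ν w 1 Complex.I - fderiv ℝ ν w Complex.I 1) +
        2 * deriv β (‖w‖ ^ 2) * ((A - lam) (φ w) (fderiv ℝ φ w (Complex.I * w))) := by
    intro w
    rw [hcurl, clm_complex_apply_real (fderiv ℝ φ w) (Complex.I * w)]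
    simp
    ring
  simp_rw [hsum]
  rw [integral_add _ (hκc.integrable_of_hasCompactSupport hκs), hexact, hκi, hc]
  · ring
  · have hfc : Continuous (fderiv ℝ ν) := hν.continuous_fderiv one_ne_zero
    refine Continuous.integrable_of_hasCompactSupport (by fun_prop) ?_
    exact (hνs.fderiv (𝕜 := ℝ)).comp_left
      (g := fun M : ℂ →L[ℝ] ℂ →L[ℝ] ℝ => M 1 Complex.I - M Complex.I 1) (by simp)

end LocalDegree

/-! ### Real derivatives of maps between manifolds -/

section SmoothMaps

variable {E : Type*} [NormedAddCommGroup E] [NormedSpace ℝ E]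
  {F : Type*} [NormedAddCommGroup F] [NormedSpace ℝ F]
  {F' : Type*} [NormedAddCommGroup F'] [NormedSpace ℝ F']
  {M : Type*} [TopologicalSpace M] [ChartedSpace E M]
  {N : Type*} [TopologicalSpace N] [ChartedSpace F N]
  {P : Type*} [TopologicalSpace P] [ChartedSpace F' P]

lemma manifoldDeriv_comp {g : N → P} {f : M → N} (x : M)
    (hg : MDifferentiableAt 𝓘(ℝ, F) 𝓘(ℝ, F') g (f x))
    (hf : MDifferentiableAt 𝓘(ℝ, E) 𝓘(ℝ, F) f x) :
    manifoldDeriv E F' (fun y => g (f y)) x =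
      (manifoldDeriv F F' g (f x)).comp (manifoldDeriv E F f x) :=
  mfderiv_comp x hg hf

lemma manifoldDeriv_congr {f g : M → N} {x : M} (h : f =ᶠ[𝓝 x] g) :
    manifoldDeriv E F f x = manifoldDeriv E F g x :=
  h.mfderiv_eq

lemma manifoldDeriv_eq_fderiv (f : E → F) (x : E) : manifoldDeriv E F f x = fderiv ℝ f x :=
  mfderiv_eq_fderiv

lemma manifoldDeriv_id (x : M) :
    manifoldDeriv E E (fun y : M => y) x = ContinuousLinearMap.id ℝ E :=
  mfderiv_id

lemma manifoldDeriv_const (c : N) (x : M) : manifoldDeriv E F (fun _ : M => c) x = 0 :=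
  mfderiv_const

/-- The local homeomorphism `Φ` is a diffeomorphism of its source onto its target. -/
structure IsSmoothHomeo (Φ : OpenPartialHomeomorph M N) : Prop where
  smooth : ContMDiffOn 𝓘(ℝ, E) 𝓘(ℝ, F) ∞ Φ Φ.source
  smooth_symm : ContMDiffOn 𝓘(ℝ, F) 𝓘(ℝ, E) ∞ Φ.symm Φ.target

namespace IsSmoothHomeo

variable {Φ : OpenPartialHomeomorph M N} {Ψ : OpenPartialHomeomorph N P}

lemma symm (h : IsSmoothHomeo (E := E) (F := F) Φ) : IsSmoothHomeo (E := F) (F := E) Φ.symm :=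
  ⟨h.smooth_symm, h.smooth⟩

lemma contMDiffAt (h : IsSmoothHomeo (E := E) (F := F) Φ) {x : M} (hx : x ∈ Φ.source) :
    ContMDiffAt 𝓘(ℝ, E) 𝓘(ℝ, F) ∞ Φ x :=
  h.smooth.contMDiffAt (Φ.open_source.mem_nhds hx)

lemma mdifferentiableAt (h : IsSmoothHomeo (E := E) (F := F) Φ) {x : M} (hx : x ∈ Φ.source) :
    MDifferentiableAt 𝓘(ℝ, E) 𝓘(ℝ, F) Φ x :=
  (h.contMDiffAt hx).mdifferentiableAt (by simp)

lemma trans (h : IsSmoothHomeo (E := E) (F := F) Φ) (h' : IsSmoothHomeo (E := F) (F := F') Ψ) :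
    IsSmoothHomeo (E := E) (F := F') (Φ.trans Ψ) where
  smooth := by
    rw [OpenPartialHomeomorph.coe_trans, OpenPartialHomeomorph.trans_source]
    exact h'.smooth.comp (h.smooth.mono inter_subset_left) fun x hx => hx.2
  smooth_symm := by
    rw [OpenPartialHomeomorph.coe_trans_symm, OpenPartialHomeomorph.trans_target]
    exact h.smooth_symm.comp (h'.smooth_symm.mono inter_subset_left) fun x hx => hx.2

lemma restrOpen (h : IsSmoothHomeo (E := E) (F := F) Φ) {s : Set M} (hs : IsOpen s) :
    IsSmoothHomeo (E := E) (F := F) (Φ.restrOpen s hs) where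
  smooth := h.smooth.mono (by rw [OpenPartialHomeomorph.restrOpen_source]; exact inter_subset_left)
  smooth_symm := h.smooth_symm.mono fun x hx => by
    have := (Φ.restrOpen s hs).map_target hx
    rw [OpenPartialHomeomorph.restrOpen_source] at this
    have h2 := Φ.map_source this.1
    have h3 : Φ.restrOpen s hs ((Φ.restrOpen s hs).symm x) = x :=
      (Φ.restrOpen s hs).right_inv hx
    have h4 : Φ ((Φ.restrOpen s hs).symm x) = x := h3
    rwa [h4] at h2

lemma deriv_comp_deriv_symm (h : IsSmoothHomeo (E := E) (F := F) Φ) {y : N} (hy : y ∈ Φ.target) :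
    (manifoldDeriv E F Φ (Φ.symm y)).comp (manifoldDeriv F E Φ.symm y) =
      ContinuousLinearMap.id ℝ F := by
  rw [← manifoldDeriv_comp y (h.mdifferentiableAt (Φ.map_target hy)) (h.symm.mdifferentiableAt hy),
    ← manifoldDeriv_id y]
  exact manifoldDeriv_congr (Φ.eventually_right_inverse hy)

lemma deriv_symm_comp_deriv (h : IsSmoothHomeo (E := E) (F := F) Φ) {x : M} (hx : x ∈ Φ.source) :
    (manifoldDeriv F E Φ.symm (Φ x)).comp (manifoldDeriv E F Φ x) =
      ContinuousLinearMap.id ℝ E := by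
  have := h.symm.deriv_comp_deriv_symm hx
  exact this

lemma inverse_deriv (h : IsSmoothHomeo (E := E) (F := F) Φ) {x : M} (hx : x ∈ Φ.source) :
    (manifoldDeriv E F Φ x).inverse = manifoldDeriv F E Φ.symm (Φ x) := by
  refine ContinuousLinearMap.inverse_eq ?_ (h.deriv_symm_comp_deriv hx)
  have := h.deriv_comp_deriv_symm (Φ.map_source hx)
  rwa [Φ.left_inv hx] at this

end IsSmoothHomeo

lemma isSmoothHomeo_chart [IsManifold 𝓘(ℝ, E) ∞ M] {e : OpenPartialHomeomorph M E}
    (he : e ∈ atlas E M) : IsSmoothHomeo (E := E) (F := E) e :=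
  ⟨contMDiffOn_of_mem_maximalAtlas (IsManifold.subset_maximalAtlas he),
    contMDiffOn_symm_of_mem_maximalAtlas (IsManifold.subset_maximalAtlas he)⟩

/-- A local diffeomorphism restricts to a diffeomorphism of open sets near each point. -/
lemma IsLocalDiffeomorph.exists_isSmoothHomeo {f : M → N}
    (hf : IsLocalDiffeomorph 𝓘(ℝ, E) 𝓘(ℝ, F) ∞ f) (x : M) :
    ∃ Φ : OpenPartialHomeomorph M N, x ∈ Φ.source ∧ IsSmoothHomeo (E := E) (F := F) Φ ∧
      ∀ y ∈ Φ.source, Φ y = f y := by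
  obtain ⟨Φ, hx, hΦ⟩ := hf x
  exact ⟨Φ.toOpenPartialHomeomorph, hx, ⟨Φ.contMDiffOn_toFun, Φ.contMDiffOn_invFun⟩,
    fun y hy => (hΦ hy).symm⟩

lemma IsLocalDiffeomorph.isInvertible_manifoldDeriv {f : M → N}
    (hf : IsLocalDiffeomorph 𝓘(ℝ, E) 𝓘(ℝ, F) ∞ f) (x : M) :
    (manifoldDeriv E F f x).IsInvertible :=
  ⟨(hf x).mfderivToContinuousLinearEquiv (by simp), rfl⟩

end SmoothMaps

section Jacobian

variable {M : Type*} [TopologicalSpace M] [ChartedSpace ℂ M]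
  {N : Type*} [TopologicalSpace N] [ChartedSpace ℂ N]
  {P : Type*} [TopologicalSpace P] [ChartedSpace ℂ P]

/-- The Jacobian determinant of a map between real surfaces, with respect to the trivializations
of the tangent bundles given by the model space. -/
noncomputable def jac (f : M → N) (x : M) : ℝ := (manifoldDeriv ℂ ℂ f x).det

lemma ContinuousLinearMap.det_comp_real (A B : ℂ →L[ℝ] ℂ) : (A.comp B).det = A.det * B.det :=
  LinearMap.det_comp (A : ℂ →ₗ[ℝ] ℂ) (B : ℂ →ₗ[ℝ] ℂ)

lemma ContinuousLinearMap.det_id_real : (ContinuousLinearMap.id ℝ ℂ).det = 1 :=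
  LinearMap.det_id

lemma ContinuousLinearMap.det_complex (A : ℂ →L[ℝ] ℂ) :
    A.det = (A 1).re * (A Complex.I).im - (A 1).im * (A Complex.I).re := by
  rw [ContinuousLinearMap.det, ← LinearMap.det_toMatrix Complex.basisOneI, Matrix.det_fin_two]
  simp [LinearMap.toMatrix_apply]
  ring

lemma ContinuousLinearMap.det_pos_of_complex_linear {A : ℂ →L[ℝ] ℂ} (hA : A.IsInvertible)
    (hI : A Complex.I = Complex.I * A 1) : 0 < A.det := by
  rw [ContinuousLinearMap.det_complex, hI]
  have h1 : A 1 ≠ 0 := fun h => by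
    obtain ⟨e, rfl⟩ := hA
    exact one_ne_zero ((map_eq_zero_iff _ e.injective).1 h)
  have := Complex.normSq_pos.2 h1
  rw [Complex.normSq_apply] at this
  simpa using this

lemma jac_comp {g : N → P} {f : M → N} (x : M)
    (hg : MDifferentiableAt 𝓘(ℝ, ℂ) 𝓘(ℝ, ℂ) g (f x))
    (hf : MDifferentiableAt 𝓘(ℝ, ℂ) 𝓘(ℝ, ℂ) f x) :
    jac (fun y => g (f y)) x = jac g (f x) * jac f x := by
  rw [jac, manifoldDeriv_comp x hg hf, ContinuousLinearMap.det_comp_real]; rfl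

lemma jac_congr {f g : M → N} {x : M} (h : f =ᶠ[𝓝 x] g) : jac f x = jac g x := by
  rw [jac, jac, manifoldDeriv_congr h]

/-- The Jacobians of a diffeomorphism and of its inverse are inverse to one another. -/
lemma IsSmoothHomeo.jac_mul_jac_symm {Φ : OpenPartialHomeomorph M N}
    (h : IsSmoothHomeo (E := ℂ) (F := ℂ) Φ) {y : N} (hy : y ∈ Φ.target) :
    jac Φ (Φ.symm y) * jac Φ.symm y = 1 := by
  rw [jac, jac, ← ContinuousLinearMap.det_comp_real, h.deriv_comp_deriv_symm hy,
    ContinuousLinearMap.det_id_real]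

/-- The value of a `2`-form on the plane is a multiple of its value on the frame `1, I`. -/
lemma alternating_complex_apply (σ : ℂ [⋀^Fin 2]→L[ℝ] ℝ) (u v : ℂ) :
    σ ![u, v] = (u.re * v.im - u.im * v.re) * σ ![1, Complex.I] := by
  have h1 : ∀ a b c : ℂ, ∀ s t : ℝ, σ ![s • a + t • b, c] = s * σ ![a, c] + t * σ ![b, c] := by
    intro a b c s t
    have e : ∀ z : ℂ, (![z, c] : Fin 2 → ℂ) = Function.update ![0, c] 0 z := by
      intro z; ext i; fin_cases i <;> simp
    rw [e (s • a + t • b), σ.map_update_add, σ.map_update_smul, σ.map_update_smul, ← e a, ← e b]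
    rfl
  have h2 : ∀ a b c : ℂ, ∀ s t : ℝ, σ ![c, s • a + t • b] = s * σ ![c, a] + t * σ ![c, b] := by
    intro a b c s t
    have e : ∀ z : ℂ, (![c, z] : Fin 2 → ℂ) = Function.update ![c, 0] 1 z := by
      intro z; ext i; fin_cases i <;> simp
    rw [e (s • a + t • b), σ.map_update_add, σ.map_update_smul, σ.map_update_smul, ← e a, ← e b]
    rfl
  have h3 : ∀ a : ℂ, σ ![a, a] = 0 := fun a =>
    σ.map_eq_zero_of_eq _ (i := 0) (j := 1) (by simp) (by simp)
  have h4 : σ ![Complex.I, 1] = - σ ![1, Complex.I] := by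
    have h := h3 ((1 : ℝ) • (1 : ℂ) + (1 : ℝ) • Complex.I)
    rw [h1, h2, h2, h3, h3] at h
    linarith
  have hd : ∀ z : ℂ, z = z.re • (1 : ℂ) + z.im • Complex.I := fun z => by
    simp [Complex.re_add_im]
  conv_lhs => rw [hd u, hd v, h1, h2, h2, h3, h3, h4]
  ring

lemma alternating_comp_apply (σ : ℂ [⋀^Fin 2]→L[ℝ] ℝ) (A : ℂ →L[ℝ] ℂ) :
    σ.compContinuousLinearMap A ![1, Complex.I] = A.det * σ ![1, Complex.I] := by
  rw [ContinuousLinearMap.det_complex, ← alternating_complex_apply]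
  rw [ContinuousAlternatingMap.compContinuousLinearMap_apply]
  congr 1; ext i; fin_cases i <;> simp

end Jacobian

/-! ### Fibre sums and integration along a correspondence -/

section FiberSums

/-- The sum of the values of `F` over the fibre of `s` at `y`. -/
noncomputable def fiberSum {X Y : Type*} (s : X → Y) (F : X → ℝ) (y : Y) : ℝ :=
  ∑ᶠ g : {g : X // s g = y}, F g.1

/-- Only finitely many points of a fibre of a local homeomorphism lie in a compact set. -/
lemma finite_fiber_inter {X Y : Type*} [TopologicalSpace X] [TopologicalSpace Y] [T1Space Y]
    {s : X → Y} (hs : IsLocalHomeomorph s) {K : Set X} (hK : IsCompact K) (y : Y) :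
    (s ⁻¹' {y} ∩ K).Finite := by
  refine IsCompact.finite (hK.inter_left (isClosed_singleton.preimage hs.continuous)) ?_
  refine (hs.isLocalHomeomorphOn.mono (subset_univ _)).isDiscrete_of_image ?_
  refine Set.Subsingleton.isDiscrete ?_
  rintro _ ⟨g, hg, rfl⟩ _ ⟨g', hg', rfl⟩
  exact hg.1.trans hg'.1.symm

lemma finite_support_fiber {X Y : Type*} {s : X → Y} {F : X → ℝ} {K : Set X} {y : Y}
    (h : (s ⁻¹' {y} ∩ K).Finite) (hF : ∀ g, F g ≠ 0 → g ∈ K) :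
    (Function.support fun g : {g : X // s g = y} => F g.1).Finite := by
  refine Set.Finite.of_finite_image (f := Subtype.val) (h.subset ?_) Subtype.val_injective.injOn
  rintro _ ⟨g, hg, rfl⟩
  exact ⟨g.2, hF _ hg⟩

lemma fiberSum_sum {X Y ι : Type*} {s : X → Y} {F : ι → X → ℝ} {K : Set X} {y : Y}
    (h : (s ⁻¹' {y} ∩ K).Finite) (t : Finset ι) (hF : ∀ i ∈ t, ∀ g, F i g ≠ 0 → g ∈ K) :
    fiberSum s (fun g => ∑ i ∈ t, F i g) y = ∑ i ∈ t, fiberSum s (F i) y :=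
  finsum_sum_comm t (fun (g : {g : X // s g = y}) i => F i g.1)
    fun i hi => finite_support_fiber h (hF i hi)

lemma fiberSum_congr {X Y : Type*} {s : X → Y} {F F' : X → ℝ} {y : Y}
    (h : ∀ g, s g = y → F g = F' g) : fiberSum s F y = fiberSum s F' y :=
  finsum_congr fun g => h g.1 g.2

/-- The fibre sum of a function supported in the domain of a chart `S` that covers the chart `e` of
the base. -/
lemma fiberSum_eq_indicator {X Y Z : Type*} [TopologicalSpace X] [TopologicalSpace Y]
    [TopologicalSpace Z] {s : X → Y} {e : OpenPartialHomeomorph Y Z}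
    {S : OpenPartialHomeomorph X Z} (hS : ∀ g ∈ S.source, s g ∈ e.source ∧ S g = e (s g))
    {F : X → ℝ} (hF : ∀ g, F g ≠ 0 → g ∈ S.source) {p : Z} (hp : p ∈ e.target) :
    fiberSum s F (e.symm p) = S.target.indicator (fun p => F (S.symm p)) p := by
  by_cases h : p ∈ S.target
  · rw [indicator_of_mem h]
    have h1 := hS _ (S.map_target h)
    have h2 : s (S.symm p) = e.symm p := by
      rw [← e.left_inv h1.1, ← h1.2, S.right_inv h]
    refine finsum_eq_single _ (⟨S.symm p, h2⟩ : {g : X // s g = e.symm p}) fun g hg => ?_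
    by_contra h0
    have h3 := hF _ h0
    refine hg (Subtype.ext ?_)
    rw [← S.left_inv h3, (hS _ h3).2, g.2, e.right_inv hp]
  · rw [indicator_of_notMem h]
    refine finsum_eq_zero_of_forall_eq_zero fun g => ?_
    by_contra h0
    have h3 := hF _ h0
    refine h ?_
    have := S.map_source h3
    rwa [(hS _ h3).2, g.2, e.right_inv hp] at this

end FiberSums

section Correspondence

variable {X : Type*} [TopologicalSpace X]

lemma integrableOn_comp_symm {S : OpenPartialHomeomorph X ℂ} {F : X → ℝ} (hF : Continuous F)
    (hc : HasCompactSupport F) (hs : tsupport F ⊆ S.source) :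
    IntegrableOn (fun p => F (S.symm p)) S.target := by
  have hK : IsCompact (S '' tsupport F) :=
    IsCompact.image_of_continuousOn hc (S.continuousOn.mono hs)
  have hKt : S '' tsupport F ⊆ S.target := by
    rintro _ ⟨g, hg, rfl⟩
    exact S.map_source (hs hg)
  have h1 : IntegrableOn (fun p => F (S.symm p)) (S '' tsupport F) :=
    (hF.comp_continuousOn (S.continuousOn_symm.mono hKt)).integrableOn_compact hK
  refine h1.of_forall_sdiff_eq_zero S.open_target.measurableSet fun p hp => ?_
  by_contra h0
  exact hp.2 ⟨S.symm p, subset_tsupport _ h0, S.right_inv hp.1⟩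

/-- Integration over a set of a function that is supported in a smaller set. -/
lemma integral_eq_of_eq_indicator {V U : Set ℂ} (hV : MeasurableSet V) (hU : MeasurableSet U)
    (hUV : U ⊆ V) {φ ψ : ℂ → ℝ} (h : ∀ p ∈ V, φ p = U.indicator ψ p) (hψ : IntegrableOn ψ U) :
    IntegrableOn φ V ∧ ∫ p in V, φ p = ∫ p in U, ψ p := by
  refine ⟨(integrableOn_congr_fun h hV).2
    ((integrable_indicator_iff hU).2 hψ).integrableOn, ?_⟩
  rw [setIntegral_congr_fun hV h, setIntegral_indicator hU, inter_eq_right.2 hUV]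

/-- The change of variables between two charts `S` and `T` with the same domain. -/
lemma integral_comp_symm_eq {S T : OpenPartialHomeomorph X ℂ} (hST : S.source = T.source)
    {A : ℂ → ℂ →L[ℝ] ℂ} (hA : ∀ q ∈ T.target, HasFDerivAt (fun q => S (T.symm q)) (A q) q)
    {F : X → ℝ} (hF : IntegrableOn (fun p => F (S.symm p)) S.target) :
    IntegrableOn (fun q => |(A q).det| * F (T.symm q)) T.target ∧
      ∫ p in S.target, F (S.symm p) = ∫ q in T.target, |(A q).det| * F (T.symm q) := by
  have himg : (fun q => S (T.symm q)) '' T.target = S.target := by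
    ext p
    constructor
    · rintro ⟨q, hq, rfl⟩
      exact S.map_source (hST ▸ T.map_target hq)
    · intro hp
      have h1 : S.symm p ∈ T.source := hST ▸ S.map_target hp
      exact ⟨T (S.symm p), T.map_source h1, by simp only [T.left_inv h1, S.right_inv hp]⟩
  have hinj : InjOn (fun q => S (T.symm q)) T.target := fun q hq q' hq' h =>
    T.symm.injOn hq hq' (S.injOn (hST ▸ T.map_target hq) (hST ▸ T.map_target hq') h)
  have hm := T.open_target.measurableSet
  have hA' : ∀ q ∈ T.target, HasFDerivWithinAt (fun q => S (T.symm q)) (A q) T.target q :=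
    fun q hq => (hA q hq).hasFDerivWithinAt
  have h1 := integrableOn_image_iff_integrableOn_abs_det_fderiv_smul (volume : Measure ℂ) hm hA'
    hinj (fun p => F (S.symm p))
  have h2 := integral_image_eq_integral_abs_det_fderiv_smul (volume : Measure ℂ) hm hA'
    hinj (fun p => F (S.symm p))
  have hc : ∀ q ∈ T.target, |(A q).det| • F (S.symm (S (T.symm q))) =
      |(A q).det| * F (T.symm q) := fun q hq => by
    rw [S.left_inv (hST ▸ T.map_target hq), smul_eq_mul]
  rw [himg] at h1 h2
  refine ⟨(integrableOn_congr_fun hc hm).1 (h1.1 hF), h2.trans (setIntegral_congr_fun hm hc)⟩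

variable [ChartedSpace ℂ X] {M : Type*} [TopologicalSpace M] [ChartedSpace ℂ M]

/-- A chart of a surface that is a diffeomorphism onto its image and preserves the orientation of
the model space. -/
structure IsOrientedChart (e : OpenPartialHomeomorph M ℂ) : Prop where
  smooth : IsSmoothHomeo (E := ℂ) (F := ℂ) e
  jac_pos : ∀ x ∈ e.source, 0 < jac e x

lemma IsOrientedChart.jac_symm_pos {e : OpenPartialHomeomorph M ℂ} (he : IsOrientedChart e) {p : ℂ}
    (hp : p ∈ e.target) : 0 < jac e.symm p := by
  have h1 := he.smooth.jac_mul_jac_symm hp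
  have h2 := he.jac_pos _ (e.map_target hp)
  by_contra h
  nlinarith

/-- Two oriented charts on the base give, near each point of the total space, two charts with the
same domain. -/
lemma exists_charts_of_localDiffeomorph {s t : X → M}
    (hs : IsLocalDiffeomorph 𝓘(ℝ, ℂ) 𝓘(ℝ, ℂ) ∞ s) (ht : IsLocalDiffeomorph 𝓘(ℝ, ℂ) 𝓘(ℝ, ℂ) ∞ t)
    (hsj : ∀ g, 0 < jac s g) (htj : ∀ g, 0 < jac t g)
    {e e' : OpenPartialHomeomorph M ℂ} (he : IsOrientedChart e) (he' : IsOrientedChart e') {g : X}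
    (hg : s g ∈ e.source) (hg' : t g ∈ e'.source) :
    ∃ S T : OpenPartialHomeomorph X ℂ, g ∈ S.source ∧ S.source = T.source ∧
      (∀ g ∈ S.source, s g ∈ e.source ∧ S g = e (s g)) ∧
      (∀ g ∈ T.source, t g ∈ e'.source ∧ T g = e' (t g)) ∧
      ∃ A : ℂ → ℂ →L[ℝ] ℂ, ∀ q ∈ T.target, HasFDerivAt (fun q => S (T.symm q)) (A q) q ∧
        |(A q).det| = jac e (s (T.symm q)) * jac s (T.symm q) / jac t (T.symm q) *
          jac e'.symm q := by
  obtain ⟨Φ, hgΦ, hΦ, hΦs⟩ := hs.exists_isSmoothHomeo g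
  obtain ⟨Ψ, hgΨ, hΨ, hΨt⟩ := ht.exists_isSmoothHomeo g
  let S₁ := Φ.trans e
  let T₁ := Ψ.trans e'
  have hS₁ : ∀ x, x ∈ S₁.source ↔ x ∈ Φ.source ∧ s x ∈ e.source := fun x => by
    rw [OpenPartialHomeomorph.trans_source]
    refine and_congr_right fun hx => ?_
    rw [mem_preimage, hΦs x hx]
  have hT₁ : ∀ x, x ∈ T₁.source ↔ x ∈ Ψ.source ∧ t x ∈ e'.source := fun x => by
    rw [OpenPartialHomeomorph.trans_source]
    refine and_congr_right fun hx => ?_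
    rw [mem_preimage, hΨt x hx]
  let S := S₁.restrOpen T₁.source T₁.open_source
  let T := T₁.restrOpen S₁.source S₁.open_source
  have hSs : S.source = S₁.source ∩ T₁.source := S₁.restrOpen_source _ _
  have hTs : T.source = T₁.source ∩ S₁.source := T₁.restrOpen_source _ _
  have hST : S.source = T.source := by rw [hSs, hTs, inter_comm]
  have hSe : ∀ g ∈ S.source, s g ∈ e.source ∧ S g = e (s g) := fun x hx => by
    rw [hSs] at hx
    have h1 := (hS₁ x).1 hx.1
    refine ⟨h1.2, ?_⟩
    change e (Φ x) = _
    rw [hΦs x h1.1]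
  have hTe : ∀ g ∈ T.source, t g ∈ e'.source ∧ T g = e' (t g) := fun x hx => by
    rw [hTs] at hx
    have h1 := (hT₁ x).1 hx.1
    refine ⟨h1.2, ?_⟩
    change e' (Ψ x) = _
    rw [hΨt x h1.1]
  have hSd : IsSmoothHomeo (E := ℂ) (F := ℂ) S := (hΦ.trans he.smooth).restrOpen T₁.open_source
  have hTd : IsSmoothHomeo (E := ℂ) (F := ℂ) T := (hΨ.trans he'.smooth).restrOpen S₁.open_source
  refine ⟨S, T, ?_, hST, hSe, hTe, fun q => fderiv ℝ (fun q => S (T.symm q)) q, fun q hq => ?_⟩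
  · rw [hSs]
    exact ⟨(hS₁ g).2 ⟨hgΦ, hg⟩, (hT₁ g).2 ⟨hgΨ, hg'⟩⟩
  have hqT : T.symm q ∈ T.source := T.map_target hq
  have hqS : T.symm q ∈ S.source := hST ▸ hqT
  have hTq : MDifferentiableAt 𝓘(ℝ, ℂ) 𝓘(ℝ, ℂ) T.symm q := hTd.symm.mdifferentiableAt hq
  have hSq := hSd.mdifferentiableAt hqS
  have hd : DifferentiableAt ℝ (fun q => S (T.symm q)) q :=
    (MDifferentiableAt.comp q hSq hTq).differentiableAt
  refine ⟨hd.hasFDerivAt, ?_⟩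
  have hjac : (fderiv ℝ (fun q => S (T.symm q)) q).det = jac S (T.symm q) * jac T.symm q := by
    rw [← manifoldDeriv_eq_fderiv]
    exact jac_comp q hSq hTq
  have hsd : ∀ g, MDifferentiableAt 𝓘(ℝ, ℂ) 𝓘(ℝ, ℂ) s g := hs.mdifferentiable (by simp)
  have htd : ∀ g, MDifferentiableAt 𝓘(ℝ, ℂ) 𝓘(ℝ, ℂ) t g := ht.mdifferentiable (by simp)
  have h1 : jac S (T.symm q) = jac e (s (T.symm q)) * jac s (T.symm q) := by
    rw [← jac_comp _ (he.smooth.mdifferentiableAt (hSe _ hqS).1) (hsd _)]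
    refine jac_congr ?_
    filter_upwards [S.open_source.mem_nhds hqS] with x hx using (hSe x hx).2
  have h2 : jac T (T.symm q) = jac e' (t (T.symm q)) * jac t (T.symm q) := by
    rw [← jac_comp _ (he'.smooth.mdifferentiableAt (hTe _ hqT).1) (htd _)]
    refine jac_congr ?_
    filter_upwards [T.open_source.mem_nhds hqT] with x hx using (hTe x hx).2
  have h3 := hTd.jac_mul_jac_symm hq
  have h4 : e' (t (T.symm q)) = q := by rw [← (hTe _ hqT).2, T.right_inv hq]
  have hq' : q ∈ e'.target := h4 ▸ e'.map_source (hTe _ hqT).1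
  have h5 : e'.symm q = t (T.symm q) := by rw [← e'.left_inv (hTe _ hqT).1, h4]
  have h6 := he'.smooth.jac_mul_jac_symm hq'
  rw [h5] at h6
  have p1 := he.jac_pos _ (hSe _ hqS).1
  have p2 := hsj (T.symm q)
  have p3 := htj (T.symm q)
  have p4 := he'.jac_pos _ (hTe _ hqT).1
  have p5 := he'.jac_symm_pos hq'
  have h7 : jac T.symm q = jac e'.symm q / jac t (T.symm q) := by
    rw [h2] at h3
    rw [eq_div_iff p3.ne']
    have : jac e' (t (T.symm q)) * (jac T.symm q * jac t (T.symm q)) =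
      jac e' (t (T.symm q)) * jac e'.symm q := by rw [h6, ← h3]; ring
    exact mul_left_cancel₀ p4.ne' this
  rw [hjac, h1, h7, abs_of_pos (by positivity)]
  ring

/-- **Integration along a correspondence.** For two local diffeomorphisms `s, t : X → M` and a
compactly supported function on `X`, the integral of the sums over the fibres of `s` equals the
integral of the sums over the fibres of `t`, weighted by the Jacobian. -/
theorem integral_fiberSum_eq [T2Space X] [SecondCountableTopology X] [T1Space M] {s t : X → M}
    (hs : IsLocalDiffeomorph 𝓘(ℝ, ℂ) 𝓘(ℝ, ℂ) ∞ s) (ht : IsLocalDiffeomorph 𝓘(ℝ, ℂ) 𝓘(ℝ, ℂ) ∞ t)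
    (hsj : ∀ g, 0 < jac s g) (htj : ∀ g, 0 < jac t g)
    {e e' : OpenPartialHomeomorph M ℂ} (he : IsOrientedChart e) (he' : IsOrientedChart e')
    {F : X → ℝ} (hF : Continuous F) (hc : HasCompactSupport F)
    (hFs : ∀ g ∈ tsupport F, s g ∈ e.source) (hFt : ∀ g ∈ tsupport F, t g ∈ e'.source) :
    IntegrableOn (fun p => fiberSum s F (e.symm p)) e.target ∧
    IntegrableOn (fun q => jac e'.symm q *
      fiberSum t (fun g => F g * (jac e (s g) * jac s g / jac t g)) (e'.symm q)) e'.target ∧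
    ∫ p in e.target, fiberSum s F (e.symm p) = ∫ q in e'.target, jac e'.symm q *
      fiberSum t (fun g => F g * (jac e (s g) * jac s g / jac t g)) (e'.symm q) := by
  have : LocallyCompactSpace X := ChartedSpace.locallyCompactSpace ℂ X
  have hK : IsCompact (tsupport F) := hc
  -- A partition of unity reduces the claim to functions supported in the domain of a pair of charts
  -- of `X` that express `s` and `t`; there it is the change of variables between these charts.
  choose S T hgS hST hSe hTe A hA using fun (g : tsupport F) =>
    exists_charts_of_localDiffeomorph hs ht hsj htj he he' (hFs g g.2) (hFt g g.2)
  obtain ⟨I, hIc⟩ := hK.elim_nhds_subcover' (fun g hg => (S ⟨g, hg⟩).source)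
    (fun g hg => (S ⟨g, hg⟩).open_source.mem_nhds (hgS ⟨g, hg⟩))
  obtain ⟨χ, hχ⟩ := PartitionOfUnity.exists_isSubordinate (X := X) (isClosed_tsupport F)
    (fun i : I => (S i.1).source) (fun i => (S i.1).open_source) (fun g hg => by
      obtain ⟨i, hi, hgi⟩ := mem_iUnion₂.1 (hIc hg)
      exact mem_iUnion.2 ⟨⟨i, hi⟩, hgi⟩)
  let J : X → ℝ := fun g => jac e (s g) * jac s g / jac t g
  let f : I → X → ℝ := fun i g => χ i g * F g
  have hfc : ∀ i, Continuous (f i) := fun i => (χ i).continuous.mul hF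
  have hfs : ∀ i, HasCompactSupport (f i) := fun i => hc.mul_left
  have hfS : ∀ i, tsupport (f i) ⊆ (S i.1).source := fun i =>
    (tsupport_mul_subset_left).trans (hχ i)
  have hfF : ∀ i g, f i g ≠ 0 → g ∈ tsupport F := fun i g h =>
    subset_tsupport _ (right_ne_zero_of_mul h)
  have hsum : ∀ g, F g = ∑ i, f i g := fun g => by
    by_cases hg : g ∈ tsupport F
    · rw [← Finset.sum_mul, ← finsum_eq_sum_of_fintype, χ.sum_eq_one hg, one_mul]
    · rw [image_eq_zero_of_notMem_tsupport hg, Finset.sum_eq_zero fun i _ => ?_]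
      simp only [f, image_eq_zero_of_notMem_tsupport hg, mul_zero]
  have hleft : ∀ i, IntegrableOn (fun p => fiberSum s (f i) (e.symm p)) e.target ∧
      ∫ p in e.target, fiberSum s (f i) (e.symm p) =
        ∫ p in (S i.1).target, f i ((S i.1).symm p) := fun i =>
    integral_eq_of_eq_indicator e.open_target.measurableSet (S i.1).open_target.measurableSet
      (fun p hp => by
        have h1 := hSe i.1 _ ((S i.1).map_target hp)
        rw [(S i.1).right_inv hp] at h1
        rw [h1.2]
        exact e.map_source h1.1)
      (fun p hp => fiberSum_eq_indicator (hSe i.1) (fun g hg => hfS i (subset_tsupport _ hg)) hp)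
      (integrableOn_comp_symm (hfc i) (hfs i) (hfS i))
  have hmid := fun i => integral_comp_symm_eq (hST i.1) (fun q hq => (hA i.1 q hq).1)
    (integrableOn_comp_symm (hfc i) (hfs i) (hfS i))
  have hright : ∀ i, IntegrableOn (fun q => jac e'.symm q *
        fiberSum t (fun g => f i g * J g) (e'.symm q)) e'.target ∧
      ∫ q in e'.target, jac e'.symm q * fiberSum t (fun g => f i g * J g) (e'.symm q) =
        ∫ q in (T i.1).target, |(A i.1 q).det| * f i ((T i.1).symm q) := fun i =>
    integral_eq_of_eq_indicator e'.open_target.measurableSet (T i.1).open_target.measurableSet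
      (fun p hp => by
        have h1 := hTe i.1 _ ((T i.1).map_target hp)
        rw [(T i.1).right_inv hp] at h1
        rw [h1.2]
        exact e'.map_source h1.1)
      (fun q hq => by
        rw [fiberSum_eq_indicator (hTe i.1) (fun g hg => hST i.1 ▸
          hfS i (subset_tsupport _ (left_ne_zero_of_mul hg))) hq]
        by_cases h : q ∈ (T i.1).target
        · rw [indicator_of_mem h, indicator_of_mem h, (hA i.1 q h).2]
          ring
        · rw [indicator_of_notMem h, indicator_of_notMem h, mul_zero])
      (hmid i).1
  have hFl : ∀ p, fiberSum s F (e.symm p) = ∑ i, fiberSum s (f i) (e.symm p) := fun p => by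
    rw [← fiberSum_sum (finite_fiber_inter hs.isLocalHomeomorph hK _) _ fun i _ => hfF i]
    exact fiberSum_congr fun g _ => hsum g
  have hFr : ∀ q, jac e'.symm q * fiberSum t (fun g => F g * J g) (e'.symm q) =
      ∑ i, jac e'.symm q * fiberSum t (fun g => f i g * J g) (e'.symm q) := fun q => by
    rw [← Finset.mul_sum,
      ← fiberSum_sum (finite_fiber_inter ht.isLocalHomeomorph hK _) _
        fun i _ g hg => hfF i g (left_ne_zero_of_mul hg)]
    congr 1
    refine fiberSum_congr fun g _ => ?_
    rw [← Finset.sum_mul, ← hsum]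
  rw [show (fun p => fiberSum s F (e.symm p)) = _ from funext hFl,
    show (fun q => jac e'.symm q * fiberSum t (fun g => F g * (jac e (s g) * jac s g / jac t g))
      (e'.symm q)) = _ from funext hFr]
  refine ⟨integrable_finsetSum _ fun i _ => (hleft i).1,
    integrable_finsetSum _ fun i _ => (hright i).1, ?_⟩
  rw [integral_finsetSum _ fun i _ => (hleft i).1, integral_finsetSum _ fun i _ => (hright i).1]
  exact Finset.sum_congr rfl fun i _ => by rw [(hleft i).2, (hmid i).2, (hright i).2]

end Correspondence

/-! ### Sums over the orbits of an orbifold groupoid -/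

namespace OrbifoldGroupoid

variable {E : Type*} [NormedAddCommGroup E] [NormedSpace ℝ E] (G : OrbifoldGroupoid E)

lemma inv_inv (g : G.Arr) : G.inv (G.inv g) = g := by
  have h1 : G.comp (G.comp g (G.inv g)) (G.inv (G.inv g)) = G.inv (G.inv g) := by
    rw [G.comp_inv, ← G.tgt_inv g, ← G.src_inv (G.inv g), G.unit_comp]
  rw [← h1, G.comp_assoc _ _ _ (G.src_inv g).symm (G.src_inv _).symm, G.comp_inv, G.src_inv,
    G.comp_unit]

lemma comp_inv_comp {g h : G.Arr} (hgh : G.src g = G.src h) :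
    G.comp g (G.comp (G.inv g) h) = h := by
  rw [← G.comp_assoc _ _ _ (G.src_inv g).symm ((G.tgt_inv g).trans hgh), G.comp_inv, hgh,
    G.unit_comp]

lemma inv_comp_comp {g h : G.Arr} (hgh : G.tgt g = G.src h) :
    G.comp (G.inv g) (G.comp g h) = h := by
  rw [← G.comp_assoc _ _ _ (G.tgt_inv g) hgh, G.inv_comp, hgh, G.unit_comp]

lemma continuous_src : Continuous G.src := G.etale_src.isLocalHomeomorph.continuous

lemma continuous_tgt : Continuous G.tgt := G.etale_tgt.isLocalHomeomorph.continuous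

lemma mdifferentiable_src : MDifferentiable 𝓘(ℝ, E) 𝓘(ℝ, E) G.src :=
  G.etale_src.mdifferentiable (by simp)

lemma mdifferentiable_tgt : MDifferentiable 𝓘(ℝ, E) 𝓘(ℝ, E) G.tgt :=
  G.etale_tgt.mdifferentiable (by simp)

lemma isCompact_src_tgt {P Q : Set G.Obj} (hP : IsCompact P) (hQ : IsCompact Q) :
    IsCompact {g | G.src g ∈ P ∧ G.tgt g ∈ Q} :=
  G.proper.isCompact_preimage (hP.prod hQ)

lemma finite_src_tgt (x : G.Obj) {Q : Set G.Obj} (hQ : IsCompact Q) :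
    {g | G.src g = x ∧ G.tgt g ∈ Q}.Finite := by
  have := finite_fiber_inter G.etale_src.isLocalHomeomorph
    (G.isCompact_src_tgt (isCompact_singleton (x := x)) hQ) x
  refine this.subset fun g hg => ⟨hg.1, hg.1, hg.2⟩

/-- The sum over the arrows that start at `x` equals the sum over the arrows that end at `x`, taken
at the inverses. -/
lemma fiberSum_src_eq_fiberSum_tgt_inv (F : G.Arr → ℝ) (x : G.Obj) :
    fiberSum G.src F x = fiberSum G.tgt (fun g => F (G.inv g)) x := by
  let e : {g // G.src g = x} ≃ {g // G.tgt g = x} :=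
    { toFun := fun g => ⟨G.inv g.1, (G.tgt_inv _).trans g.2⟩
      invFun := fun g => ⟨G.inv g.1, (G.src_inv _).trans g.2⟩
      left_inv := fun g => Subtype.ext (G.inv_inv _)
      right_inv := fun g => Subtype.ext (G.inv_inv _) }
  refine finsum_eq_of_bijective e e.bijective fun g => ?_
  simp only [e, Equiv.coe_fn_mk, G.inv_inv]

/-- The sum of the values of `v` at the targets of the arrows that start at `x`: the sum over the
orbit of `x`, each point being counted with the order of its local group as multiplicity. -/
noncomputable def orbitSum (v : G.Obj → ℝ) (x : G.Obj) : ℝ := fiberSum G.src (fun g => v (G.tgt g)) x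

lemma orbitSum_src_eq_tgt (v : G.Obj → ℝ) (g : G.Arr) :
    G.orbitSum v (G.src g) = G.orbitSum v (G.tgt g) := by
  let e : {h // G.src h = G.tgt g} ≃ {h // G.src h = G.src g} :=
    { toFun := fun h => ⟨G.comp g h.1, G.src_comp _ _ h.2.symm⟩
      invFun := fun h => ⟨G.comp (G.inv g) h.1,
        (G.src_comp _ _ ((G.tgt_inv g).trans h.2.symm)).trans (G.src_inv g)⟩
      left_inv := fun h => Subtype.ext (G.inv_comp_comp h.2.symm)
      right_inv := fun h => Subtype.ext (G.comp_inv_comp h.2.symm) }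
  refine (finsum_eq_of_bijective e e.bijective fun h => ?_).symm
  simp only [e, Equiv.coe_fn_mk, G.tgt_comp _ _ h.2.symm]

lemma orbitSum_mul_of_invariant {c : G.Obj → ℝ} (hc : ∀ g, c (G.src g) = c (G.tgt g))
    (v : G.Obj → ℝ) (x : G.Obj) :
    G.orbitSum (fun x => v x * c x) x = G.orbitSum v x * c x := by
  have : ∀ g : {g // G.src g = x}, v (G.tgt g.1) * c (G.tgt g.1) = v (G.tgt g.1) * c x := fun g => by
    rw [← hc, g.2]
  simp only [orbitSum, fiberSum, this]
  exact (finsum_mul _ _).symm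

/-- Near `x₀`, the arrows whose target lies in a compact set are the values of finitely many
disjoint local sections of the source map. -/
theorem exists_local_sections (x₀ : G.Obj) {Q : Set G.Obj} (hQ : IsCompact Q) :
    ∃ (n : ℕ) (σ : Fin n → G.Obj → G.Arr) (W : Set G.Obj), IsOpen W ∧ x₀ ∈ W ∧
      (∀ i, ContMDiffOn 𝓘(ℝ, E) 𝓘(ℝ, E) ∞ (σ i) W) ∧ (∀ i, ∀ x ∈ W, G.src (σ i x) = x) ∧
      (∀ x ∈ W, Function.Injective fun i => σ i x) ∧
      (∀ g, G.src g ∈ W → G.tgt g ∈ Q → ∃ i, g = σ i (G.src g)) ∧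
      ∀ i, G.tgt (σ i x₀) ∈ Q := by
  have hS := G.finite_src_tgt x₀ hQ
  obtain ⟨n, γ, hγ, hγS⟩ := hS.fin_param
  have hγ' : ∀ i, G.src (γ i) = x₀ ∧ G.tgt (γ i) ∈ Q := fun i => by
    have : γ i ∈ {g | G.src g = x₀ ∧ G.tgt g ∈ Q} := by rw [← hγS]; exact mem_range_self i
    exact this
  obtain ⟨U, hU, hUd⟩ := (finite_range γ).t2_separation
  choose Φ hΦγ hΦ hΦs using fun i => G.etale_src.exists_isSmoothHomeo (γ i)
  let Ψ : Fin n → OpenPartialHomeomorph G.Arr G.Obj := fun i =>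
    (Φ i).restrOpen (U (γ i)) (hU (γ i)).2
  have hΨsrc : ∀ i, (Ψ i).source = (Φ i).source ∩ U (γ i) := fun i => (Φ i).restrOpen_source _ _
  have hΨd : ∀ i, IsSmoothHomeo (E := E) (F := E) (Ψ i) := fun i => (hΦ i).restrOpen (hU (γ i)).2
  have hΨγ : ∀ i, γ i ∈ (Ψ i).source := fun i => by
    rw [hΨsrc]; exact ⟨hΦγ i, (hU (γ i)).1⟩
  have hΨs : ∀ i, ∀ g ∈ (Ψ i).source, Ψ i g = G.src g := fun i g hg => by
    rw [hΨsrc] at hg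
    exact hΦs i g hg.1
  -- the arrows into `Q` outside the chosen neighbourhoods have a closed set of sources
  have hclosed : IsClosed (G.src '' {g | G.tgt g ∈ Q ∧ ∀ i, g ∉ (Ψ i).source}) := by
    have h1 : IsClosed {g : G.Arr | G.tgt g ∈ Q ∧ ∀ i, g ∉ (Ψ i).source} := by
      have : {g : G.Arr | G.tgt g ∈ Q ∧ ∀ i, g ∉ (Ψ i).source} =
          G.tgt ⁻¹' Q ∩ ⋂ i, ((Ψ i).source)ᶜ := by
        ext g; simp
      rw [this]
      exact (hQ.isClosed.preimage G.continuous_tgt).inter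
        (isClosed_iInter fun i => (Ψ i).open_source.isClosed_compl)
    -- The groupoid is proper, and the projection along the compact set `Q` is closed.
    have h2 := G.proper.isClosedMap _ h1
    have h3 : G.src '' {g | G.tgt g ∈ Q ∧ ∀ i, g ∉ (Ψ i).source} =
        Prod.fst '' ((fun g => (G.src g, G.tgt g)) '' {g | G.tgt g ∈ Q ∧ ∀ i, g ∉ (Ψ i).source} ∩
          univ ×ˢ Q) := by
      ext x
      constructor
      · rintro ⟨g, hg, rfl⟩
        exact ⟨(G.src g, G.tgt g), ⟨⟨g, hg, rfl⟩, mem_univ _, hg.1⟩, rfl⟩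
      · rintro ⟨_, ⟨⟨g, hg, rfl⟩, -⟩, rfl⟩
        exact ⟨g, hg, rfl⟩
    rw [h3]
    have : CompactSpace Q := isCompact_iff_compactSpace.1 hQ
    let j : G.Obj × Q → G.Obj × G.Obj := fun p => (p.1, p.2.1)
    have hj : Continuous j := by fun_prop
    have h4 : Prod.fst '' ((fun g => (G.src g, G.tgt g)) '' {g | G.tgt g ∈ Q ∧
        ∀ i, g ∉ (Ψ i).source} ∩ univ ×ˢ Q) = Prod.fst '' (j ⁻¹' ((fun g => (G.src g, G.tgt g)) ''
          {g | G.tgt g ∈ Q ∧ ∀ i, g ∉ (Ψ i).source})) := by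
      ext x
      constructor
      · rintro ⟨⟨a, b⟩, ⟨h, -, hb⟩, rfl⟩
        exact ⟨(a, ⟨b, hb⟩), h, rfl⟩
      · rintro ⟨⟨a, b⟩, h, rfl⟩
        exact ⟨(a, b.1), ⟨h, mem_univ _, b.2⟩, rfl⟩
    rw [h4]
    exact isClosedMap_fst_of_compactSpace _ (h2.preimage hj)
  refine ⟨n, fun i => (Ψ i).symm, (⋂ i, (Ψ i).target) ∩
    (G.src '' {g | G.tgt g ∈ Q ∧ ∀ i, g ∉ (Ψ i).source})ᶜ, ?_, ⟨?_, ?_⟩, fun i => ?_,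
    fun i x hx => ?_, fun x hx i j hij => ?_, fun g hg hgQ => ?_, fun i => ?_⟩
  · exact (isOpen_iInter_of_finite fun i => (Ψ i).open_target).inter hclosed.isOpen_compl
  · refine mem_iInter.2 fun i => ?_
    have := (Ψ i).map_source (hΨγ i)
    rwa [hΨs i _ (hΨγ i), (hγ' i).1] at this
  · rintro ⟨g, ⟨hgQ, hg⟩, hgx⟩
    have : g ∈ range γ := by rw [hγS]; exact ⟨hgx, hgQ⟩
    obtain ⟨i, rfl⟩ := this
    exact hg i (hΨγ i)
  · exact (hΨd i).smooth_symm.mono fun x hx => mem_iInter.1 hx.1 i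
  · have hxi := mem_iInter.1 hx.1 i
    rw [← hΨs i _ ((Ψ i).map_target hxi), (Ψ i).right_inv hxi]
  · by_contra hne
    have h1 := (Ψ i).map_target (mem_iInter.1 hx.1 i)
    have h2 := (Ψ j).map_target (mem_iInter.1 hx.1 j)
    have hij' : (Ψ i).symm x = (Ψ j).symm x := hij
    rw [hij', hΨsrc] at h1
    rw [hΨsrc] at h2
    exact (disjoint_left.1 (hUd (mem_range_self i) (mem_range_self j)
      (fun h => hne (hγ h))) h1.2) h2.2
  · by_contra hno
    push Not at hno
    refine hg.2 ⟨g, ⟨hgQ, fun i hi => hno i ?_⟩, rfl⟩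
    rw [← hΨs i g hi, (Ψ i).left_inv hi]
  · have h1 : (Ψ i).symm x₀ = γ i := by
      rw [← (hγ' i).1, ← hΨs i _ (hΨγ i), (Ψ i).left_inv (hΨγ i)]
    change G.tgt ((Ψ i).symm x₀) ∈ Q
    rw [h1]
    exact (hγ' i).2

/-- The fibre sums of the source map are finite sums over local sections, hence they depend smoothly
on the base point. -/
lemma fiberSum_eq_sum_sections {n : ℕ} {σ : Fin n → G.Obj → G.Arr} {W Q : Set G.Obj}
    (hs : ∀ i, ∀ x ∈ W, G.src (σ i x) = x) (hi : ∀ x ∈ W, Function.Injective fun i => σ i x)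
    (hQ : ∀ g, G.src g ∈ W → G.tgt g ∈ Q → ∃ i, g = σ i (G.src g)) {F : G.Arr → ℝ}
    (hF : ∀ g, F g ≠ 0 → G.tgt g ∈ Q) {x : G.Obj} (hx : x ∈ W) :
    fiberSum G.src F x = ∑ i, F (σ i x) := by
  let j : Fin n ↪ {g // G.src g = x} :=
    ⟨fun i => ⟨σ i x, hs i x hx⟩, fun a b hab => hi x hx (congrArg Subtype.val hab)⟩
  rw [fiberSum, finsum_eq_sum_of_support_subset (s := Finset.univ.map j), Finset.sum_map]
  · rfl
  · rintro ⟨g, rfl⟩ hg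
    obtain ⟨i, hi'⟩ := hQ g hx (hF g hg)
    simp only [Finset.coe_map, Finset.coe_univ, image_univ, mem_range]
    exact ⟨i, Subtype.ext hi'.symm⟩

lemma contMDiff_orbitSum {v : G.Obj → ℝ} (hv : ContMDiff 𝓘(ℝ, E) 𝓘(ℝ, ℝ) ∞ v)
    (hc : HasCompactSupport v) : ContMDiff 𝓘(ℝ, E) 𝓘(ℝ, ℝ) ∞ (G.orbitSum v) := by
  intro x₀
  obtain ⟨n, σ, W, hW, hx₀, hσ, hs, hi, hQ, -⟩ := G.exists_local_sections x₀ (Q := tsupport v) hc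
  have h1 : ContMDiffOn 𝓘(ℝ, E) 𝓘(ℝ, ℝ) ∞ (fun x => ∑ i, v (G.tgt (σ i x))) W :=
    contMDiffOn_finsetSum fun i _ => hv.comp_contMDiffOn (G.etale_tgt.contMDiff.comp_contMDiffOn (hσ i))
  refine (h1.contMDiffAt (hW.mem_nhds hx₀)).congr_of_eventuallyEq ?_
  filter_upwards [hW.mem_nhds hx₀] with x hx
  exact G.fiberSum_eq_sum_sections hs hi hQ (fun g hg => subset_tsupport _ hg) hx

end OrbifoldGroupoid

/-! ### The orbifold integral in charts -/

section ComplexLinear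

variable {M : Type*} [TopologicalSpace M] [ChartedSpace ℂ M]
  {N : Type*} [TopologicalSpace N] [ChartedSpace ℂ N]

/-- The real derivative of a holomorphic map is complex linear. -/
lemma MDifferentiableAt.manifoldDeriv_I_mul {f : M → N} {x : M}
    (hf : MDifferentiableAt 𝓘(ℂ) 𝓘(ℂ) f x) (v : ℂ) :
    manifoldDeriv ℂ ℂ f x (Complex.I * v) = Complex.I * manifoldDeriv ℂ ℂ f x v := by
  rw [mdifferentiableAt_iff] at hf
  obtain ⟨hc, hd⟩ := hf
  obtain ⟨f', hf'⟩ := hd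
  let A : ℂ →L[ℝ] ℂ := ContinuousLinearMap.restrictScalars ℝ (f' : ℂ →L[ℂ] ℂ)
  have h : HasMFDerivAt 𝓘(ℝ, ℂ) 𝓘(ℝ, ℂ) f x A :=
    ⟨hc, HasFDerivWithinAt.restrictScalars ℝ hf'⟩
  have h2 : manifoldDeriv ℂ ℂ f x = A := h.mfderiv
  rw [h2]
  exact f'.map_smul Complex.I v

lemma jac_pos_of_holomorphic {f : M → N} {x : M} (hf : MDifferentiableAt 𝓘(ℂ) 𝓘(ℂ) f x)
    (hi : (manifoldDeriv ℂ ℂ f x).IsInvertible) : 0 < jac f x :=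
  ContinuousLinearMap.det_pos_of_complex_linear hi (by simpa using hf.manifoldDeriv_I_mul 1)

lemma IsSmoothHomeo.isInvertible {Φ : OpenPartialHomeomorph M N}
    (h : IsSmoothHomeo (E := ℂ) (F := ℂ) Φ) {x : M} (hx : x ∈ Φ.source) :
    (manifoldDeriv ℂ ℂ Φ x).IsInvertible := by
  have h1 := h.deriv_symm_comp_deriv hx
  have h2 := h.deriv_comp_deriv_symm (Φ.map_source hx)
  rw [Φ.left_inv hx] at h2
  exact ⟨ContinuousLinearEquiv.equivOfInverse _ _
    (fun v => DFunLike.congr_fun h1 v) (fun v => DFunLike.congr_fun h2 v), rfl⟩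

lemma isOrientedChart_of_holomorphic {e : OpenPartialHomeomorph M ℂ}
    (h : IsSmoothHomeo (E := ℂ) (F := ℂ) e)
    (hd : ∀ x ∈ e.source, MDifferentiableAt 𝓘(ℂ) 𝓘(ℂ) e x) : IsOrientedChart e :=
  ⟨h, fun x hx => jac_pos_of_holomorphic (hd x hx) (h.isInvertible hx)⟩

end ComplexLinear

namespace ComplexOrbifoldGroupoid

variable (C : ComplexOrbifoldGroupoid)

lemma isOrientedChart {e : OpenPartialHomeomorph C.Obj ℂ} (he : e ∈ atlas ℂ C.Obj) :
    IsOrientedChart e := by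
  have := C.holoObj
  refine isOrientedChart_of_holomorphic (isSmoothHomeo_chart he) fun x hx => ?_
  have h : ContMDiffOn 𝓘(ℂ) 𝓘(ℂ) ω e e.source :=
    contMDiffOn_of_mem_maximalAtlas (IsManifold.subset_maximalAtlas he)
  exact (h.contMDiffAt (e.open_source.mem_nhds hx)).mdifferentiableAt (by simp)

lemma jac_src_pos (g : C.Arr) : 0 < jac C.src g :=
  jac_pos_of_holomorphic (C.holo_src g) (C.etale_src.isInvertible_manifoldDeriv g)

lemma jac_tgt_pos (g : C.Arr) : 0 < jac C.tgt g :=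
  jac_pos_of_holomorphic (C.holo_tgt g) (C.etale_tgt.isInvertible_manifoldDeriv g)

lemma jac_tgt_inv_div (g : C.Arr) :
    jac C.tgt (C.inv g) / jac C.src (C.inv g) = jac C.src g / jac C.tgt g := by
  have hi : MDifferentiableAt 𝓘(ℝ, ℂ) 𝓘(ℝ, ℂ) C.inv g :=
    C.smooth_inv.mdifferentiableAt (by simp)
  have h1 : jac C.tgt g = jac C.src (C.inv g) * jac C.inv g := by
    rw [← jac_comp g (C.mdifferentiable_src _) hi]
    exact jac_congr (Filter.Eventually.of_forall fun y => (C.src_inv y).symm)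
  have h2 : jac C.src g = jac C.tgt (C.inv g) * jac C.inv g := by
    rw [← jac_comp g (C.mdifferentiable_tgt _) hi]
    exact jac_congr (Filter.Eventually.of_forall fun y => (C.tgt_inv y).symm)
  have h3 := C.jac_tgt_pos g
  have h4 : jac C.inv g ≠ 0 := fun h => by rw [h1, h, mul_zero] at h3; exact lt_irrefl _ h3
  rw [h1, h2, mul_div_mul_right _ _ h4]

variable {C}

/-- The integral of a function over a chart, unfolded over the orbits: each arrow transports the
function to the charts of a partition of unity. -/
theorem Partition.integral_chart_eq (P : C.Partition) {e : OpenPartialHomeomorph C.Obj ℂ}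
    (he : IsOrientedChart e) {w : C.Obj → ℝ} (hw : Continuous w) (hwc : HasCompactSupport w)
    (hws : tsupport w ⊆ e.source) :
    (∀ j, IntegrableOn (fun q => jac (P.chart j).symm q * (P.weight j ((P.chart j).symm q) *
      fiberSum C.src (fun g => w (C.tgt g) * jac e (C.tgt g) * (jac C.tgt g / jac C.src g))
        ((P.chart j).symm q))) (P.chart j).target) ∧
    ∫ p in e.target, w (e.symm p) = ∑ j, ∫ q in (P.chart j).target,
      jac (P.chart j).symm q * (P.weight j ((P.chart j).symm q) *
      fiberSum C.src (fun g => w (C.tgt g) * jac e (C.tgt g) * (jac C.tgt g / jac C.src g))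
        ((P.chart j).symm q)) := by
  -- The function on the arrows that spreads `w` over the supports of the weights.
  let F : Fin P.n → C.Arr → ℝ := fun j g => w (C.src g) * P.weight j (C.tgt g)
  have hF : ∀ j, Continuous (F j) := fun j =>
    (hw.comp C.continuous_src).mul ((P.smooth j).continuous.comp C.continuous_tgt)
  have hFK : ∀ j, tsupport (F j) ⊆ {g | C.src g ∈ tsupport w ∧ C.tgt g ∈ tsupport (P.weight j)} :=
    fun j => by
      refine closure_minimal (fun g hg => ?_) ?_
      · exact ⟨subset_tsupport _ (left_ne_zero_of_mul hg),
          subset_tsupport _ (right_ne_zero_of_mul hg)⟩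
      · exact ((isClosed_tsupport w).preimage C.continuous_src).inter
          ((isClosed_tsupport _).preimage C.continuous_tgt)
  have hFc : ∀ j, HasCompactSupport (F j) := fun j =>
    (C.isCompact_src_tgt hwc (P.compact j)).of_isClosed_subset (isClosed_tsupport _) (hFK j)
  have key := fun j => integral_fiberSum_eq C.etale_src C.etale_tgt C.jac_src_pos C.jac_tgt_pos
    he (C.isOrientedChart (P.chart_mem j)) (hF j) (hFc j) (fun g hg => hws (hFK j hg).1)
    (fun g hg => P.support j (hFK j hg).2)
  have hright : ∀ j q, jac (P.chart j).symm q * fiberSum C.tgt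
      (fun g => F j g * (jac e (C.src g) * jac C.src g / jac C.tgt g)) ((P.chart j).symm q) =
      jac (P.chart j).symm q * (P.weight j ((P.chart j).symm q) *
      fiberSum C.src (fun g => w (C.tgt g) * jac e (C.tgt g) * (jac C.tgt g / jac C.src g))
        ((P.chart j).symm q)) := fun j q => by
    congr 1
    rw [C.fiberSum_src_eq_fiberSum_tgt_inv, fiberSum, fiberSum, mul_finsum]
    refine finsum_congr fun g => ?_
    simp only [F]
    rw [C.jac_tgt_inv_div, C.tgt_inv, g.2]
    ring
  have hleft : ∀ p, w (e.symm p) = ∑ j, fiberSum C.src (F j) (e.symm p) := fun p => by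
    have h1 : ∀ j, fiberSum C.src (F j) (e.symm p) =
        w (e.symm p) * ∑ᶠ g : {g : C.Arr // C.src g = e.symm p}, P.weight j (C.tgt g.1) := fun j => by
      rw [fiberSum, mul_finsum]
      exact finsum_congr fun g => by simp only [F, g.2]
    simp_rw [h1]
    rw [← Finset.mul_sum, P.sum_eq_one, mul_one]
  refine ⟨fun j => (key j).2.1.congr (Filter.Eventually.of_forall (hright j)), ?_⟩
  rw [show (fun p => w (e.symm p)) = _ from funext hleft,
    integral_finsetSum _ fun j _ => (key j).1]
  refine Finset.sum_congr rfl fun j _ => ?_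
  rw [(key j).2.2]
  exact integral_congr_ae (Filter.Eventually.of_forall (hright j))

/-- The integral of a form does not change when it is replaced by finitely many forms with supports
in charts that have the same sum over the orbits. -/
theorem Partition.integral_eq_sum (P : C.Partition) {ι : Type*} [Fintype ι]
    {e : ι → OpenPartialHomeomorph C.Obj ℂ} (he : ∀ i, IsOrientedChart (e i))
    {ζ : ι → DForm ℂ C.Obj 2} {K : ι → Set C.Obj} (hK : ∀ i, IsCompact (K i))
    (hKe : ∀ i, K i ⊆ (e i).source) (hζK : ∀ i x, x ∉ K i → ζ i x = 0)
    (hζc : ∀ i, ContinuousOn (fun p => (ζ i).inChart (e i) p ![1, Complex.I]) (e i).target)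
    {ξ : DForm ℂ C.Obj 2}
    (hav : ∀ x, fiberSum C.src (fun g => ∑ i, ζ i (C.tgt g) ![1, Complex.I] *
      (jac C.tgt g / jac C.src g)) x = ξ x ![1, Complex.I]) :
    P.integral ξ = ∑ i, ∫ p in (e i).target, (ζ i).inChart (e i) p ![1, Complex.I] := by
  classical
  have hin : ∀ (ζ : DForm ℂ C.Obj 2) (e : OpenPartialHomeomorph C.Obj ℂ) (p : ℂ),
      ζ.inChart e p ![1, Complex.I] = jac e.symm p * ζ (e.symm p) ![1, Complex.I] := fun ζ e p =>
    alternating_comp_apply _ _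
  -- The coefficient of `ζ i` in the chart `e i`, extended by zero.
  let w : ι → C.Obj → ℝ := fun i x =>
    if x ∈ (e i).source then (ζ i).inChart (e i) (e i x) ![1, Complex.I] else 0
  have hwK : ∀ i x, x ∉ K i → w i x = 0 := fun i x hx => by
    simp only [w]
    split_ifs with h
    · rw [hin, (e i).left_inv h, hζK i x hx]
      simp
    · rfl
  have hw : ∀ i, Continuous (w i) := fun i => by
    rw [continuous_iff_continuousAt]
    intro x
    by_cases hx : x ∈ (e i).source
    · have h1 : ContinuousOn (fun x => (ζ i).inChart (e i) (e i x) ![1, Complex.I]) (e i).source :=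
        (hζc i).comp (e i).continuousOn (e i).mapsTo
      refine (h1.continuousAt ((e i).open_source.mem_nhds hx)).congr ?_
      filter_upwards [(e i).open_source.mem_nhds hx] with y hy
      simp only [w, if_pos hy]
    · have hxK : x ∈ (K i)ᶜ := fun h => hx (hKe i h)
      refine (continuousAt_const (y := (0 : ℝ))).congr ?_
      filter_upwards [(hK i).isClosed.isOpen_compl.mem_nhds hxK] with y hy using (hwK i y hy).symm
  have hwt : ∀ i, tsupport (w i) ⊆ K i := fun i =>
    closure_minimal (fun x hx => by by_contra h; exact hx (hwK i x h)) (hK i).isClosed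
  have hwc : ∀ i, HasCompactSupport (w i) := fun i =>
    (hK i).of_isClosed_subset (isClosed_tsupport _) (hwt i)
  have key := fun i => P.integral_chart_eq (he i) (hw i) (hwc i) ((hwt i).trans (hKe i))
  have hleft : ∀ i, ∫ p in (e i).target, (ζ i).inChart (e i) p ![1, Complex.I] =
      ∫ p in (e i).target, w i ((e i).symm p) := fun i =>
    setIntegral_congr_fun (e i).open_target.measurableSet fun p hp => by
      simp only [w, if_pos ((e i).map_target hp), (e i).right_inv hp]
  have hwj : ∀ i x, w i x * jac (e i) x = ζ i x ![1, Complex.I] := fun i x => by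
    by_cases hx : x ∈ K i
    · have hs := hKe i hx
      have h1 := (he i).smooth.jac_mul_jac_symm ((e i).map_source hs)
      rw [(e i).left_inv hs] at h1
      simp only [w, if_pos hs]
      rw [hin, (e i).left_inv hs]
      linear_combination (ζ i x ![1, Complex.I]) * h1
    · rw [hwK i x hx, hζK i x hx, zero_mul]
      simp
  have hav' : ∀ x, ∑ i, fiberSum C.src (fun g => w i (C.tgt g) * jac (e i) (C.tgt g) *
      (jac C.tgt g / jac C.src g)) x = ξ x ![1, Complex.I] := fun x => by
    rw [← hav x]
    have hKc : IsCompact (⋃ i ∈ Finset.univ, K i) := Finset.univ.isCompact_biUnion fun i _ => hK i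
    have hf : (C.src ⁻¹' {x} ∩ C.tgt ⁻¹' (⋃ i ∈ Finset.univ, K i)).Finite := C.finite_src_tgt x hKc
    rw [← fiberSum_sum hf]
    · simp only [hwj]
    · intro i hi g hg
      refine mem_biUnion hi ?_
      by_contra h
      rw [hwK i _ h] at hg
      simp at hg
  simp_rw [hleft, fun i => (key i).2]
  rw [Finset.sum_comm, Partition.integral]
  refine Finset.sum_congr rfl fun j _ => ?_
  rw [← integral_finsetSum _ fun i _ => (key i).1 j]
  refine integral_congr_ae (Filter.Eventually.of_forall fun q => ?_)
  simp only
  rw [← Finset.mul_sum, ← Finset.mul_sum, hav', hin]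
  ring

end ComplexOrbifoldGroupoid

/-! ### Existence of orbifold partitions of unity -/

namespace OrbifoldGroupoid

variable {E : Type*} [NormedAddCommGroup E] [NormedSpace ℝ E] (G : OrbifoldGroupoid E)

lemma orbit_eq_iff {x y : G.Obj} : G.orbit x = G.orbit y ↔ ∃ g, G.src g = x ∧ G.tgt g = y :=
  Quotient.eq (r := G.orbitSetoid)

lemma isOpenMap_orbit : IsOpenMap G.orbit := by
  intro U hU
  have hq : Topology.IsQuotientMap G.orbit := isQuotientMap_quot_mk
  rw [← hq.isOpen_preimage]
  have : G.orbit ⁻¹' (G.orbit '' U) = G.tgt '' (G.src ⁻¹' U) := by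
    ext y
    constructor
    · rintro ⟨x, hx, hxy⟩
      obtain ⟨g, rfl, rfl⟩ := G.orbit_eq_iff.1 hxy
      exact ⟨g, hx, rfl⟩
    · rintro ⟨g, hg, rfl⟩
      exact ⟨G.src g, hg, G.orbit_eq_iff.2 ⟨g, rfl, rfl⟩⟩
  rw [this]
  exact G.etale_tgt.isOpenMap _ (hU.preimage G.continuous_src)

lemma orbitSum_nonneg {v : G.Obj → ℝ} (hv : ∀ x, 0 ≤ v x) (x : G.Obj) : 0 ≤ G.orbitSum v x :=
  finsum_nonneg fun _ => hv _

/-- The sum of a nonnegative function over an orbit is positive if one of its terms is. -/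
lemma orbitSum_pos {v : G.Obj → ℝ} (hv : ∀ x, 0 ≤ v x) (hc : HasCompactSupport v) {g : G.Arr}
    (hg : 0 < v (G.tgt g)) : 0 < G.orbitSum v (G.src g) := by
  refine finsum_pos (fun _ => hv _) ⟨⟨g, rfl⟩, hg⟩ ?_
  have hf : (G.src ⁻¹' {G.src g} ∩ G.tgt ⁻¹' tsupport v).Finite := G.finite_src_tgt _ hc
  exact finite_support_fiber hf fun h hh => subset_tsupport _ hh

end OrbifoldGroupoid

namespace ComplexOrbifoldGroupoid

/-- An orbifold groupoid of complex dimension one with compact orbit space has a partition of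
unity: finitely many bump functions, divided by their sum over the orbits. -/
theorem nonempty_partition (C : ComplexOrbifoldGroupoid) [CompactSpace C.Orbit] :
    Nonempty C.Partition := by
  have hb : ∀ x : C.Obj, ∃ f : C.Obj → ℝ, ContMDiff 𝓘(ℝ, ℂ) 𝓘(ℝ, ℝ) ∞ f ∧ HasCompactSupport f ∧
      tsupport f ⊆ (chartAt ℂ x).source ∧ (∀ y, 0 ≤ f y) ∧ 0 < f x := fun x => by
    obtain ⟨f⟩ : Nonempty (SmoothBumpFunction 𝓘(ℝ, ℂ) x) := inferInstance
    exact ⟨f, f.contMDiff, f.hasCompactSupport, f.tsupport_subset_chartAt_source,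
      fun y => f.nonneg, by rw [f.eq_one]; exact one_pos⟩
  choose f hf hfc hfs hf0 hfx using hb
  have hop : ∀ x, IsOpen (C.orbit '' {y | 0 < f x y}) := fun x =>
    C.isOpenMap_orbit _ (isOpen_lt continuous_const (hf x).continuous)
  obtain ⟨t, ht⟩ := (isCompact_univ (X := C.Orbit)).elim_finite_subcover
    (fun x => C.orbit '' {y | 0 < f x y}) hop (fun y _ => by
      obtain ⟨x, rfl⟩ := Quotient.exists_rep y
      exact mem_iUnion.2 ⟨x, x, hfx x, rfl⟩)
  let p : Fin t.card → C.Obj := fun j => (t.equivFin.symm j).1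
  let h : C.Obj → ℝ := fun x => ∑ j, C.orbitSum (f (p j)) x
  have hsm : ContMDiff 𝓘(ℝ, ℂ) 𝓘(ℝ, ℝ) ∞ h := by
    have := contMDiff_finsetSum (t := Finset.univ) (I' := 𝓘(ℝ, ℂ)) (I := 𝓘(ℝ, ℝ)) (n := ∞)
      (f := fun j => C.orbitSum (f (p j)))
      fun j _ => C.contMDiff_orbitSum (hf (p j)) (hfc (p j))
    exact this
  have hpos : ∀ x, 0 < h x := fun x => by
    obtain ⟨z, hz, y, hy, hyx⟩ := mem_iUnion₂.1 (ht (mem_univ (C.orbit x)))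
    obtain ⟨g, rfl, rfl⟩ := C.orbit_eq_iff.1 hyx.symm
    refine Finset.sum_pos' (fun j _ => C.orbitSum_nonneg (hf0 _) _)
      ⟨t.equivFin ⟨z, hz⟩, Finset.mem_univ _, ?_⟩
    have hpz : p (t.equivFin ⟨z, hz⟩) = z := by simp [p]
    rw [hpz]
    exact C.orbitSum_pos (hf0 z) (hfc z) hy
  have hinv : ∀ g, (h (C.src g))⁻¹ = (h (C.tgt g))⁻¹ := fun g => by
    simp only [h, C.orbitSum_src_eq_tgt]
  refine ⟨{
    n := t.card
    chart := fun j => chartAt ℂ (p j)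
    chart_mem := fun j => chart_mem_atlas ℂ (p j)
    weight := fun j x => f (p j) x * (h x)⁻¹
    smooth := fun j => (hf _).mul (hsm.inv₀ fun x => (hpos x).ne')
    compact := fun j => (hfc _).mul_right
    support := fun j => tsupport_mul_subset_left.trans (hfs _)
    sum_eq_one := fun x => ?_ }⟩
  have h1 := fun j => C.orbitSum_mul_of_invariant (c := fun x => (h x)⁻¹) hinv (f (p j)) x
  simp only [OrbifoldGroupoid.orbitSum, fiberSum] at h1
  simp_rw [h1]
  rw [← Finset.sum_mul]
  exact mul_inv_cancel₀ (hpos x).ne'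

end ComplexOrbifoldGroupoid

/-! ### The derivative of an arrow -/

namespace OrbifoldGroupoid

variable {E : Type*} [NormedAddCommGroup E] [NormedSpace ℝ E] (G : OrbifoldGroupoid E)

/-- The derivative of the germ of a diffeomorphism, from the source to the target of `g`, that is
defined by the arrow `g`. -/
noncomputable def arrowDeriv (g : G.Arr) : E →L[ℝ] E :=
  (manifoldDeriv E E G.tgt g).comp (manifoldDeriv E E G.src g).inverse

lemma isInvertible_src (g : G.Arr) : (manifoldDeriv E E G.src g).IsInvertible :=
  G.etale_src.isInvertible_manifoldDeriv g

lemma isInvertible_tgt (g : G.Arr) : (manifoldDeriv E E G.tgt g).IsInvertible :=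
  G.etale_tgt.isInvertible_manifoldDeriv g

lemma arrowDeriv_comp_deriv_src (g : G.Arr) :
    (G.arrowDeriv g).comp (manifoldDeriv E E G.src g) = manifoldDeriv E E G.tgt g := by
  rw [arrowDeriv, ContinuousLinearMap.comp_assoc, (G.isInvertible_src g).inverse_comp_self,
    ContinuousLinearMap.comp_id]

/-- A continuous local section of the source map is smooth, and computes `arrowDeriv`. -/
lemma arrowDeriv_eq_of_section {σ : G.Obj → G.Arr} {x : G.Obj} (hσ : ContinuousAt σ x)
    (h : ∀ᶠ y in 𝓝 x, G.src (σ y) = y) :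
    MDifferentiableAt 𝓘(ℝ, E) 𝓘(ℝ, E) σ x ∧
      manifoldDeriv E E (fun y => G.tgt (σ y)) x = G.arrowDeriv (σ x) := by
  obtain ⟨Φ, hΦx, hΦ, hΦs⟩ := G.etale_src.exists_isSmoothHomeo (σ x)
  have hx : G.src (σ x) = x := h.self_of_nhds
  have hev : σ =ᶠ[𝓝 x] Φ.symm := by
    filter_upwards [hσ.eventually (Φ.open_source.mem_nhds hΦx), h] with y hy hy'
    rw [← Φ.left_inv hy, hΦs _ hy, hy']
  have hxt : x ∈ Φ.target := by
    have := Φ.map_source hΦx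
    rwa [hΦs _ hΦx, hx] at this
  have hd : MDifferentiableAt 𝓘(ℝ, E) 𝓘(ℝ, E) σ x :=
    (hΦ.symm.mdifferentiableAt hxt).congr_of_eventuallyEq hev
  refine ⟨hd, ?_⟩
  have h1 : (manifoldDeriv E E G.src (σ x)).comp (manifoldDeriv E E σ x) =
      ContinuousLinearMap.id ℝ E := by
    rw [← manifoldDeriv_comp x (G.mdifferentiable_src _) hd, ← manifoldDeriv_id x]
    exact manifoldDeriv_congr h
  have h2 : manifoldDeriv E E σ x = (manifoldDeriv E E G.src (σ x)).inverse := by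
    rw [← ContinuousLinearMap.comp_id (manifoldDeriv E E G.src (σ x)).inverse, ← h1,
      ← ContinuousLinearMap.comp_assoc, (G.isInvertible_src _).inverse_comp_self,
      ContinuousLinearMap.id_comp]
  rw [manifoldDeriv_comp x (G.mdifferentiable_tgt _) hd, h2, arrowDeriv]

lemma exists_section (g : G.Arr) : ∃ σ : G.Obj → G.Arr, ContinuousAt σ (G.src g) ∧
    (∀ᶠ y in 𝓝 (G.src g), G.src (σ y) = y) ∧ σ (G.src g) = g := by
  obtain ⟨Φ, hΦx, hΦ, hΦs⟩ := G.etale_src.exists_isSmoothHomeo g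
  have hxt := Φ.map_source hΦx
  rw [hΦs _ hΦx] at hxt
  refine ⟨Φ.symm, Φ.continuousAt_symm hxt, ?_, ?_⟩
  · filter_upwards [Φ.open_target.mem_nhds hxt] with y hy
    rw [← hΦs _ (Φ.map_target hy), Φ.right_inv hy]
  · rw [← hΦs _ hΦx, Φ.left_inv hΦx]

lemma arrowDeriv_unit (x : G.Obj) : G.arrowDeriv (G.unit x) = ContinuousLinearMap.id ℝ E := by
  rw [← (G.arrowDeriv_eq_of_section (σ := G.unit) G.smooth_unit.continuous.continuousAt
    (Filter.Eventually.of_forall G.src_unit)).2, ← manifoldDeriv_id x]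
  exact manifoldDeriv_congr (Filter.Eventually.of_forall G.tgt_unit)

lemma arrowDeriv_comp {g h : G.Arr} (hgh : G.tgt g = G.src h) :
    G.arrowDeriv (G.comp g h) = (G.arrowDeriv h).comp (G.arrowDeriv g) := by
  obtain ⟨σ, hσ, hσs, hσg⟩ := G.exists_section g
  obtain ⟨τ, hτ, hτs, hτh⟩ := G.exists_section h
  have ht : ContinuousAt (fun y => G.tgt (σ y)) (G.src g) :=
    G.continuous_tgt.continuousAt.comp hσ
  have htx : G.tgt (σ (G.src g)) = G.src h := by rw [hσg, hgh]
  have hτ' : ContinuousAt (fun y => τ (G.tgt (σ y))) (G.src g) :=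
    ContinuousAt.comp (g := τ) (by rw [htx]; exact hτ) ht
  have hτs₁ : ∀ᶠ z in 𝓝 (G.tgt (σ (G.src g))), G.src (τ z) = z := by rw [htx]; exact hτs
  have hτs' : ∀ᶠ y in 𝓝 (G.src g), G.src (τ (G.tgt (σ y))) = G.tgt (σ y) := ht.eventually hτs₁
  have hc : ContinuousAt (fun y => G.comp (σ y) (τ (G.tgt (σ y)))) (G.src g) := by
    have hx : (σ (G.src g), τ (G.tgt (σ (G.src g)))) ∈
        {p : G.Arr × G.Arr | G.tgt p.1 = G.src p.2} := hτs'.self_of_nhds.symm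
    have h1 := G.continuousOn_comp _ hx
    have h2 : Filter.Tendsto (fun y => (σ y, τ (G.tgt (σ y)))) (𝓝 (G.src g))
        (𝓝[{p : G.Arr × G.Arr | G.tgt p.1 = G.src p.2}] (σ (G.src g), τ (G.tgt (σ (G.src g))))) :=
      tendsto_nhdsWithin_iff.2 ⟨hσ.prodMk hτ', hτs'.mono fun y hy => hy.symm⟩
    exact Filter.Tendsto.comp h1 h2
  have hs : ∀ᶠ y in 𝓝 (G.src g), G.src (G.comp (σ y) (τ (G.tgt (σ y)))) = y := by
    filter_upwards [hσs, hτs'] with y hy hy'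
    rw [G.src_comp _ _ hy'.symm, hy]
  have h1 := (G.arrowDeriv_eq_of_section hc hs).2
  obtain ⟨hσd, h2⟩ := G.arrowDeriv_eq_of_section hσ hσs
  obtain ⟨hτd, h4⟩ := G.arrowDeriv_eq_of_section hτ hτs
  rw [htx, hσg, hτh] at h1
  rw [hσg] at h2
  rw [hτh] at h4
  rw [← h1, ← h2, ← h4]
  have hm : MDifferentiableAt 𝓘(ℝ, E) 𝓘(ℝ, E) (fun y => G.tgt (τ y)) (G.tgt (σ (G.src g))) := by
    rw [htx]; exact (G.mdifferentiable_tgt _).comp _ hτd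
  have h3 := manifoldDeriv_comp (G.src g) (f := fun y => G.tgt (σ y)) (g := fun y => G.tgt (τ y))
    hm ((G.mdifferentiable_tgt _).comp _ hσd)
  rw [htx] at h3
  rw [← h3]
  refine manifoldDeriv_congr ?_
  filter_upwards [hτs'] with y hy
  rw [G.tgt_comp _ _ hy.symm]

lemma arrowDeriv_inv_comp (g : G.Arr) :
    (G.arrowDeriv (G.inv g)).comp (G.arrowDeriv g) = ContinuousLinearMap.id ℝ E := by
  rw [← G.arrowDeriv_comp (G.src_inv g).symm, G.comp_inv, G.arrowDeriv_unit]

lemma arrowDeriv_comp_inv (g : G.Arr) :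
    (G.arrowDeriv g).comp (G.arrowDeriv (G.inv g)) = ContinuousLinearMap.id ℝ E := by
  rw [← G.arrowDeriv_comp (G.tgt_inv g), G.inv_comp, G.arrowDeriv_unit]

lemma arrowDeriv_inv (g : G.Arr) : G.arrowDeriv (G.inv g) =
    (manifoldDeriv E E G.src g).comp (manifoldDeriv E E G.tgt g).inverse := by
  have h1 : (G.arrowDeriv (G.inv g)).comp (manifoldDeriv E E G.tgt g) =
      manifoldDeriv E E G.src g := by
    rw [← G.arrowDeriv_comp_deriv_src g, ← ContinuousLinearMap.comp_assoc, G.arrowDeriv_inv_comp,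
      ContinuousLinearMap.id_comp]
  rw [← h1, ContinuousLinearMap.comp_assoc, (G.isInvertible_tgt g).self_comp_inverse,
    ContinuousLinearMap.comp_id]

lemma IsInvariantFormOn.comp_arrowDeriv {G : OrbifoldGroupoid E} {k : ℕ} {η : DForm E G.Obj k}
    {W : Set G.Obj} (h : G.IsInvariantFormOn η W) {g : G.Arr} (hg : G.src g ∈ W) :
    (η (G.tgt g)).compContinuousLinearMap (G.arrowDeriv g) = η (G.src g) := by
  have h1 := h g hg
  simp only [DForm.pullback] at h1
  ext v
  have h2 := DFunLike.congr_fun h1 (fun i => (manifoldDeriv E E G.src g).inverse (v i))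
  have h3 : ∀ w, manifoldDeriv E E G.src g ((manifoldDeriv E E G.src g).inverse w) = w := fun w =>
    DFunLike.congr_fun (G.isInvertible_src g).self_comp_inverse w
  simp only [ContinuousAlternatingMap.compContinuousLinearMap_apply, Function.comp_def, h3] at h2
  exact h2.symm

end OrbifoldGroupoid

section Hom

variable {E : Type*} [NormedAddCommGroup E] [NormedSpace ℝ E]
    {F : Type*} [NormedAddCommGroup F] [NormedSpace ℝ F]
    {H : OrbifoldGroupoid E} {G : OrbifoldGroupoid F}

lemma GroupoidHom.mdifferentiableAt_obj (f : GroupoidHom H G) (x : H.Obj) :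
    MDifferentiableAt 𝓘(ℝ, E) 𝓘(ℝ, F) f.obj x := f.smooth_obj.mdifferentiableAt (by simp)

/-- A homomorphism commutes with the germs defined by the arrows. -/
lemma GroupoidHom.arrowDeriv_comp_deriv (f : GroupoidHom H G) (κ : H.Arr) :
    (G.arrowDeriv (f.arr κ)).comp (manifoldDeriv E F f.obj (H.src κ)) =
      (manifoldDeriv E F f.obj (H.tgt κ)).comp (H.arrowDeriv κ) := by
  have ha : MDifferentiableAt 𝓘(ℝ, E) 𝓘(ℝ, F) f.arr κ := f.smooth_arr.mdifferentiableAt (by simp)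
  have h1 : (manifoldDeriv F F G.src (f.arr κ)).comp (manifoldDeriv E F f.arr κ) =
      (manifoldDeriv E F f.obj (H.src κ)).comp (manifoldDeriv E E H.src κ) := by
    rw [← manifoldDeriv_comp κ (G.mdifferentiable_src _) ha,
      ← manifoldDeriv_comp κ (f.mdifferentiableAt_obj _) (H.mdifferentiable_src _)]
    exact manifoldDeriv_congr (Filter.Eventually.of_forall f.src_arr)
  have h2 : (manifoldDeriv F F G.tgt (f.arr κ)).comp (manifoldDeriv E F f.arr κ) =
      (manifoldDeriv E F f.obj (H.tgt κ)).comp (manifoldDeriv E E H.tgt κ) := by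
    rw [← manifoldDeriv_comp κ (G.mdifferentiable_tgt _) ha,
      ← manifoldDeriv_comp κ (f.mdifferentiableAt_obj _) (H.mdifferentiable_tgt _)]
    exact manifoldDeriv_congr (Filter.Eventually.of_forall f.tgt_arr)
  have h3 : ((G.arrowDeriv (f.arr κ)).comp (manifoldDeriv E F f.obj (H.src κ))).comp
      (manifoldDeriv E E H.src κ) =
      ((manifoldDeriv E F f.obj (H.tgt κ)).comp (H.arrowDeriv κ)).comp
        (manifoldDeriv E E H.src κ) := by
    rw [ContinuousLinearMap.comp_assoc, ← h1, ← ContinuousLinearMap.comp_assoc,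
      G.arrowDeriv_comp_deriv_src, h2, ContinuousLinearMap.comp_assoc _ (H.arrowDeriv κ),
      H.arrowDeriv_comp_deriv_src]
  have h4 := congrArg (fun A => A.comp (manifoldDeriv E E H.src κ).inverse) h3
  simpa only [ContinuousLinearMap.comp_assoc, (H.isInvertible_src κ).self_comp_inverse,
    ContinuousLinearMap.comp_id] using h4

end Hom

/-! ### Pull-back by an orbifold morphism -/

namespace HolomorphicOrbimorphism

variable {C : Orbicurve} {E : Type*} [NormedAddCommGroup E] [NormedSpace ℝ E]
  {G : OrbifoldGroupoid E} {J : AlmostComplexStructure G} (f : HolomorphicOrbimorphism C J)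

lemma isInvertible_eps (k : f.K.Obj) : (manifoldDeriv ℂ ℂ f.eps.obj k).IsInvertible :=
  f.eps_equiv.etale.isInvertible_manifoldDeriv k

/-- The derivative at `tgt a` of the local lift of `f` that is defined by the object `k` of `K` and
the arrow `a` from `eps k`. -/
noncomputable def liftDeriv (k : f.K.Obj) (a : C.norm.Arr) : ℂ →L[ℝ] E :=
  (manifoldDeriv ℂ E f.phi.obj k).comp
    ((manifoldDeriv ℂ ℂ f.eps.obj k).inverse.comp (C.norm.arrowDeriv (C.norm.inv a)))

/-- Two local lifts of `f` at points of the same orbit differ by an arrow of `G`. -/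
lemma exists_arrow_comp_liftDeriv {k k' : f.K.Obj} {a a' g : C.norm.Arr}
    (ha : C.norm.src a = f.eps.obj k) (ha' : C.norm.src a' = f.eps.obj k')
    (hg : C.norm.src g = C.norm.tgt a) (hg' : C.norm.tgt g = C.norm.tgt a') :
    ∃ γ : G.Arr, G.src γ = f.phi.obj k ∧ G.tgt γ = f.phi.obj k' ∧
      (G.arrowDeriv γ).comp (f.liftDeriv k a) =
        (f.liftDeriv k' a').comp (C.norm.arrowDeriv g) := by
  have h1 : C.norm.tgt (C.norm.comp a g) = C.norm.src (C.norm.inv a') := by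
    rw [C.norm.tgt_comp _ _ hg.symm, C.norm.src_inv, hg']
  obtain ⟨κ, ⟨hκs, hκt, hκ⟩, -⟩ := f.eps_equiv.full_faithful k k'
    (C.norm.comp (C.norm.comp a g) (C.norm.inv a'))
    (by rw [C.norm.src_comp _ _ h1, C.norm.src_comp _ _ hg.symm, ha])
    (by rw [C.norm.tgt_comp _ _ h1, C.norm.tgt_inv, ha'])
  refine ⟨f.phi.arr κ, by rw [f.phi.src_arr, hκs], by rw [f.phi.tgt_arr, hκt], ?_⟩
  have h2 := f.phi.arrowDeriv_comp_deriv κ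
  have h3 := f.eps.arrowDeriv_comp_deriv κ
  rw [hκs, hκt] at h2 h3
  rw [hκ, C.norm.arrowDeriv_comp h1, C.norm.arrowDeriv_comp hg.symm] at h3
  have h4 : (f.K.arrowDeriv κ).comp (manifoldDeriv ℂ ℂ f.eps.obj k).inverse =
      (manifoldDeriv ℂ ℂ f.eps.obj k').inverse.comp ((C.norm.arrowDeriv (C.norm.inv a')).comp
        ((C.norm.arrowDeriv g).comp (C.norm.arrowDeriv a))) := by
    have h5 := congrArg (fun A => (manifoldDeriv ℂ ℂ f.eps.obj k').inverse.comp
      (A.comp (manifoldDeriv ℂ ℂ f.eps.obj k).inverse)) h3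
    simp only [ContinuousLinearMap.comp_assoc, (f.isInvertible_eps k).self_comp_inverse,
      ContinuousLinearMap.comp_id] at h5
    rw [h5, ← ContinuousLinearMap.comp_assoc, (f.isInvertible_eps k').inverse_comp_self,
      ContinuousLinearMap.id_comp]
  simp only [liftDeriv]
  rw [← ContinuousLinearMap.comp_assoc, h2, ContinuousLinearMap.comp_assoc,
    ← ContinuousLinearMap.comp_assoc (f.K.arrowDeriv κ), h4]
  simp only [ContinuousLinearMap.comp_assoc, C.norm.arrowDeriv_comp_inv,
    ContinuousLinearMap.comp_id]

/-- The pull-back of an invariant form may be computed with any object `k` of `K` and any arrow `a`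
from `eps k`, whichever choice its definition makes. -/
lemma pullback_eq_liftDeriv {n : ℕ} {η : DForm E G.Obj n} {W : Set G.Obj}
    (hη : G.IsInvariantFormOn η W) {k : f.K.Obj} {a : C.norm.Arr}
    (ha : C.norm.src a = f.eps.obj k) (hk : f.phi.obj k ∈ W) :
    f.pullback η (C.norm.tgt a) = (η (f.phi.obj k)).compContinuousLinearMap (f.liftDeriv k a) := by
  obtain ⟨hp1, hp2⟩ := (f.eps_equiv.ess_surj (C.norm.tgt a)).choose_spec
  obtain ⟨γ, hγs, hγt, hγ⟩ := f.exists_arrow_comp_liftDeriv ha hp1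
    (C.norm.src_unit (C.norm.tgt a)) ((C.norm.tgt_unit _).trans hp2.symm)
  rw [C.norm.arrowDeriv_unit, ContinuousLinearMap.comp_id] at hγ
  have h1 := hη.comp_arrowDeriv (g := γ) (by rw [hγs]; exact hk)
  rw [hγs, hγt] at h1
  rw [← h1]
  simp only [pullback]
  rw [← C.norm.arrowDeriv_inv]
  change (η _).compContinuousLinearMap (f.liftDeriv _ _) = _
  rw [← hγ]
  rfl

/-- The pull-back of an invariant form is invariant. -/
lemma pullback_comp_arrowDeriv {n : ℕ} {η : DForm E G.Obj n} {W : Set G.Obj}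
    (hη : G.IsInvariantFormOn η W) {k : f.K.Obj} {a g : C.norm.Arr}
    (ha : C.norm.src a = f.eps.obj k) (hk : f.phi.obj k ∈ W) (hg : C.norm.src g = C.norm.tgt a) :
    (f.pullback η (C.norm.tgt g)).compContinuousLinearMap (C.norm.arrowDeriv g) =
      f.pullback η (C.norm.src g) := by
  have h1 : C.norm.src (C.norm.comp a g) = f.eps.obj k := by rw [C.norm.src_comp _ _ hg.symm, ha]
  have h2 := f.pullback_eq_liftDeriv hη h1 hk
  rw [C.norm.tgt_comp _ _ hg.symm] at h2
  have hi : C.norm.arrowDeriv (C.norm.inv (C.norm.comp a g)) =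
      (C.norm.arrowDeriv (C.norm.inv a)).comp (C.norm.arrowDeriv (C.norm.inv g)) := by
    have h3 := C.norm.arrowDeriv_inv_comp (C.norm.comp a g)
    rw [C.norm.arrowDeriv_comp hg.symm] at h3
    have h4 := congrArg (fun A => A.comp ((C.norm.arrowDeriv (C.norm.inv a)).comp
      (C.norm.arrowDeriv (C.norm.inv g)))) h3
    simp only [ContinuousLinearMap.comp_assoc, ContinuousLinearMap.id_comp] at h4
    rw [← ContinuousLinearMap.comp_assoc (C.norm.arrowDeriv a), C.norm.arrowDeriv_comp_inv,
      ContinuousLinearMap.id_comp, C.norm.arrowDeriv_comp_inv, ContinuousLinearMap.comp_id] at h4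
    exact h4
  rw [h2, hg, f.pullback_eq_liftDeriv hη ha hk]
  have h5 : (f.liftDeriv k (C.norm.comp a g)).comp (C.norm.arrowDeriv g) = f.liftDeriv k a := by
    simp only [liftDeriv, hi, ContinuousLinearMap.comp_assoc, C.norm.arrowDeriv_inv_comp,
      ContinuousLinearMap.comp_id]
  rw [← h5]
  rfl

/-- Whether a lift of a point lies over an invariant set is independent of the lift. -/
lemma phi_mem_iff {Z : Set G.Obj} (hZ : G.IsInvariantSet Z) {k k' : f.K.Obj}
    (h : C.norm.orbit (f.eps.obj k) = C.norm.orbit (f.eps.obj k')) :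
    f.phi.obj k ∈ Z ↔ f.phi.obj k' ∈ Z := by
  obtain ⟨a, has, hat⟩ := C.norm.orbit_eq_iff.1 h
  obtain ⟨κ, ⟨hκs, hκt, -⟩, -⟩ := f.eps_equiv.full_faithful k k' a has hat
  rw [← hκs, ← hκt, ← f.phi.src_arr, ← f.phi.tgt_arr]
  exact hZ _

lemma phi_mem_iff_orbit_mem_preimage {Z : Set G.Obj} (hZ : G.IsInvariantSet Z) (k : f.K.Obj) :
    f.phi.obj k ∈ Z ↔ C.norm.orbit (f.eps.obj k) ∈ f.preimage Z :=
  ⟨fun h => ⟨k, rfl, h⟩, fun ⟨_, hk', h⟩ => (f.phi_mem_iff hZ hk').1 h⟩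

/-- The inverse `θ` of `eps`, near the target of the arrow `a₀` from `eps k₀`, composed with the
germ of diffeomorphism defined by `a₀`. The local lift of `f` is `phi ∘ θ`. -/
theorem exists_local_inverse {k₀ : f.K.Obj} {a₀ : C.norm.Arr}
    (ha₀ : C.norm.src a₀ = f.eps.obj k₀) :
    ∃ θ : OpenPartialHomeomorph C.norm.Obj f.K.Obj, IsSmoothHomeo (E := ℂ) (F := ℂ) θ ∧
      C.norm.tgt a₀ ∈ θ.source ∧ θ (C.norm.tgt a₀) = k₀ ∧
      (∀ x ∈ θ.source, 0 < jac θ x) ∧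
      (∀ x ∈ θ.source, C.norm.orbit (f.eps.obj (θ x)) = C.norm.orbit x) ∧
      ∀ (n : ℕ) (η : DForm E G.Obj n) (W : Set G.Obj), G.IsInvariantFormOn η W → ∀ x ∈ θ.source,
        f.phi.obj (θ x) ∈ W → f.pullback η x =
          (DForm.pullback (fun x => f.phi.obj (θ x)) η : DForm ℂ C.norm.Obj n) x := by
  obtain ⟨Φ, hΦa, hΦ, hΦs⟩ := C.norm.etale_src.exists_isSmoothHomeo a₀
  obtain ⟨Ψ, hΨa, hΨ, hΨt⟩ := C.norm.etale_tgt.exists_isSmoothHomeo a₀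
  obtain ⟨Ξ, hΞk, hΞ, hΞe⟩ := f.eps_equiv.etale.exists_isSmoothHomeo k₀
  have hΨa' : Ψ.symm (C.norm.tgt a₀) = a₀ := by rw [← hΨt _ hΨa, Ψ.left_inv hΨa]
  let θ := Ψ.symm.trans (Φ.trans Ξ.symm)
  have hθ : IsSmoothHomeo (E := ℂ) (F := ℂ) θ := hΨ.symm.trans (hΦ.trans hΞ.symm)
  have hθs : ∀ x, x ∈ θ.source ↔ x ∈ Ψ.target ∧ Ψ.symm x ∈ Φ.source ∧ Φ (Ψ.symm x) ∈ Ξ.target := by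
    intro x
    simp only [θ, OpenPartialHomeomorph.trans_source, OpenPartialHomeomorph.symm_source]
    rfl
  have hθv : ∀ x, θ x = Ξ.symm (Φ (Ψ.symm x)) := fun x => rfl
  have hbase : f.eps.obj k₀ ∈ Ξ.target := by
    have := Ξ.map_source hΞk
    rwa [hΞe _ hΞk] at this
  have hb : C.norm.tgt a₀ ∈ θ.source := by
    refine (hθs _).2 ⟨?_, ?_, ?_⟩
    · have := Ψ.map_source hΨa
      rwa [hΨt _ hΨa] at this
    · rwa [hΨa']
    · rwa [hΨa', hΦs _ hΦa, ha₀]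
  -- the arrow from `eps (θ x)` to `x`
  have harr : ∀ x ∈ θ.source, C.norm.src (Ψ.symm x) = f.eps.obj (θ x) ∧
      C.norm.tgt (Ψ.symm x) = x := fun x hx => by
    obtain ⟨h1, h2, h3⟩ := (hθs x).1 hx
    constructor
    · rw [hθv, ← hΞe _ (Ξ.map_target h3), Ξ.right_inv h3, hΦs _ h2]
    · rw [← hΨt _ (Ψ.map_target h1), Ψ.right_inv h1]
  -- The chain rule identifies the derivative of the composite `eps ∘ θ` with that of an arrow.
  have hD : ∀ x ∈ θ.source, (manifoldDeriv ℂ ℂ f.eps.obj (θ x)).comp (manifoldDeriv ℂ ℂ θ x) =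
      C.norm.arrowDeriv (C.norm.inv (Ψ.symm x)) := fun x hx => by
    obtain ⟨h1, h2, h3⟩ := (hθs x).1 hx
    rw [← manifoldDeriv_comp x (f.eps.mdifferentiableAt_obj _) (hθ.mdifferentiableAt hx)]
    have h4 : (fun y => f.eps.obj (θ y)) =ᶠ[𝓝 x] fun y => C.norm.src (Ψ.symm y) := by
      filter_upwards [θ.open_source.mem_nhds hx] with y hy using (harr y hy).1.symm
    rw [manifoldDeriv_congr h4, manifoldDeriv_comp x (C.norm.mdifferentiable_src _)
      (hΨ.symm.mdifferentiableAt h1), C.norm.arrowDeriv_inv]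
    have h5 := hΨ.inverse_deriv (Ψ.map_target h1)
    rw [Ψ.right_inv h1] at h5
    have h6 : manifoldDeriv ℂ ℂ Ψ (Ψ.symm x) = manifoldDeriv ℂ ℂ C.norm.tgt (Ψ.symm x) := by
      refine manifoldDeriv_congr ?_
      filter_upwards [Ψ.open_source.mem_nhds (Ψ.map_target h1)] with y hy using hΨt y hy
    rw [← h5, h6]
  refine ⟨θ, hθ, hb, ?_, fun x hx => ?_, fun x hx => ?_, fun n η W hη x hx hxW => ?_⟩
  · rw [hθv, hΨa', hΦs _ hΦa, ha₀, ← hΞe _ hΞk, Ξ.left_inv hΞk]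
  · have h1 := congrArg ContinuousLinearMap.det (hD x hx)
    rw [ContinuousLinearMap.det_comp_real, OrbifoldGroupoid.arrowDeriv,
      ContinuousLinearMap.det_comp_real] at h1
    have h2 := (C.norm.isInvertible_src (C.norm.inv (Ψ.symm x))).self_comp_inverse
    have h3 := congrArg ContinuousLinearMap.det h2
    rw [ContinuousLinearMap.det_comp_real, ContinuousLinearMap.det_id_real] at h3
    have h4 : 0 < (manifoldDeriv ℂ ℂ C.norm.src (C.norm.inv (Ψ.symm x))).det := C.norm.jac_src_pos _
    have h5 : 0 < (manifoldDeriv ℂ ℂ C.norm.tgt (C.norm.inv (Ψ.symm x))).det := C.norm.jac_tgt_pos _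
    have h6 : 0 < (manifoldDeriv ℂ ℂ f.eps.obj (θ x)).det :=
      jac_pos_of_holomorphic (f.eps_holo _) (f.isInvertible_eps _)
    have h7 : 0 < (manifoldDeriv ℂ ℂ C.norm.src (C.norm.inv (Ψ.symm x))).inverse.det := by
      by_contra h
      nlinarith
    have h8 : 0 < (manifoldDeriv ℂ ℂ f.eps.obj (θ x)).det * (manifoldDeriv ℂ ℂ θ x).det := by
      rw [h1]; positivity
    exact (pos_iff_pos_of_mul_pos h8).1 h6
  · exact C.norm.orbit_eq_iff.2 ⟨_, (harr x hx).1, (harr x hx).2⟩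
  · have h1 := f.pullback_eq_liftDeriv hη (harr x hx).1 hxW
    rw [(harr x hx).2] at h1
    rw [h1, DForm.pullback]
    congr 1
    rw [manifoldDeriv_comp x (f.phi.mdifferentiableAt_obj _) (hθ.mdifferentiableAt hx), liftDeriv,
      ← hD x hx, ← ContinuousLinearMap.comp_assoc (manifoldDeriv ℂ ℂ f.eps.obj (θ x)).inverse,
      (f.isInvertible_eps _).inverse_comp_self, ContinuousLinearMap.id_comp]

end HolomorphicOrbimorphism

/-! ### Submersions to the plane -/

section Straightening

variable {E : Type*} [NormedAddCommGroup E] [NormedSpace ℝ E] [FiniteDimensional ℝ E]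
  {F : Type*} [NormedAddCommGroup F] [NormedSpace ℝ F]

omit [FiniteDimensional ℝ E] in
lemma exists_rightInverse_clm {L : E →L[ℝ] ℂ} (hL : Function.Surjective L) :
    ∃ R : ℂ →L[ℝ] E, ∀ z, L (R z) = z := by
  obtain ⟨R, hR⟩ := LinearMap.exists_rightInverse_of_surjective (L : E →ₗ[ℝ] ℂ)
    (LinearMap.range_eq_top.2 hL)
  exact ⟨LinearMap.toContinuousLinearMap R, fun z => LinearMap.congr_fun hR z⟩

/-- A submersion to the complex plane is linear in suitable coordinates. The coordinate map is as
smooth as the submersion. -/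
theorem exists_straightening {A : E → ℂ} {p₀ : E} (hA : ContDiffAt ℝ 1 A p₀) (hA0 : A p₀ = 0)
    (hs : Function.Surjective (fderiv ℝ A p₀)) :
    ∃ (L : E →L[ℝ] ℂ) (R : ℂ →L[ℝ] E) (Φ : OpenPartialHomeomorph E E), (∀ z, L (R z) = z) ∧
      p₀ ∈ Φ.source ∧ Φ p₀ = 0 ∧ (∀ p, L (Φ p) = A p) ∧
      ∀ p ∈ Φ.source, ∀ n : WithTop ℕ∞, n ≠ 0 → ContDiffAt ℝ n A p →
        ContDiffAt ℝ n Φ p ∧ ContDiffAt ℝ n Φ.symm (Φ p) := by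
  have : CompleteSpace E := FiniteDimensional.complete ℝ E
  set L := fderiv ℝ A p₀ with hL
  obtain ⟨R, hR⟩ := exists_rightInverse_clm hs
  -- The derivative of `Ψ` at `p₀` is the identity, so the inverse function theorem applies.
  let Ψ : E → E := fun p => (p - p₀) - R (L (p - p₀)) + R (A p)
  have hΨn : ∀ p (n : WithTop ℕ∞), ContDiffAt ℝ n A p → ContDiffAt ℝ n Ψ p := fun p n h =>
    ((contDiffAt_id.sub contDiffAt_const).sub (R.contDiff.contDiffAt.comp p
      (L.contDiff.contDiffAt.comp p (contDiffAt_id.sub contDiffAt_const)))).add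
      (R.contDiff.contDiffAt.comp p h)
  have hΨ : ContDiffAt ℝ 1 Ψ p₀ := hΨn p₀ 1 hA
  have hΨd : HasFDerivAt Ψ ((ContinuousLinearEquiv.refl ℝ E : E ≃L[ℝ] E) : E →L[ℝ] E) p₀ := by
    have h1 : HasFDerivAt A L p₀ := (hA.differentiableAt one_ne_zero).hasFDerivAt
    have h2 : HasFDerivAt (fun p : E => p - p₀) (ContinuousLinearMap.id ℝ E) p₀ :=
      (hasFDerivAt_id p₀).sub_const p₀
    have h3 := (h2.sub ((R.comp L).hasFDerivAt.comp p₀ h2)).add (R.hasFDerivAt.comp p₀ h1)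
    refine h3.congr_fderiv ?_
    ext v
    simp
  let Φ₁ := hΨ.toOpenPartialHomeomorph Ψ hΨd one_ne_zero
  have hΦ₁ : ∀ p, Φ₁ p = Ψ p := fun p => rfl
  have hmem : p₀ ∈ Φ₁.source := hΨ.mem_toOpenPartialHomeomorph_source hΨd one_ne_zero
  -- The open set on which the inverse of `Ψ` is as smooth as `Ψ`, not only at the centre.
  let S : Set E := {p | fderiv ℝ Ψ p ∈ range ((↑) : (E ≃L[ℝ] E) → E →L[ℝ] E)}
  have hS : S ∈ 𝓝 p₀ := by
    have h1 : ContinuousAt (fderiv ℝ Ψ) p₀ := (hΨ.fderiv_right (m := 0) (by simp)).continuousAt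
    refine h1.preimage_mem_nhds ?_
    rw [hΨd.fderiv]
    exact ContinuousLinearEquiv.nhds _
  refine ⟨L, R, Φ₁.restrOpen (interior S) isOpen_interior, hR, ?_, ?_, fun p => ?_,
    fun p hp n hn hAp => ?_⟩
  · rw [OpenPartialHomeomorph.restrOpen_source]
    exact ⟨hmem, mem_interior_iff_mem_nhds.2 hS⟩
  · change Ψ p₀ = 0
    simp [Ψ, hA0]
  · change L (Ψ p) = A p
    simp [Ψ, hR]
  · rw [OpenPartialHomeomorph.restrOpen_source] at hp
    obtain ⟨hp1, hp2⟩ := hp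
    obtain ⟨e', he'⟩ := interior_subset hp2
    have hsm : ContDiffAt ℝ n Φ₁ p := hΨn p n hAp
    refine ⟨hsm, ?_⟩
    change ContDiffAt ℝ n Φ₁.symm (Φ₁ p)
    refine Φ₁.contDiffAt_symm (f₀' := e') (Φ₁.map_source hp1) ?_ ?_
    · rw [Φ₁.left_inv hp1, he']
      exact (hsm.differentiableAt hn).hasFDerivAt
    · rwa [Φ₁.left_inv hp1]

/-- A `C¹` function that vanishes on the zero set of a submersion is bounded by a multiple of the
submersion. -/
theorem exists_norm_le_mul_of_vanishing {A : E → ℂ} {B : E → F} {p₀ : E}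
    (hA : ContDiffAt ℝ 1 A p₀) (hA0 : A p₀ = 0) (hs : Function.Surjective (fderiv ℝ A p₀))
    (hB : ContDiffAt ℝ 1 B p₀) (hAB : ∀ᶠ p in 𝓝 p₀, A p = 0 → B p = 0) :
    ∃ K : ℝ, ∀ᶠ p in 𝓝 p₀, ‖B p‖ ≤ K * ‖A p‖ := by
  obtain ⟨L, R, Φ, hLR, hp₀, hΦ0, hLΦ, hΦ⟩ := exists_straightening hA hA0 hs
  have h0 : (0 : E) ∈ Φ.target := hΦ0 ▸ Φ.map_source hp₀
  have hs0 : Φ.symm 0 = p₀ := by rw [← hΦ0, Φ.left_inv hp₀]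
  have hsymm : ContDiffAt ℝ 1 Φ.symm 0 := by
    have := (hΦ p₀ hp₀ 1 one_ne_zero hA).2
    rwa [hΦ0] at this
  have hBs : ContDiffAt ℝ 1 (fun q => B (Φ.symm q)) 0 :=
    ContDiffAt.comp (g := B) 0 (by rw [hs0]; exact hB) hsymm
  obtain ⟨K, t, ht, hK⟩ := hBs.exists_lipschitzOnWith
  let Q : E → E := fun q => q - R (L q)
  have hQc : Continuous Q := by fun_prop
  have hev : ∀ᶠ q in 𝓝 (0 : E), q ∈ t ∧ q ∈ Φ.target ∧ (A (Φ.symm q) = 0 → B (Φ.symm q) = 0) := by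
    have h1 : ∀ᶠ q in 𝓝 (0 : E), A (Φ.symm q) = 0 → B (Φ.symm q) = 0 :=
      hsymm.continuousAt.eventually (by rw [hs0]; exact hAB)
    filter_upwards [ht, Φ.open_target.mem_nhds h0, h1] with q a b c using ⟨a, b, c⟩
  have hevQ := (hQc.tendsto' 0 0 (by simp [Q])).eventually hev
  have hΦc : Filter.Tendsto Φ (𝓝 p₀) (𝓝 0) := by
    have := Φ.continuousAt hp₀
    rwa [ContinuousAt, hΦ0] at this
  refine ⟨K * ‖R‖, ?_⟩
  filter_upwards [hΦc.eventually hev, hΦc.eventually hevQ, Φ.open_source.mem_nhds hp₀]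
    with p h1 h2 hp
  have h3 : B (Φ.symm (Q (Φ p))) = 0 := by
    refine h2.2.2 ?_
    rw [← hLΦ, Φ.right_inv h2.2.1]
    simp [Q, hLR]
  have h4 := hK.dist_le_mul _ h1.1 _ h2.1
  rw [h3, Φ.left_inv hp, dist_zero_right, dist_eq_norm] at h4
  have h5 : Φ p - Q (Φ p) = R (A p) := by simp [Q, hLΦ]
  rw [h5] at h4
  calc ‖B p‖ ≤ K * ‖R (A p)‖ := h4
    _ ≤ K * (‖R‖ * ‖A p‖) := by gcongr; exact R.le_opNorm _
    _ = K * ‖R‖ * ‖A p‖ := by ring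

variable {M : Type*} [TopologicalSpace M] [ChartedSpace E M] [IsManifold 𝓘(ℝ, E) ∞ M]

omit [FiniteDimensional ℝ E] in
lemma contDiffAt_comp_chart_symm {n : WithTop ℕ∞} (hn : n ≤ ∞) {f : M → F} {m : M}
    (hf : ContMDiffAt 𝓘(ℝ, E) 𝓘(ℝ, F) n f m) :
    ContDiffAt ℝ n (fun p => f ((chartAt E m).symm p)) (chartAt E m m) := by
  rw [← contMDiffAt_iff_contDiffAt]
  have hc := isSmoothHomeo_chart (chart_mem_atlas E m)
  have h1 := hc.symm.contMDiffAt (mem_chart_target E m)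
  refine ContMDiffAt.comp (I' := 𝓘(ℝ, E)) (g := f) _ ?_ (h1.of_le hn)
  rwa [(chartAt E m).left_inv (mem_chart_source E m)]

/-- The manifold version of `exists_norm_le_mul_of_vanishing`. -/
theorem exists_norm_le_mul_of_vanishing_manifold {A : M → ℂ} {B : M → F} {m : M}
    (hA : ContMDiffAt 𝓘(ℝ, E) 𝓘(ℝ, ℂ) 1 A m) (hA0 : A m = 0)
    (hs : Function.Surjective (manifoldDeriv E ℂ A m))
    (hB : ContMDiffAt 𝓘(ℝ, E) 𝓘(ℝ, F) 1 B m) (hAB : ∀ᶠ x in 𝓝 m, A x = 0 → B x = 0) :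
    ∃ K : ℝ, ∀ᶠ x in 𝓝 m, ‖B x‖ ≤ K * ‖A x‖ := by
  set c := chartAt E m with hc
  have hcs := isSmoothHomeo_chart (chart_mem_atlas E m)
  have hm : m ∈ c.source := mem_chart_source E m
  have hcm : c m ∈ c.target := mem_chart_target E m
  have hlm : c.symm (c m) = m := c.left_inv hm
  have hsurj : Function.Surjective (fderiv ℝ (fun p => A (c.symm p)) (c m)) := by
    rw [← manifoldDeriv_eq_fderiv, manifoldDeriv_comp (c m)
      (by rw [hlm]; exact hA.mdifferentiableAt one_ne_zero) (hcs.symm.mdifferentiableAt hcm), hlm]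
    intro z
    obtain ⟨v, hv⟩ := hs z
    refine ⟨manifoldDeriv E E c m v, ?_⟩
    have h1 := DFunLike.congr_fun (hcs.deriv_symm_comp_deriv hm) v
    simp only [ContinuousLinearMap.comp_apply] at h1 ⊢
    rw [h1]
    exact hv
  have hsc : Filter.Tendsto c.symm (𝓝 (c m)) (𝓝 m) := by
    have := c.continuousAt_symm hcm
    rwa [ContinuousAt, hlm] at this
  have h1 : (1 : WithTop ℕ∞) ≤ ∞ := by exact_mod_cast le_top
  obtain ⟨K, hK⟩ := exists_norm_le_mul_of_vanishing (contDiffAt_comp_chart_symm h1 hA)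
    (by rw [hlm]; exact hA0) hsurj (contDiffAt_comp_chart_symm h1 hB) (hsc.eventually hAB)
  refine ⟨K, ?_⟩
  filter_upwards [(c.continuousAt hm).eventually hK, c.open_source.mem_nhds hm] with x hx hxs
  rwa [c.left_inv hxs] at hx

end Straightening

/-! ### Holomorphic charts and isolated orbits -/

section ComplexCharts

variable {M : Type*} [TopologicalSpace M] [ChartedSpace ℂ M]
  {N : Type*} [TopologicalSpace N] [ChartedSpace ℂ N]

lemma ContMDiffAt.real_of_complex {f : M → N} {x : M} (hf : ContMDiffAt 𝓘(ℂ) 𝓘(ℂ) ω f x) :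
    ContMDiffAt 𝓘(ℝ, ℂ) 𝓘(ℝ, ℂ) ∞ f x := by
  rw [contMDiffAt_iff] at hf ⊢
  refine ⟨hf.1, ?_⟩
  have h := (hf.2.restrict_scalars ℝ).of_le (m := ∞) le_top
  exact h

lemma mdifferentiableAt_of_mem_maximalAtlas_omega {e : OpenPartialHomeomorph M ℂ}
    (he : e ∈ IsManifold.maximalAtlas 𝓘(ℂ) ω M) {x : M} (hx : x ∈ e.source) :
    MDifferentiableAt 𝓘(ℂ) 𝓘(ℂ) e x :=
  ((contMDiffOn_of_mem_maximalAtlas he).contMDiffAt (e.open_source.mem_nhds hx)).mdifferentiableAt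
    (by simp)

lemma mdifferentiableAt_symm_of_mem_maximalAtlas_omega {e : OpenPartialHomeomorph M ℂ}
    (he : e ∈ IsManifold.maximalAtlas 𝓘(ℂ) ω M) {p : ℂ} (hp : p ∈ e.target) :
    MDifferentiableAt 𝓘(ℂ) 𝓘(ℂ) e.symm p :=
  ((contMDiffOn_symm_of_mem_maximalAtlas he).contMDiffAt
    (e.open_target.mem_nhds hp)).mdifferentiableAt (by simp)

lemma isOrientedChart_of_mem_maximalAtlas {e : OpenPartialHomeomorph M ℂ}
    (he : e ∈ IsManifold.maximalAtlas 𝓘(ℂ) ω M) : IsOrientedChart e := by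
  refine isOrientedChart_of_holomorphic ⟨fun x hx => ?_, fun x hx => ?_⟩
    fun x hx => mdifferentiableAt_of_mem_maximalAtlas_omega he hx
  · exact ((contMDiffOn_of_mem_maximalAtlas he).contMDiffAt
      (e.open_source.mem_nhds hx)).real_of_complex.contMDiffWithinAt
  · exact ((contMDiffOn_symm_of_mem_maximalAtlas he).contMDiffAt
      (e.open_target.mem_nhds hx)).real_of_complex.contMDiffWithinAt

variable [IsManifold 𝓘(ℂ) ω M]

/-- A holomorphic chart centred at a given point. -/
lemma exists_centered_chart (x : M) :
    ∃ e ∈ IsManifold.maximalAtlas 𝓘(ℂ) ω M, x ∈ e.source ∧ e x = 0 := by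
  set c := chartAt ℂ x with hc
  let t : OpenPartialHomeomorph ℂ ℂ := (Homeomorph.subRight (c x)).toOpenPartialHomeomorph
  have ht : t ∈ contDiffGroupoid ω 𝓘(ℂ) := by
    rw [contDiffGroupoid, mem_groupoid_of_pregroupoid]
    refine ⟨ContDiff.contDiffOn ?_, ContDiff.contDiffOn ?_⟩
    · change ContDiff ℂ ω fun z : ℂ => z - c x
      fun_prop
    · change ContDiff ℂ ω fun z : ℂ => z + c x
      fun_prop
  refine ⟨c.trans t, ?_, ?_, ?_⟩
  · intro e' he'
    have h1 := (contDiffGroupoid ω 𝓘(ℂ)).compatible (chart_mem_atlas ℂ x) he'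
    have h2 := (contDiffGroupoid ω 𝓘(ℂ)).compatible he' (chart_mem_atlas ℂ x)
    constructor
    · rw [OpenPartialHomeomorph.trans_symm_eq_symm_trans_symm, OpenPartialHomeomorph.trans_assoc]
      exact (contDiffGroupoid ω 𝓘(ℂ)).trans ((contDiffGroupoid ω 𝓘(ℂ)).symm ht) h1
    · rw [← OpenPartialHomeomorph.trans_assoc]
      exact (contDiffGroupoid ω 𝓘(ℂ)).trans h2 ht
  · rw [OpenPartialHomeomorph.trans_source]
    exact ⟨mem_chart_source ℂ x, mem_univ _⟩
  · change c x - c x = 0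
    exact sub_self _

end ComplexCharts

namespace OrbifoldGroupoid

/-- Finitely many orbits form a discrete set of objects. -/
lemma eventually_orbit_notMem (G : OrbifoldGroupoid ℂ) {S : Set G.Orbit} (hS : S.Finite)
    (x₀ : G.Obj) : ∀ᶠ x in 𝓝[≠] x₀, G.orbit x ∉ S := by
  have : LocallyCompactSpace G.Obj := ChartedSpace.locallyCompactSpace ℂ G.Obj
  obtain ⟨Q, hQ, hQx⟩ := exists_compact_mem_nhds x₀
  have hfin : {x | x ∈ Q ∧ G.orbit x ∈ S}.Finite := by
    have h1 : {x | x ∈ Q ∧ G.orbit x ∈ S} = ⋃ s ∈ S, {x | x ∈ Q ∧ G.orbit x = s} := by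
      ext x; simp
    rw [h1]
    refine hS.biUnion fun s _ => ?_
    obtain ⟨z, rfl⟩ := Quotient.exists_rep s
    refine ((G.finite_src_tgt z hQ).image G.tgt).subset ?_
    rintro x ⟨hxQ, hx⟩
    obtain ⟨g, hg, rfl⟩ := G.orbit_eq_iff.1 (Eq.symm hx)
    exact ⟨g, ⟨hg, hxQ⟩, rfl⟩
  have h2 := (hfin.subset (sdiff_subset (t := {x₀}))).isClosed.isOpen_compl.mem_nhds
    (x := x₀) (by simp)
  filter_upwards [nhdsWithin_le_nhds hQx, nhdsWithin_le_nhds h2, self_mem_nhdsWithin]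
    with x h3 h4 h5 h6
  exact h4 ⟨⟨h3, h6⟩, h5⟩

/-- Conjugation by an arrow identifies the local groups of its two ends. -/
lemma card_isotropy_eq {E : Type*} [NormedAddCommGroup E] [NormedSpace ℝ E]
    (G : OrbifoldGroupoid E) {x y : G.Obj} (h : G.orbit x = G.orbit y) :
    Nat.card (G.isotropy x) = Nat.card (G.isotropy y) := by
  obtain ⟨a, rfl, rfl⟩ := G.orbit_eq_iff.1 h
  refine Nat.card_congr
    { toFun := fun g => ⟨G.comp (G.inv a) (G.comp g.1 a), ?_, ?_⟩
      invFun := fun g => ⟨G.comp a (G.comp g.1 (G.inv a)), ?_, ?_⟩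
      left_inv := fun g => Subtype.ext ?_
      right_inv := fun g => Subtype.ext ?_ }
  · have h1 := g.2.1
    have h2 := g.2.2
    rw [G.src_comp, G.src_inv]
    rw [G.tgt_inv, G.src_comp _ _ h2, h1]
  · have h1 := g.2.1
    have h2 := g.2.2
    rw [G.tgt_comp, G.tgt_comp _ _ h2]
    rw [G.tgt_inv, G.src_comp _ _ h2, h1]
  · have h1 := g.2.1
    have h2 := g.2.2
    have h3 : G.tgt g.1 = G.src (G.inv a) := by rw [h2, G.src_inv]
    rw [G.src_comp]
    rw [G.src_comp _ _ h3, h1]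
  · have h1 := g.2.1
    have h2 := g.2.2
    have h3 : G.tgt g.1 = G.src (G.inv a) := by rw [h2, G.src_inv]
    rw [G.tgt_comp, G.tgt_comp _ _ h3, G.tgt_inv]
    rw [G.src_comp _ _ h3, h1]
  · obtain ⟨g, h1, h2⟩ := g
    have h3 : G.tgt (G.inv a) = G.src (G.comp g a) := by
      rw [G.tgt_inv, G.src_comp _ _ h2, h1]
    have h4 : G.comp g (G.unit (G.src a)) = g := by rw [← h2, G.comp_unit]
    change G.comp a (G.comp (G.comp (G.inv a) (G.comp g a)) (G.inv a)) = g
    rw [G.comp_assoc _ _ _ h3 (by rw [G.tgt_comp _ _ h2, G.src_inv]),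
      G.comp_assoc _ _ _ h2 (G.src_inv a).symm, G.comp_inv, h4, G.comp_inv_comp h1.symm]
  · obtain ⟨g, h1, h2⟩ := g
    have h3 : G.tgt g = G.src (G.inv a) := by rw [h2, G.src_inv]
    have h4 : G.tgt a = G.src (G.comp g (G.inv a)) := by rw [G.src_comp _ _ h3, h1]
    have h5 : G.comp g (G.unit (G.tgt a)) = g := by rw [← h2, G.comp_unit]
    have h6 : G.tgt (G.comp g (G.inv a)) = G.src a := by rw [G.tgt_comp _ _ h3, G.tgt_inv]
    change G.comp (G.inv a) (G.comp (G.comp a (G.comp g (G.inv a))) a) = g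
    rw [G.comp_assoc _ _ _ h4 h6, G.inv_comp_comp (by rw [G.src_comp _ _ h6, ← h4]),
      G.comp_assoc _ _ _ h3 (G.tgt_inv a), G.inv_comp, h5]

end OrbifoldGroupoid

/-! ### Existence and uniqueness of the contact order -/

section ContactOrder

variable {E : Type*} [NormedAddCommGroup E] [NormedSpace ℝ E]
  {G : OrbifoldGroupoid E} {J : AlmostComplexStructure G} {Z : Set G.Obj}

namespace IsNormalCoordinate

variable {z : G.Obj} {h : G.Obj → ℂ}

lemma eventually_contMDiffAt (hh : IsNormalCoordinate J Z z h) :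
    ∀ᶠ x in 𝓝 z, ContMDiffAt 𝓘(ℝ, E) 𝓘(ℝ, ℂ) ∞ h x := by
  obtain ⟨U, hU, hzU, hs, -⟩ := hh
  filter_upwards [hU.mem_nhds hzU] with x hx using hs.contMDiffAt (hU.mem_nhds hx)

lemma eventually_mem_iff (hh : IsNormalCoordinate J Z z h) : ∀ᶠ x in 𝓝 z, x ∈ Z ↔ h x = 0 := by
  obtain ⟨U, hU, hzU, -, h0, -⟩ := hh
  filter_upwards [hU.mem_nhds hzU] with x hx using h0 x hx

lemma eventually_deriv (hh : IsNormalCoordinate J Z z h) :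
    ∀ᶠ x in 𝓝 z, x ∈ Z → Function.Surjective (manifoldDeriv E ℂ h x) ∧
      ∀ v : E, manifoldDeriv E ℂ h x (J.J x v) = Complex.I * manifoldDeriv E ℂ h x v := by
  obtain ⟨U, hU, hzU, -, -, hd⟩ := hh
  filter_upwards [hU.mem_nhds hzU] with x hx hxZ using hd x ⟨hx, hxZ⟩

lemma eq_zero (hh : IsNormalCoordinate J Z z h) (hz : z ∈ Z) : h z = 0 :=
  hh.eventually_mem_iff.self_of_nhds.1 hz

/-- Normal coordinates may be multiplied by a nonzero number. This normalizes leading coefficients. -/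
lemma const_mul (hh : IsNormalCoordinate J Z z h) {a : ℂ} (ha : a ≠ 0) :
    IsNormalCoordinate J Z z fun x => a * h x := by
  obtain ⟨U, hU, hzU, hs, h0, hd⟩ := hh
  have hlin : ContMDiff 𝓘(ℝ, ℂ) 𝓘(ℝ, ℂ) ∞ fun w : ℂ => a * w := by
    rw [contMDiff_iff_contDiff]; fun_prop
  refine ⟨U, hU, hzU, hlin.comp_contMDiffOn hs, fun x hx => by simp [h0 x hx, ha], fun x hx => ?_⟩
  have hdx : manifoldDeriv E ℂ (fun x => a * h x) x =
      (a • ContinuousLinearMap.id ℝ ℂ).comp (manifoldDeriv E ℂ h x) := by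
    have h1 : manifoldDeriv ℂ ℂ (fun w : ℂ => a * w) (h x) = a • ContinuousLinearMap.id ℝ ℂ := by
      rw [manifoldDeriv_eq_fderiv]
      exact ((hasFDerivAt_id (𝕜 := ℝ) (h x)).const_mul a).fderiv
    rw [← h1]
    exact manifoldDeriv_comp (g := fun w : ℂ => a * w) x (hlin.contMDiffAt.mdifferentiableAt (by simp))
      ((hs.contMDiffAt (hU.mem_nhds hx.1)).mdifferentiableAt (by simp))
  obtain ⟨hsurj, hJ⟩ := hd x hx
  rw [hdx]
  refine ⟨fun w => ?_, fun v => ?_⟩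
  · obtain ⟨v, hv⟩ := hsurj (a⁻¹ * w)
    exact ⟨v, by simp [hv, ha]⟩
  · simp only [ContinuousLinearMap.comp_apply, hJ v, _root_.smul_apply,
      ContinuousLinearMap.id_apply, smul_eq_mul]
    ring

end IsNormalCoordinate

/-- Along a `J`-holomorphic curve, a normal coordinate is holomorphic up to an error that is
controlled by the coordinate itself, because its differential is complex linear along `Z`. -/
theorem exists_norm_dbar_le [FiniteDimensional ℝ E] {φ : ℂ → G.Obj} {h : G.Obj → ℂ}
    (hφ : ContMDiffAt 𝓘(ℝ, ℂ) 𝓘(ℝ, E) ∞ φ 0)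
    (hφJ : ∀ᶠ w in 𝓝 0, MDifferentiableAt 𝓘(ℝ, ℂ) 𝓘(ℝ, E) φ w ∧
      manifoldDeriv ℂ E φ w Complex.I = J.J (φ w) (manifoldDeriv ℂ E φ w 1))
    (hZ : φ 0 ∈ Z) (hh : IsNormalCoordinate J Z (φ 0) h) :
    ∃ K : ℝ, ∀ᶠ w in 𝓝 (0 : ℂ), ‖dbar (fun w => h (φ w)) w‖ ≤ K * ‖h (φ w)‖ := by
  set c := chartAt E (φ 0) with hc
  have hcs : IsSmoothHomeo (E := E) (F := E) c := isSmoothHomeo_chart (chart_mem_atlas E (φ 0))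
  have hm : φ 0 ∈ c.source := mem_chart_source E _
  have hcm : c (φ 0) ∈ c.target := mem_chart_target E _
  have hlm : c.symm (c (φ 0)) = φ 0 := c.left_inv hm
  have hsc : Filter.Tendsto c.symm (𝓝 (c (φ 0))) (𝓝 (φ 0)) := by
    have := c.continuousAt_symm hcm
    rwa [ContinuousAt, hlm] at this
  let g : E → ℂ := fun p => h (c.symm p)
  let T : E → E →L[ℝ] E := fun p => (manifoldDeriv E E c (c.symm p)).comp
      ((J.J (c.symm p)).comp (manifoldDeriv E E c.symm p))
  -- `X` is the failure of the differential of the coordinate to be complex linear, in the chart.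
  let X : E → E →L[ℝ] ℂ := fun p =>
    (fderiv ℝ g p).comp (T p) - Complex.I • fderiv ℝ g p
  have hg : ContDiffAt ℝ ∞ g (c (φ 0)) :=
    contDiffAt_comp_chart_symm le_rfl hh.eventually_contMDiffAt.self_of_nhds
  have h1le : (1 : WithTop ℕ∞) ≤ ∞ := by exact_mod_cast le_top
  have hTd : ContDiffAt ℝ 1 T (c (φ 0)) :=
    ((J.smooth c (chart_mem_atlas E _)).contDiffAt (c.open_target.mem_nhds hcm)).of_le h1le
  have hg1 : ContDiffAt ℝ 1 (fderiv ℝ g) (c (φ 0)) :=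
    ContDiffAt.fderiv_right (n := 2) (hg.of_le ENat.LEInfty.out) (by norm_num)
  have hX : ContDiffAt ℝ 1 X (c (φ 0)) :=
    (hg1.clm_comp hTd).sub (hg1.const_smul _)
  have hgd : ∀ᶠ p in 𝓝 (c (φ 0)), fderiv ℝ g p =
      (manifoldDeriv E ℂ h (c.symm p)).comp (manifoldDeriv E E c.symm p) := by
    filter_upwards [hsc.eventually hh.eventually_contMDiffAt, c.open_target.mem_nhds hcm]
      with p hp hpt
    rw [← manifoldDeriv_eq_fderiv]
    exact manifoldDeriv_comp p (hp.mdifferentiableAt (by simp)) (hcs.symm.mdifferentiableAt hpt)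
  have hX0 : ∀ᶠ p in 𝓝 (c (φ 0)), g p = 0 → X p = 0 := by
    filter_upwards [hgd, hsc.eventually hh.eventually_mem_iff, hsc.eventually hh.eventually_deriv,
      c.open_target.mem_nhds hcm] with p h1 h2 h3 hpt h4
    have h5 := (h3 (h2.2 h4)).2
    ext v
    have h6 := DFunLike.congr_fun (hcs.deriv_symm_comp_deriv (c.map_target hpt))
      (J.J (c.symm p) (manifoldDeriv E E c.symm p v))
    rw [c.right_inv hpt] at h6
    simp only [ContinuousLinearMap.comp_apply, ContinuousLinearMap.id_apply] at h6
    simp only [X, T, h1, _root_.sub_apply, ContinuousLinearMap.comp_apply,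
      _root_.smul_apply, _root_.zero_apply, smul_eq_mul, h6, h5, sub_self]
  have hgs : Function.Surjective (fderiv ℝ g (c (φ 0))) := by
    rw [hgd.self_of_nhds, hlm]
    intro z
    obtain ⟨v, hv⟩ := (hh.eventually_deriv.self_of_nhds hZ).1 z
    refine ⟨manifoldDeriv E E c (φ 0) v, ?_⟩
    have h1 := DFunLike.congr_fun (hcs.deriv_symm_comp_deriv hm) v
    simp only [ContinuousLinearMap.comp_apply] at h1 ⊢
    rw [h1]
    exact hv
  obtain ⟨K, hK⟩ := exists_norm_le_mul_of_vanishing (hg.of_le h1le)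
    (by change h (c.symm (c (φ 0))) = 0; rw [hlm]; exact hh.eq_zero hZ) hgs hX hX0
  have hcφ : ContDiffAt ℝ ∞ (fun w => c (φ w)) 0 := by
    rw [← contMDiffAt_iff_contDiffAt]
    exact (hcs.contMDiffAt hm).comp 0 hφ
  have hbd : ∀ᶠ w in 𝓝 (0 : ℂ), ‖fderiv ℝ (fun w => c (φ w)) w 1‖ ≤
      ‖fderiv ℝ (fun w => c (φ w)) 0 1‖ + 1 := by
    have h1 : ContinuousAt (fun w : ℂ => ‖fderiv ℝ (fun w => c (φ w)) w 1‖) 0 :=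
      ((hcφ.fderiv_right (m := 0) (by simp)).continuousAt.clm_apply continuousAt_const).norm
    filter_upwards [h1.eventually (gt_mem_nhds (lt_add_one _))] with w hw using hw.le
  refine ⟨K * (‖fderiv ℝ (fun w => c (φ w)) 0 1‖ + 1), ?_⟩
  have hφc : Filter.Tendsto (fun w => c (φ w)) (𝓝 0) (𝓝 (c (φ 0))) := hcφ.continuousAt
  have hφt : Filter.Tendsto φ (𝓝 0) (𝓝 (φ 0)) := hφ.continuousAt
  filter_upwards [hφc.eventually hK, hbd, hφJ, hφt.eventually (c.open_source.mem_nhds hm),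
    hφt.eventually hh.eventually_contMDiffAt, hφc.eventually hgd] with w h1 h2 h3 h4 h5 h6
  obtain ⟨h3d, h3J⟩ := h3
  have h7 : c.symm (c (φ w)) = φ w := c.left_inv h4
  have hdh : fderiv ℝ (fun w => h (φ w)) w = (manifoldDeriv E ℂ h (φ w)).comp
      (manifoldDeriv ℂ E φ w) := by
    rw [← manifoldDeriv_eq_fderiv]
    exact manifoldDeriv_comp w (h5.mdifferentiableAt (by simp)) h3d
  have hdc : fderiv ℝ (fun w => c (φ w)) w = (manifoldDeriv E E c (φ w)).comp
      (manifoldDeriv ℂ E φ w) := by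
    rw [← manifoldDeriv_eq_fderiv]
    exact manifoldDeriv_comp w (hcs.mdifferentiableAt h4) h3d
  rw [h7] at h6
  have hinv : ∀ v, manifoldDeriv E E c.symm (c (φ w)) (manifoldDeriv E E c (φ w) v) = v :=
    fun v => DFunLike.congr_fun (hcs.deriv_symm_comp_deriv h4) v
  -- As `φ` is `J`-holomorphic, `∂̄(h ∘ φ)` is `X` applied to a derivative of `φ`.
  have hkey : dbar (fun w => h (φ w)) w = X (c (φ w)) (fderiv ℝ (fun w => c (φ w)) w 1) := by
    simp only [dbar, X, T, hdh, hdc, h6, h7, _root_.sub_apply,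
      ContinuousLinearMap.comp_apply, _root_.smul_apply, smul_eq_mul, hinv, h3J]
  have hgw : g (c (φ w)) = h (φ w) := by simp only [g, h7]
  rw [hgw] at h1
  rw [hkey]
  calc _ ≤ ‖X (c (φ w))‖ * ‖fderiv ℝ (fun w => c (φ w)) w 1‖ := ContinuousLinearMap.le_opNorm _ _
    _ ≤ (K * ‖h (φ w)‖) * (‖fderiv ℝ (fun w => c (φ w)) 0 1‖ + 1) := by
      gcongr
      exact (norm_nonneg _).trans h1
    _ = _ := by ring

end ContactOrder

namespace HolomorphicOrbimorphism

variable {C : Orbicurve} {E : Type*} [NormedAddCommGroup E] [NormedSpace ℝ E]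
  {G : OrbifoldGroupoid E} {J : AlmostComplexStructure G} (f : HolomorphicOrbimorphism C J)
  {Z : Set G.Obj}

lemma isEquivalent_pow {g : ℂ → ℂ} {d : ℕ}
    (h : (fun ζ : ℂ => g ζ - ζ ^ d) =O[𝓝 0] fun ζ : ℂ => ζ ^ (d + 1)) :
    Asymptotics.IsEquivalent (𝓝 0) g fun ζ : ℂ => ζ ^ d :=
  h.trans_isLittleO (Asymptotics.isLittleO_pow_pow (Nat.lt_succ_self d))

lemma le_of_pow_isBigO_pow {m n : ℕ}
    (h : (fun ζ : ℂ => ζ ^ m) =O[𝓝 0] fun ζ : ℂ => ζ ^ n) : n ≤ m := by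
  by_contra hlt
  push Not at hlt
  have h1 : (fun ζ : ℂ => ζ ^ m) =o[𝓝 0] fun ζ : ℂ => ζ ^ m :=
    h.trans_isLittleO (Asymptotics.isLittleO_pow_pow hlt)
  have h2 := (Asymptotics.isLittleO_irrefl (f'' := fun ζ : ℂ => ζ ^ m) (l := 𝓝 0))
  refine h2 ?_ h1
  have h3 : ∀ᶠ ζ : ℂ in 𝓝[≠] 0, ζ ^ m ≠ 0 := by
    filter_upwards [self_mem_nhdsWithin] with ζ hζ using pow_ne_zero m hζ
  exact h3.frequently.filter_mono nhdsWithin_le_nhds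

/-- The contact order does not increase along an arrow, for any choice of coordinates: a normal
coordinate at one end is bounded by a multiple of one at the other end, as they have the same zero
set. -/
lemma contact_order_le [FiniteDimensional ℝ E] (hZ : G.IsInvariantSet Z) {κ : f.K.Arr} {d d' : ℕ}
    (hκ : f.phi.obj (f.K.src κ) ∈ Z) (hd : f.HasLocalOrder Z (f.K.src κ) d)
    (hd' : f.HasLocalOrder Z (f.K.tgt κ) d') : d ≤ d' := by
  have := f.K.holoObj
  obtain ⟨h, hh, e, he, hke, he0, hO⟩ := hd
  obtain ⟨h', hh', e', he', hke', he'0, hO'⟩ := hd'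
  obtain ⟨Φ, hκΦ, hΦs, hΦ⟩ := f.K.etale_tgt.exists_isSmoothHomeo κ
  have heS := (isOrientedChart_of_mem_maximalAtlas he).smooth
  have heS' := (isOrientedChart_of_mem_maximalAtlas he').smooth
  have hsymm0 : e'.symm 0 = f.K.tgt κ := by rw [← he'0, e'.left_inv hke']
  have h0t : (0 : ℂ) ∈ e'.target := he'0 ▸ e'.map_source hke'
  have htΦ : f.K.tgt κ ∈ Φ.target := by rw [← hΦ κ hκΦ]; exact Φ.map_source hκΦ
  have hΦκ : Φ.symm (f.K.tgt κ) = κ := by rw [← hΦ κ hκΦ, Φ.left_inv hκΦ]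
  let ψ : ℂ → f.K.Arr := fun ζ => Φ.symm (e'.symm ζ)
  have hψ0 : ψ 0 = κ := by simp only [ψ, hsymm0, hΦκ]
  have hψs : ContMDiffAt 𝓘(ℝ, ℂ) 𝓘(ℝ, ℂ) ∞ ψ 0 :=
    ContMDiffAt.comp (g := Φ.symm) 0 (hΦs.symm.contMDiffAt (by rw [hsymm0]; exact htΦ))
      (heS'.symm.contMDiffAt h0t)
  have hψt : Filter.Tendsto ψ (𝓝 0) (𝓝 κ) := by
    have := hψs.continuousAt
    rwa [ContinuousAt, hψ0] at this
  have htgt : ∀ᶠ ζ in 𝓝 (0 : ℂ), f.K.tgt (ψ ζ) = e'.symm ζ := by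
    have h1 : Filter.Tendsto e'.symm (𝓝 0) (𝓝 (f.K.tgt κ)) := by
      have := e'.continuousAt_symm h0t
      rwa [ContinuousAt, hsymm0] at this
    filter_upwards [h1.eventually (Φ.open_target.mem_nhds htΦ)] with ζ hζ
    simp only [ψ]
    rw [← hΦ _ (Φ.map_target hζ), Φ.right_inv hζ]
  have hsrcs : ContMDiffAt 𝓘(ℝ, ℂ) 𝓘(ℝ, ℂ) ∞ (fun ζ => f.K.src (ψ ζ)) 0 :=
    ContMDiffAt.comp (g := f.K.src) 0 f.K.etale_src.contMDiff.contMDiffAt hψs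
  have hsrc0 : f.K.src (ψ 0) = f.K.src κ := by rw [hψ0]
  have hsrct : Filter.Tendsto (fun ζ => f.K.src (ψ ζ)) (𝓝 0) (𝓝 (f.K.src κ)) := by
    have := hsrcs.continuousAt
    rwa [ContinuousAt, hsrc0] at this
  have hes : ContDiffAt ℝ ∞ (fun ζ => e (f.K.src (ψ ζ))) 0 := by
    rw [← contMDiffAt_iff_contDiffAt]
    exact ContMDiffAt.comp (g := e) 0 (heS.contMDiffAt (by rw [hsrc0]; exact hke)) hsrcs
  have hes0 : e (f.K.src (ψ 0)) = 0 := by rw [hsrc0, he0]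
  have hesO : (fun ζ => e (f.K.src (ψ ζ))) =O[𝓝 0] fun ζ : ℂ => ζ := by
    have h1 := (hes.differentiableAt (by simp)).hasFDerivAt.isBigO_sub
    simpa [hes0] using h1
  have hest : Filter.Tendsto (fun ζ => e (f.K.src (ψ ζ))) (𝓝 0) (𝓝 0) := by
    have := hes.continuousAt
    rwa [ContinuousAt, hes0] at this
  -- the comparison of the two normal coordinates on the manifold of arrows of `G`
  have hγs : G.src (f.phi.arr κ) = f.phi.obj (f.K.src κ) := f.phi.src_arr κ
  have hγt : G.tgt (f.phi.arr κ) = f.phi.obj (f.K.tgt κ) := f.phi.tgt_arr κ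
  have hsG := G.etale_src.contMDiff
  have htG := G.etale_tgt.contMDiff
  have h1le : (1 : WithTop ℕ∞) ≤ ∞ := by exact_mod_cast le_top
  obtain ⟨B, hB⟩ : ∃ B : ℝ, ∀ᶠ g in 𝓝 (f.phi.arr κ), ‖h' (G.tgt g)‖ ≤ B * ‖h (G.src g)‖ := by
    have hsc : Filter.Tendsto G.src (𝓝 (f.phi.arr κ)) (𝓝 (f.phi.obj (f.K.src κ))) := by
      have := (hsG.continuous.continuousAt (x := f.phi.arr κ))
      rwa [ContinuousAt, hγs] at this
    have htc : Filter.Tendsto G.tgt (𝓝 (f.phi.arr κ)) (𝓝 (f.phi.obj (f.K.tgt κ))) := by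
      have := (htG.continuous.continuousAt (x := f.phi.arr κ))
      rwa [ContinuousAt, hγt] at this
    have hhs : ContMDiffAt 𝓘(ℝ, E) 𝓘(ℝ, ℂ) ∞ h (G.src (f.phi.arr κ)) := by
      rw [hγs]; exact hh.eventually_contMDiffAt.self_of_nhds
    have hhs' : ContMDiffAt 𝓘(ℝ, E) 𝓘(ℝ, ℂ) ∞ h' (G.tgt (f.phi.arr κ)) := by
      rw [hγt]; exact hh'.eventually_contMDiffAt.self_of_nhds
    refine exists_norm_le_mul_of_vanishing_manifold (A := fun g => h (G.src g))
      (B := fun g => h' (G.tgt g)) ((hhs.comp _ hsG.contMDiffAt).of_le h1le) ?_ ?_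
      ((hhs'.comp _ htG.contMDiffAt).of_le h1le) ?_
    · rw [hγs]; exact hh.eq_zero hκ
    · rw [manifoldDeriv_comp _ (hhs.mdifferentiableAt (by simp)) (G.mdifferentiable_src _), hγs]
      refine (hh.eventually_deriv.self_of_nhds hκ).1.comp ?_
      obtain ⟨A, hA⟩ := G.etale_src.isInvertible_manifoldDeriv (f.phi.arr κ)
      rw [← hA]
      exact A.surjective
    · filter_upwards [hsc.eventually hh.eventually_mem_iff, htc.eventually hh'.eventually_mem_iff]
        with g h1 h2 h3
      exact h2.1 ((hZ g).1 (h1.2 h3))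
  have harr : Filter.Tendsto (fun ζ => f.phi.arr (ψ ζ)) (𝓝 0) (𝓝 (f.phi.arr κ)) :=
    (f.phi.smooth_arr.continuous.tendsto κ).comp hψt
  have hc1 : (fun ζ : ℂ => ζ ^ d') =O[𝓝 0] fun ζ => h' (f.phi.obj (e'.symm ζ)) :=
    (isEquivalent_pow hO').isBigO_symm
  have hc2 : (fun ζ => h' (f.phi.obj (e'.symm ζ))) =O[𝓝 0]
      fun ζ => h (f.phi.obj (f.K.src (ψ ζ))) := by
    refine Asymptotics.IsBigO.of_bound B ?_
    filter_upwards [harr.eventually hB, htgt] with ζ h1 h2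
    rwa [f.phi.src_arr, f.phi.tgt_arr, h2] at h1
  have hc3 : (fun ζ => h (f.phi.obj (f.K.src (ψ ζ)))) =O[𝓝 0]
      fun ζ => (e (f.K.src (ψ ζ))) ^ d := by
    refine ((isEquivalent_pow hO).isBigO.comp_tendsto hest).congr' ?_ Filter.EventuallyEq.rfl
    filter_upwards [hsrct.eventually (e.open_source.mem_nhds hke)] with ζ hζ
    simp only [Function.comp_apply]
    rw [e.left_inv hζ]
  exact le_of_pow_isBigO_pow (((hc1.trans hc2).trans hc3).trans (hesO.pow d))

/-- The leading term of a normal coordinate along the lift is a monomial, by `exists_leading_term`: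
the coordinate does not vanish identically, as the contact points are isolated. -/
lemma exists_hasLocalOrder [FiniteDimensional ℝ E] (hZ : IsDivisor J Z)
    (hfin : (f.preimage Z).Finite) {k : f.K.Obj} (hk : f.phi.obj k ∈ Z) :
    ∃ d : ℕ, f.HasLocalOrder Z k d := by
  have := f.K.holoObj
  obtain ⟨h, hh⟩ := hZ.coordinate _ hk
  obtain ⟨e, he, hke, he0⟩ := exists_centered_chart k
  have heS := (isOrientedChart_of_mem_maximalAtlas he).smooth
  have hsymm0 : e.symm 0 = k := by rw [← he0, e.left_inv hke]
  have h0t : (0 : ℂ) ∈ e.target := he0 ▸ e.map_source hke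
  let φ : ℂ → G.Obj := fun ζ => f.phi.obj (e.symm ζ)
  have hφ0 : φ 0 = f.phi.obj k := by simp only [φ, hsymm0]
  have hφs : ∀ ζ ∈ e.target, ContMDiffAt 𝓘(ℝ, ℂ) 𝓘(ℝ, E) ∞ φ ζ := fun ζ hζ =>
    ContMDiffAt.comp (g := f.phi.obj) ζ f.phi.smooth_obj.contMDiffAt (heS.symm.contMDiffAt hζ)
  have hφt : Filter.Tendsto φ (𝓝 0) (𝓝 (f.phi.obj k)) := by
    have := (hφs 0 h0t).continuousAt
    rwa [ContinuousAt, hφ0] at this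
  have hJ : ∀ ζ ∈ e.target,
      manifoldDeriv ℂ E φ ζ Complex.I = J.J (φ ζ) (manifoldDeriv ℂ E φ ζ 1) := by
    intro ζ hζ
    have h1 : manifoldDeriv ℂ E φ ζ = (manifoldDeriv ℂ E f.phi.obj (e.symm ζ)).comp
        (manifoldDeriv ℂ ℂ e.symm ζ) :=
      manifoldDeriv_comp ζ (f.phi.smooth_obj.contMDiffAt.mdifferentiableAt (by simp))
        (heS.symm.mdifferentiableAt hζ)
    have h2 := (mdifferentiableAt_symm_of_mem_maximalAtlas_omega he hζ).manifoldDeriv_I_mul 1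
    rw [mul_one] at h2
    rw [h1, ContinuousLinearMap.comp_apply, ContinuousLinearMap.comp_apply, h2]
    exact f.phi_holo _ _
  rw [← hφ0] at hh
  obtain ⟨K, hK⟩ := exists_norm_dbar_le (hφs 0 h0t)
    (by filter_upwards [e.open_target.mem_nhds h0t] with ζ hζ using
      ⟨(hφs ζ hζ).mdifferentiableAt (by simp), hJ ζ hζ⟩) (by rw [hφ0]; exact hk) hh
  have hsm : ContDiffAt ℝ ∞ (fun ζ => h (φ ζ)) 0 := by
    rw [← contMDiffAt_iff_contDiffAt]
    exact ContMDiffAt.comp (g := h) 0 hh.eventually_contMDiffAt.self_of_nhds (hφs 0 h0t)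
  -- Away from the centre, the lift avoids the divisor, because `eps` is injective near `k` and the
  -- orbits of contact points are isolated.
  have hne : ∃ᶠ ζ in 𝓝 (0 : ℂ), h (φ ζ) ≠ 0 := by
    obtain ⟨Φ, hkΦ, hΦs, hΦ⟩ := f.eps_equiv.etale.exists_isSmoothHomeo k
    have hst : Filter.Tendsto e.symm (𝓝 0) (𝓝 k) := by
      have := e.continuousAt_symm h0t
      rwa [ContinuousAt, hsymm0] at this
    have h1 : Filter.Tendsto (fun ζ => f.eps.obj (e.symm ζ)) (𝓝[≠] 0) (𝓝[≠] (f.eps.obj k)) := by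
      refine tendsto_nhdsWithin_iff.2 ⟨?_, ?_⟩
      · exact ((f.eps.smooth_obj.continuous.tendsto k).comp hst).mono_left nhdsWithin_le_nhds
      · filter_upwards [self_mem_nhdsWithin, nhdsWithin_le_nhds (e.open_target.mem_nhds h0t),
          nhdsWithin_le_nhds (hst.eventually (Φ.open_source.mem_nhds hkΦ))] with ζ h2 h3 h4 h5
        refine h2 ?_
        have h6 : e.symm ζ = k := by
          refine Φ.injOn h4 hkΦ ?_
          rw [hΦ _ h4, hΦ _ hkΦ]
          exact h5
        rw [mem_singleton_iff, ← he0, ← h6, e.right_inv h3]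
    have h2 := h1.eventually (C.norm.eventually_orbit_notMem hfin (f.eps.obj k))
    have h3 : ∀ᶠ ζ in 𝓝[≠] (0 : ℂ), φ ζ ∈ Z ↔ h (φ ζ) = 0 :=
      nhdsWithin_le_nhds ((hφ0 ▸ hφt : Filter.Tendsto φ (𝓝 0) (𝓝 (φ 0))).eventually
        hh.eventually_mem_iff)
    refine Filter.Frequently.filter_mono (Filter.Eventually.frequently ?_)
      (nhdsWithin_le_nhds (s := {0}ᶜ))
    filter_upwards [h2, h3] with ζ h4 h5 h6
    exact h4 ((f.phi_mem_iff_orbit_mem_preimage hZ.invariant _).1 (h5.2 h6))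
  obtain ⟨d, a, ha, hO⟩ := exists_leading_term hsm hK hne
  refine ⟨d, fun x => a⁻¹ * h x, by rw [← hφ0]; exact hh.const_mul (inv_ne_zero ha), e, he, hke,
    he0, ?_⟩
  refine (hO.const_mul_left a⁻¹).congr_left fun ζ => ?_
  simp only [φ]
  field_simp

/-- The fractional contact order exists and is unique. -/
theorem existsUnique_isFractionalContactOrder [FiniteDimensional ℝ E] (hZ : IsDivisor J Z)
    (hfin : (f.preimage Z).Finite) {y : C.norm.Orbit} (hy : y ∈ f.preimage Z) :
    ∃! ℓ : ℚ, f.IsFractionalContactOrder Z y ℓ := by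
  obtain ⟨k, hky, hkZ⟩ := hy
  obtain ⟨d, hd⟩ := f.exists_hasLocalOrder hZ hfin hkZ
  refine ⟨_, ⟨k, d, hky, hd, rfl⟩, ?_⟩
  rintro ℓ' ⟨k', d', hky', hd', rfl⟩
  have horb : C.norm.orbit (f.eps.obj k) = C.norm.orbit (f.eps.obj k') := hky.trans hky'.symm
  obtain ⟨a, has, hat⟩ := C.norm.orbit_eq_iff.1 horb
  obtain ⟨κ, ⟨rfl, rfl, -⟩, -⟩ := f.eps_equiv.full_faithful k k' a has hat
  have h1 : d ≤ d' := f.contact_order_le hZ.invariant hkZ hd hd'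
  have h2 : d' ≤ d := by
    refine f.contact_order_le (κ := f.K.inv κ) hZ.invariant ?_ ?_ ?_
    · rw [f.K.src_inv]
      exact (f.phi_mem_iff hZ.invariant horb).1 hkZ
    · rwa [f.K.src_inv]
    · rwa [f.K.tgt_inv]
  rw [le_antisymm h1 h2, C.norm.card_isotropy_eq horb]

end HolomorphicOrbimorphism

/-! ### Forms of degree one and two in coordinates -/

section FormsAsMultilinearMaps

variable {E : Type*} [NormedAddCommGroup E] [NormedSpace ℝ E]
  {F : Type*} [NormedAddCommGroup F] [NormedSpace ℝ F]

/-- A form of degree one on a vector space, as a linear functional. -/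
noncomputable def toFunctional : (E [⋀^Fin 1]→L[ℝ] ℝ) →L[ℝ] E →L[ℝ] ℝ :=
  ((ContinuousAlternatingMap.ofSubsingletonLIE (𝕜 := ℝ) (E := E) (F := ℝ) (0 : Fin 1)).symm.toContinuousLinearEquiv :
    (E [⋀^Fin 1]→L[ℝ] ℝ) →L[ℝ] E →L[ℝ] ℝ)

lemma toFunctional_apply (σ : E [⋀^Fin 1]→L[ℝ] ℝ) (u : E) : toFunctional σ u = σ ![u] := by
  change σ (fun _ => u) = σ ![u]
  congr 1
  ext i
  fin_cases i
  rfl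

/-- A form of degree two on a vector space, as a bilinear map. -/
noncomputable def toBilinear : (E [⋀^Fin 2]→L[ℝ] ℝ) →L[ℝ] E →L[ℝ] E →L[ℝ] ℝ :=
  (ContinuousLinearMap.compL ℝ E (E [⋀^Fin 1]→L[ℝ] ℝ) (E →L[ℝ] ℝ) toFunctional).comp
    (ContinuousAlternatingMap.curryLeftLI (𝕜 := ℝ) (E := E) (F := ℝ) (n := 1)).toContinuousLinearMap

lemma toBilinear_apply (σ : E [⋀^Fin 2]→L[ℝ] ℝ) (u v : E) : toBilinear σ u v = σ ![u, v] := by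
  change toFunctional (σ.curryLeft u) v = _
  rw [toFunctional_apply, ContinuousAlternatingMap.curryLeft_apply_apply]

lemma toBilinear_swap (σ : E [⋀^Fin 2]→L[ℝ] ℝ) (u v : E) :
    toBilinear σ u v = - toBilinear σ v u := by
  have h1 : ∀ w, toBilinear σ w w = 0 := fun w => by
    rw [toBilinear_apply]
    exact σ.map_eq_zero_of_eq _ (i := 0) (j := 1) (by simp) (by simp)
  have h := h1 (u + v)
  simp only [map_add, _root_.add_apply, h1] at h
  linarith

lemma toFunctional_comp (σ : F [⋀^Fin 1]→L[ℝ] ℝ) (A : E →L[ℝ] F) :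
    toFunctional (σ.compContinuousLinearMap A) = (toFunctional σ).comp A := by
  ext u
  rw [ContinuousLinearMap.comp_apply, toFunctional_apply, toFunctional_apply,
    ContinuousAlternatingMap.compContinuousLinearMap_apply]
  congr 1
  ext i
  fin_cases i
  rfl

lemma toBilinear_comp (σ : F [⋀^Fin 2]→L[ℝ] ℝ) (A : E →L[ℝ] F) (u v : E) :
    toBilinear (σ.compContinuousLinearMap A) u v = toBilinear σ (A u) (A v) := by
  rw [toBilinear_apply, toBilinear_apply,
    ContinuousAlternatingMap.compContinuousLinearMap_apply]
  congr 1
  ext i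
  fin_cases i <;> rfl

lemma extDeriv_one_form {a : E → E [⋀^Fin 1]→L[ℝ] ℝ} {p : E} (ha : DifferentiableAt ℝ a p)
    (u v : E) : extDeriv a p ![u, v] =
      fderiv ℝ (fun x => toFunctional (a x)) p u v -
        fderiv ℝ (fun x => toFunctional (a x)) p v u := by
  have h1 : fderiv ℝ (fun x => toFunctional (a x)) p = toFunctional.comp (fderiv ℝ a p) :=
    (toFunctional.hasFDerivAt.comp p ha.hasFDerivAt).fderiv
  rw [h1, extDeriv, ContinuousAlternatingMap.alternatizeUncurryFin_apply]
  simp only [ContinuousLinearMap.comp_apply, toFunctional_apply]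
  refine (Fin.sum_univ_two _).trans ?_
  have e0 : (0 : Fin 2).removeNth ![u, v] = ![v] := by ext i; fin_cases i; rfl
  have e1 : (1 : Fin 2).removeNth ![u, v] = ![u] := by ext i; fin_cases i; rfl
  rw [e0, e1]
  simp [sub_eq_add_neg]

set_option maxSynthPendingDepth 3 in
lemma extDeriv_two_form {b : E → E [⋀^Fin 2]→L[ℝ] ℝ} {p : E} (hb : DifferentiableAt ℝ b p)
    (u v w : E) : extDeriv b p ![u, v, w] =
      fderiv ℝ (fun x => toBilinear (b x)) p u v w - fderiv ℝ (fun x => toBilinear (b x)) p v u w +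
        fderiv ℝ (fun x => toBilinear (b x)) p w u v := by
  have h1 : fderiv ℝ (fun x => toBilinear (b x)) p = toBilinear.comp (fderiv ℝ b p) :=
    (toBilinear.hasFDerivAt.comp p hb.hasFDerivAt).fderiv
  rw [h1, extDeriv, ContinuousAlternatingMap.alternatizeUncurryFin_apply]
  simp only [ContinuousLinearMap.comp_apply, toBilinear_apply]
  refine (Fin.sum_univ_three _).trans ?_
  have e0 : (0 : Fin 3).removeNth ![u, v, w] = ![v, w] := by ext i; fin_cases i <;> rfl
  have e1 : (1 : Fin 3).removeNth ![u, v, w] = ![u, w] := by ext i; fin_cases i <;> rfl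
  have e2 : (2 : Fin 3).removeNth ![u, v, w] = ![u, v] := by ext i; fin_cases i <;> rfl
  rw [e0, e1, e2]
  simp [sub_eq_add_neg]

end FormsAsMultilinearMaps

section Pullback

variable {E : Type*} [NormedAddCommGroup E] [NormedSpace ℝ E]
  {F : Type*} [NormedAddCommGroup F] [NormedSpace ℝ F]
  {M : Type*} [TopologicalSpace M] [ChartedSpace E M]

namespace DForm

/-- The pull-back of a form, in terms of its expression in a chart. -/
lemma pullback_eq_inChart {k : ℕ} (η : DForm E M k) {u : F → M} {c : OpenPartialHomeomorph M E}
    (hc : IsSmoothHomeo (E := E) (F := E) c) {w : F}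
    (hu : MDifferentiableAt 𝓘(ℝ, F) 𝓘(ℝ, E) u w) (hw : u w ∈ c.source) :
    (DForm.pullback u η : DForm F F k) w =
      (η.inChart c (c (u w))).compContinuousLinearMap (fderiv ℝ (fun x => c (u x)) w) := by
  have h1 : fderiv ℝ (fun x => c (u x)) w =
      (manifoldDeriv E E c (u w)).comp (manifoldDeriv F E u w) := by
    rw [← manifoldDeriv_eq_fderiv]
    exact manifoldDeriv_comp w (hc.mdifferentiableAt hw) hu
  have h2 : (manifoldDeriv E E c.symm (c (u w))).comp (manifoldDeriv E E c (u w)) =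
      ContinuousLinearMap.id ℝ E := hc.deriv_symm_comp_deriv hw
  ext v
  simp only [inChart, pullback, ContinuousAlternatingMap.compContinuousLinearMap_apply, h1,
    c.left_inv hw]
  congr 1
  ext i
  exact (DFunLike.congr_fun h2 (manifoldDeriv F E u w (v i))).symm

variable {u : F → M} {w : F} {W : Set M}

lemma SmoothOn.contDiffAt_inChart {k : ℕ} {η : DForm E M k} (hη : η.SmoothOn W) (hW : IsOpen W)
    {m : M} (hm : m ∈ W) : ContDiffAt ℝ ∞ (η.inChart (chartAt E m)) (chartAt E m m) := by
  refine (hη _ (chart_mem_atlas E m)).contDiffAt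
    (((chartAt E m).isOpen_inter_preimage_symm hW).mem_nhds ⟨mem_chart_target E m, ?_⟩)
  rw [mem_preimage, (chartAt E m).left_inv (mem_chart_source E m)]
  exact hm

variable [IsManifold 𝓘(ℝ, E) ∞ M]

lemma eventually_pullback_eq {k : ℕ} (η : DForm E M k)
    (hu : ∀ᶠ x in 𝓝 w, ContMDiffAt 𝓘(ℝ, F) 𝓘(ℝ, E) ∞ u x) :
    (DForm.pullback u η : DForm F F k) =ᶠ[𝓝 w] fun x =>
      (η.inChart (chartAt E (u w)) (chartAt E (u w) (u x))).compContinuousLinearMap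
        (fderiv ℝ (fun x => chartAt E (u w) (u x)) x) := by
  filter_upwards [hu, hu.self_of_nhds.continuousAt.eventually
    ((chartAt E (u w)).open_source.mem_nhds (mem_chart_source E (u w)))] with x hx hxs
  exact pullback_eq_inChart η (isSmoothHomeo_chart (chart_mem_atlas E _))
    (hx.mdifferentiableAt (by simp)) hxs

lemma contDiffAt_chart_comp (hu : ContMDiffAt 𝓘(ℝ, F) 𝓘(ℝ, E) ∞ u w) :
    ContDiffAt ℝ ∞ (fun x => chartAt E (u w) (u x)) w := by
  rw [← contMDiffAt_iff_contDiffAt]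
  exact ContMDiffAt.comp (g := chartAt E (u w)) w
    ((isSmoothHomeo_chart (chart_mem_atlas E (u w))).contMDiffAt (mem_chart_source E _)) hu

lemma SmoothOn.differentiableAt_pullback {k : ℕ} {η : DForm E M k} (hη : η.SmoothOn W)
    (hW : IsOpen W) (hu : ∀ᶠ x in 𝓝 w, ContMDiffAt 𝓘(ℝ, F) 𝓘(ℝ, E) ∞ u x) (hw : u w ∈ W) :
    DifferentiableAt ℝ (DForm.pullback u η : DForm F F k) w := by
  refine DifferentiableAt.congr_of_eventuallyEq ?_ (eventually_pullback_eq η hu)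
  have hc := contDiffAt_chart_comp hu.self_of_nhds
  refine DifferentiableAt.continuousAlternatingMapCompContinuousLinearMap ?_ ?_
  · exact DifferentiableAt.comp w
      ((hη.contDiffAt_inChart hW hw).differentiableAt (by simp)) (hc.differentiableAt (by simp))
  · exact (ContDiffAt.fderiv_right (m := 1) (n := 2) (hc.of_le ENat.LEInfty.out)
      (by norm_num)).differentiableAt one_ne_zero

lemma SmoothOn.contDiffAt_toFunctional_pullback {η : DForm E M 1} (hη : η.SmoothOn W)
    (hW : IsOpen W) (hu : ∀ᶠ x in 𝓝 w, ContMDiffAt 𝓘(ℝ, F) 𝓘(ℝ, E) ∞ u x) (hw : u w ∈ W) :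
    ContDiffAt ℝ 1 (fun x => toFunctional ((DForm.pullback u η : DForm F F 1) x)) w := by
  have hc := contDiffAt_chart_comp hu.self_of_nhds
  have h1 : ContDiffAt ℝ 1 (fun x => (toFunctional (η.inChart (chartAt E (u w))
      (chartAt E (u w) (u x)))).comp (fderiv ℝ (fun x => chartAt E (u w) (u x)) x)) w := by
    refine ContDiffAt.clm_comp ?_ ?_
    · refine (toFunctional (E := E)).contDiff.contDiffAt.comp w (ContDiffAt.of_le ?_ (ENat.LEInfty.out))
      exact ContDiffAt.comp w (hη.contDiffAt_inChart hW hw) hc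
    · exact ContDiffAt.fderiv_right (m := 1) (n := 2) (hc.of_le ENat.LEInfty.out) (by norm_num)
  refine h1.congr_of_eventuallyEq ?_
  filter_upwards [eventually_pullback_eq η hu] with x hx
  rw [hx, toFunctional_comp]

set_option maxSynthPendingDepth 3 in
lemma SmoothOn.contDiffAt_toBilinear_pullback [FiniteDimensional ℝ F] {η : DForm E M 2}
    (hη : η.SmoothOn W)
    (hW : IsOpen W) (hu : ∀ᶠ x in 𝓝 w, ContMDiffAt 𝓘(ℝ, F) 𝓘(ℝ, E) ∞ u x) (hw : u w ∈ W) :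
    ContDiffAt ℝ 1 (fun x => toBilinear ((DForm.pullback u η : DForm F F 2) x)) w := by
  have hc := contDiffAt_chart_comp hu.self_of_nhds
  have hd : ContDiffAt ℝ 1 (fderiv ℝ (fun x => chartAt E (u w) (u x))) w :=
    ContDiffAt.fderiv_right (m := 1) (n := 2) (hc.of_le ENat.LEInfty.out) (by norm_num)
  have h0 : ContDiffAt ℝ 1 (fun x => toBilinear (η.inChart (chartAt E (u w))
      (chartAt E (u w) (u x)))) w := by
    refine (toBilinear (E := E)).contDiff.contDiffAt.comp w (ContDiffAt.of_le ?_ (ENat.LEInfty.out))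
    exact ContDiffAt.comp w (hη.contDiffAt_inChart hW hw) hc
  let D : F → F →L[ℝ] E := fderiv ℝ (fun x => chartAt E (u w) (u x))
  have h1 : ContDiffAt ℝ 1 (fun x => (ContinuousLinearMap.compL ℝ F E ℝ).flip (D x) ∘L
      (toBilinear (η.inChart (chartAt E (u w)) (chartAt E (u w) (u x)))).comp (D x)) w := by
    refine ContDiffAt.clm_comp ?_ (h0.clm_comp hd)
    exact (ContinuousLinearMap.compL ℝ F E ℝ).flip.contDiff.contDiffAt.comp w hd
  refine h1.congr_of_eventuallyEq ?_
  filter_upwards [eventually_pullback_eq η hu] with x hx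
  ext a b
  rw [hx, toBilinear_comp]
  rfl

lemma HasExtDerivOn.extDeriv_pullback {k : ℕ} {α : DForm E M k} {β : DForm E M (k + 1)}
    (h : α.HasExtDerivOn β W) (hα : α.SmoothOn W)
    (hW : IsOpen W) (hu : ∀ᶠ x in 𝓝 w, ContMDiffAt 𝓘(ℝ, F) 𝓘(ℝ, E) ∞ u x) (hw : u w ∈ W) :
    extDeriv (DForm.pullback u α : DForm F F k) w = (DForm.pullback u β : DForm F F (k + 1)) w := by
  have hc := contDiffAt_chart_comp hu.self_of_nhds
  have hmem : chartAt E (u w) (u w) ∈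
      (chartAt E (u w)).target ∩ (chartAt E (u w)).symm ⁻¹' W := by
    refine ⟨mem_chart_target E _, ?_⟩
    rw [mem_preimage, (chartAt E (u w)).left_inv (mem_chart_source E _)]
    exact hw
  rw [(eventually_pullback_eq α hu).extDeriv_eq, (eventually_pullback_eq β hu).self_of_nhds]
  beta_reduce
  rw [← h _ (chart_mem_atlas E _) _ hmem]
  exact _root_.extDeriv_pullback (r := ∞)
    ((hα.contDiffAt_inChart hW hw).differentiableAt (by simp)) hc (by
      rw [minSmoothness_of_isRCLikeNormedField]; exact ENat.LEInfty.out)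

end DForm

end Pullback

/-! ### The contribution of a contact point in the manifold of objects -/

section LocalContribution

variable {E : Type*} [NormedAddCommGroup E] [NormedSpace ℝ E] [FiniteDimensional ℝ E]
  {G : OrbifoldGroupoid E} {J : AlmostComplexStructure G} {Z : Set G.Obj}

/-- Coordinates of the manifold of objects in which the normal coordinate `h` is linear. -/
theorem IsNormalCoordinate.exists_adapted_chart {z : G.Obj} {h : G.Obj → ℂ}
    (hh : IsNormalCoordinate J Z z h) (hz : z ∈ Z) :
    ∃ (L : E →L[ℝ] ℂ) (R : ℂ →L[ℝ] E) (q : OpenPartialHomeomorph G.Obj E), (∀ w, L (R w) = w) ∧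
      IsSmoothHomeo (E := E) (F := E) q ∧ z ∈ q.source ∧ q z = 0 ∧
      ∀ x ∈ q.source, L (q x) = h x ∧ (x ∈ Z ↔ h x = 0) := by
  have hh0 := hh
  obtain ⟨U, hU, hzU, hs, hmem, hd⟩ := hh
  set c := chartAt E z with hc
  have hcs : IsSmoothHomeo (E := E) (F := E) c := isSmoothHomeo_chart (chart_mem_atlas E z)
  have hzc : z ∈ c.source := mem_chart_source E z
  have hhat : ∀ x ∈ U, ContMDiffAt 𝓘(ℝ, E) 𝓘(ℝ, ℂ) ∞ h x := fun x hx =>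
    hs.contMDiffAt (hU.mem_nhds hx)
  let g : E → ℂ := fun p => h (c.symm p)
  have hg : ∀ x ∈ c.source ∩ U, ContDiffAt ℝ ∞ g (c x) := by
    intro x hx
    rw [← contMDiffAt_iff_contDiffAt]
    refine ContMDiffAt.comp (g := h) _ ?_ (hcs.symm.contMDiffAt (c.map_source hx.1))
    have h1 : c.symm (c x) = x := c.left_inv hx.1
    rw [h1]
    exact hhat x hx.2
  have hgs : Function.Surjective (fderiv ℝ g (c z)) := by
    have hlm : c.symm (c z) = z := c.left_inv hzc
    have h1 : fderiv ℝ g (c z) =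
        (manifoldDeriv E ℂ h (c.symm (c z))).comp (manifoldDeriv E E c.symm (c z)) := by
      rw [← manifoldDeriv_eq_fderiv]
      refine manifoldDeriv_comp (g := h) (c z) ?_ (hcs.symm.mdifferentiableAt (c.map_source hzc))
      rw [hlm]
      exact (hhat z hzU).mdifferentiableAt (by simp)
    rw [h1, hlm]
    intro w
    obtain ⟨v, hv⟩ := (hd z ⟨hzU, hz⟩).1 w
    refine ⟨manifoldDeriv E E c z v, ?_⟩
    have h2 := DFunLike.congr_fun (hcs.deriv_symm_comp_deriv hzc) v
    simp only [ContinuousLinearMap.comp_apply] at h2 ⊢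
    rw [h2]
    exact hv
  have hg0 : g (c z) = 0 := by
    simp only [g, c.left_inv hzc]
    exact hh0.eq_zero hz
  obtain ⟨L, R, Φ, hLR, hp₀, hΦ0, hLΦ, hΦ⟩ :=
    exists_straightening ((hg z ⟨hzc, hzU⟩).of_le ENat.LEInfty.out) hg0 hgs
  -- The chart at `z`, followed by the straightening of the coordinate.
  let q := (c.trans Φ).restrOpen U hU
  have hq : ∀ x, q x = Φ (c x) := fun x => rfl
  have hqs : ∀ x, x ∈ q.source ↔ (x ∈ c.source ∧ c x ∈ Φ.source) ∧ x ∈ U := fun x => by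
    simp only [q, OpenPartialHomeomorph.restrOpen_source, OpenPartialHomeomorph.trans_source,
      mem_inter_iff, mem_preimage]
  refine ⟨L, R, q, hLR, ⟨fun x hx => ?_, fun p hp => ?_⟩, (hqs z).2 ⟨⟨hzc, hp₀⟩, hzU⟩,
    (hq z).trans hΦ0, fun x hx => ⟨?_, hmem x ((hqs x).1 hx).2⟩⟩
  · obtain ⟨⟨h1, h2⟩, h3⟩ := (hqs x).1 hx
    refine ContMDiffAt.contMDiffWithinAt ?_
    refine ContMDiffAt.comp (g := Φ) x ?_ (hcs.contMDiffAt h1)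
    rw [contMDiffAt_iff_contDiffAt]
    exact (hΦ _ h2 ∞ (by simp) (hg x ⟨h1, h3⟩)).1
  · have hx := q.map_target hp
    obtain ⟨⟨h1, h2⟩, h3⟩ := (hqs _).1 hx
    refine ContMDiffAt.contMDiffWithinAt ?_
    have h4 := (hΦ _ h2 ∞ (by simp) (hg _ ⟨h1, h3⟩)).2
    rw [← hq, q.right_inv hp] at h4
    refine ContMDiffAt.comp (g := c.symm) (f := Φ.symm) p ?_ (contMDiffAt_iff_contDiffAt.2 h4)
    refine hcs.symm.contMDiffAt ?_
    have h5 : Φ.symm p = c (q.symm p) := by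
      conv_lhs => rw [← q.right_inv hp]
      rw [hq, Φ.left_inv h2]
    rw [h5]
    exact c.map_source h1
  · rw [hq, hLΦ]
    simp only [g, c.left_inv ((hqs x).1 hx).1.1]

omit [FiniteDimensional ℝ E] in
lemma DForm.pullback_comp_linear {F : Type*} [NormedAddCommGroup F] [NormedSpace ℝ F]
    {M : Type*} [TopologicalSpace M] [ChartedSpace E M] {k : ℕ} (η : DForm E M k) {u : E → M}
    (A : F →L[ℝ] E) {w : F} (hu : MDifferentiableAt 𝓘(ℝ, E) 𝓘(ℝ, E) u (A w)) :
    (DForm.pullback (fun x => u (A x)) η : DForm F F k) w =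
      ((DForm.pullback u η : DForm E E k) (A w)).compContinuousLinearMap A := by
  have h1 : manifoldDeriv F E (fun x => u (A x)) w = (manifoldDeriv E E u (A w)).comp A := by
    rw [manifoldDeriv_comp w hu (A.differentiableAt.mdifferentiableAt),
      manifoldDeriv_eq_fderiv, A.fderiv]
  simp only [pullback, h1]
  rfl

end LocalContribution

section LocalContribution

variable {E : Type*} [NormedAddCommGroup E] [NormedSpace ℝ E] [FiniteDimensional ℝ E]
  {G : OrbifoldGroupoid E} {J : AlmostComplexStructure G} {Z : Set G.Obj}

omit [FiniteDimensional ℝ E] in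
/-- In adapted coordinates, the discs `ζ ↦ R (s * ζ)` are normal discs of the divisor. -/
lemma isNormalDisc_of_adapted_chart {z : G.Obj} {h : G.Obj → ℂ}
    (hh : IsNormalCoordinate J Z z h) {L : E →L[ℝ] ℂ} {R : ℂ →L[ℝ] E}
    {q : OpenPartialHomeomorph G.Obj E} (hLR : ∀ w, L (R w) = w)
    (hq : IsSmoothHomeo (E := E) (F := E) q) (hz : z ∈ q.source) (hqz : q z = 0)
    (hqh : ∀ x ∈ q.source, L (q x) = h x ∧ (x ∈ Z ↔ h x = 0)) {s : ℝ} (hs : s ≠ 0)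
    (hst : ∀ ζ ∈ Metric.ball (0 : ℂ) 2, R (s * ζ) ∈ q.target) :
    IsNormalDisc J Z fun ζ => q.symm (R (s * ζ)) := by
  have hval : ∀ ζ ∈ Metric.ball (0 : ℂ) 2, h (q.symm (R (s * ζ))) = s * ζ := by
    intro ζ hζ
    rw [← (hqh _ (q.map_target (hst ζ hζ))).1, q.right_inv (hst ζ hζ), hLR]
  refine ⟨⟨2, one_lt_two, fun ζ hζ => ContMDiffAt.contMDiffWithinAt ?_⟩, fun ζ hζ => ?_, ?_⟩
  · refine ContMDiffAt.comp (g := q.symm) ζ (hq.symm.contMDiffAt (hst ζ hζ)) ?_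
    rw [contMDiffAt_iff_contDiffAt]
    fun_prop
  · have hζ' : ζ ∈ Metric.ball (0 : ℂ) 2 := Metric.closedBall_subset_ball one_lt_two hζ
    rw [(hqh _ (q.map_target (hst ζ hζ'))).2, hval ζ hζ']
    simp [hs]
  · have h0 : q.symm (R (s * 0)) = z := by
      rw [mul_zero, map_zero, ← hqz, q.left_inv hz]
    refine ⟨h, s, by rw [h0]; exact hh, by exact_mod_cast hs, ?_⟩
    refine Asymptotics.IsBigO.congr' (Asymptotics.isBigO_zero _ _) ?_ Filter.EventuallyEq.rfl
    filter_upwards [Metric.ball_mem_nhds (0 : ℂ) two_pos] with ζ hζ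
    rw [hval ζ hζ, sub_self]

set_option maxSynthPendingDepth 3 in
/-- The contribution of a contact point to the integral of `η`: for a radial cut-off function `β`
and the primitive `α` of `η` off the divisor, the pull-back of `β(|w|²) η + d(β(|w|²)) ∧ α`, which is
`d(β(|w|²) α)` off the contact point, has as integral the contact order times `β 0`. -/
theorem integral_cutoff_pullback_eq_mul_contact_order (hZc : IsClosed Z) {η : DForm E G.Obj 2}
    {α : DForm E G.Obj 1} (hη : η.SmoothOn univ) (hηc : η.HasExtDerivOn 0 univ)
    (hα : α.SmoothOn Zᶜ) (hαη : α.HasExtDerivOn η Zᶜ)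
    (hthom : ∀ u : ℂ → G.Obj, IsNormalDisc J Z u → discIntegral u η - circleFormIntegral u α = 1)
    {φ : ℂ → G.Obj} (hφ : ∀ᶠ w in 𝓝 0, ContMDiffAt 𝓘(ℝ, ℂ) 𝓘(ℝ, E) ∞ φ w) (hφZ : φ 0 ∈ Z)
    {h : G.Obj → ℂ} (hh : IsNormalCoordinate J Z (φ 0) h) {d : ℕ}
    (hd : (fun w : ℂ => h (φ w) - w ^ d) =O[𝓝 0] fun w : ℂ => w ^ (d + 1)) :
    ∃ ε₁ > 0, ∀ ε₀, 0 < ε₀ → ε₀ < ε₁ → ∀ β : ℝ → ℝ, ContDiff ℝ ∞ β →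
      (∃ s₀ > 0, ∀ s < s₀, β s = β 0) → (∀ s, ε₀ ^ 2 ≤ s → β s = 0) →
      ∫ w : ℂ, (β (‖w‖ ^ 2) * (DForm.pullback φ η : DForm ℂ ℂ 2) w ![1, Complex.I] +
        (2 * deriv β (‖w‖ ^ 2) * w.re * (DForm.pullback φ α : DForm ℂ ℂ 1) w ![Complex.I] -
          2 * deriv β (‖w‖ ^ 2) * w.im * (DForm.pullback φ α : DForm ℂ ℂ 1) w ![1])) = d * β 0 := by
  obtain ⟨L, R, q, hLR, hq, hzq, hqz, hqh⟩ := hh.exists_adapted_chart hφZ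
  have h0t : (0 : E) ∈ q.target := hqz ▸ q.map_source hzq
  obtain ⟨δ, hδ, hδt⟩ := Metric.isOpen_iff.1 q.open_target 0 h0t
  -- The form is cut off outside the domain of the chart, to have coefficients on the whole space.
  let χ : ContDiffBump (0 : E) := ⟨δ / 3, δ / 2, by positivity, by linarith⟩
  let b : DForm E E 2 := DForm.pullback q.symm η
  let B : E → E →L[ℝ] E →L[ℝ] ℝ := fun p => χ p • toBilinear (b p)
  let A : E → E →L[ℝ] ℝ := fun p => toFunctional ((DForm.pullback q.symm α : DForm E E 1) p)
  have hqs : ∀ p ∈ q.target, ∀ᶠ x in 𝓝 p, ContMDiffAt 𝓘(ℝ, E) 𝓘(ℝ, E) ∞ q.symm x := by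
    intro p hp
    filter_upwards [q.open_target.mem_nhds hp] with x hx using hq.symm.contMDiffAt hx
  have hbs : ∀ p ∈ q.target, ContDiffAt ℝ 1 (fun p => toBilinear (b p)) p := fun p hp =>
    hη.contDiffAt_toBilinear_pullback isOpen_univ (hqs p hp) (mem_univ _)
  have hB : ContDiff ℝ 1 B := by
    rw [contDiff_iff_contDiffAt]
    intro p
    by_cases hp : p ∈ q.target
    · exact χ.contDiff.contDiffAt.smul (hbs p hp)
    · have hp2 : p ∉ tsupport χ := by
        rw [χ.tsupport_eq]
        refine fun hp3 => hp (hδt (Metric.closedBall_subset_ball (?_ : δ / 2 < δ) hp3))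
        linarith
      refine (contDiffAt_const (c := 0)).congr_of_eventuallyEq ?_
      filter_upwards [(isClosed_tsupport χ).isOpen_compl.mem_nhds hp2] with x hx
      simp only [B, image_eq_zero_of_notMem_tsupport hx, zero_smul]
  have hball : ∀ p ∈ Metric.ball (0 : E) (δ / 3), p ∈ q.target := fun p hp =>
    hδt (Metric.ball_subset_ball (by linarith) hp)
  have hB1 : ∀ p ∈ Metric.ball (0 : E) (δ / 3), B p = toBilinear (b p) := by
    intro p hp
    have : χ p = 1 := χ.one_of_mem_closedBall (Metric.ball_subset_closedBall hp)
    simp only [B, this, one_smul]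
  have hB1' : ∀ p ∈ Metric.ball (0 : E) (δ / 3), fderiv ℝ B p =
      fderiv ℝ (fun p => toBilinear (b p)) p := by
    intro p hp
    refine Filter.EventuallyEq.fderiv_eq ?_
    filter_upwards [Metric.isOpen_ball.mem_nhds hp] with x hx using hB1 x hx
  have hoff : ∀ p ∈ Metric.ball (0 : E) (δ / 3), L p ≠ 0 → q.symm p ∈ Zᶜ := by
    intro p hp hLp hpZ
    have h1 := hqh _ (q.map_target (hball p hp))
    rw [q.right_inv (hball p hp)] at h1
    exact hLp (h1.1.trans (h1.2.1 hpZ))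
  have hhd : (fun w => L (q (φ w)) - w ^ d) =O[𝓝 0] fun w : ℂ => w ^ (d + 1) := by
    refine hd.congr' ?_ Filter.EventuallyEq.rfl
    filter_upwards [hφ.self_of_nhds.continuousAt.eventually (q.open_source.mem_nhds hzq)] with w hw
    rw [(hqh _ hw).1]
  have hqφ : ContDiffAt ℝ 2 (fun w => q (φ w)) 0 := by
    refine ContDiffAt.of_le ?_ (ENat.LEInfty.out : (2 : WithTop ℕ∞) ≤ ∞)
    rw [← contMDiffAt_iff_contDiffAt]
    exact ContMDiffAt.comp (g := q) 0 (hq.contMDiffAt hzq) hφ.self_of_nhds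
  obtain ⟨ε₁, hε₁, hmain⟩ := integral_cutoff_eq_mul_contact_order L R hLR
    (δ := δ / 3) (by positivity) hB
    (fun x u v => by
      simp only [B, _root_.smul_apply, smul_eq_mul]
      rw [toBilinear_swap]; ring)
    (fun x hx u v w => by
      rw [hB1' x hx, ← extDeriv_two_form (hη.differentiableAt_pullback isOpen_univ
        (hqs x (hball x hx)) (mem_univ _))]
      rw [hηc.extDeriv_pullback hη isOpen_univ (hqs x (hball x hx)) (mem_univ _)]
      rfl)
    (A := A)
    (fun x hx hLx => hα.contDiffAt_toFunctional_pullback hZc.isOpen_compl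
      (hqs x (hball x hx)) (hoff x hx hLx))
    (fun x hx hLx u v => by
      rw [hB1 x hx, toBilinear_apply, ← extDeriv_one_form (hα.differentiableAt_pullback
        hZc.isOpen_compl (hqs x (hball x hx)) (hoff x hx hLx))]
      rw [hαη.extDeriv_pullback hα hZc.isOpen_compl (hqs x (hball x hx)) (hoff x hx hLx)])
    (by
      have hev : ∀ᶠ s : ℝ in 𝓝[>] 0, ∀ ζ ∈ Metric.ball (0 : ℂ) 2,
          R (s * ζ) ∈ Metric.ball (0 : E) (δ / 3) := by
        have h1 : ∀ᶠ s : ℝ in 𝓝 0, s * (2 * ‖R‖) < δ / 3 :=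
          ContinuousAt.eventually_lt (by fun_prop) continuousAt_const (by simp; positivity)
        filter_upwards [nhdsWithin_le_nhds h1, self_mem_nhdsWithin] with s h2 h3 ζ hζ
        rw [mem_ball_zero_iff] at hζ ⊢
        have h3' : 0 < s := h3
        calc ‖R (s * ζ)‖ ≤ ‖R‖ * ‖(s : ℂ) * ζ‖ := R.le_opNorm _
          _ = s * (‖ζ‖ * ‖R‖) := by
            rw [norm_mul, Complex.norm_real, Real.norm_of_nonneg h3'.le]; ring
          _ ≤ s * (2 * ‖R‖) := by gcongr
          _ < δ / 3 := h2
      filter_upwards [hev, self_mem_nhdsWithin] with s hs hs0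
      have hs0' : (0 : ℝ) < s := hs0
      have hdisc := hthom _ (isNormalDisc_of_adapted_chart hh hLR hq hzq hqz hqh hs0'.ne'
        fun ζ hζ => hball _ (hs ζ hζ))
      let S : ℂ →L[ℝ] E := R.comp ((s : ℂ) • ContinuousLinearMap.id ℝ ℂ)
      have hS : ∀ ζ, R (s * ζ) = S ζ := fun ζ => rfl
      have hd2 : ∀ {k : ℕ} (ρ : DForm E G.Obj k), ∀ ζ ∈ Metric.ball (0 : ℂ) 2,
          (DForm.pullback (fun ζ => q.symm (R (s * ζ))) ρ : DForm ℂ ℂ k) ζ =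
            ((DForm.pullback q.symm ρ : DForm E E k) (R (s * ζ))).compContinuousLinearMap S := by
        intro k ρ ζ hζ
        exact DForm.pullback_comp_linear ρ S
          (hq.symm.mdifferentiableAt (hball _ (hs ζ hζ)))
      refine Eq.trans ?_ hdisc
      rw [discIntegral, circleFormIntegral]
      congr 1
      · refine setIntegral_congr_fun Metric.isClosed_closedBall.measurableSet fun ζ hζ => ?_
        have hζ' : ζ ∈ Metric.ball (0 : ℂ) 2 := Metric.closedBall_subset_ball one_lt_two hζ
        rw [hB1 _ (hs ζ hζ'), hd2 η ζ hζ', ← toBilinear_apply, toBilinear_comp]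
        simp only [b, ← hS, mul_one]
      · refine intervalIntegral.integral_congr fun t _ => ?_
        have hζ' : Complex.exp (t * Complex.I) ∈ Metric.ball (0 : ℂ) 2 := by
          rw [mem_ball_zero_iff, Complex.norm_exp_ofReal_mul_I]; exact one_lt_two
        rw [hd2 α _ hζ', ← toFunctional_apply, toFunctional_comp, ContinuousLinearMap.comp_apply,
          ← hS])
    hqφ hqz hhd
  obtain ⟨ε₂, hε₂, hε₂b⟩ := Metric.eventually_nhds_iff.1
    ((hφ.and (hφ.self_of_nhds.continuousAt.eventually (q.open_source.mem_nhds hzq))).and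
      (hqφ.continuousAt.eventually
        (show ∀ᶠ p in 𝓝 (q (φ 0)), p ∈ Metric.ball (0 : E) (δ / 3) by
          rw [hqz]; exact Metric.ball_mem_nhds (0 : E) (by positivity))))
  refine ⟨min ε₁ ε₂, lt_min hε₁ hε₂, fun ε₀ hε₀ hlt β hβ hβ0 hβs => ?_⟩
  rw [← hmain ε₀ hε₀ (hlt.trans_le (min_le_left _ _)) β hβ hβ0 hβs]
  refine integral_congr_ae (Filter.Eventually.of_forall fun w => ?_)
  beta_reduce
  by_cases hw : ‖w‖ < ε₂
  · obtain ⟨⟨h1, h2⟩, h3⟩ := hε₂b (y := w) (by rwa [dist_zero_right])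
    have h4 : ∀ {k : ℕ} (ρ : DForm E G.Obj k), (DForm.pullback φ ρ : DForm ℂ ℂ k) w =
        ((DForm.pullback q.symm ρ : DForm E E k) (q (φ w))).compContinuousLinearMap
          (fderiv ℝ (fun x => q (φ x)) w) := fun ρ =>
      DForm.pullback_eq_inChart ρ hq (h1.mdifferentiableAt (by simp)) h2
    rw [hB1 _ h3, h4 η, h4 α, ← toBilinear_apply, ← toFunctional_apply, ← toFunctional_apply,
      toBilinear_comp, toFunctional_comp]
    simp only [ContinuousLinearMap.comp_apply, A, b]
  · have h1 : ε₀ ^ 2 < ‖w‖ ^ 2 := by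
      have := hlt.trans_le ((min_le_right ε₁ ε₂).trans (not_lt.1 hw))
      gcongr
    have h2 : deriv β (‖w‖ ^ 2) = 0 := by
      have : β =ᶠ[𝓝 (‖w‖ ^ 2)] fun _ => 0 := by
        filter_upwards [lt_mem_nhds h1] with s hs using hβs s hs.le
      rw [this.deriv_eq, deriv_const]
    simp [hβs _ h1.le, h2]

end LocalContribution

/-! ### Cutting off a form together with its primitive -/

section Wedge

variable {E : Type*} [NormedAddCommGroup E] [NormedSpace ℝ E]
  {F : Type*} [NormedAddCommGroup F] [NormedSpace ℝ F]

/-- The exterior product of two linear functionals. -/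
noncomputable def wedge (a b : E →L[ℝ] ℝ) : E [⋀^Fin 2]→L[ℝ] ℝ where
  toFun m := a (m 0) * b (m 1) - a (m 1) * b (m 0)
  map_update_add' m i x y := by fin_cases i <;> simp <;> ring
  map_update_smul' m i c x := by fin_cases i <;> simp <;> ring
  map_eq_zero_of_eq' m i j hm hij := by
    fin_cases i <;> fin_cases j <;> simp_all
  cont := by fun_prop

lemma wedge_apply (a b : E →L[ℝ] ℝ) (u v : E) : wedge a b ![u, v] = a u * b v - a v * b u := rfl

lemma wedge_comp (a b : F →L[ℝ] ℝ) (A : E →L[ℝ] F) :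
    (wedge a b).compContinuousLinearMap A = wedge (a.comp A) (b.comp A) := rfl

lemma wedge_zero_left (b : E →L[ℝ] ℝ) : wedge 0 b = 0 := by
  ext m
  change (0 : ℝ) * b (m 1) - 0 * b (m 0) = 0
  ring

variable {M : Type*} [TopologicalSpace M] [ChartedSpace E M]

/-- The form `v ξ + dv ∧ β`. If `ξ = dβ`, this is the exterior derivative of `v β`. -/
noncomputable def cutoffForm (v : M → ℝ) (ξ : DForm E M 2) (β : DForm E M 1) : DForm E M 2 :=
  fun x => v x • ξ x + wedge (manifoldDeriv E ℝ v x) (toFunctional (β x))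

lemma cutoffForm_comp (v : M → ℝ) (ξ : DForm E M 2) (β : DForm E M 1) (x : M) (A : F →L[ℝ] E) :
    (cutoffForm v ξ β x).compContinuousLinearMap A = v x • (ξ x).compContinuousLinearMap A +
      wedge ((manifoldDeriv E ℝ v x).comp A)
        (toFunctional ((β x).compContinuousLinearMap A)) := by
  rw [toFunctional_comp, ← wedge_comp]
  rfl

lemma cutoffForm_inChart {v : M → ℝ} (ξ : DForm E M 2) (β : DForm E M 1)
    {e : OpenPartialHomeomorph M E} (he : IsSmoothHomeo (E := E) (F := E) e) {p : E}
    (hp : p ∈ e.target) (hv : MDifferentiableAt 𝓘(ℝ, E) 𝓘(ℝ, ℝ) v (e.symm p)) (a b : E) :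
    (cutoffForm v ξ β).inChart e p ![a, b] = v (e.symm p) * ξ.inChart e p ![a, b] +
      (fderiv ℝ (fun p => v (e.symm p)) p a * β.inChart e p ![b] -
        fderiv ℝ (fun p => v (e.symm p)) p b * β.inChart e p ![a]) := by
  have h1 : fderiv ℝ (fun p => v (e.symm p)) p =
      (manifoldDeriv E ℝ v (e.symm p)).comp (manifoldDeriv E E e.symm p) := by
    rw [← manifoldDeriv_eq_fderiv]
    exact manifoldDeriv_comp p hv (he.symm.mdifferentiableAt hp)
  have h2 : (cutoffForm v ξ β).inChart e p =
      (cutoffForm v ξ β (e.symm p)).compContinuousLinearMap (manifoldDeriv E E e.symm p) := rfl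
  rw [h2, cutoffForm_comp, ContinuousAlternatingMap.add_apply, wedge_apply, toFunctional_apply,
    toFunctional_apply, h1]
  rfl

lemma hasMFDerivAt_sum {ι : Type*} (t : Finset ι) {f : ι → M → ℝ} {x : M} {D : ι → E →L[ℝ] ℝ}
    (hf : ∀ i ∈ t, HasMFDerivAt 𝓘(ℝ, E) 𝓘(ℝ, ℝ) (f i) x (D i)) :
    HasMFDerivAt 𝓘(ℝ, E) 𝓘(ℝ, ℝ) (fun y => ∑ i ∈ t, f i y) x (∑ i ∈ t, D i) :=
  ⟨tendsto_finsetSum _ fun i hi => (hf i hi).1, HasFDerivWithinAt.fun_sum fun i hi => (hf i hi).2⟩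

end Wedge

namespace ComplexOrbifoldGroupoid

variable {C : ComplexOrbifoldGroupoid}

/-- The weight in the change of variables along an arrow is the Jacobian of its germ. -/
lemma jac_tgt_div_jac_src (g : C.Arr) : jac C.tgt g / jac C.src g = (C.arrowDeriv g).det := by
  have h1 := congrArg ContinuousLinearMap.det (C.arrowDeriv_comp_deriv_src g)
  rw [ContinuousLinearMap.det_comp_real] at h1
  have h2 : (manifoldDeriv ℂ ℂ C.src g).det ≠ 0 := (C.jac_src_pos g).ne'
  rw [jac, jac, ← h1, mul_div_assoc, div_self h2, mul_one]

/-- The orbifold integral may be computed with the forms `v i ξ + d(v i) ∧ β` instead of `v i ξ`: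
the sum of the terms `d(v i) ∧ β` over an orbit is zero, as the derivative of the constant `1`. -/
theorem Partition.integral_eq_sum_cutoffForm (P : C.Partition) {ι : Type*} [Fintype ι]
    {e : ι → OpenPartialHomeomorph C.Obj ℂ} (he : ∀ i, IsOrientedChart (e i))
    {v : ι → C.Obj → ℝ} (hv : ∀ i, ContMDiff 𝓘(ℝ, ℂ) 𝓘(ℝ, ℝ) ∞ (v i))
    (hvc : ∀ i, HasCompactSupport (v i)) (hve : ∀ i, tsupport (v i) ⊆ (e i).source)
    (hsum : ∀ x, ∑ i, C.orbitSum (v i) x = 1) {ξ : DForm ℂ C.Obj 2} {β : DForm ℂ C.Obj 1}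
    {S : Set C.Obj} (hS : ∀ g, C.src g ∈ S → C.tgt g ∈ S)
    (hξ : ∀ g, (ξ (C.tgt g)).compContinuousLinearMap (C.arrowDeriv g) = ξ (C.src g))
    (hβ : ∀ g, C.src g ∉ S →
      (β (C.tgt g)).compContinuousLinearMap (C.arrowDeriv g) = β (C.src g))
    (hvS : ∀ i, ∀ x ∈ S, manifoldDeriv ℂ ℝ (v i) x = 0)
    (hc : ∀ i, ContinuousOn
      (fun p => (cutoffForm (v i) ξ β).inChart (e i) p ![1, Complex.I]) (e i).target) :
    P.integral ξ =
      ∑ i, ∫ p in (e i).target, (cutoffForm (v i) ξ β).inChart (e i) p ![1, Complex.I] := by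
  have hzero : ∀ i x, x ∉ tsupport (v i) → v i x = 0 ∧ manifoldDeriv ℂ ℝ (v i) x = 0 := by
    intro i x hx
    refine ⟨image_eq_zero_of_notMem_tsupport hx, ?_⟩
    rw [← manifoldDeriv_const (E := ℂ) (0 : ℝ) x]
    refine manifoldDeriv_congr ?_
    filter_upwards [(isClosed_tsupport (v i)).isOpen_compl.mem_nhds hx] with y hy
    exact image_eq_zero_of_notMem_tsupport hy
  have hζ0 : ∀ i x, x ∉ tsupport (v i) → cutoffForm (v i) ξ β x = 0 := by
    intro i x hx
    rw [cutoffForm, (hzero i x hx).1, (hzero i x hx).2, wedge_zero_left, zero_smul, add_zero]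
  refine P.integral_eq_sum he (K := fun i => tsupport (v i)) hvc hve hζ0 hc fun x => ?_
  have hQ : IsCompact (⋃ i, tsupport (v i)) := isCompact_iUnion hvc
  obtain ⟨n, σ, W, hW, hxW, hσ, hs, hi, hQσ, -⟩ := C.exists_local_sections x hQ
  have hF : ∀ g, (∑ i, cutoffForm (v i) ξ β (C.tgt g) ![1, Complex.I] *
      (jac C.tgt g / jac C.src g)) ≠ 0 → C.tgt g ∈ ⋃ i, tsupport (v i) := by
    intro g hg
    by_contra hcon
    rw [mem_iUnion, not_exists] at hcon
    refine hg (Finset.sum_eq_zero fun i _ => ?_)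
    rw [hζ0 i _ (hcon i)]
    simp
  rw [C.fiberSum_eq_sum_sections hs hi hQσ hF hxW]
  -- The derivatives at `x` of the functions `y ↦ v i (tgt (σ j y))`, whose sum is constant.
  let D : Fin n → ι → ℂ →L[ℝ] ℝ := fun j i =>
    (manifoldDeriv ℂ ℝ (v i) (C.tgt (σ j x))).comp (C.arrowDeriv (σ j x))
  have hterm : ∀ j i, cutoffForm (v i) ξ β (C.tgt (σ j x)) ![1, Complex.I] *
      (jac C.tgt (σ j x) / jac C.src (σ j x)) = v i (C.tgt (σ j x)) * ξ x ![1, Complex.I] +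
        (D j i 1 * β x ![Complex.I] - D j i Complex.I * β x ![1]) := by
    intro j i
    have hsx : C.src (σ j x) = x := hs j x hxW
    rw [jac_tgt_div_jac_src, mul_comm, ← alternating_comp_apply, cutoffForm_comp, hξ, hsx,
      ContinuousAlternatingMap.add_apply, ContinuousAlternatingMap.smul_apply, smul_eq_mul]
    congr 1
    by_cases hxS : x ∈ S
    · have h0 : D j i = 0 := by
        simp only [D, hvS i _ (hS _ (by rw [hsx]; exact hxS)), ContinuousLinearMap.zero_comp]
      have h1 : wedge ((manifoldDeriv ℂ ℝ (v i) (C.tgt (σ j x))).comp (C.arrowDeriv (σ j x)))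
          (toFunctional ((β (C.tgt (σ j x))).compContinuousLinearMap (C.arrowDeriv (σ j x)))) =
          0 := by
        rw [show (manifoldDeriv ℂ ℝ (v i) (C.tgt (σ j x))).comp (C.arrowDeriv (σ j x)) = 0 from h0,
          wedge_zero_left]
      rw [h1, h0]
      simp
    · rw [hβ _ (by rw [hsx]; exact hxS), wedge_apply, toFunctional_apply, toFunctional_apply, hsx]
  have hconst : (fun y => ∑ j, ∑ i, v i (C.tgt (σ j y))) =ᶠ[𝓝 x] fun _ => (1 : ℝ) := by
    filter_upwards [hW.mem_nhds hxW] with y hy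
    rw [Finset.sum_comm, ← hsum y]
    refine Finset.sum_congr rfl fun i _ => Eq.symm ?_
    exact C.fiberSum_eq_sum_sections hs hi hQσ
      (fun g hg => mem_iUnion.2 ⟨i, subset_tsupport _ hg⟩) hy
  have hD : ∑ j, ∑ i, D j i = 0 := by
    have hji : ∀ j i, HasMFDerivAt 𝓘(ℝ, ℂ) 𝓘(ℝ, ℝ) (fun y => v i (C.tgt (σ j y))) x (D j i) := by
      intro j i
      have hσx : ContinuousAt (σ j) x := (hσ j).continuousOn.continuousAt (hW.mem_nhds hxW)
      obtain ⟨h1, h2⟩ := C.arrowDeriv_eq_of_section hσx (by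
        filter_upwards [hW.mem_nhds hxW] with y hy using hs j y hy)
      have h3 : MDifferentiableAt 𝓘(ℝ, ℂ) 𝓘(ℝ, ℂ) (fun y => C.tgt (σ j y)) x :=
        (C.mdifferentiable_tgt _).comp x h1
      have h4 : MDifferentiableAt 𝓘(ℝ, ℂ) 𝓘(ℝ, ℝ) (v i) (C.tgt (σ j x)) :=
        (hv i).mdifferentiable (by simp) _
      have h5 := (MDifferentiableAt.comp x h4 h3).hasMFDerivAt
      have h6 := manifoldDeriv_comp x h4 h3
      simp only [D]
      rw [← h2, ← h6]
      exact h5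
    have h7 : HasMFDerivAt 𝓘(ℝ, ℂ) 𝓘(ℝ, ℝ) (fun y => ∑ j, ∑ i, v i (C.tgt (σ j y))) x
        (∑ j, ∑ i, D j i) :=
      hasMFDerivAt_sum _ fun j _ => hasMFDerivAt_sum _ fun i _ => hji j i
    have h8 := h7.mfderiv
    rw [hconst.mfderiv_eq] at h8
    exact h8.symm.trans mfderiv_const
  have hval : ∑ j, ∑ i, v i (C.tgt (σ j x)) = 1 := hconst.self_of_nhds
  have hDa : ∀ t : ℂ, ∑ j, ∑ i, D j i t = 0 := by
    intro t
    have := DFunLike.congr_fun hD t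
    simpa only [_root_.sum_apply, _root_.zero_apply] using this
  simp only [hterm, Finset.sum_add_distrib, Finset.sum_sub_distrib, ← Finset.sum_mul, hval, hDa]
  ring

end ComplexOrbifoldGroupoid

/-! ### Pulled-back forms in a chart of the orbicurve -/

namespace HolomorphicOrbimorphism

variable {C : Orbicurve} {E : Type*} [NormedAddCommGroup E] [NormedSpace ℝ E]
  {G : OrbifoldGroupoid E} {J : AlmostComplexStructure G} (f : HolomorphicOrbimorphism C J)
  {Z : Set G.Obj}

/-- In a chart, the pull-backs of all invariant forms are, near each point, the pull-backs by one
smooth map. -/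
lemma exists_local_lift {e : OpenPartialHomeomorph C.norm.Obj ℂ}
    (he : IsSmoothHomeo (E := ℂ) (F := ℂ) e) {p : ℂ} (hp : p ∈ e.target) :
    ∃ (u : ℂ → G.Obj) (k : f.K.Obj), u p = f.phi.obj k ∧
      C.norm.orbit (f.eps.obj k) = C.norm.orbit (e.symm p) ∧
      (∀ᶠ x in 𝓝 p, ContMDiffAt 𝓘(ℝ, ℂ) 𝓘(ℝ, E) ∞ u x) ∧
      ∀ (n : ℕ) (η : DForm E G.Obj n) (W : Set G.Obj), IsOpen W → u p ∈ W →
        G.IsInvariantFormOn η W →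
          (f.pullback η).inChart e =ᶠ[𝓝 p] (DForm.pullback u η : DForm ℂ ℂ n) := by
  obtain ⟨⟨k, a⟩, ha, hat⟩ := f.eps_equiv.ess_surj (e.symm p)
  obtain ⟨θ, hθ, hθs, hθk, -, -, hpull⟩ := f.exists_local_inverse ha
  simp only at hat hθs hθk
  rw [hat] at hθs hθk
  have hest : Filter.Tendsto e.symm (𝓝 p) (𝓝 (e.symm p)) := e.continuousAt_symm hp
  have hev : ∀ᶠ x in 𝓝 p, x ∈ e.target ∧ e.symm x ∈ θ.source :=
    Filter.Eventually.and (e.open_target.mem_nhds hp)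
      (hest.eventually (θ.open_source.mem_nhds hθs))
  have hsm : ∀ x, x ∈ e.target ∧ e.symm x ∈ θ.source →
      ContMDiffAt 𝓘(ℝ, ℂ) 𝓘(ℝ, E) ∞ (fun x => f.phi.obj (θ (e.symm x))) x := fun x hx =>
    ContMDiffAt.comp (g := f.phi.obj) x f.phi.smooth_obj.contMDiffAt
      (ContMDiffAt.comp (g := θ) x (hθ.contMDiffAt hx.2) (he.symm.contMDiffAt hx.1))
  refine ⟨fun x => f.phi.obj (θ (e.symm x)), k, congrArg f.phi.obj hθk, ?_, ?_, ?_⟩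
  · exact C.norm.orbit_eq_iff.2 ⟨a, ha, hat⟩
  · filter_upwards [hev] with x hx using hsm x hx
  · intro n η W hW hWp hη
    have hc := (hsm p hev.self_of_nhds).continuousAt
    filter_upwards [hev, hc.eventually (hW.mem_nhds hWp)] with x hx hxW
    have h1 := hpull n η W hη _ hx.2 hxW
    have h2 : manifoldDeriv ℂ E (fun x => f.phi.obj (θ (e.symm x))) x =
        (manifoldDeriv ℂ E (fun y => f.phi.obj (θ y)) (e.symm x)).comp
          (manifoldDeriv ℂ ℂ e.symm x) :=
      manifoldDeriv_comp (g := fun y => f.phi.obj (θ y)) x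
        (MDifferentiableAt.comp (g := f.phi.obj) _ (f.phi.mdifferentiableAt_obj _)
          (hθ.mdifferentiableAt hx.2)) (he.symm.mdifferentiableAt hx.1)
    simp only [DForm.inChart, DForm.pullback, h1, h2]
    rfl

lemma continuousAt_pullback_inChart {η : DForm E G.Obj 2} (hη : η.SmoothOn univ)
    (hinv : G.IsInvariantFormOn η univ) {e : OpenPartialHomeomorph C.norm.Obj ℂ}
    (he : IsSmoothHomeo (E := ℂ) (F := ℂ) e) {p : ℂ} (hp : p ∈ e.target) (a b : ℂ) :
    ContinuousAt (fun p => (f.pullback η).inChart e p ![a, b]) p := by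
  obtain ⟨u, k, -, -, hus, hpull⟩ := f.exists_local_lift he hp
  have h1 := hpull 2 η univ isOpen_univ (mem_univ _) hinv
  have h2 := (hη.differentiableAt_pullback isOpen_univ hus (mem_univ _)).continuousAt
  have h3 : ContinuousAt (fun p => (f.pullback η).inChart e p) p :=
    h2.congr (h1.mono fun x hx => hx.symm)
  have h4 : ContinuousAt (fun p => toBilinear ((f.pullback η).inChart e p)) p :=
    toBilinear.continuous.continuousAt.comp h3
  have h5 := (h4.clm_apply (continuousAt_const (y := a))).clm_apply (continuousAt_const (y := b))
  exact h5.congr (Filter.Eventually.of_forall fun x => toBilinear_apply _ a b)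

/-- Off the preimage of the divisor, the pull-back of the primitive `α` of `η` is a primitive of the
pull-back of `η`. -/
lemma pullback_primitive_inChart (hZc : IsClosed Z) (hZ : G.IsInvariantSet Z) {η : DForm E G.Obj 2}
    {α : DForm E G.Obj 1} (hinv : G.IsInvariantFormOn η univ) (hα : α.SmoothOn Zᶜ)
    (hαinv : G.IsInvariantFormOn α Zᶜ) (hαη : α.HasExtDerivOn η Zᶜ)
    {e : OpenPartialHomeomorph C.norm.Obj ℂ}
    (he : IsSmoothHomeo (E := ℂ) (F := ℂ) e) {p : ℂ} (hp : p ∈ e.target)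
    (hpZ : C.norm.orbit (e.symm p) ∉ f.preimage Z) :
    ContDiffAt ℝ 1 (fun x => toFunctional ((f.pullback α).inChart e x)) p ∧
      ∀ a b : ℂ, fderiv ℝ (fun x => toFunctional ((f.pullback α).inChart e x)) p a b -
        fderiv ℝ (fun x => toFunctional ((f.pullback α).inChart e x)) p b a =
          (f.pullback η).inChart e p ![a, b] := by
  obtain ⟨u, k, huk, hko, hus, hpull⟩ := f.exists_local_lift he hp
  have hup : u p ∈ Zᶜ := by
    intro h
    rw [huk, f.phi_mem_iff_orbit_mem_preimage hZ, hko] at h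
    exact hpZ h
  have h1 := hpull 1 α Zᶜ hZc.isOpen_compl hup hαinv
  have h2 := (hpull 2 η univ isOpen_univ (mem_univ _) hinv).self_of_nhds
  have h3 : (fun x => toFunctional ((f.pullback α).inChart e x)) =ᶠ[𝓝 p]
      fun x => toFunctional ((DForm.pullback u α : DForm ℂ ℂ 1) x) := by
    filter_upwards [h1] with x hx
    rw [hx]
  refine ⟨(hα.contDiffAt_toFunctional_pullback hZc.isOpen_compl hus hup).congr_of_eventuallyEq h3,
    fun a b => ?_⟩
  rw [h3.fderiv_eq, h2, ← extDeriv_one_form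
    (hα.differentiableAt_pullback hZc.isOpen_compl hus hup) a b,
    hαη.extDeriv_pullback hα hZc.isOpen_compl hus hup]

section Cutoff

variable {η : DForm E G.Obj 2} {α : DForm E G.Obj 1} {v : C.norm.Obj → ℝ}

/-- The form `v ξ + dv ∧ β` is continuous across the preimage of the divisor, where `β` is not
defined, as `v` is locally constant there. -/
lemma continuousOn_cutoffForm_inChart (hZc : IsClosed Z) (hZ : G.IsInvariantSet Z)
    (hη : η.SmoothOn univ) (hinv : G.IsInvariantFormOn η univ) (hα : α.SmoothOn Zᶜ)
    (hαinv : G.IsInvariantFormOn α Zᶜ) (hαη : α.HasExtDerivOn η Zᶜ)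
    (hv : ContMDiff 𝓘(ℝ, ℂ) 𝓘(ℝ, ℝ) ∞ v)
    (hvZ : ∀ x, C.norm.orbit x ∈ f.preimage Z → ∃ c, v =ᶠ[𝓝 x] fun _ => c)
    {e : OpenPartialHomeomorph C.norm.Obj ℂ} (he : IsSmoothHomeo (E := ℂ) (F := ℂ) e) (a b : ℂ) :
    ContinuousOn (fun p => (cutoffForm v (f.pullback η) (f.pullback α)).inChart e p ![a, b])
      e.target := by
  have hvs : ∀ p ∈ e.target, ContDiffAt ℝ ∞ (fun p => v (e.symm p)) p := fun p hp => by
    rw [← contMDiffAt_iff_contDiffAt]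
    exact ContMDiffAt.comp (g := v) p hv.contMDiffAt (he.symm.contMDiffAt hp)
  have hform : ∀ p ∈ e.target, (cutoffForm v (f.pullback η) (f.pullback α)).inChart e p ![a, b] =
      v (e.symm p) * (f.pullback η).inChart e p ![a, b] +
      (fderiv ℝ (fun p => v (e.symm p)) p a * toFunctional ((f.pullback α).inChart e p) b -
        fderiv ℝ (fun p => v (e.symm p)) p b * toFunctional ((f.pullback α).inChart e p) a) :=
    fun p hp => by
      rw [toFunctional_apply, toFunctional_apply]
      exact cutoffForm_inChart _ _ he hp (hv.mdifferentiable (by simp) _) a b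
  refine ContinuousOn.congr (fun p hp => ContinuousAt.continuousWithinAt ?_) hform
  have h1 := f.continuousAt_pullback_inChart hη hinv he hp a b
  refine ((hvs p hp).continuousAt.mul h1).add ?_
  by_cases hpZ : C.norm.orbit (e.symm p) ∈ f.preimage Z
  · obtain ⟨c, hc⟩ := hvZ _ hpZ
    have hev : ∀ᶠ x in 𝓝 p, fderiv ℝ (fun p => v (e.symm p)) x = 0 := by
      have h2 : (fun p => v (e.symm p)) =ᶠ[𝓝 p] fun _ => c :=
        (e.continuousAt_symm hp).eventually hc
      filter_upwards [h2.eventuallyEq_nhds] with x hx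
      rw [hx.fderiv_eq, fderiv_const_apply]
    refine (continuousAt_const (y := (0 : ℝ))).congr ?_
    filter_upwards [hev] with x hx
    simp [hx]
  · have h2 := (f.pullback_primitive_inChart hZc hZ hinv hα hαinv hαη he hp hpZ).1.continuousAt
    have h3 : ContinuousAt (fderiv ℝ fun p => v (e.symm p)) p :=
      ((hvs p hp).fderiv_right (m := 0) (by simp)).continuousAt
    exact ((h3.clm_apply continuousAt_const).mul (h2.clm_apply continuousAt_const)).sub
      ((h3.clm_apply continuousAt_const).mul (h2.clm_apply continuousAt_const))

/-- Away from the preimage of the divisor, the form `v ξ + dv ∧ β` is exact. -/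
theorem integral_cutoffForm_eq_zero (hZc : IsClosed Z) (hZ : G.IsInvariantSet Z)
    (hinv : G.IsInvariantFormOn η univ) (hα : α.SmoothOn Zᶜ)
    (hαinv : G.IsInvariantFormOn α Zᶜ) (hαη : α.HasExtDerivOn η Zᶜ)
    (hv : ContMDiff 𝓘(ℝ, ℂ) 𝓘(ℝ, ℝ) ∞ v) (hvc : HasCompactSupport v)
    (hvZ : ∀ x, C.norm.orbit x ∈ f.preimage Z → v =ᶠ[𝓝 x] fun _ => 0)
    {e : OpenPartialHomeomorph C.norm.Obj ℂ} (he : IsSmoothHomeo (E := ℂ) (F := ℂ) e)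
    (hve : tsupport v ⊆ e.source) :
    ∫ p in e.target, (cutoffForm v (f.pullback η) (f.pullback α)).inChart e p ![1, Complex.I] =
      0 := by
  classical
  let a : ℂ → ℂ →L[ℝ] ℝ := fun p => toFunctional ((f.pullback α).inChart e p)
  -- The primitive `v β` in the chart, extended by zero.
  let ν : ℂ → ℂ →L[ℝ] ℝ := fun p => if p ∈ e.target then v (e.symm p) • a p else 0
  have hvs : ∀ p ∈ e.target, ContDiffAt ℝ ∞ (fun p => v (e.symm p)) p := fun p hp => by
    rw [← contMDiffAt_iff_contDiffAt]
    exact ContMDiffAt.comp (g := v) p hv.contMDiffAt (he.symm.contMDiffAt hp)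
  have hK : IsCompact (e '' tsupport v) :=
    IsCompact.image_of_continuousOn hvc (e.continuousOn.mono hve)
  have hKt : e '' tsupport v ⊆ e.target := by
    rintro _ ⟨x, hx, rfl⟩
    exact e.map_source (hve hx)
  have hν0 : ∀ p, p ∉ e '' tsupport v → ν p = 0 := by
    intro p hp
    simp only [ν]
    split_ifs with hpt
    · have h1 : e.symm p ∉ tsupport v := fun h => hp ⟨_, h, e.right_inv hpt⟩
      rw [image_eq_zero_of_notMem_tsupport h1, zero_smul]
    · rfl
  have hνev : ∀ p ∈ e.target, ν =ᶠ[𝓝 p] fun p => v (e.symm p) • a p := by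
    intro p hp
    filter_upwards [e.open_target.mem_nhds hp] with x hx
    simp only [ν, if_pos hx]
  have hνZ : ∀ p ∈ e.target, C.norm.orbit (e.symm p) ∈ f.preimage Z →
      (fun p => v (e.symm p)) =ᶠ[𝓝 p] fun _ => 0 := fun p hp hpZ =>
    (e.continuousAt_symm hp).eventually (hvZ _ hpZ)
  have hνz' : ∀ p ∈ e.target, C.norm.orbit (e.symm p) ∈ f.preimage Z → ν =ᶠ[𝓝 p] fun _ => 0 := by
    intro p hp hpZ
    filter_upwards [hνev p hp, hνZ p hp hpZ] with x h1 h2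
    rw [h1, h2, zero_smul]
  have hνout : ∀ p ∉ e.target, ν =ᶠ[𝓝 p] fun _ => 0 := by
    intro p hp
    filter_upwards [hK.isClosed.isOpen_compl.mem_nhds fun h => hp (hKt h)] with x hx
    exact hν0 x hx
  have hνd : ContDiff ℝ 1 ν := by
    rw [contDiff_iff_contDiffAt]
    intro p
    by_cases hp : p ∈ e.target
    · by_cases hpZ : C.norm.orbit (e.symm p) ∈ f.preimage Z
      · exact contDiffAt_const.congr_of_eventuallyEq (hνz' p hp hpZ)
      · exact (((hvs p hp).of_le ENat.LEInfty.out).smul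
          (f.pullback_primitive_inChart hZc hZ hinv hα hαinv hαη he hp hpZ).1).congr_of_eventuallyEq
          (hνev p hp)
    · exact contDiffAt_const.congr_of_eventuallyEq (hνout p hp)
  have hνc : HasCompactSupport ν := HasCompactSupport.intro hK fun p hp => hν0 p hp
  have hcurl : ∀ p, fderiv ℝ ν p 1 Complex.I - fderiv ℝ ν p Complex.I 1 =
      e.target.indicator (fun p => (cutoffForm v (f.pullback η) (f.pullback α)).inChart e p
        ![1, Complex.I]) p := by
    intro p
    by_cases hp : p ∈ e.target
    · rw [indicator_of_mem hp, cutoffForm_inChart _ _ he hp (hv.mdifferentiable (by simp) _)]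
      by_cases hpZ : C.norm.orbit (e.symm p) ∈ f.preimage Z
      · have h1 : v (e.symm p) = 0 := (hνZ p hp hpZ).self_of_nhds
        rw [(hνz' p hp hpZ).fderiv_eq, (hνZ p hp hpZ).fderiv_eq, h1]
        simp
      · obtain ⟨h1, h2⟩ := f.pullback_primitive_inChart hZc hZ hinv hα hαinv hαη he hp hpZ
        have h3 := (((hvs p hp).differentiableAt (by simp)).hasFDerivAt.smul
          (h1.differentiableAt one_ne_zero).hasFDerivAt).fderiv
        rw [(hνev p hp).fderiv_eq]
        have h4 : fderiv ℝ (fun p => v (e.symm p) • a p) p = _ := h3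
        rw [h4, ← h2, ← toFunctional_apply, ← toFunctional_apply]
        simp only [_root_.add_apply, _root_.smul_apply, ContinuousLinearMap.smulRight_apply,
          smul_eq_mul]
        ring
    · rw [indicator_of_notMem hp, (hνout p hp).fderiv_eq]
      simp
  have hmain := integral_curl_eq_zero hνd hνc
  simp_rw [hcurl] at hmain
  rwa [integral_indicator e.open_target.measurableSet] at hmain

end Cutoff

end HolomorphicOrbimorphism

/-! ### Cut-off functions and their sums over the orbits -/

section RadialCutoff

/-- A cut-off function of the squared radius, constant near the origin. -/
lemma exists_radial_cutoff {ε : ℝ} (hε : 0 < ε) (c : ℝ) :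
    ∃ β : ℝ → ℝ, ContDiff ℝ ∞ β ∧ β 0 = c ∧ (∃ s₀ > 0, ∀ s < s₀, β s = β 0) ∧
      ∀ s, ε ^ 2 ≤ s → β s = 0 := by
  have hone : ∀ s < ε ^ 2 / 2, c * Real.smoothTransition (2 - 2 * s / ε ^ 2) = c := by
    intro s hs
    rw [Real.smoothTransition.one_of_one_le, mul_one]
    have : 2 * s / ε ^ 2 ≤ 1 := by rw [div_le_one (by positivity)]; linarith
    linarith
  refine ⟨fun s => c * Real.smoothTransition (2 - 2 * s / ε ^ 2), ?_, hone 0 (by positivity),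
    ⟨ε ^ 2 / 2, by positivity, fun s hs => ?_⟩, fun s hs => ?_⟩
  · exact contDiff_const.mul (Real.smoothTransition.contDiff.comp (by fun_prop))
  · exact (hone s hs).trans (hone 0 (by positivity)).symm
  · beta_reduce
    rw [Real.smoothTransition.zero_of_nonpos, mul_zero]
    have : 2 ≤ 2 * s / ε ^ 2 := by rw [le_div_iff₀ (by positivity)]; linarith
    linarith

lemma deriv_eq_zero_of_forall_ge {β : ℝ → ℝ} {a s : ℝ} (h : ∀ s, a ≤ s → β s = 0) (hs : a < s) :
    deriv β s = 0 := by
  have : β =ᶠ[𝓝 s] fun _ => 0 := by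
    filter_upwards [lt_mem_nhds hs] with t ht using h t ht.le
  rw [this.deriv_eq, deriv_const]

variable {M : Type*} [TopologicalSpace M] [ChartedSpace ℂ M] [T2Space M]

/-- A radial function in a chart, extended by zero. -/
lemma exists_chart_bump {e : OpenPartialHomeomorph M ℂ}
    (he : IsSmoothHomeo (E := ℂ) (F := ℂ) e) {ε : ℝ}
    (hεt : Metric.closedBall 0 ε ⊆ e.target) (hε : 0 < ε) {β : ℝ → ℝ} (hβ : ContDiff ℝ ∞ β)
    (hβ0 : ∃ s₀ > 0, ∀ s < s₀, β s = β 0) (hβs : ∀ s, ε ^ 2 ≤ s → β s = 0) :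
    ∃ b : M → ℝ, ContMDiff 𝓘(ℝ, ℂ) 𝓘(ℝ, ℝ) ∞ b ∧ HasCompactSupport b ∧
      tsupport b ⊆ e.symm '' Metric.closedBall 0 ε ∧
      (∀ p ∈ e.target, b (e.symm p) = β (‖p‖ ^ 2)) ∧
      ∀ x ∈ e.source, e x = 0 → b =ᶠ[𝓝 x] fun _ => β 0 := by
  classical
  let b : M → ℝ := fun x => if x ∈ e.source then β (‖e x‖ ^ 2) else 0
  have hK : IsCompact (e.symm '' Metric.closedBall 0 ε) :=
    (isCompact_closedBall (0 : ℂ) ε).image_of_continuousOn (e.continuousOn_symm.mono hεt)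
  have hb0 : ∀ x, x ∉ e.symm '' Metric.closedBall 0 ε → b x = 0 := by
    intro x hx
    simp only [b]
    split_ifs with hxs
    · refine hβs _ ?_
      have h1 : ε < ‖e x‖ := by
        by_contra h
        exact hx ⟨e x, mem_closedBall_zero_iff.2 (not_lt.1 h), e.left_inv hxs⟩
      gcongr
    · rfl
  have hKs : e.symm '' Metric.closedBall 0 ε ⊆ e.source := by
    rintro _ ⟨p, hp, rfl⟩
    exact e.map_target (hεt hp)
  have hbs : ∀ x ∈ e.source, b =ᶠ[𝓝 x] fun x => β (‖e x‖ ^ 2) := by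
    intro x hx
    filter_upwards [e.open_source.mem_nhds hx] with y hy
    simp only [b, if_pos hy]
  refine ⟨b, fun x => ?_, HasCompactSupport.intro hK hb0,
    closure_minimal (fun x hx => ?_) hK.isClosed, fun p hp => ?_, fun x hx hx0 => ?_⟩
  · by_cases hx : x ∈ e.source
    · refine ContMDiffAt.congr_of_eventuallyEq ?_ (hbs x hx)
      have h1 : ContDiff ℝ ∞ fun p : ℂ => β (‖p‖ ^ 2) := hβ.comp (contDiff_norm_sq ℝ)
      exact ContMDiffAt.comp (g := fun p : ℂ => β (‖p‖ ^ 2)) x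
        (contMDiffAt_iff_contDiffAt.2 h1.contDiffAt) (he.contMDiffAt hx)
    · refine contMDiffAt_const.congr_of_eventuallyEq (f := fun _ => (0 : ℝ)) ?_
      filter_upwards [hK.isClosed.isOpen_compl.mem_nhds fun h => hx (hKs h)] with y hy
      exact hb0 y hy
  · by_contra h
    exact hx (hb0 x h)
  · simp only [b, if_pos (e.map_target hp), e.right_inv hp]
  · obtain ⟨s₀, hs₀, hs⟩ := hβ0
    have hc : ContinuousAt (fun y => ‖e y‖ ^ 2) x := ((e.continuousAt hx).norm).pow 2
    have hlt : ∀ᶠ y in 𝓝 x, ‖e y‖ ^ 2 < s₀ :=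
      hc.eventually (gt_mem_nhds (by simpa [hx0] using hs₀))
    filter_upwards [hbs x hx, hlt] with y h1 h2
    rw [h1, hs _ h2]

end RadialCutoff

namespace OrbifoldGroupoid

variable {E : Type*} [NormedAddCommGroup E] [NormedSpace ℝ E]
  (G : OrbifoldGroupoid E)

/-- The arrows between two points of an orbit are a torsor under the local group. -/
lemma card_arrows_eq {x x' : G.Obj} (h : G.orbit x = G.orbit x') :
    Nat.card {g // G.src g = x ∧ G.tgt g = x'} = Nat.card (G.isotropy x') := by
  obtain ⟨a, rfl, rfl⟩ := G.orbit_eq_iff.1 h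
  refine Nat.card_congr
    { toFun := fun g => ⟨G.comp (G.inv a) g.1, ?_, ?_⟩
      invFun := fun g => ⟨G.comp a g.1, ?_, ?_⟩
      left_inv := fun g => Subtype.ext ?_
      right_inv := fun g => Subtype.ext ?_ }
  · rw [G.src_comp _ _ ((G.tgt_inv a).trans g.2.1.symm), G.src_inv]
  · rw [G.tgt_comp _ _ ((G.tgt_inv a).trans g.2.1.symm), g.2.2]
  · rw [G.src_comp _ _ g.2.1.symm]
  · rw [G.tgt_comp _ _ g.2.1.symm, g.2.2]
  · exact G.comp_inv_comp g.2.1.symm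
  · exact G.inv_comp_comp g.2.1.symm

/-- If `x'` is the only point of the orbit of `x` in the support of `b`, and `b` is constant near
`x'`, then the sums of `b` over the orbits near `x` have as many terms as there are arrows from `x`
to `x'`. -/
lemma orbitSum_eventuallyEq_card_mul {b : G.Obj → ℝ} (hb : HasCompactSupport b) {x x' : G.Obj}
    (hx' : x' ∈ tsupport b) (hu : ∀ z ∈ tsupport b, G.orbit z = G.orbit x → z = x') {c : ℝ}
    (hc : b =ᶠ[𝓝 x'] fun _ => c) :
    G.orbitSum b =ᶠ[𝓝 x] fun _ => Nat.card {g // G.src g = x ∧ G.tgt g = x'} * c := by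
  obtain ⟨n, σ, W, hW, hxW, hσ, hs, hi, hQ, hσQ⟩ := G.exists_local_sections x (Q := tsupport b) hb
  have ht : ∀ i, G.tgt (σ i x) = x' := fun i =>
    hu _ (hσQ i) (Eq.symm (G.orbit_eq_iff.2 ⟨σ i x, hs i x hxW, rfl⟩))
  have hn : Nat.card {g // G.src g = x ∧ G.tgt g = x'} = n := by
    rw [← Nat.card_fin n]
    refine (Nat.card_congr (Equiv.ofBijective
      (fun i => (⟨σ i x, hs i x hxW, ht i⟩ : {g // G.src g = x ∧ G.tgt g = x'})) ⟨?_, ?_⟩)).symm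
    · intro i j hij
      exact hi x hxW (congrArg Subtype.val hij)
    · rintro ⟨g, rfl, rfl⟩
      obtain ⟨i, hg⟩ := hQ g hxW hx'
      exact ⟨i, Subtype.ext hg.symm⟩
  have hev : ∀ᶠ y in 𝓝 x, ∀ i, b (G.tgt (σ i y)) = c := by
    rw [Filter.eventually_all]
    intro i
    have h1 : ContinuousAt (fun y => G.tgt (σ i y)) x :=
      G.continuous_tgt.continuousAt.comp ((hσ i).continuousOn.continuousAt (hW.mem_nhds hxW))
    have h2 : Filter.Tendsto (fun y => G.tgt (σ i y)) (𝓝 x) (𝓝 x') := by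
      have := h1.tendsto
      rwa [ht i] at this
    exact h2.eventually hc
  filter_upwards [hW.mem_nhds hxW, hev] with y hy hyc
  have h3 := G.fiberSum_eq_sum_sections hs hi hQ (F := fun g => b (G.tgt g))
    (fun g hg => subset_tsupport _ hg) hy
  rw [hn]
  refine h3.trans ?_
  simp [hyc]

/-- The sums of `b` over orbits near `x` vanish if the orbit of `x` avoids the support of `b`. -/
lemma orbitSum_eventuallyEq_zero {b : G.Obj → ℝ} (hb : HasCompactSupport b) {x : G.Obj}
    (hu : ∀ z ∈ tsupport b, G.orbit z ≠ G.orbit x) : G.orbitSum b =ᶠ[𝓝 x] fun _ => 0 := by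
  obtain ⟨n, σ, W, hW, hxW, hσ, hs, hi, hQ, hσQ⟩ := G.exists_local_sections x (Q := tsupport b) hb
  have hn : IsEmpty (Fin n) :=
    ⟨fun i => hu _ (hσQ i) (Eq.symm (G.orbit_eq_iff.2 ⟨σ i x, hs i x hxW, rfl⟩))⟩
  filter_upwards [hW.mem_nhds hxW] with y hy
  have h3 := G.fiberSum_eq_sum_sections hs hi hQ (F := fun g => b (G.tgt g))
    (fun g hg => subset_tsupport _ hg) hy
  exact h3.trans (by simp)

end OrbifoldGroupoid

/-! ### The sum of the local contributions -/

namespace HolomorphicOrbimorphism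

variable {C : Orbicurve} {E : Type*} [NormedAddCommGroup E] [NormedSpace ℝ E]
  [FiniteDimensional ℝ E] {G : OrbifoldGroupoid E} {J : AlmostComplexStructure G}
  (f : HolomorphicOrbimorphism C J) {Z : Set G.Obj} {η : DForm E G.Obj 2} {α : DForm E G.Obj 1}

/-- The contribution of one contact point, in a chart of the orbicurve: if `b` is a radial cut-off
function in the chart with the value `β 0` at the contact point, the integral of
`b f^*η + db ∧ f^*α` is `d * β 0`, where `d` is the local contact order. -/
theorem exists_chart_integral_eq_contact_order (hZc : IsClosed Z) (hZ : G.IsInvariantSet Z)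
    (hfin : (f.preimage Z).Finite) (hη : η.SmoothOn univ) (hηc : η.HasExtDerivOn 0 univ)
    (hinv : G.IsInvariantFormOn η univ) (hα : α.SmoothOn Zᶜ)
    (hαinv : G.IsInvariantFormOn α Zᶜ) (hαη : α.HasExtDerivOn η Zᶜ)
    (hthom : ∀ u : ℂ → G.Obj, IsNormalDisc J Z u → discIntegral u η - circleFormIntegral u α = 1)
    {k : f.K.Obj} (hk : f.phi.obj k ∈ Z) {d : ℕ} (hd : f.HasLocalOrder Z k d) :
    ∃ e : OpenPartialHomeomorph C.norm.Obj ℂ, IsOrientedChart e ∧ f.eps.obj k ∈ e.source ∧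
      e (f.eps.obj k) = 0 ∧ ∃ ε₁ > 0, Metric.closedBall 0 ε₁ ⊆ e.target ∧
        (∀ p ∈ Metric.closedBall 0 ε₁, C.norm.orbit (e.symm p) ∈ f.preimage Z → p = 0) ∧
        ∀ ε₀, 0 < ε₀ → ε₀ < ε₁ → ∀ β : ℝ → ℝ, ContDiff ℝ ∞ β →
          (∃ s₀ > 0, ∀ s < s₀, β s = β 0) → (∀ s, ε₀ ^ 2 ≤ s → β s = 0) →
          ∀ b : C.norm.Obj → ℝ, ContMDiff 𝓘(ℝ, ℂ) 𝓘(ℝ, ℝ) ∞ b →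
            (∀ p ∈ e.target, b (e.symm p) = β (‖p‖ ^ 2)) →
            ∫ p in e.target, (cutoffForm b (f.pullback η) (f.pullback α)).inChart e p
              ![1, Complex.I] = d * β 0 := by
  have := f.K.holoObj
  obtain ⟨h, hh, e, he, hke, he0, hO⟩ := hd
  have heo := isOrientedChart_of_mem_maximalAtlas he
  obtain ⟨θ, hθ, hθs, hθk, hθj, hθo, hpull⟩ :=
    f.exists_local_inverse (C.norm.src_unit (f.eps.obj k))
  rw [C.norm.tgt_unit] at hθs hθk
  -- A chart of the orbicurve at the contact point: the chart `e` of `K` composed with the local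
  -- inverse of `eps`. In this chart, the lift of `f` is the expression of `phi` in the chart `e`.
  let E' := θ.trans e
  have hE's : IsSmoothHomeo (E := ℂ) (F := ℂ) E' := hθ.trans heo.smooth
  have hsrc : ∀ x, x ∈ E'.source ↔ x ∈ θ.source ∧ θ x ∈ e.source := fun x => by
    simp only [E', OpenPartialHomeomorph.trans_source, mem_inter_iff, mem_preimage]
  have hE'o : IsOrientedChart E' := by
    refine ⟨hE's, fun x hx => ?_⟩
    obtain ⟨h1, h2⟩ := (hsrc x).1 hx
    have h3 : jac E' x = jac e (θ x) * jac θ x :=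
      jac_comp (g := e) (f := θ) x (heo.smooth.mdifferentiableAt h2) (hθ.mdifferentiableAt h1)
    rw [h3]
    exact mul_pos (heo.jac_pos _ h2) (hθj x h1)
  have hkE : f.eps.obj k ∈ E'.source := (hsrc _).2 ⟨hθs, by rw [hθk]; exact hke⟩
  have hE'0 : E' (f.eps.obj k) = 0 := by
    change e (θ (f.eps.obj k)) = 0
    rw [hθk, he0]
  have hsymm0 : e.symm 0 = k := by rw [← he0, e.left_inv hke]
  have h0t : (0 : ℂ) ∈ e.target := he0 ▸ e.map_source hke
  have h0t' : (0 : ℂ) ∈ E'.target := hE'0 ▸ E'.map_source hkE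
  have hE'symm0 : E'.symm 0 = f.eps.obj k := by rw [← hE'0, E'.left_inv hkE]
  let φ : ℂ → G.Obj := fun ζ => f.phi.obj (e.symm ζ)
  have hφ0 : φ 0 = f.phi.obj k := congrArg f.phi.obj hsymm0
  have hφs : ∀ ζ ∈ e.target, ContMDiffAt 𝓘(ℝ, ℂ) 𝓘(ℝ, E) ∞ φ ζ := fun ζ hζ =>
    ContMDiffAt.comp (g := f.phi.obj) ζ f.phi.smooth_obj.contMDiffAt (heo.smooth.symm.contMDiffAt hζ)
  -- the local lift in the chart `E'` is `φ`
  have htgt : ∀ p ∈ E'.target, p ∈ e.target ∧ E'.symm p ∈ θ.source ∧ θ (E'.symm p) = e.symm p := by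
    intro p hp
    have h1 := (hsrc _).1 (E'.map_target hp)
    have h2 : e (θ (E'.symm p)) = p := E'.right_inv hp
    refine ⟨?_, h1.1, ?_⟩
    · rw [← h2]
      exact e.map_source h1.2
    · conv_rhs => rw [← h2]
      rw [e.left_inv h1.2]
  have hlift : ∀ (n : ℕ) (ρ : DForm E G.Obj n) (W : Set G.Obj), G.IsInvariantFormOn ρ W →
      ∀ p ∈ E'.target, φ p ∈ W →
        (f.pullback ρ).inChart E' p = (DForm.pullback φ ρ : DForm ℂ ℂ n) p := by
    intro n ρ W hρ p hp hpW
    obtain ⟨h1, h2, h3⟩ := htgt p hp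
    have h4 := hpull n ρ W hρ _ h2 (by rw [h3]; exact hpW)
    have h5 : φ =ᶠ[𝓝 p] fun x => f.phi.obj (θ (E'.symm x)) := by
      filter_upwards [E'.open_target.mem_nhds hp] with x hx
      rw [(htgt x hx).2.2]
    have h6 : manifoldDeriv ℂ E φ p = (manifoldDeriv ℂ E (fun y => f.phi.obj (θ y))
        (E'.symm p)).comp (manifoldDeriv ℂ ℂ E'.symm p) := by
      rw [manifoldDeriv_congr h5]
      exact manifoldDeriv_comp (g := fun y => f.phi.obj (θ y)) p
        (MDifferentiableAt.comp (g := f.phi.obj) _ (f.phi.mdifferentiableAt_obj _)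
          (hθ.mdifferentiableAt h2)) (hE's.symm.mdifferentiableAt hp)
    simp only [DForm.inChart, DForm.pullback, h4, h6, h3]
    rfl
  have horb : ∀ p ∈ E'.target, φ p ∈ Z ↔ C.norm.orbit (E'.symm p) ∈ f.preimage Z := by
    intro p hp
    obtain ⟨h1, h2, h3⟩ := htgt p hp
    rw [← hθo _ h2, h3]
    exact f.phi_mem_iff_orbit_mem_preimage hZ _
  have hiso : ∀ᶠ p in 𝓝 (0 : ℂ), C.norm.orbit (E'.symm p) ∈ f.preimage Z → p = 0 := by
    have h1 := C.norm.eventually_orbit_notMem hfin (f.eps.obj k)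
    rw [eventually_nhdsWithin_iff] at h1
    have h2 : Filter.Tendsto E'.symm (𝓝 0) (𝓝 (f.eps.obj k)) := by
      have := E'.continuousAt_symm h0t'
      rwa [ContinuousAt, hE'symm0] at this
    filter_upwards [h2.eventually h1, E'.open_target.mem_nhds h0t'] with p h3 h4 h5
    by_contra hp
    refine h3 (fun h6 => hp ?_) h5
    rw [mem_singleton_iff] at h6
    rw [← E'.right_inv h4, h6, hE'0]
  obtain ⟨ε₁, hε₁, hmain⟩ := integral_cutoff_pullback_eq_mul_contact_order hZc hη hηc hα hαη hthom
    (φ := φ) (by filter_upwards [e.open_target.mem_nhds h0t] with ζ hζ using hφs ζ hζ)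
    (by rw [hφ0]; exact hk) (h := h) (by rw [hφ0]; exact hh) hO
  obtain ⟨ε₂, hε₂, hε₂t⟩ := Metric.nhds_basis_closedBall.mem_iff.1
    (Filter.inter_mem (E'.open_target.mem_nhds h0t') hiso)
  refine ⟨E', hE'o, hkE, hE'0, min ε₁ ε₂, lt_min hε₁ hε₂, fun p hp => ?_, fun p hp hpZ => ?_,
    fun ε₀ hε₀ hlt β hβ hβ0 hβs b hb hbβ => ?_⟩
  · exact (hε₂t (Metric.closedBall_subset_closedBall (min_le_right _ _) hp)).1
  · exact (hε₂t (Metric.closedBall_subset_closedBall (min_le_right _ _) hp)).2 hpZ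
  have hbig : ∀ p : ℂ, p ∉ Metric.closedBall (0 : ℂ) ε₂ →
      β (‖p‖ ^ 2) = 0 ∧ deriv β (‖p‖ ^ 2) = 0 := by
    intro p hp
    have h1 : ε₀ < ‖p‖ := by
      rw [mem_closedBall_zero_iff, not_le] at hp
      exact (hlt.trans_le (min_le_right _ _)).trans hp
    have h2 : ε₀ ^ 2 < ‖p‖ ^ 2 := by gcongr
    exact ⟨hβs _ h2.le, deriv_eq_zero_of_forall_ge hβs h2⟩
  refine Eq.trans ?_ ((setIntegral_eq_integral_of_forall_compl_eq_zero (s := E'.target) ?_).trans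
    (hmain ε₀ hε₀ (hlt.trans_le (min_le_left _ _)) β hβ hβ0 hβs))
  · refine setIntegral_congr_fun E'.open_target.measurableSet fun p hp => ?_
    have h1 : (fun p => b (E'.symm p)) =ᶠ[𝓝 p] fun p => β (‖p‖ ^ 2) := by
      filter_upwards [E'.open_target.mem_nhds hp] with x hx using hbβ x hx
    rw [cutoffForm_inChart _ _ hE's hp (hb.mdifferentiable (by simp) _), hbβ p hp,
      hlift 2 η univ hinv p hp (mem_univ _), h1.fderiv_eq,
      (hasFDerivAt_normSq_comp hβ p).fderiv]
    congr 1
    simp only [_root_.smul_apply, smul_eq_mul, innerSL_apply_apply]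
    have hi1 : inner ℝ p 1 = p.re := by simp [Complex.inner]
    have hi2 : inner ℝ p Complex.I = p.im := by simp [Complex.inner]
    rw [hi1, hi2]
    -- At the contact point the pull-back of `α` by `f` has no meaning, but the factor `p` vanishes.
    by_cases hpZ : φ p ∈ Z
    · have h2 : p = 0 ∨ deriv β (‖p‖ ^ 2) = 0 := by
        by_cases hp2 : p ∈ Metric.closedBall (0 : ℂ) ε₂
        · exact Or.inl ((hε₂t hp2).2 ((horb p hp).1 hpZ))
        · exact Or.inr (hbig p hp2).2
      rcases h2 with rfl | h2
      · simp
      · simp [h2]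
    · rw [hlift 1 α Zᶜ hαinv p hp hpZ]
  · intro p hp
    have h1 := hbig p fun h => hp (hε₂t h).1
    simp [h1.1, h1.2]

/-- A cut-off function at the contact point `y`, of total weight one on the orbits close to `y`. -/
theorem exists_contact_bump (hZc : IsClosed Z) (hZ : G.IsInvariantSet Z)
    (hfin : (f.preimage Z).Finite) (hη : η.SmoothOn univ) (hηc : η.HasExtDerivOn 0 univ)
    (hinv : G.IsInvariantFormOn η univ) (hα : α.SmoothOn Zᶜ)
    (hαinv : G.IsInvariantFormOn α Zᶜ) (hαη : α.HasExtDerivOn η Zᶜ)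
    (hthom : ∀ u : ℂ → G.Obj, IsNormalDisc J Z u → discIntegral u η - circleFormIntegral u α = 1)
    {y : C.norm.Orbit} (hy : y ∈ f.preimage Z) {ℓ : ℚ} (hℓ : f.IsFractionalContactOrder Z y ℓ) :
    ∃ (e : OpenPartialHomeomorph C.norm.Obj ℂ) (b : C.norm.Obj → ℝ), IsOrientedChart e ∧
      ContMDiff 𝓘(ℝ, ℂ) 𝓘(ℝ, ℝ) ∞ b ∧ HasCompactSupport b ∧ tsupport b ⊆ e.source ∧
      (∀ x, C.norm.orbit x ∈ f.preimage Z → C.norm.orbit x = y →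
        C.norm.orbitSum b =ᶠ[𝓝 x] fun _ => 1) ∧
      (∀ x, C.norm.orbit x ∈ f.preimage Z → C.norm.orbit x ≠ y →
        C.norm.orbitSum b =ᶠ[𝓝 x] fun _ => 0) ∧
      (∀ x, C.norm.orbit x ∈ f.preimage Z → ∃ c, b =ᶠ[𝓝 x] fun _ => c) ∧
      ∫ p in e.target, (cutoffForm b (f.pullback η) (f.pullback α)).inChart e p
        ![1, Complex.I] = ℓ := by
  obtain ⟨k, d, rfl, hd, rfl⟩ := hℓ
  have hk : f.phi.obj k ∈ Z := (f.phi_mem_iff_orbit_mem_preimage hZ k).2 hy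
  obtain ⟨e, heo, hke, he0, ε₁, hε₁, hε₁t, hiso, hint⟩ :=
    f.exists_chart_integral_eq_contact_order hZc hZ hfin hη hηc hinv hα hαinv hαη hthom hk hd
  set r := Nat.card (C.norm.isotropy (f.eps.obj k)) with hr
  have hr0 : (r : ℝ) ≠ 0 := by
    have hfin' : Finite (C.norm.isotropy (f.eps.obj k)) := by
      refine ((C.norm.finite_src_tgt (f.eps.obj k) (isCompact_singleton
        (x := f.eps.obj k))).subset ?_).to_subtype
      exact fun g hg => hg
    have : Nonempty (C.norm.isotropy (f.eps.obj k)) :=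
      ⟨⟨C.norm.unit _, C.norm.src_unit _, C.norm.tgt_unit _⟩⟩
    exact_mod_cast Nat.card_pos.ne'
  -- The value `1 / r` at the contact point makes the sum over `r` arrows of an orbit equal to one.
  obtain ⟨β, hβ, hβ0, hβc, hβs⟩ := exists_radial_cutoff (half_pos hε₁) (1 / (r : ℝ))
  have hsub : Metric.closedBall (0 : ℂ) (ε₁ / 2) ⊆ Metric.closedBall 0 ε₁ :=
    Metric.closedBall_subset_closedBall (by linarith)
  obtain ⟨b, hb, hbc, hbt, hbβ, hbloc⟩ := exists_chart_bump heo.smooth (hsub.trans hε₁t)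
    (half_pos hε₁) hβ hβc hβs
  have huniq : ∀ z ∈ tsupport b, C.norm.orbit z ∈ f.preimage Z → z = f.eps.obj k := by
    intro z hz hzZ
    obtain ⟨p, hp, rfl⟩ := hbt hz
    rw [hiso p (hsub hp) hzZ, ← he0, e.left_inv hke]
  have hloc : b =ᶠ[𝓝 (f.eps.obj k)] fun _ => 1 / (r : ℝ) := hβ0 ▸ hbloc _ hke he0
  have hmem : f.eps.obj k ∈ tsupport b := by
    refine subset_tsupport _ ?_
    rw [Function.mem_support, hloc.self_of_nhds]
    exact one_div_ne_zero hr0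
  refine ⟨e, b, heo, hb, hbc, fun z hz => ?_, fun x hxZ hx => ?_, fun x hxZ hx => ?_,
    fun x hxZ => ?_, ?_⟩
  · obtain ⟨p, hp, rfl⟩ := hbt hz
    exact e.map_target (hε₁t (hsub hp))
  · have h1 := C.norm.orbitSum_eventuallyEq_card_mul hbc (x := x) hmem
      (fun z hz hzx => huniq z hz (hzx ▸ hxZ)) hloc
    rw [C.norm.card_arrows_eq hx, ← hr] at h1
    refine h1.trans (Filter.Eventually.of_forall fun _ => ?_)
    field_simp
  · refine C.norm.orbitSum_eventuallyEq_zero hbc fun z hz hzx => hx ?_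
    rw [← hzx, huniq z hz (hzx ▸ hxZ)]
  · by_cases hx : x ∈ tsupport b
    · rw [huniq x hx hxZ]
      exact ⟨_, hloc⟩
    · refine ⟨0, ?_⟩
      filter_upwards [(isClosed_tsupport b).isOpen_compl.mem_nhds hx] with z hz
      exact image_eq_zero_of_notMem_tsupport hz
  · rw [hint (ε₁ / 2) (half_pos hε₁) (by linarith) β hβ hβc hβs b hb hbβ, hβ0]
    push_cast
    ring

end HolomorphicOrbimorphism

namespace HolomorphicOrbimorphism

variable {C : Orbicurve} {E : Type*} [NormedAddCommGroup E] [NormedSpace ℝ E]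
  [FiniteDimensional ℝ E] {G : OrbifoldGroupoid E} {J : AlmostComplexStructure G}
  (f : HolomorphicOrbimorphism C J) {Z : Set G.Obj} {η : DForm E G.Obj 2}

/-- The orbifold integral of the pull-back of a representative of the dual class of the divisor,
computed with any orbifold partition of unity, is the sum of the fractional contact orders. -/
theorem partition_integral_pullback_eq_sum (hZ : IsDivisor J Z)
    (hfin : (f.preimage Z).Finite) {ℓ : C.norm.Orbit → ℚ}
    (hℓ : ∀ y ∈ f.preimage Z, f.IsFractionalContactOrder Z y (ℓ y))
    (hη : RepresentsDualClass J Z η) (P : C.norm.Partition) :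
    P.integral (f.pullback η) = ∑ y ∈ hfin.toFinset, (ℓ y : ℝ) := by
  obtain ⟨α, hα, hαinv, hαη, hthom⟩ := hη.thom
  have hyS : ∀ y : hfin.toFinset, y.1 ∈ f.preimage Z := fun y => hfin.mem_toFinset.1 y.2
  choose e b heo hb hbc hbe hb1 hb0 hbloc hint using fun y : hfin.toFinset =>
    f.exists_contact_bump hZ.closed hZ.invariant hfin hη.smooth hη.closed hη.invariant hα hαinv
      hαη hthom (hyS y) (hℓ y.1 (hyS y))
  -- The total weight of the cut-off functions at the contact points. The weights of the partition
  -- are multiplied by `1 - Ψ`, so that they vanish near the contact points.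
  let Ψ : C.norm.Obj → ℝ := fun x => ∑ y, C.norm.orbitSum (b y) x
  have hΨs : ContMDiff 𝓘(ℝ, ℂ) 𝓘(ℝ, ℝ) ∞ Ψ :=
    contMDiff_finsetSum fun y _ => C.norm.contMDiff_orbitSum (hb y) (hbc y)
  have hΨinv : ∀ g, Ψ (C.norm.src g) = Ψ (C.norm.tgt g) := fun g =>
    Finset.sum_congr rfl fun y _ => C.norm.orbitSum_src_eq_tgt (b y) g
  have hΨ1 : ∀ x, C.norm.orbit x ∈ f.preimage Z → Ψ =ᶠ[𝓝 x] fun _ => 1 := by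
    intro x hx
    let y₀ : hfin.toFinset := ⟨C.norm.orbit x, hfin.mem_toFinset.2 hx⟩
    have hothers : ∀ᶠ z in 𝓝 x, ∀ y, y ≠ y₀ → C.norm.orbitSum (b y) z = 0 := by
      rw [Filter.eventually_all]
      intro y
      by_cases hy : y = y₀
      · exact Filter.Eventually.of_forall fun z h => absurd hy h
      · filter_upwards [hb0 y x hx fun h => hy (Subtype.ext h.symm)] with z hz _ using hz
    filter_upwards [hothers, hb1 y₀ x hx rfl] with z h1 h2
    simp only [Ψ]
    rw [Finset.sum_eq_single y₀ (fun y _ hy => h1 y hy) (fun h => absurd (Finset.mem_univ _) h), h2]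
  let c : Fin P.n → C.norm.Obj → ℝ := fun m x => P.weight m x * (1 - Ψ x)
  have hcs : ∀ m, ContMDiff 𝓘(ℝ, ℂ) 𝓘(ℝ, ℝ) ∞ (c m) := fun m =>
    (P.smooth m).mul (contMDiff_const.sub hΨs)
  have hcc : ∀ m, HasCompactSupport (c m) := fun m => (P.compact m).mul_right
  have hct : ∀ m, tsupport (c m) ⊆ (P.chart m).source := fun m =>
    (tsupport_mul_subset_left).trans (P.support m)
  have hcZ : ∀ m x, C.norm.orbit x ∈ f.preimage Z → c m =ᶠ[𝓝 x] fun _ => 0 := by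
    intro m x hx
    filter_upwards [hΨ1 x hx] with z hz
    simp only [c, hz, sub_self, mul_zero]
  have hcsum : ∀ x, ∑ m, C.norm.orbitSum (c m) x = 1 - Ψ x := by
    intro x
    have h1 : ∀ m, C.norm.orbitSum (c m) x = C.norm.orbitSum (P.weight m) x * (1 - Ψ x) :=
      fun m => C.norm.orbitSum_mul_of_invariant (c := fun x => 1 - Ψ x)
        (fun g => by simp only [hΨinv g]) (P.weight m) x
    have h2 : ∑ m, C.norm.orbitSum (P.weight m) x = 1 := P.sum_eq_one x
    rw [Finset.sum_congr rfl fun m _ => h1 m, ← Finset.sum_mul, h2, one_mul]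
  let v : Fin P.n ⊕ hfin.toFinset → C.norm.Obj → ℝ := Sum.elim c b
  have hvs : ∀ i, ContMDiff 𝓘(ℝ, ℂ) 𝓘(ℝ, ℝ) ∞ (v i) := by
    rintro (m | y)
    exacts [hcs m, hb y]
  have hvloc : ∀ i x, C.norm.orbit x ∈ f.preimage Z → ∃ a, v i =ᶠ[𝓝 x] fun _ => a := by
    rintro (m | y) x hx
    exacts [⟨0, hcZ m x hx⟩, hbloc y x hx]
  have hchart : ∀ i, IsOrientedChart (Sum.elim P.chart e i) := by
    rintro (m | y)
    exacts [C.norm.isOrientedChart (P.chart_mem m), heo y]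
  have hmain := P.integral_eq_sum_cutoffForm hchart (v := v) hvs
    (by rintro (m | y); exacts [hcc m, hbc y]) (by rintro (m | y); exacts [hct m, hbe y])
    (fun x => by
      rw [Fintype.sum_sum_type]
      change ∑ m, C.norm.orbitSum (c m) x + Ψ x = 1
      rw [hcsum]; ring)
    (ξ := f.pullback η) (β := f.pullback α) (S := {x | C.norm.orbit x ∈ f.preimage Z})
    (fun g hg => by
      rw [mem_ofPred_eq] at hg ⊢
      rwa [← C.norm.orbit_eq_iff.2 ⟨g, rfl, rfl⟩])
    (fun g => by
      obtain ⟨⟨k, a⟩, ha, hat⟩ := f.eps_equiv.ess_surj (C.norm.src g)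
      exact f.pullback_comp_arrowDeriv hη.invariant ha (mem_univ _) hat.symm)
    (fun g hg => by
      obtain ⟨⟨k, a⟩, ha, hat⟩ := f.eps_equiv.ess_surj (C.norm.src g)
      refine f.pullback_comp_arrowDeriv hαinv ha (fun hk => hg ?_) hat.symm
      rw [f.phi_mem_iff_orbit_mem_preimage hZ.invariant] at hk
      rw [mem_ofPred_eq, ← C.norm.orbit_eq_iff.2 ⟨a, ha, hat⟩]
      exact hk)
    (fun i x hx => by
      obtain ⟨a, ha⟩ := hvloc i x hx
      rw [manifoldDeriv_congr ha, manifoldDeriv_const])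
    (fun i => f.continuousOn_cutoffForm_inChart hZ.closed hZ.invariant hη.smooth hη.invariant hα
      hαinv hαη (hvs i) (hvloc i) (hchart i).smooth _ _)
  rw [hmain, Fintype.sum_sum_type]
  have hzero : ∀ m, ∫ p in (P.chart m).target,
      (cutoffForm (c m) (f.pullback η) (f.pullback α)).inChart (P.chart m) p ![1, Complex.I] = 0 :=
    fun m => f.integral_cutoffForm_eq_zero hZ.closed hZ.invariant hη.invariant hα hαinv hαη
      (hcs m) (hcc m) (hcZ m) (C.norm.isOrientedChart (P.chart_mem m)).smooth (hct m)
  simp only [v, Sum.elim_inl, Sum.elim_inr, hzero, hint, Finset.sum_const_zero, zero_add]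
  exact Finset.sum_coe_sort hfin.toFinset fun y => (ℓ y : ℝ)

end HolomorphicOrbimorphism
theorem lemma3p3 {E : Type*} [NormedAddCommGroup E] [NormedSpace ℝ E] [FiniteDimensional ℝ E]
    (G : OrbifoldGroupoid E) (J : AlmostComplexStructure G)
    (Z : Set G.Obj) (hZ : IsDivisor J Z)
    (C : Orbicurve) (f : HolomorphicOrbimorphism C J)
    (hfin : (f.preimage Z).Finite) :
    (∀ y ∈ f.preimage Z, ∃! ℓ : ℚ, f.IsFractionalContactOrder Z y ℓ) ∧
    ∀ ℓ : C.norm.Orbit → ℚ, (∀ y ∈ f.preimage Z, f.IsFractionalContactOrder Z y (ℓ y)) →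
      ∀ η : DForm E G.Obj 2, RepresentsDualClass J Z η →
        f.pushforwardClass η = C.fundamentalClass (f.pullback η) ∧
        C.fundamentalClass (f.pullback η) = ∑ y ∈ hfin.toFinset, (ℓ y : ℝ) := by
  refine ⟨fun y hy => f.existsUnique_isFractionalContactOrder hZ hfin hy,
    fun ℓ hℓ η hη => ⟨rfl, ?_⟩⟩
  have := C.compact
  have hP : Nonempty C.norm.Partition :=
    ComplexOrbifoldGroupoid.nonempty_partition C.norm
  rw [Orbicurve.fundamentalClass, ComplexOrbifoldGroupoid.orbIntegral, dif_pos hP]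
  exact f.partition_integral_pullback_eq_sum hZ hfin hℓ hη hP.some
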